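/- **Setting.** Let $u_0<-2$ and $m_0>0$ with $|u_0|>2m_0$. Let $\gamma$ be the unit round metric on $S^2$, equal to $(1+\frac14|\theta|^2)^{-2}\delta_{AB}$ in each of two stereographic charts. A *seed* is a smooth function $\psi_0(s,\theta)$ with compact support in $(0,1)\times S^2$ and values in the symmetric trace-free $2\times2$ matrices (in the two charts $(1+\frac14|\theta|^2)^{-2}\psi_0$ represents the same tensor field on $S^2$), such that $$\int_0^1|\partial_s\psi_0(s,\theta)|^2\,ds=16m_0\qquad\text{for all }\theta\in S^2 .$$ For $\delta>0$ put $\psi(\underline u,\theta)=\frac{\delta^{1/2}}{|u_0|}\psi_0(\underline u/\delta,\theta)$ for $0\le\underline u\le\delta+1$, with $\psi_0$ extended by $0$; thus $\psi=0$ for $\underline u\ge\delta$, which amounts to extending the data from $[0,\delta]$ to $[0,\delta+1]$ by vanishing shear $\widehat\chi$. Let $u_1>u_0$ and let $$g=-2\Omega^2(d\underline u\otimes du+du\otimes d\underline u)+h_{AB}(d\theta^A-b^Ad\underline u)\otimes(d\theta^B-b^Bd\underline u)$$ be a solution of the Einstein vacuum equations, smooth up to the boundary, on $[0,\delta+1]\times[u_0,u_1]\times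 S^2$ with coordinates $(\underline u,u,\theta)$, with $\Omega>0$ and $h$ Riemannian, such that * on $C_{u_0}=\{u=u_0\}$: $\Omega=1$, $b=0$, and $h=\phi^2|u_0|^2(1+\frac14|\theta|^2)^{-2}\exp\psi$ in the charts, for some function $\phi>0$; * on $\underline C_0=\{\underline u=0\}$, as on a light cone of Minkowski space: $\Omega=1$ and $h=|u|^2\gamma$; and on the sphere $\underline u=0,\ u=u_0$: $\zeta=0$ and $\mathrm{tr}\chi=2/|u_0|$. Put $\underline L=\partial_u$, $L=\partial_{\underline u}+b^A\partial_{\theta^A}$, $e_3=\Omega^{-1}\underline L$, $e_4=\Omega^{-1}L$, and let $e_A$ be tangent to the spheres $S_{\underline u,u}$. The connection coefficients are $$\chi_{AB}=g(\nabla_Ae_4,e_B),\quad \underline\chi_{AB}=g(\nabla_Ae_3,e_B),\quad \eta_A=-\tfrac12g(\nabla_3e_A,e_4),\quad \underline\eta_A=-\tfrac12g(\nabla_4e_A,e_3),$$ $$\omega=\tfrac12\Omega\,g(\nabla_4e_3,e_4),\quad \underline\omega=\tfrac12\Omega\,g(\nabla_3e_4,e_3),\quad \zeta=\tfrac12(\eta-\underline\eta);$$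 $\mathrm{tr}$ and a hat denote trace and trace-free part with respect to $h$. With $R(W,Z,X,Y)=g(W,([\nabla_X,\nabla_Y]-\nabla_{[X,Y]})Z)$ and $\epsilon$ the area form of $h$, the curvature components are $$\alpha_{AB}=R(e_A,e_4,e_B,e_4),\quad \underline\alpha_{AB}=R(e_A,e_3,e_B,e_3),\quad \beta_A=\tfrac12R(e_A,e_4,e_3,e_4),\quad \underline\beta_A=\tfrac12R(e_A,e_3,e_3,e_4),$$ $$\rho=\tfrac14R(e_3,e_4,e_3,e_4),\quad \sigma=\tfrac14R(e_3,e_4,e_A,e_B)\epsilon^{AB}.$$ Let $r(\underline u)=|u_0|+(1-\frac{2m_0}{|u_0|})(\underline u-\delta)$. The values for the Schwarzschild space-time of mass $m_0$ on the outgoing cone issuing from a sphere of radius $|u_0|$ at $\underline u=\delta$ (with $\Omega=1$ on that cone and on the incoming cone through that sphere, and $\mathrm{tr}\underline\chi=-2/|u_0|$, $\mathrm{tr}\chi=2/|u_0|-4m_0/|u_0|^2$ on the sphere) are $$\mathrm{tr}\chi_{m_0}=\frac2r\Big(1-\frac{2m_0}{|u_0|}\Big),\quad \mathrm{tr}\underline\chi_{m_0}=-\frac2r\,\frac{1-2m_0/r}{1-2m_0/|u_0|},\quad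 \rho_{m_0}=-\frac{2m_0}{r^3},\quad \underline\omega_{m_0}=\frac{m_0}{1-2m_0/|u_0|}\Big(\frac1{|u_0|^2}-\frac1{r^2}\Big),$$ and all other components vanish. **Statement.** There is $N\in\mathbb N$ such that the following holds for all $u_0,m_0$ as above. 1. For every such seed, $\delta>0$ and solution: $\widehat\chi\equiv0$, $\alpha\equiv0$ and $\omega\equiv0$ on $C_{u_0}^{[\delta,\delta+1]}=\{u=u_0,\ \delta\le\underline u\le\delta+1\}$. 2. For every bound $B_0$ there is $\delta_0>0$ such that for every $k\ge0$ and every bound $B$ there is a constant $C_k$ with the following property. For every such seed with $\|\psi_0\|_{C^N}\le B_0$ and $\|\psi_0\|_{C^{k+N}}\le B$, every $0<\delta<\delta_0$ and every such solution, on $C_{u_0}^{[\delta,\delta+1]}$ $$\big|(\nabla^{h})^k(\widehat{\underline\chi},\ \eta,\ \underline\eta,\ \underline\omega-\underline\omega_{m_0},\ \mathrm{tr}\chi-\mathrm{tr}\chi_{m_0},\ \mathrm{tr}\underline\chi-\mathrm{tr}\underline\chi_{m_0},\ \beta,\ \rho-\rho_{m_0},\ \sigma,\ \underline\beta,\ \underline\alpha)\big|\le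 C_k\,\delta^{1/2},$$ where $\nabla^{h}$ is the Levi-Civita connection of $h$ on the spheres and $|\cdot|$ the norm with respect to $h$. Here $\|\psi_0\|_{C^n}$ is the maximum of the derivatives of order at most $n$ in $(s,\theta)$, over the two closed hemispheres $|\theta|\le2$ of the charts. -/

import Mathlib

open scoped ContDiff Matrix

noncomputable section

namespace NullCone

/-! ### Pseudo-Riemannian geometry in a coordinate chart of `ℝⁿ`

A metric is given by its component matrix `G`. -/

/-- The partial derivative `∂_μ f` at `x`. -/
def pd {n : ℕ} (μ : Fin n) (f : (Fin n → ℝ) → ℝ) (x : Fin n → ℝ) : ℝ :=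
  fderiv ℝ f x (Pi.single μ 1)

/-- The Christoffel symbol `Γ^k_{ij}`. -/
def christoffel {n : ℕ} (G : (Fin n → ℝ) → Matrix (Fin n) (Fin n) ℝ)
    (k i j : Fin n) (x : Fin n → ℝ) : ℝ :=
  (1 / 2) * ∑ l, (G x)⁻¹ k l *
    (pd i (fun y => G y j l) x + pd j (fun y => G y i l) x - pd l (fun y => G y i j) x)

/-- The curvature components `R^a_{bcd}`, that is
`R(∂_c, ∂_d) ∂_b = R^a_{bcd} ∂_a` with `R(X, Y) = [∇_X, ∇_Y] - ∇_{[X, Y]}`. -/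
def curvature {n : ℕ} (G : (Fin n → ℝ) → Matrix (Fin n) (Fin n) ℝ)
    (a b c d : Fin n) (x : Fin n → ℝ) : ℝ :=
  pd c (christoffel G a d b) x - pd d (christoffel G a c b) x
    + ∑ e, (christoffel G a c e x * christoffel G e d b x
          - christoffel G a d e x * christoffel G e c b x)

/-- The Ricci curvature `R_{bd} = R^a_{bad}`. -/
def ricci {n : ℕ} (G : (Fin n → ℝ) → Matrix (Fin n) (Fin n) ℝ)
    (b d : Fin n) (x : Fin n → ℝ) : ℝ :=
  ∑ a, curvature G a b a d x

/-- The inner product `g(X, Y)` of two vectors at `x`. -/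
def inner2 {n : ℕ} (G : (Fin n → ℝ) → Matrix (Fin n) (Fin n) ℝ) (x : Fin n → ℝ)
    (X Y : Fin n → ℝ) : ℝ :=
  ∑ a, ∑ b, G x a b * X a * Y b

/-- The curvature tensor `R(W, Z, X, Y) = g(W, R(X, Y) Z)` at `x`. -/
def riemann {n : ℕ} (G : (Fin n → ℝ) → Matrix (Fin n) (Fin n) ℝ) (x : Fin n → ℝ)
    (W Z X Y : Fin n → ℝ) : ℝ :=
  inner2 G x W (fun a => ∑ b, ∑ c, ∑ d, curvature G a b c d x * Z b * X c * Y d)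

/-- The covariant derivative `∇_X Y` at `x` of the vector field `Y`. -/
def covVec {n : ℕ} (G : (Fin n → ℝ) → Matrix (Fin n) (Fin n) ℝ) (X : Fin n → ℝ)
    (Y : (Fin n → ℝ) → Fin n → ℝ) (x : Fin n → ℝ) : Fin n → ℝ :=
  fun k => ∑ i, X i * (pd i (fun y => Y y k) x + ∑ j, christoffel G k i j x * Y x j)

/-- The covariant derivative of a covariant tensor field of rank `r`; the index of
differentiation comes first. -/
def covDeriv {n r : ℕ} (G : (Fin n → ℝ) → Matrix (Fin n) (Fin n) ℝ)
    (T : (Fin n → ℝ) → (Fin r → Fin n) → ℝ) :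
    (Fin n → ℝ) → (Fin (r + 1) → Fin n) → ℝ :=
  fun x I => pd (I 0) (fun y => T y (Fin.tail I)) x
    - ∑ j : Fin r, ∑ c : Fin n,
        christoffel G c (I 0) (Fin.tail I j) x * T x (Function.update (Fin.tail I) j c)

/-- The `k`-th covariant derivative `∇^k T`. -/
def iterCovDeriv {n r : ℕ} (G : (Fin n → ℝ) → Matrix (Fin n) (Fin n) ℝ)
    (T : (Fin n → ℝ) → (Fin r → Fin n) → ℝ) :
    (k : ℕ) → (Fin n → ℝ) → (Fin (r + k) → Fin n) → ℝ
  | 0 => T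
  | k + 1 => covDeriv G (iterCovDeriv G T k)

/-- The pointwise norm `|T|` of a covariant tensor, all indices being raised by `G`. -/
def tensorNorm {n r : ℕ} (G : (Fin n → ℝ) → Matrix (Fin n) (Fin n) ℝ)
    (T : (Fin n → ℝ) → (Fin r → Fin n) → ℝ) (x : Fin n → ℝ) : ℝ :=
  Real.sqrt (∑ I : Fin r → Fin n, ∑ J : Fin r → Fin n,
    (∏ i, (G x)⁻¹ (I i) (J i)) * T x I * T x J)

/-- `|∇^k f|` for a function `f`. -/
def normDeriv0 {n : ℕ} (G : (Fin n → ℝ) → Matrix (Fin n) (Fin n) ℝ) (k : ℕ)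
    (f : (Fin n → ℝ) → ℝ) (x : Fin n → ℝ) : ℝ :=
  tensorNorm G (iterCovDeriv (r := 0) G (fun y _ => f y) k) x

/-- `|∇^k ξ|` for a one-form `ξ`. -/
def normDeriv1 {n : ℕ} (G : (Fin n → ℝ) → Matrix (Fin n) (Fin n) ℝ) (k : ℕ)
    (ξ : (Fin n → ℝ) → Fin n → ℝ) (x : Fin n → ℝ) : ℝ :=
  tensorNorm G (iterCovDeriv (r := 1) G (fun y I => ξ y (I 0)) k) x

/-- `|∇^k θ|` for a covariant two-tensor `θ`. -/
def normDeriv2 {n : ℕ} (G : (Fin n → ℝ) → Matrix (Fin n) (Fin n) ℝ) (k : ℕ)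
    (θ : (Fin n → ℝ) → Fin n → Fin n → ℝ) (x : Fin n → ℝ) : ℝ :=
  tensorNorm G (iterCovDeriv (r := 2) G (fun y I => θ y (I 0) (I 1)) k) x

/-! ### The sphere in two stereographic charts -/

/-- `|θ|²` for a point of a stereographic chart. -/
def rsq (θ : Fin 2 → ℝ) : ℝ := θ 0 ^ 2 + θ 1 ^ 2

/-- The conformal factor of the round unit metric `δ_{AB} / (1 + |θ|²/4)²`. -/
def roundFactor (θ : Fin 2 → ℝ) : ℝ := 1 / (1 + rsq θ / 4) ^ 2

/-- The change between the two (coherently oriented) stereographic charts, defined for `θ ≠ 0`.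
In complex notation it is `z ↦ 4 / z`. The closed discs `|θ| ≤ 2` of the two charts are
complementary closed hemispheres. -/
def chartChange (θ : Fin 2 → ℝ) : Fin 2 → ℝ :=
  ![4 * θ 0 / rsq θ, -(4 * θ 1 / rsq θ)]

/-- The Jacobian matrix of `chartChange`. -/
def chartJac (θ : Fin 2 → ℝ) : Matrix (Fin 2) (Fin 2) ℝ :=
  Matrix.of fun A B => pd B (fun y => chartChange y A) θ

/-! ### Seed data -/

/-- Seed data: a smooth function `ψ₀` of `s ∈ (0,1)` and of a point of the sphere, with values in
the symmetric trace-free `2 × 2` matrices and compact support in `(0,1) × S²`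
(extended by zero to all `s ∈ ℝ`). The matrices in the two charts represent one and the same
trace-free tensor field `ψ_{AB} / (1 + |θ|²/4)²` on the sphere. -/
structure SeedData where
  toFun : Fin 2 → ℝ → (Fin 2 → ℝ) → Matrix (Fin 2) (Fin 2) ℝ
  smooth : ∀ i A B, ContDiff ℝ ∞ (fun p : ℝ × (Fin 2 → ℝ) => toFun i p.1 p.2 A B)
  symm : ∀ i s θ, (toFun i s θ).IsSymm
  traceFree : ∀ i s θ, (toFun i s θ).trace = 0
  support : ∃ a b : ℝ, 0 < a ∧ b < 1 ∧ ∀ i s θ, s ∉ Set.Icc a b → toFun i s θ = 0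
  overlap : ∀ s θ, θ ≠ 0 →
    roundFactor θ • toFun 0 s θ =
      (chartJac θ)ᵀ * (roundFactor (chartChange θ) • toFun 1 s (chartChange θ)) * chartJac θ

/-- The `C^n` norm of the seed data is at most `B` (derivatives in `s` and in the coordinates,
over the two closed hemispheres). -/
def SeedData.CnBound (ψ : SeedData) (n : ℕ) (B : ℝ) : Prop :=
  ∀ j ≤ n, ∀ (i A B' : Fin 2) (s : ℝ) (θ : Fin 2 → ℝ), rsq θ ≤ 4 →
    ‖iteratedFDeriv ℝ j (fun p : ℝ × (Fin 2 → ℝ) => ψ.toFun i p.1 p.2 A B') (s, θ)‖ ≤ B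

/-- The condition `∫₀¹ |∂_s ψ₀(s, θ)|² ds = 16 m₀` for every `θ`. -/
def SeedData.HasMass (ψ : SeedData) (m₀ : ℝ) : Prop :=
  ∀ i θ, ∫ s in (0 : ℝ)..1, ∑ A, ∑ B, (deriv (fun t => ψ.toFun i t θ A B) s) ^ 2 = 16 * m₀

/-- The short pulse `ψ(u̲, θ) = (δ^{1/2} / |u₀|) ψ₀(u̲ / δ, θ)`; it vanishes for `u̲ ≥ δ`. -/
def SeedData.pulse (ψ : SeedData) (δ u₀ : ℝ) (i : Fin 2) (ub : ℝ) (θ : Fin 2 → ℝ) :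
    Matrix (Fin 2) (Fin 2) ℝ :=
  (Real.sqrt δ / |u₀|) • ψ.toFun i (ub / δ) θ

/-! ### Space-times in double null coordinates `(u̲, u, θ¹, θ²)` -/

/-- The point with coordinates `(u̲, u, θ)`. -/
def pt (ub u : ℝ) (θ : Fin 2 → ℝ) : Fin 4 → ℝ := ![ub, u, θ 0, θ 1]

/-- The angular coordinates of a point. -/
def ang (x : Fin 4 → ℝ) : Fin 2 → ℝ := ![x 2, x 3]

/-- The position of the angular index `A` among the four coordinate indices. -/
def sph (A : Fin 2) : Fin 4 := ![2, 3] A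

/-- The coordinate domain `0 ≤ u̲ ≤ T`, `u₀ ≤ u ≤ u₁`. -/
def slab (T u₀ u₁ : ℝ) : Set (Fin 4 → ℝ) :=
  {x | (0 ≤ x 0 ∧ x 0 ≤ T) ∧ (u₀ ≤ x 1 ∧ x 1 ≤ u₁)}

/-- A Lorentzian metric
`-2 Ω² (du̲ ⊗ du + du ⊗ du̲) + g̸_{AB} (dθ^A - b^A du̲) ⊗ (dθ^B - b^B du̲)`
on `[0,T] × [u₀,u₁] × S²`, smooth up to the boundary: the components in each of the two
stereographic charts extend smoothly across the boundary, and the extensions are the functions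
given here. -/
structure Spacetime (T u₀ u₁ : ℝ) where
  lapse : Fin 2 → (Fin 4 → ℝ) → ℝ
  shift : Fin 2 → (Fin 4 → ℝ) → Fin 2 → ℝ
  sphereMetric : Fin 2 → (Fin 4 → ℝ) → Matrix (Fin 2) (Fin 2) ℝ
  lapse_smooth : ∀ i, ∀ x ∈ slab T u₀ u₁, ContDiffAt ℝ ∞ (lapse i) x
  shift_smooth : ∀ i A, ∀ x ∈ slab T u₀ u₁, ContDiffAt ℝ ∞ (fun y => shift i y A) x
  sphereMetric_smooth : ∀ i A B, ∀ x ∈ slab T u₀ u₁,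
    ContDiffAt ℝ ∞ (fun y => sphereMetric i y A B) x
  lapse_pos : ∀ i, ∀ x ∈ slab T u₀ u₁, 0 < lapse i x
  sphereMetric_posDef : ∀ i, ∀ x ∈ slab T u₀ u₁, (sphereMetric i x).PosDef
  lapse_overlap : ∀ x ∈ slab T u₀ u₁, ang x ≠ 0 →
    lapse 1 (pt (x 0) (x 1) (chartChange (ang x))) = lapse 0 x
  shift_overlap : ∀ x ∈ slab T u₀ u₁, ang x ≠ 0 →
    shift 1 (pt (x 0) (x 1) (chartChange (ang x))) = chartJac (ang x) *ᵥ shift 0 x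
  sphereMetric_overlap : ∀ x ∈ slab T u₀ u₁, ang x ≠ 0 →
    sphereMetric 0 x =
      (chartJac (ang x))ᵀ * sphereMetric 1 (pt (x 0) (x 1) (chartChange (ang x)))
        * chartJac (ang x)

namespace Spacetime

variable {T u₀ u₁ : ℝ} (S : Spacetime T u₀ u₁) (i : Fin 2)

/-- The components of the one-form `dθ^A - b^A du̲`. -/
def coframe (A : Fin 2) (x : Fin 4 → ℝ) (μ : Fin 4) : ℝ :=
  (if μ = sph A then 1 else 0) - S.shift i x A * (if μ = 0 then 1 else 0)

/-- The components of the space-time metric. -/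
def metric (x : Fin 4 → ℝ) : Matrix (Fin 4) (Fin 4) ℝ :=
  Matrix.of fun μ ν =>
    -2 * S.lapse i x ^ 2 *
      ((if μ = 0 then 1 else 0) * (if ν = 1 then 1 else 0)
        + (if μ = 1 then 1 else 0) * (if ν = 0 then 1 else 0))
    + ∑ A, ∑ B, S.sphereMetric i x A B * S.coframe i A x μ * S.coframe i B x ν

/-- The Einstein vacuum equations. -/
def IsVacuum : Prop :=
  ∀ i, ∀ x ∈ slab T u₀ u₁, ∀ μ ν, ricci (S.metric i) μ ν x = 0

/-- The null vector `e₃ = Ω⁻¹ L̲`, with `L̲ = ∂_u`. -/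
def e3 (x : Fin 4 → ℝ) : Fin 4 → ℝ := (S.lapse i x)⁻¹ • Pi.single 1 1

/-- The null vector `e₄ = Ω⁻¹ L`, with `L = ∂_u̲ + b^A ∂_{θ^A}`. -/
def e4 (x : Fin 4 → ℝ) : Fin 4 → ℝ :=
  (S.lapse i x)⁻¹ • (Pi.single 0 1 + ∑ A, S.shift i x A • Pi.single (sph A) 1)

/-- The coordinate vectors tangent to the spheres; all tangential tensors below are given by
their components in this frame. -/
def eS (A : Fin 2) (_ : Fin 4 → ℝ) : Fin 4 → ℝ := Pi.single (sph A) 1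

/-! #### Connection coefficients -/

def chi (x : Fin 4 → ℝ) (A B : Fin 2) : ℝ :=
  inner2 (S.metric i) x (covVec (S.metric i) (eS A x) (S.e4 i) x) (eS B x)

def chib (x : Fin 4 → ℝ) (A B : Fin 2) : ℝ :=
  inner2 (S.metric i) x (covVec (S.metric i) (eS A x) (S.e3 i) x) (eS B x)

def eta (x : Fin 4 → ℝ) (A : Fin 2) : ℝ :=
  -(1 / 2) * inner2 (S.metric i) x (covVec (S.metric i) (S.e3 i x) (eS A) x) (S.e4 i x)

def etab (x : Fin 4 → ℝ) (A : Fin 2) : ℝ :=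
  -(1 / 2) * inner2 (S.metric i) x (covVec (S.metric i) (S.e4 i x) (eS A) x) (S.e3 i x)

def omega (x : Fin 4 → ℝ) : ℝ :=
  (1 / 2) * S.lapse i x *
    inner2 (S.metric i) x (covVec (S.metric i) (S.e4 i x) (S.e3 i) x) (S.e4 i x)

def omegab (x : Fin 4 → ℝ) : ℝ :=
  (1 / 2) * S.lapse i x *
    inner2 (S.metric i) x (covVec (S.metric i) (S.e3 i x) (S.e4 i) x) (S.e3 i x)

/-- The torsion `ζ = (η - η̲) / 2`. -/
def zeta (x : Fin 4 → ℝ) (A : Fin 2) : ℝ := (1 / 2) * (S.eta i x A - S.etab i x A)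

def trchi (x : Fin 4 → ℝ) : ℝ := ∑ A, ∑ B, (S.sphereMetric i x)⁻¹ A B * S.chi i x A B

def trchib (x : Fin 4 → ℝ) : ℝ := ∑ A, ∑ B, (S.sphereMetric i x)⁻¹ A B * S.chib i x A B

/-- The trace-free part of `χ`. -/
def chih (x : Fin 4 → ℝ) (A B : Fin 2) : ℝ :=
  S.chi i x A B - (1 / 2) * S.trchi i x * S.sphereMetric i x A B

/-- The trace-free part of `χ̲`. -/
def chibh (x : Fin 4 → ℝ) (A B : Fin 2) : ℝ :=
  S.chib i x A B - (1 / 2) * S.trchib i x * S.sphereMetric i x A B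

/-! #### Null curvature components -/

def alpha (x : Fin 4 → ℝ) (A B : Fin 2) : ℝ :=
  riemann (S.metric i) x (eS A x) (S.e4 i x) (eS B x) (S.e4 i x)

def alphab (x : Fin 4 → ℝ) (A B : Fin 2) : ℝ :=
  riemann (S.metric i) x (eS A x) (S.e3 i x) (eS B x) (S.e3 i x)

def beta (x : Fin 4 → ℝ) (A : Fin 2) : ℝ :=
  (1 / 2) * riemann (S.metric i) x (eS A x) (S.e4 i x) (S.e3 i x) (S.e4 i x)

def betab (x : Fin 4 → ℝ) (A : Fin 2) : ℝ :=
  (1 / 2) * riemann (S.metric i) x (eS A x) (S.e3 i x) (S.e3 i x) (S.e4 i x)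

def rho (x : Fin 4 → ℝ) : ℝ :=
  (1 / 4) * riemann (S.metric i) x (S.e3 i x) (S.e4 i x) (S.e3 i x) (S.e4 i x)

/-- The components `ε^{AB}` of the area form of `g̸` with raised indices. -/
def areaForm (x : Fin 4 → ℝ) (A B : Fin 2) : ℝ :=
  !![0, 1; -1, 0] A B / Real.sqrt (S.sphereMetric i x).det

def sigma (x : Fin 4 → ℝ) : ℝ :=
  (1 / 4) * ∑ A, ∑ B,
    riemann (S.metric i) x (S.e3 i x) (S.e4 i x) (eS A x) (eS B x) * S.areaForm i x A B

/-- The metric induced on the sphere `S_{u̲,u}`, as a function of the angular coordinates. -/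
def sphereAt (ub u : ℝ) (θ : Fin 2 → ℝ) : Matrix (Fin 2) (Fin 2) ℝ :=
  S.sphereMetric i (pt ub u θ)

end Spacetime

/-- The characteristic data. On the initial outgoing cone `u = u₀` the coordinates satisfy
`Ω = 1`, `b = 0`, and the conformal class of the spheres is prescribed by the short pulse on
`0 ≤ u̲ ≤ δ`, continued by zero (vanishing shear) for `δ ≤ u̲ ≤ δ + 1`. The incoming cone `u̲ = 0`
carries the data of the light cone of Minkowski space-time: `Ω = 1` and spheres of radius `|u|`,
and on the sphere `u̲ = 0`, `u = u₀` vanishing torsion and `tr χ = 2 / |u₀|`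
(the value `tr χ̲ = -2 / |u₀|` is contained in the first two). -/
structure Spacetime.HasShortPulseData {δ u₀ u₁ : ℝ} (S : Spacetime (δ + 1) u₀ u₁)
    (ψ : SeedData) : Prop where
  lapse_outgoing : ∀ i, ∀ ub ∈ Set.Icc 0 (δ + 1), ∀ θ, S.lapse i (pt ub u₀ θ) = 1
  shift_outgoing : ∀ i, ∀ ub ∈ Set.Icc 0 (δ + 1), ∀ θ, S.shift i (pt ub u₀ θ) = 0
  conformal_outgoing : ∃ φ : Fin 2 → ℝ → (Fin 2 → ℝ) → ℝ,
    ∀ i, ∀ ub ∈ Set.Icc 0 (δ + 1), ∀ θ, 0 < φ i ub θ ∧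
      S.sphereMetric i (pt ub u₀ θ) =
        (φ i ub θ ^ 2 * (|u₀| ^ 2 * roundFactor θ)) • NormedSpace.exp (ψ.pulse δ u₀ i ub θ)
  lapse_incoming : ∀ i, ∀ u ∈ Set.Icc u₀ u₁, ∀ θ, S.lapse i (pt 0 u θ) = 1
  sphereMetric_incoming : ∀ i, ∀ u ∈ Set.Icc u₀ u₁, ∀ θ,
    S.sphereMetric i (pt 0 u θ) = (|u| ^ 2 * roundFactor θ) • (1 : Matrix (Fin 2) (Fin 2) ℝ)
  torsion_corner : ∀ i θ A, S.zeta i (pt 0 u₀ θ) A = 0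
  trchi_corner : ∀ i θ, S.trchi i (pt 0 u₀ θ) = 2 / |u₀|

/-! ### The Schwarzschild values

In the Schwarzschild space-time of mass `m₀`, take the outgoing cone issuing from a sphere
`u̲ = δ` of radius `|u₀|`, in the double null gauge with `Ω = 1` on that outgoing cone and on the
incoming cone `u̲ = δ`, normalized by `tr χ̲ = -2 / |u₀|` (hence `tr χ = 2 / |u₀| - 4 m₀ / |u₀|²`)
on that sphere. Along the outgoing cone the area radius is affine in `u̲`, and the only
non-vanishing connection and curvature components are the following four. -/

/-- The area radius `r`. -/
def schwR (m₀ u₀ δ ub : ℝ) : ℝ := |u₀| + (1 - 2 * m₀ / |u₀|) * (ub - δ)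

/-- The value of `tr χ`. -/
def schwTrchi (m₀ u₀ δ ub : ℝ) : ℝ := 2 * (1 - 2 * m₀ / |u₀|) / schwR m₀ u₀ δ ub

/-- The value of `tr χ̲`; it satisfies `1 - 2 m₀ / r = - r² tr χ tr χ̲ / 4`. -/
def schwTrchib (m₀ u₀ δ ub : ℝ) : ℝ :=
  -(2 / schwR m₀ u₀ δ ub) * ((1 - 2 * m₀ / schwR m₀ u₀ δ ub) / (1 - 2 * m₀ / |u₀|))

/-- The value of `ω̲`, the solution of `∂_u̲ ω̲ = -ρ` that vanishes at `u̲ = δ`. -/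
def schwOmegab (m₀ u₀ δ ub : ℝ) : ℝ :=
  m₀ / (1 - 2 * m₀ / |u₀|) * (1 / |u₀| ^ 2 - 1 / schwR m₀ u₀ δ ub ^ 2)

/-- The value of `ρ`. -/
def schwRho (m₀ u₀ δ ub : ℝ) : ℝ := -(2 * m₀ / schwR m₀ u₀ δ ub ^ 3)

end NullCone

end

open NullCone

/-! On the cone u = u₀ the gauge Ω = 1, b = 0 turns the vacuum equations into a hierarchy of
ordinary differential equations along the generators. Each stage is linear in its new unknown, with
coefficients and sources made of quantities already controlled and their angular derivatives. With h
= φ²|u₀|²γ e^ψ the order is: φ from R₀₀ = 0; the torsion (`fc`) from R_{0A} = 0; χ̲ (`fk`) from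
R_{AB} = 0; ω̲ (`fw`) from R₀₁ = 0; and α̲ from the Bianchi identities (`pd_zero_lowCurv_1A1B`). The
remaining curvature components are read off from the Gauss and Codazzi formulas and the vacuum
equations.

The mass appears in the first stage. Raychaudhuri's equation becomes φ'' = ¼ det(∂e^ψ) φ
(`dt_dt_phi`), and ¼ det(∂e^ψ) equals −⅛|∂ψ|² up to smaller terms. Across the pulse φ' therefore
drops by ⅛∫|∂ψ|² = 2m₀/u₀², in every direction alike (`mf_eq`). Afterwards φ is, up to O(δ^{1/2}),
affine with slope (1 − 2m₀/|u₀|)/|u₀|, so that |u₀|φ is the Schwarzschild radius r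
(`ctl_phi_sub_aux`).

The estimates are Gronwall estimates. Coefficients are at most of size 1/δ for a time δ and bounded
for a unit time, so solutions grow by a factor independent of δ (`Ctl.ode`). The Schwarzschild
values solve the same hierarchy with reference coefficients, and the coefficient errors are
O(δ^{-1/2}) on the pulse and O(δ^{1/2}) after it. Their time integrals are O(δ^{1/2}), hence so is
the error of the solution (`Ap.ode`). Angular derivatives obey the differentiated linear systems,
with the same matrix.

Uniformity of the constants is obtained by working with families indexed by all solutions with given
seed bounds, together with a choice of chart. Since the equations act at fixed θ, each closed
hemisphere is treated inside its own chart.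

The vanishing statements after the pulse need no estimate: ψ = 0 makes h, χ and R_{A0B0} pure trace,
and R₀₀ = 0 then removes the trace of α. -/

noncomputable section

namespace NullCone

section

/-! ### Calculus on a set of unique differentiability -/

/-- `f` is smooth (in a neighbourhood of each point) at every point of `s`. -/
def SmoothAtOn {n : ℕ} (s : Set (Fin n → ℝ)) (f : (Fin n → ℝ) → ℝ) : Prop :=
  ∀ x ∈ s, ContDiffAt ℝ ∞ f x

section Calculus

variable {n : ℕ} {s : Set (Fin n → ℝ)} {f g : (Fin n → ℝ) → ℝ} {x : Fin n → ℝ}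

theorem SmoothAtOn.differentiableAt (hf : SmoothAtOn s f) (hx : x ∈ s) :
    DifferentiableAt ℝ f x := (hf x hx).differentiableAt (by simp)

theorem SmoothAtOn.const (a : ℝ) : SmoothAtOn s (fun _ => a) := fun _ _ => contDiffAt_const

theorem SmoothAtOn.add (hf : SmoothAtOn s f) (hg : SmoothAtOn s g) :
    SmoothAtOn s (fun x => f x + g x) := fun x hx => (hf x hx).add (hg x hx)

theorem SmoothAtOn.sub (hf : SmoothAtOn s f) (hg : SmoothAtOn s g) :
    SmoothAtOn s (fun x => f x - g x) := fun x hx => (hf x hx).sub (hg x hx)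

theorem SmoothAtOn.mul (hf : SmoothAtOn s f) (hg : SmoothAtOn s g) :
    SmoothAtOn s (fun x => f x * g x) := fun x hx => (hf x hx).mul (hg x hx)

theorem SmoothAtOn.neg (hf : SmoothAtOn s f) : SmoothAtOn s (fun x => -f x) :=
  fun x hx => (hf x hx).neg

theorem SmoothAtOn.sum {ι : Type*} {t : Finset ι} {f : ι → (Fin n → ℝ) → ℝ}
    (hf : ∀ i ∈ t, SmoothAtOn s (f i)) : SmoothAtOn s (fun x => ∑ i ∈ t, f i x) :=
  fun x hx => ContDiffAt.sum fun i hi => hf i hi x hx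

theorem SmoothAtOn.pd (hf : SmoothAtOn s f) (i : Fin n) : SmoothAtOn s (NullCone.pd i f) := by
  intro x hx
  have h : ContDiffAt ℝ ∞ (fderiv ℝ f) x := (hf x hx).fderiv_right (by simp)
  exact h.clm_apply contDiffAt_const

theorem pd_const (i : Fin n) (a : ℝ) : pd i (fun _ => a) x = 0 := by simp [pd]

theorem pd_add (i : Fin n) (hf : SmoothAtOn s f) (hg : SmoothAtOn s g) (hx : x ∈ s) :
    pd i (fun y => f y + g y) x = pd i f x + pd i g x := by
  simp [pd, fderiv_fun_add (hf.differentiableAt hx) (hg.differentiableAt hx)]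

theorem pd_sub (i : Fin n) (hf : SmoothAtOn s f) (hg : SmoothAtOn s g) (hx : x ∈ s) :
    pd i (fun y => f y - g y) x = pd i f x - pd i g x := by
  simp [pd, fderiv_fun_sub (hf.differentiableAt hx) (hg.differentiableAt hx)]

theorem pd_neg (i : Fin n) : pd i (fun y => -f y) x = -pd i f x := by
  simp [pd, fderiv_fun_neg]

theorem pd_mul (i : Fin n) (hf : SmoothAtOn s f) (hg : SmoothAtOn s g) (hx : x ∈ s) :
    pd i (fun y => f y * g y) x = pd i f x * g x + f x * pd i g x := by
  simp [pd, fderiv_fun_mul (hf.differentiableAt hx) (hg.differentiableAt hx)]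
  ring

theorem pd_const_mul (i : Fin n) (a : ℝ) (hf : SmoothAtOn s f) (hx : x ∈ s) :
    pd i (fun y => a * f y) x = a * pd i f x := by
  rw [pd_mul i (SmoothAtOn.const a) hf hx, pd_const, zero_mul, zero_add]

theorem pd_sum {ι : Type*} (i : Fin n) (t : Finset ι) {f : ι → (Fin n → ℝ) → ℝ}
    (hf : ∀ a ∈ t, SmoothAtOn s (f a)) (hx : x ∈ s) :
    pd i (fun y => ∑ a ∈ t, f a y) x = ∑ a ∈ t, pd i (f a) x := by
  unfold pd
  rw [fderiv_fun_sum fun a ha => (hf a ha).differentiableAt hx]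
  simp

theorem pd_comm (i j : Fin n) (hf : SmoothAtOn s f) (hx : x ∈ s) :
    pd i (pd j f) x = pd j (pd i f) x := by
  have h : ContDiffAt ℝ ∞ (fderiv ℝ f) x := (hf x hx).fderiv_right (by simp)
  have hd : DifferentiableAt ℝ (fderiv ℝ f) x := h.differentiableAt (by simp)
  have key : ∀ v w : Fin n → ℝ, fderiv ℝ (fun y => fderiv ℝ f y v) x w
      = fderiv ℝ (fderiv ℝ f) x w v := by
    intro v w
    rw [fderiv_clm_apply hd (differentiableAt_const v)]
    simp
  have hsym := (hf x hx).isSymmSndFDerivAt (by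
    simp only [minSmoothness_of_isRCLikeNormedField]
    exact WithTop.coe_le_coe.2 le_top)
  change fderiv ℝ (fun y => fderiv ℝ f y _) x _ = fderiv ℝ (fun y => fderiv ℝ f y _) x _
  rw [key, key]
  exact hsym _ _

/-- Gauge conditions and vacuum equations hold only on a closed slab, not in a neighbourhood of its
boundary. Unique differentiability makes the values on `s` determine every partial derivative,
boundary points included. -/
theorem pd_eq_of_eqOn (hs : UniqueDiffOn ℝ s) (hf : SmoothAtOn s f) (hg : SmoothAtOn s g)
    (h : ∀ y ∈ s, f y = g y) (i : Fin n) (hx : x ∈ s) : pd i f x = pd i g x := by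
  unfold pd
  rw [← (hf.differentiableAt hx).fderivWithin (hs x hx),
    ← (hg.differentiableAt hx).fderivWithin (hs x hx), fderivWithin_congr h (h x hx)]

theorem smoothAtOn_det {m : ℕ} {M : (Fin n → ℝ) → Matrix (Fin m) (Fin m) ℝ}
    (hM : ∀ a b, SmoothAtOn s (fun y => M y a b)) : SmoothAtOn s (fun y => (M y).det) := by
  intro x hx
  simp only [Matrix.det_apply']
  exact ContDiffAt.sum fun σ _ => contDiffAt_const.mul (contDiffAt_prod fun i _ => hM _ _ x hx)

/-- The inverse is the adjugate divided by the determinant, and an adjugate entry is again a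
determinant. -/
theorem smoothAtOn_inv {m : ℕ} {M : (Fin n → ℝ) → Matrix (Fin m) (Fin m) ℝ}
    (hM : ∀ a b, SmoothAtOn s (fun y => M y a b)) (hdet : ∀ y ∈ s, IsUnit (M y).det)
    (a b : Fin m) : SmoothAtOn s (fun y => (M y)⁻¹ a b) := by
  intro x hx
  have h1 : ContDiffAt ℝ ∞ (fun y => ((M y).det)⁻¹) x :=
    (smoothAtOn_det hM x hx).inv (hdet x hx).ne_zero
  have h2 : ContDiffAt ℝ ∞ (fun y => (M y).adjugate a b) x := by
    simp only [Matrix.adjugate_apply]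
    refine smoothAtOn_det (fun c d => ?_) x hx
    by_cases h : c = b
    · subst h
      simp only [Matrix.updateRow_self]
      exact SmoothAtOn.const _
    · simp only [Matrix.updateRow_ne h]
      exact hM c d
  refine (h1.mul h2).congr_of_eventuallyEq ?_
  filter_upwards with y
  simp [Matrix.inv_def, Ring.inverse_eq_inv']

end Calculus

/-! ### Curvature identities for a pseudo-Riemannian metric -/

/-- The Christoffel symbol of the first kind `Γ_{l,ij}`. -/
def christoffel1 {n : ℕ} (G : (Fin n → ℝ) → Matrix (Fin n) (Fin n) ℝ)
    (l i j : Fin n) (x : Fin n → ℝ) : ℝ :=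
  (1 / 2) * (pd i (fun y => G y j l) x + pd j (fun y => G y i l) x - pd l (fun y => G y i j) x)

/-- The covariant curvature components `R_{abcd}`. -/
def lowCurv {n : ℕ} (G : (Fin n → ℝ) → Matrix (Fin n) (Fin n) ℝ)
    (a b c d : Fin n) (x : Fin n → ℝ) : ℝ :=
  ∑ e, G x a e * curvature G e b c d x

/-- The components `∇_e R_{abcd}`. -/
def covCurv {n : ℕ} (G : (Fin n → ℝ) → Matrix (Fin n) (Fin n) ℝ)
    (e a b c d : Fin n) (x : Fin n → ℝ) : ℝ :=
  pd e (lowCurv G a b c d) x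
    - ∑ f, (christoffel G f e a x * lowCurv G f b c d x + christoffel G f e b x * lowCurv G a f c d x
      + christoffel G f e c x * lowCurv G a b f d x + christoffel G f e d x * lowCurv G a b c f x)

/-- A smooth pseudo-Riemannian metric on a set with the unique differentiability property. -/
structure MetricOn {n : ℕ} (s : Set (Fin n → ℝ))
    (G : (Fin n → ℝ) → Matrix (Fin n) (Fin n) ℝ) : Prop where
  uniq : UniqueDiffOn ℝ s
  smooth : ∀ a b, SmoothAtOn s (fun y => G y a b)
  symm : ∀ x ∈ s, ∀ a b, G x a b = G x b a
  det : ∀ x ∈ s, IsUnit (G x).det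

namespace MetricOn

variable {n : ℕ} {s : Set (Fin n → ℝ)} {G : (Fin n → ℝ) → Matrix (Fin n) (Fin n) ℝ}
  (hG : MetricOn s G) {x : Fin n → ℝ}
include hG

theorem inv_smooth (a b : Fin n) : SmoothAtOn s (fun y => (G y)⁻¹ a b) :=
  smoothAtOn_inv hG.smooth hG.det a b

theorem inv_symm (hx : x ∈ s) (a b : Fin n) : (G x)⁻¹ a b = (G x)⁻¹ b a := by
  have h : (G x)ᵀ = G x := by
    ext i j
    exact hG.symm x hx j i
  have := Matrix.transpose_nonsing_inv (G x)
  rw [h] at this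
  exact congrFun (congrFun this b) a

theorem pd_symm (hx : x ∈ s) (i a b : Fin n) :
    pd i (fun y => G y a b) x = pd i (fun y => G y b a) x :=
  pd_eq_of_eqOn hG.uniq (hG.smooth a b) (hG.smooth b a) (fun y hy => hG.symm y hy a b) i hx

theorem christoffel1_smooth (l i j : Fin n) : SmoothAtOn s (christoffel1 G l i j) :=
  (SmoothAtOn.const _).mul ((((hG.smooth _ _).pd _).add ((hG.smooth _ _).pd _)).sub
    ((hG.smooth _ _).pd _))

omit hG in
theorem christoffel_eq (k i j : Fin n) (x : Fin n → ℝ) :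
    christoffel G k i j x = ∑ l, (G x)⁻¹ k l * christoffel1 G l i j x := by
  simp only [christoffel, christoffel1, Finset.mul_sum]
  exact Finset.sum_congr rfl fun l _ => by ring

theorem christoffel_smooth (k i j : Fin n) : SmoothAtOn s (christoffel G k i j) := by
  have : christoffel G k i j = fun x => ∑ l, (G x)⁻¹ k l * christoffel1 G l i j x :=
    funext fun x => christoffel_eq k i j x
  rw [this]
  exact SmoothAtOn.sum fun l _ => (hG.inv_smooth _ _).mul (hG.christoffel1_smooth _ _ _)

theorem curvature_smooth (a b c d : Fin n) : SmoothAtOn s (curvature G a b c d) :=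
  (((hG.christoffel_smooth _ _ _).pd _).sub ((hG.christoffel_smooth _ _ _).pd _)).add
    (SmoothAtOn.sum fun _ _ => ((hG.christoffel_smooth _ _ _).mul (hG.christoffel_smooth _ _ _)).sub
      ((hG.christoffel_smooth _ _ _).mul (hG.christoffel_smooth _ _ _)))

theorem lowCurv_smooth (a b c d : Fin n) : SmoothAtOn s (lowCurv G a b c d) :=
  SmoothAtOn.sum fun _ _ => (hG.smooth _ _).mul (hG.curvature_smooth _ _ _ _)

theorem christoffel1_symm (hx : x ∈ s) (l i j : Fin n) :
    christoffel1 G l i j x = christoffel1 G l j i x := by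
  simp only [christoffel1, hG.pd_symm hx l i j]
  ring

theorem christoffel_symm (hx : x ∈ s) (l i j : Fin n) :
    christoffel G l i j x = christoffel G l j i x := by
  rw [christoffel_eq, christoffel_eq]
  exact Finset.sum_congr rfl fun e _ => by rw [hG.christoffel1_symm hx]

theorem sum_metric_mul_inv (hx : x ∈ s) (a c : Fin n) :
    ∑ b, G x a b * (G x)⁻¹ b c = if a = c then 1 else 0 := by
  have := Matrix.mul_nonsing_inv (G x) (hG.det x hx)
  have h := congrFun (congrFun this a) c
  rwa [Matrix.mul_apply, Matrix.one_apply] at h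

theorem sum_inv_mul_metric (hx : x ∈ s) (a c : Fin n) :
    ∑ b, (G x)⁻¹ a b * G x b c = if a = c then 1 else 0 := by
  have := Matrix.nonsing_inv_mul (G x) (hG.det x hx)
  have h := congrFun (congrFun this a) c
  rwa [Matrix.mul_apply, Matrix.one_apply] at h

theorem lower_christoffel (hx : x ∈ s) (a i j : Fin n) :
    ∑ k, G x a k * christoffel G k i j x = christoffel1 G a i j x := by
  simp only [christoffel_eq, Finset.mul_sum]
  rw [Finset.sum_comm]
  simp only [← mul_assoc, ← Finset.sum_mul, hG.sum_metric_mul_inv hx]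
  simp

/-- This is metric compatibility. It gives the price of moving the metric past a derivative when an
index is lowered. -/
theorem pd_metric (hx : x ∈ s) (e a b : Fin n) :
    pd e (fun y => G y a b) x = christoffel1 G a e b x + christoffel1 G b e a x := by
  simp only [christoffel1, hG.pd_symm hx e b a, hG.pd_symm hx b e a, hG.pd_symm hx a e b]
  ring

/-- The curvature in terms of the Christoffel symbols of the first kind. -/
theorem lowCurv_eq (hx : x ∈ s) (a b c d : Fin n) :
    lowCurv G a b c d x = pd c (christoffel1 G a d b) x - pd d (christoffel1 G a c b) x
      - (∑ e, ∑ f, (G x)⁻¹ e f * (christoffel1 G e c a x * christoffel1 G f d b x))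
      + ∑ e, ∑ f, (G x)⁻¹ e f * (christoffel1 G e d a x * christoffel1 G f c b x) := by
  -- Moving the metric past the derivative produces two Christoffel terms. The first cancels the
  -- quadratic term computed in `quad`; the second survives as the quadratic term of the statement.
  have key : ∀ c d, ∑ e, G x a e * pd c (christoffel G e d b) x
      = pd c (christoffel1 G a d b) x
        - ∑ e, (christoffel1 G a c e x + christoffel1 G e c a x) * christoffel G e d b x := by
    intro c d
    have h := pd_eq_of_eqOn hG.uniq
      (SmoothAtOn.sum (t := Finset.univ) fun e _ =>
        (hG.smooth a e).mul (hG.christoffel_smooth e d b))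
      (hG.christoffel1_smooth a d b) (fun y hy => hG.lower_christoffel hy a d b) c hx
    rw [pd_sum _ _ (fun _ _ => (hG.smooth _ _).mul (hG.christoffel_smooth _ d b)) hx] at h
    rw [← h, eq_sub_iff_add_eq, ← Finset.sum_add_distrib]
    refine Finset.sum_congr rfl fun e _ => ?_
    rw [pd_mul c (hG.smooth a e) (hG.christoffel_smooth e d b) hx, hG.pd_metric hx]
    ring
  have quad : ∀ c d, ∑ e, G x a e * ∑ f, christoffel G e c f x * christoffel G f d b x
      = ∑ f, christoffel1 G a c f x * christoffel G f d b x := by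
    intro c d
    simp only [Finset.mul_sum]
    rw [Finset.sum_comm]
    refine Finset.sum_congr rfl fun f _ => ?_
    rw [← hG.lower_christoffel hx, Finset.sum_mul]
    exact Finset.sum_congr rfl fun e _ => by ring
  have lin : ∀ c d, ∑ e, christoffel1 G e c a x * christoffel G e d b x
      = ∑ e, ∑ f, (G x)⁻¹ e f * (christoffel1 G e c a x * christoffel1 G f d b x) := by
    intro c d
    refine Finset.sum_congr rfl fun e _ => ?_
    rw [christoffel_eq, Finset.mul_sum]
    exact Finset.sum_congr rfl fun f _ => by ring
  unfold lowCurv curvature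
  simp only [mul_add, mul_sub, Finset.sum_add_distrib, Finset.sum_sub_distrib]
  rw [key, key, quad, quad, ← lin, ← lin]
  simp only [add_mul, Finset.sum_add_distrib]
  ring

omit hG in
theorem lowCurv_swap_right (a b c d : Fin n) (x : Fin n → ℝ) :
    lowCurv G a b c d x = -lowCurv G a b d c x := by
  simp only [lowCurv, curvature, ← Finset.sum_neg_distrib]
  refine Finset.sum_congr rfl fun e _ => ?_
  simp only [Finset.sum_sub_distrib]
  ring

theorem pd_pd_symm (hx : x ∈ s) (i j a b : Fin n) :
    pd i (pd j (fun y => G y a b)) x = pd i (pd j (fun y => G y b a)) x :=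
  pd_eq_of_eqOn hG.uniq ((hG.smooth a b).pd j) ((hG.smooth b a).pd j)
    (fun _ hy => hG.pd_symm hy j a b) i hx

theorem pd_christoffel1 (hx : x ∈ s) (c l i j : Fin n) :
    pd c (christoffel1 G l i j) x = (1 / 2) * (pd c (pd i (fun y => G y j l)) x
      + pd c (pd j (fun y => G y i l)) x - pd c (pd l (fun y => G y i j)) x) := by
  unfold christoffel1
  rw [pd_const_mul c _ ((((hG.smooth _ _).pd _).add ((hG.smooth _ _).pd _)).sub
    ((hG.smooth _ _).pd _)) hx, pd_sub c (((hG.smooth _ _).pd _).add ((hG.smooth _ _).pd _))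
    ((hG.smooth _ _).pd _) hx, pd_add c ((hG.smooth _ _).pd _) ((hG.smooth _ _).pd _) hx]

theorem sum_inv_swap (hx : x ∈ s) (u v : Fin n → ℝ) :
    ∑ e, ∑ f, (G x)⁻¹ e f * (u e * v f) = ∑ e, ∑ f, (G x)⁻¹ e f * (v e * u f) := by
  rw [Finset.sum_comm]
  refine Finset.sum_congr rfl fun e _ => Finset.sum_congr rfl fun f _ => ?_
  rw [hG.inv_symm hx]
  ring

/-- In terms of Christoffel symbols of the first kind the second derivatives of the metric cancel
because they commute, and the quadratic terms because the inverse metric is symmetric. -/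
theorem lowCurv_swap_left (hx : x ∈ s) (a b c d : Fin n) :
    lowCurv G a b c d x = -lowCurv G b a c d x := by
  rw [hG.lowCurv_eq hx, hG.lowCurv_eq hx]
  simp only [hG.pd_christoffel1 hx]
  rw [hG.sum_inv_swap hx (fun e => christoffel1 G e c a x) (fun f => christoffel1 G f d b x),
    hG.sum_inv_swap hx (fun e => christoffel1 G e d a x) (fun f => christoffel1 G f c b x),
    pd_comm c d (hG.smooth b a) hx, hG.pd_pd_symm hx d c b a, hG.pd_pd_symm hx c b d a,
    hG.pd_pd_symm hx c a d b, hG.pd_pd_symm hx d b c a, hG.pd_pd_symm hx d a c b,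
    pd_comm c d (hG.smooth a b) hx]
  ring

theorem lowCurv_pair (hx : x ∈ s) (a b c d : Fin n) :
    lowCurv G a b c d x = lowCurv G c d a b x := by
  rw [hG.lowCurv_eq hx, hG.lowCurv_eq hx]
  simp only [hG.pd_christoffel1 hx]
  rw [hG.sum_inv_swap hx (fun e => christoffel1 G e d a x) (fun f => christoffel1 G f c b x)]
  simp only [hG.christoffel1_symm hx _ c a, hG.christoffel1_symm hx _ d b,
    hG.christoffel1_symm hx _ c b, hG.christoffel1_symm hx _ d a]
  rw [pd_comm c d (hG.smooth b a) hx, pd_comm a b (hG.smooth d c) hx,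
    pd_comm c b (hG.smooth d a) hx, pd_comm c a (hG.smooth d b) hx,
    pd_comm d b (hG.smooth c a) hx, pd_comm d a (hG.smooth c b) hx,
    hG.pd_pd_symm hx b c d a, hG.pd_pd_symm hx a c d b, hG.pd_pd_symm hx b d c a,
    hG.pd_pd_symm hx a d c b]
  ring

theorem ricci_eq (hx : x ∈ s) (b d : Fin n) :
    ricci G b d x = ∑ a, ∑ c, (G x)⁻¹ a c * lowCurv G c b a d x := by
  unfold ricci lowCurv
  refine Finset.sum_congr rfl fun a _ => ?_
  simp only [Finset.mul_sum]
  rw [Finset.sum_comm]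
  simp only [← mul_assoc, ← Finset.sum_mul, hG.sum_inv_mul_metric hx]
  simp

/-- For the connection matrices Γ_c the curvature is ∂_cΓ_d − ∂_dΓ_c + [Γ_c, Γ_d]. Once mixed second
derivatives are identified, the cyclic sum of covariant derivatives vanishes by the Jacobi identity,
a computation in the noncommutative ring of matrices. -/
theorem bianchi_mixed (hx : x ∈ s) (g b e c d : Fin n) :
    (pd e (curvature G g b c d) x + ∑ f, christoffel G g e f x * curvature G f b c d x
        - ∑ f, curvature G g f c d x * christoffel G f e b x)
      + (pd c (curvature G g b d e) x + ∑ f, christoffel G g c f x * curvature G f b d e x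
        - ∑ f, curvature G g f d e x * christoffel G f c b x)
      + (pd d (curvature G g b e c) x + ∑ f, christoffel G g d f x * curvature G f b e c x
        - ∑ f, curvature G g f e c x * christoffel G f d b x) = 0 := by
  let Γ : Fin n → Matrix (Fin n) (Fin n) ℝ := fun c => Matrix.of fun g b => christoffel G g c b x
  let P : Fin n → Fin n → Matrix (Fin n) (Fin n) ℝ := fun e c =>
    Matrix.of fun g b => pd e (christoffel G g c b) x
  let Q : Fin n → Fin n → Fin n → Matrix (Fin n) (Fin n) ℝ := fun a e c =>
    Matrix.of fun g b => pd a (pd e (christoffel G g c b)) x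
  let R : Fin n → Fin n → Matrix (Fin n) (Fin n) ℝ := fun c d =>
    P c d - P d c + (Γ c * Γ d - Γ d * Γ c)
  have hR : ∀ g b c d, curvature G g b c d x = R c d g b := by
    intro g b c d
    simp [R, P, Γ, curvature, Matrix.mul_apply, Finset.sum_sub_distrib]
  have hdR : ∀ g b e c d, pd e (curvature G g b c d) x
      = (Q e c d - Q e d c + ((P e c * Γ d + Γ c * P e d) - (P e d * Γ c + Γ d * P e c))) g b := by
    intro g b e c d
    have hs := hG.christoffel_smooth
    have e1 : pd e (curvature G g b c d) x = pd e (pd c (christoffel G g d b)) x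
        - pd e (pd d (christoffel G g c b)) x + ∑ f, ((pd e (christoffel G g c f) x
          * christoffel G f d b x + christoffel G g c f x * pd e (christoffel G f d b) x)
        - (pd e (christoffel G g d f) x * christoffel G f c b x
          + christoffel G g d f x * pd e (christoffel G f c b) x)) := by
      unfold curvature
      rw [pd_add e (((hs _ _ _).pd _).sub ((hs _ _ _).pd _))
        (SmoothAtOn.sum fun _ _ => ((hs _ _ _).mul (hs _ _ _)).sub ((hs _ _ _).mul (hs _ _ _))) hx,
        pd_sub e ((hs _ _ _).pd _) ((hs _ _ _).pd _) hx,
        pd_sum e _ (fun _ _ => ((hs _ _ _).mul (hs _ _ _)).sub ((hs _ _ _).mul (hs _ _ _))) hx]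
      congr 1
      refine Finset.sum_congr rfl fun f _ => ?_
      rw [pd_sub e ((hs _ _ _).mul (hs _ _ _)) ((hs _ _ _).mul (hs _ _ _)) hx,
        pd_mul e (hs _ _ _) (hs _ _ _) hx, pd_mul e (hs _ _ _) (hs _ _ _) hx]
    rw [e1]
    simp [Q, P, Γ, Matrix.mul_apply, Finset.sum_sub_distrib, Finset.sum_add_distrib]
  have hQ : ∀ a e c, Q a e c = Q e a c := by
    intro a e c
    ext g b
    exact pd_comm a e (hG.christoffel_smooth g c b) hx
  have key : ∀ e c d, pd e (curvature G g b c d) x + ∑ f, christoffel G g e f x * curvature G f b c d x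
        - ∑ f, curvature G g f c d x * christoffel G f e b x
      = (Q e c d - Q e d c + ((P e c * Γ d + Γ c * P e d) - (P e d * Γ c + Γ d * P e c))
        + Γ e * R c d - R c d * Γ e) g b := by
    intro e c d
    rw [hdR]
    simp [Matrix.mul_apply, hR, Γ]
  rw [key, key, key, ← Matrix.add_apply, ← Matrix.add_apply]
  refine congrFun (congrFun (?_ : _ = (0 : Matrix (Fin n) (Fin n) ℝ)) g) b
  rw [hQ c d e, hQ c e d, hQ d e c]
  simp only [R]
  noncomm_ring

/-- Lowering the first index commutes with ∇. The corrections for the last two indices are kept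
apart because they drop out of the cyclic sum in `bianchi` by the symmetry of the Christoffel
symbols. -/
theorem covCurv_eq (hx : x ∈ s) (e a b c d : Fin n) :
    covCurv G e a b c d x = ∑ g, G x a g * (pd e (curvature G g b c d) x
        + ∑ f, christoffel G g e f x * curvature G f b c d x
        - ∑ f, curvature G g f c d x * christoffel G f e b x)
      - ∑ f, (christoffel G f e c x * lowCurv G a b f d x
        + christoffel G f e d x * lowCurv G a b c f x) := by
  have h1 : pd e (lowCurv G a b c d) x
      = ∑ g, (christoffel1 G a e g x + christoffel1 G g e a x) * curvature G g b c d x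
        + ∑ g, G x a g * pd e (curvature G g b c d) x := by
    unfold lowCurv
    rw [pd_sum e _ (fun g _ => (hG.smooth a g).mul (hG.curvature_smooth g b c d)) hx,
      ← Finset.sum_add_distrib]
    refine Finset.sum_congr rfl fun g _ => ?_
    rw [pd_mul e (hG.smooth a g) (hG.curvature_smooth g b c d) hx, hG.pd_metric hx]
  have h2 : ∑ g, G x a g * ∑ f, christoffel G g e f x * curvature G f b c d x
      = ∑ g, christoffel1 G a e g x * curvature G g b c d x := by
    simp only [Finset.mul_sum]
    rw [Finset.sum_comm]
    refine Finset.sum_congr rfl fun f _ => ?_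
    rw [← hG.lower_christoffel hx, Finset.sum_mul]
    exact Finset.sum_congr rfl fun e _ => by ring
  have h3 : ∑ f, christoffel G f e a x * lowCurv G f b c d x
      = ∑ g, christoffel1 G g e a x * curvature G g b c d x := by
    unfold lowCurv
    simp only [Finset.mul_sum]
    rw [Finset.sum_comm]
    refine Finset.sum_congr rfl fun f _ => ?_
    rw [← hG.lower_christoffel hx, Finset.sum_mul]
    exact Finset.sum_congr rfl fun e _ => by rw [hG.symm x hx f e]; ring
  have h4 : ∑ f, christoffel G f e b x * lowCurv G a f c d x
      = ∑ g, G x a g * ∑ f, curvature G g f c d x * christoffel G f e b x := by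
    unfold lowCurv
    simp only [Finset.mul_sum]
    rw [Finset.sum_comm]
    exact Finset.sum_congr rfl fun _ _ => Finset.sum_congr rfl fun _ _ => by ring
  unfold covCurv
  simp only [Finset.sum_add_distrib, mul_add, mul_sub, Finset.sum_sub_distrib]
  rw [h1, h2, h3, h4]
  simp only [add_mul, Finset.sum_add_distrib]
  ring

/-- The second Bianchi identity. -/
theorem bianchi (hx : x ∈ s) (e a b c d : Fin n) :
    covCurv G e a b c d x + covCurv G c a b d e x + covCurv G d a b e c x = 0 := by
  rw [hG.covCurv_eq hx, hG.covCurv_eq hx, hG.covCurv_eq hx]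
  have h1 := fun g => hG.bianchi_mixed hx g b e c d
  have h2 : ∑ g, G x a g * (pd e (curvature G g b c d) x
        + ∑ f, christoffel G g e f x * curvature G f b c d x
        - ∑ f, curvature G g f c d x * christoffel G f e b x)
      + ∑ g, G x a g * (pd c (curvature G g b d e) x
        + ∑ f, christoffel G g c f x * curvature G f b d e x
        - ∑ f, curvature G g f d e x * christoffel G f c b x)
      + ∑ g, G x a g * (pd d (curvature G g b e c) x
        + ∑ f, christoffel G g d f x * curvature G f b e c x
        - ∑ f, curvature G g f e c x * christoffel G f d b x) = 0 := by
    rw [← Finset.sum_add_distrib, ← Finset.sum_add_distrib]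
    refine Finset.sum_eq_zero fun g _ => ?_
    rw [← mul_add, ← mul_add, h1, mul_zero]
  have h3 : ∑ f, (christoffel G f e c x * lowCurv G a b f d x
        + christoffel G f e d x * lowCurv G a b c f x)
      + ∑ f, (christoffel G f c d x * lowCurv G a b f e x
        + christoffel G f c e x * lowCurv G a b d f x)
      + ∑ f, (christoffel G f d e x * lowCurv G a b f c x
        + christoffel G f d c x * lowCurv G a b e f x) = 0 := by
    rw [← Finset.sum_add_distrib, ← Finset.sum_add_distrib]
    refine Finset.sum_eq_zero fun f _ => ?_
    rw [hG.christoffel_symm hx f c e, hG.christoffel_symm hx f d e, hG.christoffel_symm hx f d c,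
      lowCurv_swap_right a b c f, lowCurv_swap_right a b d f, lowCurv_swap_right a b e f]
    ring
  linarith

theorem covCurv_pair (hx : x ∈ s) (e a b c d : Fin n) :
    covCurv G e a b c d x = covCurv G e c d a b x := by
  unfold covCurv
  rw [pd_eq_of_eqOn hG.uniq (hG.lowCurv_smooth a b c d) (hG.lowCurv_smooth c d a b)
    (fun y hy => hG.lowCurv_pair hy a b c d) e hx]
  congr 1
  refine Finset.sum_congr rfl fun f _ => ?_
  rw [hG.lowCurv_pair hx f b c d, hG.lowCurv_pair hx a f c d, hG.lowCurv_pair hx a b f d,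
    hG.lowCurv_pair hx a b c f]
  ring

theorem covCurv_swap_right (hx : x ∈ s) (e a b c d : Fin n) :
    covCurv G e a b c d x = -covCurv G e a b d c x := by
  have h : pd e (lowCurv G a b c d) x = -pd e (lowCurv G a b d c) x := by
    rw [← pd_neg]
    exact pd_eq_of_eqOn hG.uniq (hG.lowCurv_smooth a b c d) (hG.lowCurv_smooth a b d c).neg
      (fun y _ => lowCurv_swap_right a b c d y) e hx
  unfold covCurv
  rw [h, neg_sub', sub_left_inj.2 rfl, sub_eq_sub_iff_add_eq_add, ← Finset.sum_neg_distrib]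
  congr 1
  refine Finset.sum_congr rfl fun f _ => ?_
  rw [lowCurv_swap_right f b c d, lowCurv_swap_right a f c d, lowCurv_swap_right a b f d,
    lowCurv_swap_right a b c f]
  ring

/-- The inverse metric is parallel: differentiate g⁻¹g = 1 and multiply by g⁻¹ from the right. -/
theorem pd_inv (hx : x ∈ s) (e a c : Fin n) :
    pd e (fun y => (G y)⁻¹ a c) x
      = -∑ f, (christoffel G a e f x * (G x)⁻¹ f c + christoffel G c e f x * (G x)⁻¹ a f) := by
  have h : ∀ d, ∑ b, (pd e (fun y => (G y)⁻¹ a b) x * G x b d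
      + (G x)⁻¹ a b * pd e (fun y => G y b d) x) = 0 := by
    intro d
    have h1 := pd_eq_of_eqOn hG.uniq
      (SmoothAtOn.sum (t := Finset.univ) fun b _ => (hG.inv_smooth a b).mul (hG.smooth b d))
      (SmoothAtOn.const _) (fun y hy => hG.sum_inv_mul_metric hy a d) e hx
    rw [pd_const, pd_sum e _ (fun _ _ => (hG.inv_smooth _ _).mul (hG.smooth _ _)) hx] at h1
    rw [← h1]
    exact Finset.sum_congr rfl fun b _ => (pd_mul e (hG.inv_smooth a b) (hG.smooth b d) hx).symm
  have h2 : ∀ b, ∑ d, G x b d * (G x)⁻¹ d c = if b = c then 1 else 0 :=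
    fun b => hG.sum_metric_mul_inv hx b c
  have h3 : pd e (fun y => (G y)⁻¹ a c) x
      = ∑ d, (∑ b, pd e (fun y => (G y)⁻¹ a b) x * G x b d) * (G x)⁻¹ d c := by
    simp only [Finset.sum_mul]
    rw [Finset.sum_comm]
    simp only [mul_assoc, ← Finset.mul_sum, h2]
    simp
  have h4 : ∀ d, ∑ b, pd e (fun y => (G y)⁻¹ a b) x * G x b d
      = -(christoffel G a e d x + ∑ b, (G x)⁻¹ a b * christoffel1 G d e b x) := by
    intro d
    have := h d
    rw [Finset.sum_add_distrib] at this
    rw [eq_neg_of_add_eq_zero_left this, christoffel_eq, ← Finset.sum_add_distrib]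
    congr 1
    refine Finset.sum_congr rfl fun b _ => ?_
    rw [hG.pd_metric hx]
    ring
  rw [h3]
  simp only [h4, neg_mul, Finset.sum_neg_distrib, add_mul, Finset.sum_add_distrib]
  congr 2
  simp only [Finset.sum_mul]
  rw [Finset.sum_comm]
  refine Finset.sum_congr rfl fun b _ => ?_
  rw [hG.christoffel_symm hx c e b, christoffel_eq, Finset.sum_mul]
  refine Finset.sum_congr rfl fun d _ => ?_
  rw [hG.inv_symm hx d c, hG.christoffel1_symm hx d e b]
  ring

/-- In vacuum the trace of `∇R` over the first and third curvature index vanishes. -/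
theorem sum_inv_covCurv (hric : ∀ y ∈ s, ∀ b d, ricci G b d y = 0) (hx : x ∈ s) (e b d : Fin n) :
    ∑ a, ∑ c, (G x)⁻¹ a c * covCurv G e a b c d x = 0 := by
  have hr : ∀ y ∈ s, ∀ b d, ∑ a, ∑ c, (G y)⁻¹ a c * lowCurv G a b c d y = 0 := by
    intro y hy b d
    rw [← hric y hy b d, hG.ricci_eq hy, Finset.sum_comm]
    exact Finset.sum_congr rfl fun a _ => Finset.sum_congr rfl fun c _ => by rw [hG.inv_symm hy]
  have sm : ∀ a c, SmoothAtOn s (fun y => (G y)⁻¹ a c * lowCurv G a b c d y) :=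
    fun a c => (hG.inv_smooth a c).mul (hG.lowCurv_smooth a b c d)
  have h0 := pd_eq_of_eqOn hG.uniq
    (SmoothAtOn.sum (t := Finset.univ) fun a _ => SmoothAtOn.sum (t := Finset.univ)
      fun c _ => sm a c) (SmoothAtOn.const 0) (fun y hy => hr y hy b d) e hx
  rw [pd_const, pd_sum e _ (fun a _ => SmoothAtOn.sum fun c _ => sm a c) hx] at h0
  have h1 : ∀ a, pd e (fun y => ∑ c, (G y)⁻¹ a c * lowCurv G a b c d y) x
      = ∑ c, (-(∑ f, (christoffel G a e f x * (G x)⁻¹ f c + christoffel G c e f x * (G x)⁻¹ a f))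
        * lowCurv G a b c d x + (G x)⁻¹ a c * pd e (lowCurv G a b c d) x) := by
    intro a
    rw [pd_sum e _ (fun c _ => sm a c) hx]
    refine Finset.sum_congr rfl fun c _ => ?_
    rw [pd_mul e (hG.inv_smooth a c) (hG.lowCurv_smooth a b c d) hx, hG.pd_inv hx]
  simp only [h1] at h0
  -- The corrections for the free indices b and d are contractions of the Ricci tensor and so
  -- vanish.
  have hb : ∑ a, ∑ c, (G x)⁻¹ a c * ∑ f, christoffel G f e b x * lowCurv G a f c d x = 0 := by
    have : ∀ f, ∑ a, ∑ c, (G x)⁻¹ a c * (christoffel G f e b x * lowCurv G a f c d x) = 0 := by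
      intro f
      have := congrArg (christoffel G f e b x * ·) (hr x hx f d)
      simp only [Finset.mul_sum, mul_zero] at this
      rw [← this]
      exact Finset.sum_congr rfl fun a _ => Finset.sum_congr rfl fun c _ => by ring
    simp only [Finset.mul_sum]
    rw [Finset.sum_congr rfl fun a _ => Finset.sum_comm, Finset.sum_comm]
    exact Finset.sum_eq_zero fun f _ => this f
  have hd : ∑ a, ∑ c, (G x)⁻¹ a c * ∑ f, christoffel G f e d x * lowCurv G a b c f x = 0 := by
    have : ∀ f, ∑ a, ∑ c, (G x)⁻¹ a c * (christoffel G f e d x * lowCurv G a b c f x) = 0 := by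
      intro f
      have := congrArg (christoffel G f e d x * ·) (hr x hx b f)
      simp only [Finset.mul_sum, mul_zero] at this
      rw [← this]
      exact Finset.sum_congr rfl fun a _ => Finset.sum_congr rfl fun c _ => by ring
    simp only [Finset.mul_sum]
    rw [Finset.sum_congr rfl fun a _ => Finset.sum_comm, Finset.sum_comm]
    exact Finset.sum_eq_zero fun f _ => this f
  -- The corrections for the contracted indices are exactly those produced by differentiating the
  -- inverse metric.
  have ha : ∑ a, ∑ c, (G x)⁻¹ a c * ∑ f, christoffel G f e a x * lowCurv G f b c d x
      = ∑ a, ∑ c, (∑ f, christoffel G a e f x * (G x)⁻¹ f c) * lowCurv G a b c d x := by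
    simp only [Finset.mul_sum, Finset.sum_mul]
    rw [Finset.sum_congr rfl fun a _ => Finset.sum_comm, Finset.sum_comm]
    refine Finset.sum_congr rfl fun f _ => ?_
    rw [Finset.sum_comm]
    refine Finset.sum_congr rfl fun c _ => Finset.sum_congr rfl fun a _ => ?_
    rw [hG.christoffel_symm hx f e a, hG.christoffel_symm hx f a e]
    ring
  have hc : ∑ a, ∑ c, (G x)⁻¹ a c * ∑ f, christoffel G f e c x * lowCurv G a b f d x
      = ∑ a, ∑ c, (∑ f, christoffel G c e f x * (G x)⁻¹ a f) * lowCurv G a b c d x := by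
    simp only [Finset.mul_sum, Finset.sum_mul]
    refine Finset.sum_congr rfl fun a _ => ?_
    rw [Finset.sum_comm]
    exact Finset.sum_congr rfl fun c _ => Finset.sum_congr rfl fun f _ => by ring
  unfold covCurv
  simp only [Finset.sum_add_distrib, mul_add, mul_sub, Finset.sum_sub_distrib, hb, hd, ha, hc]
  simp only [Finset.sum_add_distrib, neg_add, add_mul, neg_mul, Finset.sum_neg_distrib] at h0
  linarith

/-- In vacuum the divergence of the curvature vanishes. -/
theorem sum_inv_covCurv_div (hric : ∀ y ∈ s, ∀ b d, ricci G b d y = 0) (hx : x ∈ s)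
    (d a b : Fin n) : ∑ e, ∑ c, (G x)⁻¹ e c * covCurv G e c d a b x = 0 := by
  have h1 := hG.sum_inv_covCurv hric hx a d b
  have h2 := hG.sum_inv_covCurv hric hx b d a
  -- The second Bianchi identity turns the divergence into a difference of two traces of the kind
  -- that `sum_inv_covCurv` annihilates.
  have key : ∀ e c, covCurv G e c d a b x
      = covCurv G a c d e b x - covCurv G b c d e a x := by
    intro e c
    have := hG.bianchi hx e c d a b
    rw [hG.covCurv_swap_right hx a c d b e] at this
    linarith
  simp only [key, mul_sub, Finset.sum_sub_distrib]
  have flip : ∀ a b, ∑ e, ∑ c, (G x)⁻¹ e c * covCurv G a c d e b x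
      = ∑ e, ∑ c, (G x)⁻¹ e c * covCurv G a e d c b x := by
    intro a b
    rw [Finset.sum_comm]
    exact Finset.sum_congr rfl fun e _ => Finset.sum_congr rfl fun c _ => by rw [hG.inv_symm hx]
  rw [flip, flip, h1, h2, sub_zero]

end MetricOn

end

section

/-! ### The space-time metric in double null coordinates -/

theorem sum_four (f : Fin 4 → ℝ) : ∑ μ, f μ = f 0 + f 1 + ∑ A, f (sph A) := by
  simp [Fin.sum_univ_four, Fin.sum_univ_two, sph]
  ring

theorem uniqueDiffOn_slab {T u₀ u₁ : ℝ} (hT : 0 < T) (hu : u₀ < u₁) :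
    UniqueDiffOn ℝ (slab T u₀ u₁) := by
  have hc : Convex ℝ (slab T u₀ u₁) := by
    intro x hx y hy a b ha hb hab
    obtain ⟨⟨h1, h2⟩, h3, h4⟩ := hx
    obtain ⟨⟨k1, k2⟩, k3, k4⟩ := hy
    have e : b = 1 - a := by linarith
    subst e
    refine ⟨⟨?_, ?_⟩, ?_, ?_⟩ <;> simp only [Pi.add_apply, Pi.smul_apply, smul_eq_mul] <;> nlinarith
  refine uniqueDiffOn_convex hc ⟨![T / 2, (u₀ + u₁) / 2, 0, 0], ?_⟩
  have ho : IsOpen {x : Fin 4 → ℝ | (0 < x 0 ∧ x 0 < T) ∧ (u₀ < x 1 ∧ x 1 < u₁)} := by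
    exact ((isOpen_lt continuous_const (continuous_apply 0)).inter
      (isOpen_lt (continuous_apply 0) continuous_const)).inter
      ((isOpen_lt continuous_const (continuous_apply 1)).inter
      (isOpen_lt (continuous_apply 1) continuous_const))
  refine interior_maximal (fun x hx => ?_) ho ?_
  · exact ⟨⟨hx.1.1.le, hx.1.2.le⟩, hx.2.1.le, hx.2.2.le⟩
  · refine ⟨⟨?_, ?_⟩, ?_, ?_⟩ <;> simp <;> linarith

namespace Spacetime

variable {T u₀ u₁ : ℝ} (S : Spacetime T u₀ u₁) (i : Fin 2)

theorem metric_zero_zero (x : Fin 4 → ℝ) : S.metric i x 0 0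
    = ∑ A, ∑ B, S.sphereMetric i x A B * S.shift i x A * S.shift i x B := by
  simp [metric, coframe, sph, Fin.sum_univ_two]

theorem metric_zero_one (x : Fin 4 → ℝ) : S.metric i x 0 1 = -2 * S.lapse i x ^ 2 := by
  simp [metric, coframe, sph, Fin.sum_univ_two]

theorem metric_one_zero (x : Fin 4 → ℝ) : S.metric i x 1 0 = -2 * S.lapse i x ^ 2 := by
  simp [metric, coframe, sph, Fin.sum_univ_two]

theorem metric_one_one (x : Fin 4 → ℝ) : S.metric i x 1 1 = 0 := by
  simp [metric, coframe, sph, Fin.sum_univ_two]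

theorem metric_zero_sph (x : Fin 4 → ℝ) (A : Fin 2) : S.metric i x 0 (sph A)
    = -∑ B, S.sphereMetric i x B A * S.shift i x B := by
  fin_cases A <;> simp [metric, coframe, sph, Fin.sum_univ_two] <;> ring

theorem metric_sph_zero (x : Fin 4 → ℝ) (A : Fin 2) : S.metric i x (sph A) 0
    = -∑ B, S.sphereMetric i x A B * S.shift i x B := by
  fin_cases A <;> simp [metric, coframe, sph, Fin.sum_univ_two] <;> ring

theorem metric_one_sph (x : Fin 4 → ℝ) (A : Fin 2) : S.metric i x 1 (sph A) = 0 := by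
  fin_cases A <;> simp [metric, coframe, sph, Fin.sum_univ_two]

theorem metric_sph_one (x : Fin 4 → ℝ) (A : Fin 2) : S.metric i x (sph A) 1 = 0 := by
  fin_cases A <;> simp [metric, coframe, sph, Fin.sum_univ_two]

theorem metric_sph_sph (x : Fin 4 → ℝ) (A B : Fin 2) :
    S.metric i x (sph A) (sph B) = S.sphereMetric i x A B := by
  fin_cases A <;> fin_cases B <;> simp [metric, coframe, sph, Fin.sum_univ_two]

theorem sphereMetric_symm {x : Fin 4 → ℝ} (hx : x ∈ slab T u₀ u₁) (A B : Fin 2) :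
    S.sphereMetric i x A B = S.sphereMetric i x B A := by
  simpa using (S.sphereMetric_posDef i x hx).isHermitian.apply B A

theorem sphereMetric_det_pos {x : Fin 4 → ℝ} (hx : x ∈ slab T u₀ u₁) :
    0 < (S.sphereMetric i x).det := (S.sphereMetric_posDef i x hx).det_pos

/-- The shift drops out because the coframe du̲, du, dθ^A − b^A du̲ is unimodular with respect to
the coordinates. -/
theorem det_metric (x : Fin 4 → ℝ) :
    (S.metric i x).det = -4 * S.lapse i x ^ 4 * (S.sphereMetric i x).det := by
  rw [Matrix.det_fin_two]
  have h2 : ∀ A, S.metric i x 2 A = S.metric i x (sph 0) A := fun _ => rfl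
  have h3 : ∀ A, S.metric i x 3 A = S.metric i x (sph 1) A := fun _ => rfl
  have e2 : ∀ A, S.metric i x A 2 = S.metric i x A (sph 0) := fun _ => rfl
  have e3 : ∀ A, S.metric i x A 3 = S.metric i x A (sph 1) := fun _ => rfl
  simp [Matrix.det_succ_row_zero, Fin.sum_univ_succ, Fin.succAbove, h2, h3, e2, e3,
    metric_zero_zero, metric_zero_one, metric_one_zero, metric_one_one, metric_zero_sph,
    metric_sph_zero, metric_one_sph, metric_sph_one, metric_sph_sph]
  ring

theorem smoothAtOn_lapse : SmoothAtOn (slab T u₀ u₁) (S.lapse i) := S.lapse_smooth i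

theorem smoothAtOn_shift (A : Fin 2) : SmoothAtOn (slab T u₀ u₁) (fun y => S.shift i y A) :=
  S.shift_smooth i A

theorem smoothAtOn_sphereMetric (A B : Fin 2) :
    SmoothAtOn (slab T u₀ u₁) (fun y => S.sphereMetric i y A B) := S.sphereMetric_smooth i A B

theorem metricOn (hT : 0 < T) (hu : u₀ < u₁) : MetricOn (slab T u₀ u₁) (S.metric i) where
  uniq := uniqueDiffOn_slab hT hu
  smooth a b := by
    have hc : ∀ (A : Fin 2) (μ : Fin 4), SmoothAtOn (slab T u₀ u₁) (fun y => S.coframe i A y μ) :=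
      fun A μ => (SmoothAtOn.const _).sub ((S.smoothAtOn_shift i A).mul (SmoothAtOn.const _))
    have hl : SmoothAtOn (slab T u₀ u₁) (fun y => S.lapse i y ^ 2) :=
      fun x hx => (S.lapse_smooth i x hx).pow 2
    exact (((SmoothAtOn.const _).mul hl).mul (SmoothAtOn.const _)).add (SmoothAtOn.sum fun A _ =>
      SmoothAtOn.sum fun B _ => ((S.smoothAtOn_sphereMetric i A B).mul (hc A a)).mul (hc B b))
  symm x hx a b := by
    simp only [metric, Matrix.of_apply, Fin.sum_univ_two, S.sphereMetric_symm i hx 1 0]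
    ring
  det x hx := by
    rw [det_metric, isUnit_iff_ne_zero]
    have := S.lapse_pos i x hx
    have := S.sphereMetric_det_pos i hx
    positivity

/-- The cone `u = u₀`. -/
def cone (T u₀ : ℝ) : Set (Fin 4 → ℝ) := {x | (0 ≤ x 0 ∧ x 0 ≤ T) ∧ x 1 = u₀}

theorem cone_subset (hu : u₀ ≤ u₁) : cone T u₀ ⊆ slab T u₀ u₁ :=
  fun _ hx => ⟨hx.1, hx.2.ge, hx.2.le.trans hu⟩

theorem pt_mem_cone {ub : ℝ} (h : ub ∈ Set.Icc 0 T) (θ : Fin 2 → ℝ) : pt ub u₀ θ ∈ cone T u₀ :=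
  ⟨by simpa [pt] using h, by simp [pt]⟩

theorem pt_ang {x : Fin 4 → ℝ} (hx : x ∈ cone T u₀) : pt (x 0) u₀ (ang x) = x := by
  ext μ
  fin_cases μ <;> simp [pt, ang, hx.2]

/-- Tangential derivatives on the cone depend only on the values there. -/
theorem pd_eq_of_eqOn_cone (hT : 0 < T) (hu : u₀ < u₁) {f g : (Fin 4 → ℝ) → ℝ}
    (hf : SmoothAtOn (slab T u₀ u₁) f) (hg : SmoothAtOn (slab T u₀ u₁) g)
    (h : ∀ y ∈ cone T u₀, f y = g y) {μ : Fin 4} (hμ : μ ≠ 1) {x : Fin 4 → ℝ}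
    (hx : x ∈ cone T u₀) : pd μ f x = pd μ g x := by
  -- Resetting the coordinate u to u₀ maps the slab into the cone. After composition with this map
  -- the two functions agree on the whole slab, and by the chain rule the composition leaves the
  -- derivatives in directions other than ∂_u unchanged.
  let P : (Fin 4 → ℝ) →L[ℝ] (Fin 4 → ℝ) :=
    ContinuousLinearMap.pi fun ν => if ν = 1 then 0 else ContinuousLinearMap.proj ν
  let π : (Fin 4 → ℝ) → (Fin 4 → ℝ) := fun y => P y + Pi.single 1 u₀
  have hπ0 : ∀ y ν, π y ν = if ν = 1 then u₀ else y ν := by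
    intro y ν
    by_cases hν : ν = 1
    · subst hν
      simp [π, P]
    · simp [π, P, hν]
  have hπc : ∀ y ∈ slab T u₀ u₁, π y ∈ cone T u₀ := by
    intro y hy
    refine ⟨?_, ?_⟩
    · rw [hπ0]
      simpa using hy.1
    · rw [hπ0]
      simp
  have hπs : ContDiff ℝ ∞ π := P.contDiff.add contDiff_const
  have hπx : π x = x := by
    ext ν
    rw [hπ0]
    split_ifs with hν
    · rw [hν, hx.2]
    · rfl
  have hxs := cone_subset hu.le hx
  have hcomp : ∀ {f : (Fin 4 → ℝ) → ℝ}, SmoothAtOn (slab T u₀ u₁) f →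
      SmoothAtOn (slab T u₀ u₁) (fun y => f (π y)) := fun hf y hy =>
    ContDiffAt.comp y (hf _ (cone_subset hu.le (hπc y hy))) hπs.contDiffAt
  have hchain : ∀ {f : (Fin 4 → ℝ) → ℝ}, SmoothAtOn (slab T u₀ u₁) f →
      pd μ (fun y => f (π y)) x = pd μ f x := by
    intro f hf
    have hd : HasFDerivAt π P x := P.hasFDerivAt.add_const _
    have hfx : HasFDerivAt f (fderiv ℝ f x) (π x) := by
      rw [hπx]
      exact (hf.differentiableAt hxs).hasFDerivAt
    have := (hfx.comp x hd).fderiv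
    unfold pd
    change fderiv ℝ (f ∘ π) x _ = _
    rw [this, ContinuousLinearMap.comp_apply]
    congr 1
    ext ν
    by_cases hν : ν = 1
    · subst hν
      simp [P, Ne.symm hμ]
    · simp [P, hν]
  rw [← hchain hf, ← hchain hg]
  exact pd_eq_of_eqOn (uniqueDiffOn_slab hT hu) (hcomp hf) (hcomp hg)
    (fun y hy => h _ (hπc y hy)) μ hxs

/-- The gauge conditions on the cone `u = u₀`. -/
structure ConeGauge : Prop where
  pos : 0 < T
  lt : u₀ < u₁
  lapse : ∀ x ∈ cone T u₀, S.lapse i x = 1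
  shift : ∀ x ∈ cone T u₀, S.shift i x = 0

/-- `½ ∂_u̲ h`. -/
def X (A B : Fin 2) (x : Fin 4 → ℝ) : ℝ := (1 / 2) * pd 0 (fun y => S.sphereMetric i y A B) x

/-- `½ ∂_u h`. -/
def k (A B : Fin 2) (x : Fin 4 → ℝ) : ℝ := (1 / 2) * pd 1 (fun y => S.sphereMetric i y A B) x

/-- `-∂_u g_{0A}`, which is `h_{AB} ∂_u b^B` on the cone. -/
def c (A : Fin 2) (x : Fin 4 → ℝ) : ℝ := -pd 1 (fun y => S.metric i y 0 (sph A)) x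

/-- `∂_u Ω`. -/
def w (x : Fin 4 → ℝ) : ℝ := pd 1 (S.lapse i) x

/-- The Christoffel symbols of the first kind of the spheres. -/
def Γs (C A B : Fin 2) (x : Fin 4 → ℝ) : ℝ :=
  (1 / 2) * (pd (sph A) (fun y => S.sphereMetric i y B C) x
    + pd (sph B) (fun y => S.sphereMetric i y A C) x
    - pd (sph C) (fun y => S.sphereMetric i y A B) x)

namespace ConeGauge

variable {S i} (H : S.ConeGauge i) {x : Fin 4 → ℝ} (hx : x ∈ cone T u₀)
include H

theorem metricOn : MetricOn (slab T u₀ u₁) (S.metric i) := S.metricOn i H.pos H.lt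

theorem sub {x : Fin 4 → ℝ} (hx : x ∈ cone T u₀) : x ∈ slab T u₀ u₁ := cone_subset H.lt.le hx

theorem pd_congr {f g : (Fin 4 → ℝ) → ℝ}
    (hf : SmoothAtOn (slab T u₀ u₁) f) (hg : SmoothAtOn (slab T u₀ u₁) g)
    (h : ∀ y ∈ cone T u₀, f y = g y) {μ : Fin 4} (hμ : μ ≠ 1) {x : Fin 4 → ℝ}
    (hx : x ∈ cone T u₀) : pd μ f x = pd μ g x :=
  pd_eq_of_eqOn_cone H.pos H.lt hf hg h hμ hx

theorem pd_eq_zero {f : (Fin 4 → ℝ) → ℝ} {a : ℝ}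
    (hf : SmoothAtOn (slab T u₀ u₁) f) (h : ∀ y ∈ cone T u₀, f y = a) {μ : Fin 4} (hμ : μ ≠ 1)
    {x : Fin 4 → ℝ} (hx : x ∈ cone T u₀) : pd μ f x = 0 := by
  rw [H.pd_congr hf (SmoothAtOn.const a) h hμ hx, pd_const]

omit H in
theorem sph_ne_one (A : Fin 2) : sph A ≠ 1 := by fin_cases A <;> simp [sph]

/-- With Ω = 1 and b = 0 the metric is block diagonal: a null block with off-diagonal entries −2,
and the sphere metric. -/
theorem inv_metric (hx : x ∈ cone T u₀) :
    (S.metric i x)⁻¹ 0 0 = 0 ∧ (S.metric i x)⁻¹ 0 1 = -(1 / 2) ∧ (S.metric i x)⁻¹ 1 0 = -(1 / 2) ∧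
    (S.metric i x)⁻¹ 1 1 = 0 ∧ (∀ A, (S.metric i x)⁻¹ 0 (sph A) = 0) ∧
    (∀ A, (S.metric i x)⁻¹ (sph A) 0 = 0) ∧ (∀ A, (S.metric i x)⁻¹ 1 (sph A) = 0) ∧
    (∀ A, (S.metric i x)⁻¹ (sph A) 1 = 0) ∧
    ∀ A B, (S.metric i x)⁻¹ (sph A) (sph B) = (S.sphereMetric i x)⁻¹ A B := by
  let g := (S.sphereMetric i x)⁻¹
  let N : Matrix (Fin 4) (Fin 4) ℝ :=
    !![0, -(1/2), 0, 0; -(1/2), 0, 0, 0; 0, 0, g 0 0, g 0 1; 0, 0, g 1 0, g 1 1]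
  have hg : g * S.sphereMetric i x = 1 :=
    Matrix.nonsing_inv_mul _ (isUnit_iff_ne_zero.2 (S.sphereMetric_det_pos i (H.sub hx)).ne')
  have hg' : ∀ A B, g A 0 * S.sphereMetric i x 0 B + g A 1 * S.sphereMetric i x 1 B
      = if A = B then 1 else 0 := by
    intro A B
    have := congrFun (congrFun hg A) B
    rwa [Matrix.mul_apply, Fin.sum_univ_two, Matrix.one_apply] at this
  have hM : S.metric i x = !![0, -2, 0, 0; -2, 0, 0, 0;
      0, 0, S.sphereMetric i x 0 0, S.sphereMetric i x 0 1;
      0, 0, S.sphereMetric i x 1 0, S.sphereMetric i x 1 1] := by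
    ext μ ν
    fin_cases μ <;> fin_cases ν <;>
      simp [metric, coframe, sph, Fin.sum_univ_two, H.lapse x hx, H.shift x hx]
  have hN : (S.metric i x)⁻¹ = N := by
    refine Matrix.inv_eq_left_inv ?_
    have h00 := hg' 0 0
    have h01 := hg' 0 1
    have h10 := hg' 1 0
    have h11 := hg' 1 1
    simp at h00 h01 h10 h11
    rw [hM]
    ext μ ν
    fin_cases μ <;> fin_cases ν <;>
      simp [N, Matrix.mul_apply, Fin.sum_univ_four, h00, h01, h10, h11]
  rw [hN]
  refine ⟨rfl, rfl, rfl, rfl, ?_, ?_, ?_, ?_, ?_⟩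
  · intro A; fin_cases A <;> rfl
  · intro A; fin_cases A <;> rfl
  · intro A; fin_cases A <;> rfl
  · intro A; fin_cases A <;> rfl
  · intro A B; fin_cases A <;> fin_cases B <;> rfl

theorem sum_inv (hx : x ∈ cone T u₀) (u : Fin 4 → Fin 4 → ℝ) :
    ∑ e, ∑ f, (S.metric i x)⁻¹ e f * u e f = -(1 / 2) * (u 0 1 + u 1 0)
      + ∑ A, ∑ B, (S.sphereMetric i x)⁻¹ A B * u (sph A) (sph B) := by
  obtain ⟨h1, h2, h3, h4, h5, h6, h7, h8, h9⟩ := H.inv_metric hx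
  simp only [sum_four, h1, h2, h3, h4, h5, h6, h7, h8, h9]
  simp
  ring

end ConeGauge

end Spacetime

end

/-! ### Metric derivatives and Christoffel symbols on the outgoing cone -/

section

namespace Spacetime

variable {T u₀ u₁ : ℝ} (S : Spacetime T u₀ u₁) (i : Fin 2)

theorem smoothAtOn_X (A B : Fin 2) : SmoothAtOn (slab T u₀ u₁) (S.X i A B) :=
  (SmoothAtOn.const _).mul ((S.smoothAtOn_sphereMetric i A B).pd 0)

theorem smoothAtOn_k (A B : Fin 2) : SmoothAtOn (slab T u₀ u₁) (S.k i A B) :=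
  (SmoothAtOn.const _).mul ((S.smoothAtOn_sphereMetric i A B).pd 1)

theorem smoothAtOn_w : SmoothAtOn (slab T u₀ u₁) (S.w i) := (S.smoothAtOn_lapse i).pd 1

theorem smoothAtOn_Γs (C A B : Fin 2) : SmoothAtOn (slab T u₀ u₁) (S.Γs i C A B) :=
  (SmoothAtOn.const _).mul ((((S.smoothAtOn_sphereMetric i _ _).pd _).add
    ((S.smoothAtOn_sphereMetric i _ _).pd _)).sub ((S.smoothAtOn_sphereMetric i _ _).pd _))

theorem smoothAtOn_inv_sphereMetric (A B : Fin 2) :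
    SmoothAtOn (slab T u₀ u₁) (fun y => (S.sphereMetric i y)⁻¹ A B) :=
  smoothAtOn_inv (S.smoothAtOn_sphereMetric i)
    (fun _ hy => isUnit_iff_ne_zero.2 (S.sphereMetric_det_pos i hy).ne') A B

theorem inv_sphereMetric_symm {x : Fin 4 → ℝ} (hx : x ∈ slab T u₀ u₁) (A B : Fin 2) :
    (S.sphereMetric i x)⁻¹ A B = (S.sphereMetric i x)⁻¹ B A := by
  have h : (S.sphereMetric i x)ᵀ = S.sphereMetric i x := by
    ext a b
    exact S.sphereMetric_symm i hx b a
  have := Matrix.transpose_nonsing_inv (S.sphereMetric i x)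
  rw [h] at this
  exact congrFun (congrFun this B) A

namespace ConeGauge

variable {S i} (H : S.ConeGauge i) {x : Fin 4 → ℝ} (hx : x ∈ cone T u₀)
include H

theorem smoothAtOn_c (A : Fin 2) : SmoothAtOn (slab T u₀ u₁) (S.c i A) :=
  ((H.metricOn.smooth _ _).pd 1).neg

theorem pd_sphereMetric_symm {x : Fin 4 → ℝ} (hx : x ∈ slab T u₀ u₁) (μ : Fin 4) (A B : Fin 2) :
    pd μ (fun y => S.sphereMetric i y A B) x = pd μ (fun y => S.sphereMetric i y B A) x :=
  pd_eq_of_eqOn H.metricOn.uniq (S.smoothAtOn_sphereMetric i A B) (S.smoothAtOn_sphereMetric i B A)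
    (fun _ hy => S.sphereMetric_symm i hy A B) μ hx

theorem X_symm {x : Fin 4 → ℝ} (hx : x ∈ slab T u₀ u₁) (A B : Fin 2) :
    S.X i A B x = S.X i B A x := by
  rw [X, X, H.pd_sphereMetric_symm hx]

theorem k_symm {x : Fin 4 → ℝ} (hx : x ∈ slab T u₀ u₁) (A B : Fin 2) :
    S.k i A B x = S.k i B A x := by
  rw [k, k, H.pd_sphereMetric_symm hx]

/-- g₀₀ is quadratic in the shift, which vanishes on the cone, so even the transversal derivative is
zero. -/
theorem pd_metric_zero_zero (hx : x ∈ cone T u₀) (μ : Fin 4) :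
    pd μ (fun y => S.metric i y 0 0) x = 0 := by
  simp only [metric_zero_zero]
  have h := S.smoothAtOn_sphereMetric i
  have b := S.smoothAtOn_shift i
  rw [pd_sum μ _ (fun A _ => SmoothAtOn.sum fun B _ => ((h A B).mul (b A)).mul (b B)) (H.sub hx)]
  refine Finset.sum_eq_zero fun A _ => ?_
  rw [pd_sum μ _ (fun B _ => ((h A B).mul (b A)).mul (b B)) (H.sub hx)]
  refine Finset.sum_eq_zero fun B _ => ?_
  rw [pd_mul μ ((h A B).mul (b A)) (b B) (H.sub hx), H.shift x hx]
  simp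

theorem pd_one_metric_zero_one (hx : x ∈ cone T u₀) :
    pd 1 (fun y => S.metric i y 0 1) x = -4 * S.w i x := by
  simp only [metric_zero_one, pow_two]
  have l := S.smoothAtOn_lapse i
  rw [pd_const_mul 1 _ (l.mul l) (H.sub hx), pd_mul 1 l l (H.sub hx), H.lapse x hx, w]
  ring

theorem pd_metric_zero_one (hx : x ∈ cone T u₀) {μ : Fin 4} (hμ : μ ≠ 1) :
    pd μ (fun y => S.metric i y 0 1) x = 0 :=
  H.pd_eq_zero (H.metricOn.smooth 0 1) (a := -2) (fun y hy => by
    rw [metric_zero_one, H.lapse y hy]; norm_num) hμ hx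

theorem pd_metric_zero_sph (hx : x ∈ cone T u₀) {μ : Fin 4} (hμ : μ ≠ 1) (A : Fin 2) :
    pd μ (fun y => S.metric i y 0 (sph A)) x = 0 :=
  H.pd_eq_zero (H.metricOn.smooth 0 (sph A)) (a := 0) (fun y hy => by
    rw [metric_zero_sph, H.shift y hy]; simp) hμ hx

/-- Tangential derivatives of the gauge-fixed components vanish. Thus `X`, `k`, `c`, `w` and `Γs`
are the only data of the connection on the cone, and they are the unknowns of everything that
follows. -/
theorem christoffel1_cone (hx : x ∈ cone T u₀) :
    christoffel1 (S.metric i) 0 0 0 x = 0 ∧ christoffel1 (S.metric i) 0 0 1 x = 0 ∧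
    (∀ A, christoffel1 (S.metric i) 0 0 (sph A) x = 0) ∧
    christoffel1 (S.metric i) 0 1 1 x = -4 * S.w i x ∧
    (∀ A, christoffel1 (S.metric i) 0 1 (sph A) x = -(1 / 2) * S.c i A x) ∧
    (∀ A B, christoffel1 (S.metric i) 0 (sph A) (sph B) x = -S.X i A B x) ∧
    christoffel1 (S.metric i) 1 0 0 x = 0 ∧ christoffel1 (S.metric i) 1 0 1 x = 0 ∧
    (∀ A, christoffel1 (S.metric i) 1 0 (sph A) x = (1 / 2) * S.c i A x) ∧
    christoffel1 (S.metric i) 1 1 1 x = 0 ∧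
    (∀ A, christoffel1 (S.metric i) 1 1 (sph A) x = 0) ∧
    (∀ A B, christoffel1 (S.metric i) 1 (sph A) (sph B) x = -S.k i A B x) ∧
    (∀ C, christoffel1 (S.metric i) (sph C) 0 0 x = 0) ∧
    (∀ C, christoffel1 (S.metric i) (sph C) 0 1 x = -(1 / 2) * S.c i C x) ∧
    (∀ C A, christoffel1 (S.metric i) (sph C) 0 (sph A) x = S.X i C A x) ∧
    (∀ C, christoffel1 (S.metric i) (sph C) 1 1 x = 0) ∧
    (∀ C A, christoffel1 (S.metric i) (sph C) 1 (sph A) x = S.k i C A x) ∧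
    (∀ C A B, christoffel1 (S.metric i) (sph C) (sph A) (sph B) x = S.Γs i C A B x) := by
  have hs := H.sub hx
  have a00 := H.pd_metric_zero_zero hx
  have a01 := H.pd_one_metric_zero_one hx
  have b01 : ∀ {μ}, μ ≠ 1 → pd μ (fun y => S.metric i y 0 1) x = 0 :=
    fun h => H.pd_metric_zero_one hx h
  have s10 : ∀ μ, pd μ (fun y => S.metric i y 1 0) x = pd μ (fun y => S.metric i y 0 1) x :=
    fun μ => H.metricOn.pd_symm hs μ 1 0
  have a11 : ∀ μ, pd μ (fun y => S.metric i y 1 1) x = 0 := by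
    intro μ; simp only [metric_one_one, pd_const]
  have a1A : ∀ μ A, pd μ (fun y => S.metric i y 1 (sph A)) x = 0 := by
    intro μ A; simp only [metric_one_sph, pd_const]
  have aA1 : ∀ μ A, pd μ (fun y => S.metric i y (sph A) 1) x = 0 := by
    intro μ A; simp only [metric_sph_one, pd_const]
  have b0A : ∀ {μ}, μ ≠ 1 → ∀ A, pd μ (fun y => S.metric i y 0 (sph A)) x = 0 :=
    fun h => H.pd_metric_zero_sph hx h
  have c0A : ∀ A, pd 1 (fun y => S.metric i y 0 (sph A)) x = -S.c i A x := by
    intro A; simp [c]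
  have sA0 : ∀ μ A, pd μ (fun y => S.metric i y (sph A) 0) x
      = pd μ (fun y => S.metric i y 0 (sph A)) x := fun μ A => H.metricOn.pd_symm hs μ (sph A) 0
  have hX : ∀ A B, pd 0 (fun y => S.sphereMetric i y A B) x = 2 * S.X i A B x := by
    intro A B; rw [X]; ring
  have hk : ∀ A B, pd 1 (fun y => S.sphereMetric i y A B) x = 2 * S.k i A B x := by
    intro A B; rw [k]; ring
  have n0 : (0 : Fin 4) ≠ 1 := by decide
  have nA := sph_ne_one
  refine ⟨?_, ?_, ?_, ?_, ?_, ?_, ?_, ?_, ?_, ?_, ?_, ?_, ?_, ?_, ?_, ?_, ?_, ?_⟩ <;> intros <;>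
    simp only [christoffel1, a00, a01, b01 n0, b01 (nA _), s10, a11, a1A, aA1, b0A n0, b0A (nA _),
      c0A, sA0, metric_sph_sph, hX, hk, Γs, H.X_symm hs, H.k_symm hs] <;> try ring

end ConeGauge

end Spacetime

end

/-! ### Curvature and vacuum equations on the outgoing cone -/

section

namespace Spacetime

variable {T u₀ u₁ : ℝ} (S : Spacetime T u₀ u₁) (i : Fin 2)

/-- The inverse of the metric of the spheres. -/
def hinv (A B : Fin 2) (x : Fin 4 → ℝ) : ℝ := (S.sphereMetric i x)⁻¹ A B

/-- Contraction of an upper index pair of tangential symbols. -/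
def ctr (u : Fin 2 → Fin 2 → ℝ) (x : Fin 4 → ℝ) : ℝ := ∑ C, ∑ D, S.hinv i C D x * u C D

namespace ConeGauge

variable {S i} (H : S.ConeGauge i) {x : Fin 4 → ℝ} (hx : x ∈ cone T u₀)
include H

theorem lowCurv_cone (hx : x ∈ cone T u₀) (a b c d : Fin 4) :
    lowCurv (S.metric i) a b c d x = pd c (christoffel1 (S.metric i) a d b) x
      - pd d (christoffel1 (S.metric i) a c b) x
      - (-(1 / 2) * (christoffel1 (S.metric i) 0 c a x * christoffel1 (S.metric i) 1 d b x
          + christoffel1 (S.metric i) 1 c a x * christoffel1 (S.metric i) 0 d b x)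
        + S.ctr i (fun C D => christoffel1 (S.metric i) (sph C) c a x
          * christoffel1 (S.metric i) (sph D) d b x) x)
      + (-(1 / 2) * (christoffel1 (S.metric i) 0 d a x * christoffel1 (S.metric i) 1 c b x
          + christoffel1 (S.metric i) 1 d a x * christoffel1 (S.metric i) 0 c b x)
        + S.ctr i (fun C D => christoffel1 (S.metric i) (sph C) d a x
          * christoffel1 (S.metric i) (sph D) c b x) x) := by
  rw [H.metricOn.lowCurv_eq (H.sub hx),
    H.sum_inv hx (fun e f => christoffel1 (S.metric i) e c a x * christoffel1 (S.metric i) f d b x),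
    H.sum_inv hx (fun e f => christoffel1 (S.metric i) e d a x * christoffel1 (S.metric i) f c b x)]
  rfl

/-- Most curvature components needed here differentiate Christoffel symbols in tangential directions
only. For these the values known on the cone may be differentiated directly. -/
theorem pd_christoffel1_cone (hx : x ∈ cone T u₀) {l a b : Fin 4} {g : (Fin 4 → ℝ) → ℝ}
    (hg : SmoothAtOn (slab T u₀ u₁) g)
    (h : ∀ y ∈ cone T u₀, christoffel1 (S.metric i) l a b y = g y) {μ : Fin 4} (hμ : μ ≠ 1) :
    pd μ (christoffel1 (S.metric i) l a b) x = pd μ g x :=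
  H.pd_congr (H.metricOn.christoffel1_smooth l a b) hg h hμ hx

omit H in
theorem zero_ne_one' : (0 : Fin 4) ≠ 1 := by decide

/-- `R_{A0B0}`. -/
theorem lowCurv_A0B0 (hx : x ∈ cone T u₀) (A B : Fin 2) :
    lowCurv (S.metric i) (sph A) 0 (sph B) 0 x
      = -pd 0 (S.X i A B) x + S.ctr i (fun C D => S.X i C A x * S.X i D B x) x := by
  obtain ⟨f000, f001, f00A, f011, f01A, f0AB, f100, f101, f10A, f111, f11A, f1AB, fC00, fC01, fC0A,
    fC11, fC1A, fCAB⟩ := H.christoffel1_cone hx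
  have sy := fun l a b => H.metricOn.christoffel1_symm (H.sub hx) l a b
  have d1 : pd (sph B) (christoffel1 (S.metric i) (sph A) 0 0) x = 0 := by
    rw [H.pd_christoffel1_cone hx (SmoothAtOn.const 0)
      (fun y hy => by obtain ⟨-, -, -, -, -, -, -, -, -, -, -, -, h, -⟩ := H.christoffel1_cone hy;
                      exact h A) (sph_ne_one B), pd_const]
  have d2 : pd 0 (christoffel1 (S.metric i) (sph A) (sph B) 0) x = pd 0 (S.X i A B) x := by
    refine H.pd_christoffel1_cone hx (S.smoothAtOn_X i A B) (fun y hy => ?_) zero_ne_one'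
    obtain ⟨-, -, -, -, -, -, -, -, -, -, -, -, -, -, h, -⟩ := H.christoffel1_cone hy
    rw [H.metricOn.christoffel1_symm (H.sub hy), h]
  rw [H.lowCurv_cone hx, d1, d2]
  simp only [f000, f100, fC00, sy _ (sph B) 0, f00A, fC0A]
  simp [ctr]

/-- `R_{100A}`. -/
theorem lowCurv_100A (hx : x ∈ cone T u₀) (A : Fin 2) :
    lowCurv (S.metric i) 1 0 0 (sph A) x = (1 / 2) * pd 0 (S.c i A) x
      + (1 / 2) * S.ctr i (fun C D => S.c i C x * S.X i D A x) x := by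
  obtain ⟨f000, f001, f00A, f011, f01A, f0AB, f100, f101, f10A, f111, f11A, f1AB, fC00, fC01, fC0A,
    fC11, fC1A, fCAB⟩ := H.christoffel1_cone hx
  have sy := fun l a b => H.metricOn.christoffel1_symm (H.sub hx) l a b
  have d1 : pd 0 (christoffel1 (S.metric i) 1 (sph A) 0) x = (1 / 2) * pd 0 (S.c i A) x := by
    rw [← pd_const_mul 0 _ (H.smoothAtOn_c A) (H.sub hx)]
    refine H.pd_christoffel1_cone hx ((SmoothAtOn.const _).mul (H.smoothAtOn_c A))
      (fun y hy => ?_) zero_ne_one'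
    rw [H.metricOn.christoffel1_symm (H.sub hy)]
    exact (H.christoffel1_cone hy).2.2.2.2.2.2.2.2.1 A
  have d2 : pd (sph A) (christoffel1 (S.metric i) 1 0 0) x = 0 := by
    rw [H.pd_christoffel1_cone hx (SmoothAtOn.const 0)
      (fun y hy => (H.christoffel1_cone hy).2.2.2.2.2.2.1) (sph_ne_one A), pd_const]
  rw [H.lowCurv_cone hx, d1, d2]
  simp only [sy _ (sph A) 0, sy _ (sph A) 1, f000, f001, f00A, f01A, f100, f101, f10A, f11A, fC00,
    fC01, fC0A, fC1A]
  simp [ctr, Fin.sum_univ_two]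
  ring

/-- `R_{C0DA}`. -/
theorem lowCurv_C0DA (hx : x ∈ cone T u₀) (C D A : Fin 2) :
    lowCurv (S.metric i) (sph C) 0 (sph D) (sph A) x = pd (sph D) (S.X i C A) x
      - pd (sph A) (S.X i C D) x
      - ((1 / 4) * (S.X i D C x * S.c i A x) + S.ctr i (fun E F => S.Γs i E D C x * S.X i F A x) x)
      + ((1 / 4) * (S.X i A C x * S.c i D x)
        + S.ctr i (fun E F => S.Γs i E A C x * S.X i F D x) x) := by
  obtain ⟨f000, f001, f00A, f011, f01A, f0AB, f100, f101, f10A, f111, f11A, f1AB, fC00, fC01, fC0A,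
    fC11, fC1A, fCAB⟩ := H.christoffel1_cone hx
  have sy := fun l a b => H.metricOn.christoffel1_symm (H.sub hx) l a b
  have d1 : ∀ D A, pd (sph D) (christoffel1 (S.metric i) (sph C) (sph A) 0) x
      = pd (sph D) (S.X i C A) x := by
    intro D A
    refine H.pd_christoffel1_cone hx (S.smoothAtOn_X i C A) (fun y hy => ?_) (sph_ne_one D)
    rw [H.metricOn.christoffel1_symm (H.sub hy)]
    exact (H.christoffel1_cone hy).2.2.2.2.2.2.2.2.2.2.2.2.2.2.1 C A
  rw [H.lowCurv_cone hx, d1, d1]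
  simp only [sy _ (sph _) 0, f00A, f0AB, f10A, f1AB, fC0A, fCAB]
  ring

/-- `R_{CADB}`. -/
theorem lowCurv_CADB (hx : x ∈ cone T u₀) (C A D B : Fin 2) :
    lowCurv (S.metric i) (sph C) (sph A) (sph D) (sph B) x = pd (sph D) (S.Γs i C B A) x
      - pd (sph B) (S.Γs i C D A) x
      - (-(1 / 2) * (S.X i D C x * S.k i B A x + S.k i D C x * S.X i B A x)
        + S.ctr i (fun E F => S.Γs i E D C x * S.Γs i F B A x) x)
      + (-(1 / 2) * (S.X i B C x * S.k i D A x + S.k i B C x * S.X i D A x)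
        + S.ctr i (fun E F => S.Γs i E B C x * S.Γs i F D A x) x) := by
  obtain ⟨f000, f001, f00A, f011, f01A, f0AB, f100, f101, f10A, f111, f11A, f1AB, fC00, fC01, fC0A,
    fC11, fC1A, fCAB⟩ := H.christoffel1_cone hx
  have d1 : ∀ D B, pd (sph D) (christoffel1 (S.metric i) (sph C) (sph B) (sph A)) x
      = pd (sph D) (S.Γs i C B A) x := by
    intro D B
    refine H.pd_christoffel1_cone hx (S.smoothAtOn_Γs i C B A) (fun y hy => ?_) (sph_ne_one D)
    exact (H.christoffel1_cone hy).2.2.2.2.2.2.2.2.2.2.2.2.2.2.2.2.2 C B A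
  rw [H.lowCurv_cone hx, d1, d1]
  simp only [f0AB, f1AB, fCAB]
  ring

/-- `R_{1B0A}`. -/
theorem lowCurv_1B0A (hx : x ∈ cone T u₀) (B A : Fin 2) :
    lowCurv (S.metric i) 1 (sph B) 0 (sph A) x = -pd 0 (S.k i A B) x
      - (1 / 2) * pd (sph A) (S.c i B) x
      + (1 / 2) * S.ctr i (fun C D => S.c i C x * S.Γs i D A B x) x
      + (1 / 8) * (S.c i A x * S.c i B x)
      + S.ctr i (fun C D => S.k i C A x * S.X i D B x) x := by
  obtain ⟨f000, f001, f00A, f011, f01A, f0AB, f100, f101, f10A, f111, f11A, f1AB, fC00, fC01, fC0A,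
    fC11, fC1A, fCAB⟩ := H.christoffel1_cone hx
  have sy := fun l a b => H.metricOn.christoffel1_symm (H.sub hx) l a b
  have d1 : pd 0 (christoffel1 (S.metric i) 1 (sph A) (sph B)) x = -pd 0 (S.k i A B) x := by
    rw [← pd_neg]
    refine H.pd_christoffel1_cone hx (S.smoothAtOn_k i A B).neg (fun y hy => ?_) zero_ne_one'
    exact (H.christoffel1_cone hy).2.2.2.2.2.2.2.2.2.2.2.1 A B
  have d2 : pd (sph A) (christoffel1 (S.metric i) 1 0 (sph B)) x
      = (1 / 2) * pd (sph A) (S.c i B) x := by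
    rw [← pd_const_mul _ _ (H.smoothAtOn_c B) (H.sub hx)]
    refine H.pd_christoffel1_cone hx ((SmoothAtOn.const _).mul (H.smoothAtOn_c B))
      (fun y hy => ?_) (sph_ne_one A)
    exact (H.christoffel1_cone hy).2.2.2.2.2.2.2.2.1 B
  rw [H.lowCurv_cone hx, d1, d2]
  simp only [sy _ (sph _) 1, f001, f00A, f01A, f0AB, f101, f10A, f11A, f1AB,
    fC01, fC0A, fC1A, fCAB]
  simp [ctr, Fin.sum_univ_two]
  ring

/-- `R_{10AB}`. -/
theorem lowCurv_10AB (hx : x ∈ cone T u₀) (A B : Fin 2) :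
    lowCurv (S.metric i) 1 0 (sph A) (sph B) x = (1 / 2) * pd (sph A) (S.c i B) x
      - (1 / 2) * pd (sph B) (S.c i A) x
      - S.ctr i (fun C D => S.k i C A x * S.X i D B x) x
      + S.ctr i (fun C D => S.k i C B x * S.X i D A x) x := by
  obtain ⟨f000, f001, f00A, f011, f01A, f0AB, f100, f101, f10A, f111, f11A, f1AB, fC00, fC01, fC0A,
    fC11, fC1A, fCAB⟩ := H.christoffel1_cone hx
  have sy := fun l a b => H.metricOn.christoffel1_symm (H.sub hx) l a b
  have d1 : ∀ A B, pd (sph A) (christoffel1 (S.metric i) 1 (sph B) 0) x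
      = (1 / 2) * pd (sph A) (S.c i B) x := by
    intro A B
    rw [← pd_const_mul _ _ (H.smoothAtOn_c B) (H.sub hx)]
    refine H.pd_christoffel1_cone hx ((SmoothAtOn.const _).mul (H.smoothAtOn_c B))
      (fun y hy => ?_) (sph_ne_one A)
    rw [H.metricOn.christoffel1_symm (H.sub hy)]
    exact (H.christoffel1_cone hy).2.2.2.2.2.2.2.2.1 B
  rw [H.lowCurv_cone hx, d1, d1]
  simp only [sy _ (sph _) 0, sy _ (sph _) 1, f00A, f01A, f10A, f11A, fC0A, fC1A]
  ring

/-- `R_{C1DA}`. -/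
theorem lowCurv_C1DA (hx : x ∈ cone T u₀) (C D A : Fin 2) :
    lowCurv (S.metric i) (sph C) 1 (sph D) (sph A) x = pd (sph D) (S.k i C A) x
      - pd (sph A) (S.k i C D) x
      - (-(1 / 4) * (S.k i D C x * S.c i A x) + S.ctr i (fun E F => S.Γs i E D C x * S.k i F A x) x)
      + (-(1 / 4) * (S.k i A C x * S.c i D x)
        + S.ctr i (fun E F => S.Γs i E A C x * S.k i F D x) x) := by
  obtain ⟨f000, f001, f00A, f011, f01A, f0AB, f100, f101, f10A, f111, f11A, f1AB, fC00, fC01, fC0A,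
    fC11, fC1A, fCAB⟩ := H.christoffel1_cone hx
  have sy := fun l a b => H.metricOn.christoffel1_symm (H.sub hx) l a b
  have d1 : ∀ D A, pd (sph D) (christoffel1 (S.metric i) (sph C) (sph A) 1) x
      = pd (sph D) (S.k i C A) x := by
    intro D A
    refine H.pd_christoffel1_cone hx (S.smoothAtOn_k i C A) (fun y hy => ?_) (sph_ne_one D)
    rw [H.metricOn.christoffel1_symm (H.sub hy)]
    exact (H.christoffel1_cone hy).2.2.2.2.2.2.2.2.2.2.2.2.2.2.2.2.1 C A
  rw [H.lowCurv_cone hx, d1, d1]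
  simp only [sy _ (sph _) 1, f01A, f0AB, f11A, f1AB, fC1A, fCAB]
  ring

omit H in
-- R₁₀₁₀ contains ∂_u² g₀₀. Writing g₀₀ as a quadratic form in g_{0A} reduces it to first
-- derivatives, that is to `c`.
theorem metric_zero_zero_eq {x : Fin 4 → ℝ} (hx : x ∈ slab T u₀ u₁) : S.metric i x 0 0
    = ∑ A, ∑ B, S.hinv i A B x * (S.metric i x 0 (sph A) * S.metric i x 0 (sph B)) := by
  have hdet := (S.sphereMetric_det_pos i hx).ne'
  have h1 := Matrix.nonsing_inv_mul (S.sphereMetric i x) (isUnit_iff_ne_zero.2 hdet)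
  have hg : ∀ A B, S.hinv i A 0 x * S.sphereMetric i x 0 B + S.hinv i A 1 x * S.sphereMetric i x 1 B
      = if A = B then 1 else 0 := by
    intro A B
    have := congrFun (congrFun h1 A) B
    rwa [Matrix.mul_apply, Fin.sum_univ_two, Matrix.one_apply] at this
  have key : ∀ A, ∑ B, S.hinv i A B x * S.metric i x 0 (sph B) = -S.shift i x A := by
    intro A
    simp only [metric_zero_sph, Fin.sum_univ_two, S.sphereMetric_symm i hx]
    have h0 := hg A 0
    have h1 := hg A 1
    rw [S.sphereMetric_symm i hx 0 1] at h1
    have : -((S.hinv i A 0 x * S.sphereMetric i x 0 0 + S.hinv i A 1 x * S.sphereMetric i x 1 0)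
        * S.shift i x 0 + (S.hinv i A 0 x * S.sphereMetric i x 1 0
        + S.hinv i A 1 x * S.sphereMetric i x 1 1) * S.shift i x 1) = -S.shift i x A := by
      rw [h0, h1]
      fin_cases A <;> simp
    rw [S.sphereMetric_symm i hx 0 1, ← this]
    ring
  have : ∑ A, ∑ B, S.hinv i A B x * (S.metric i x 0 (sph A) * S.metric i x 0 (sph B))
      = ∑ A, S.metric i x 0 (sph A) * ∑ B, S.hinv i A B x * S.metric i x 0 (sph B) := by
    simp only [Finset.mul_sum]
    exact Finset.sum_congr rfl fun _ _ => Finset.sum_congr rfl fun _ _ => by ring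
  rw [this]
  simp only [key]
  simp only [metric_zero_zero, metric_zero_sph, Fin.sum_univ_two]
  ring

omit H in
-- As both `f` and `g` vanish at the point, only the terms in which each is differentiated exactly
-- once survive.
theorem pd_pd_mul_mul {n : ℕ} {s : Set (Fin n → ℝ)} (hs : UniqueDiffOn ℝ s)
    {p f g : (Fin n → ℝ) → ℝ} (hp : SmoothAtOn s p) (hf : SmoothAtOn s f) (hg : SmoothAtOn s g)
    {x : Fin n → ℝ} (hx : x ∈ s) (hf0 : f x = 0) (hg0 : g x = 0) (μ : Fin n) :
    pd μ (pd μ (fun y => p y * (f y * g y))) x = p x * (2 * (pd μ f x * pd μ g x)) := by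
  have h1 : ∀ y ∈ s, pd μ (fun y => p y * (f y * g y)) y
      = pd μ p y * (f y * g y) + p y * (pd μ f y * g y + f y * pd μ g y) := by
    intro y hy
    rw [pd_mul μ hp (hf.mul hg) hy, pd_mul μ hf hg hy]
  rw [pd_eq_of_eqOn hs ((hp.mul (hf.mul hg)).pd μ) (((hp.pd μ).mul (hf.mul hg)).add
    (hp.mul (((hf.pd μ).mul hg).add (hf.mul (hg.pd μ))))) h1 μ hx,
    pd_add μ ((hp.pd μ).mul (hf.mul hg)) (hp.mul (((hf.pd μ).mul hg).add (hf.mul (hg.pd μ)))) hx,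
    pd_mul μ (hp.pd μ) (hf.mul hg) hx, pd_mul μ hf hg hx,
    pd_mul μ hp (((hf.pd μ).mul hg).add (hf.mul (hg.pd μ))) hx,
    pd_add μ ((hf.pd μ).mul hg) (hf.mul (hg.pd μ)) hx, pd_mul μ (hf.pd μ) hg hx,
    pd_mul μ hf (hg.pd μ) hx, hf0, hg0]
  ring

/-- `R_{1010}`. -/
theorem lowCurv_1010 (hx : x ∈ cone T u₀) :
    lowCurv (S.metric i) 1 0 1 0 x = -4 * pd 0 (S.w i) x
      - (3 / 4) * S.ctr i (fun C D => S.c i C x * S.c i D x) x := by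
  obtain ⟨f000, f001, f00A, f011, f01A, f0AB, f100, f101, f10A, f111, f11A, f1AB, fC00, fC01, fC0A,
    fC11, fC1A, fCAB⟩ := H.christoffel1_cone hx
  have hs := H.sub hx
  have hm := H.metricOn
  have sy := fun l a b => hm.christoffel1_symm hs l a b
  have d0 : pd 0 (christoffel1 (S.metric i) 1 1 0) x = 0 := by
    rw [H.pd_christoffel1_cone hx (SmoothAtOn.const 0)
      (fun y hy => by rw [hm.christoffel1_symm (H.sub hy)]
                      exact (H.christoffel1_cone hy).2.2.2.2.2.2.2.1) zero_ne_one', pd_const]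
  -- The derivatives are commuted so that ∂_u acts first. Its result is known on the cone, and the
  -- remaining derivative is tangential.
  have d1 : pd 1 (pd 0 (fun y => S.metric i y 0 1)) x = -4 * pd 0 (S.w i) x := by
    rw [pd_comm 1 0 (hm.smooth 0 1) hs, ← pd_const_mul 0 _ (S.smoothAtOn_w i) hs]
    exact H.pd_congr ((hm.smooth 0 1).pd 1) ((SmoothAtOn.const _).mul (S.smoothAtOn_w i))
      (fun y hy => H.pd_one_metric_zero_one hy) zero_ne_one' hx
  have d2 : pd 1 (pd 1 (fun y => S.metric i y 0 0)) x
      = 2 * S.ctr i (fun C D => S.c i C x * S.c i D x) x := by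
    have sp : ∀ A B, SmoothAtOn (slab T u₀ u₁) (S.hinv i A B) :=
      fun A B => S.smoothAtOn_inv_sphereMetric i A B
    have sg := fun A : Fin 2 => hm.smooth 0 (sph A)
    have g0 : ∀ A, S.metric i x 0 (sph A) = 0 := by
      intro A
      rw [metric_zero_sph, H.shift x hx]
      simp
    have sm : ∀ A B, SmoothAtOn (slab T u₀ u₁)
      (fun y => S.hinv i A B y * (S.metric i y 0 (sph A) * S.metric i y 0 (sph B))) :=
      fun A B => (sp A B).mul ((sg A).mul (sg B))
    have sm1 := fun A => SmoothAtOn.sum (t := Finset.univ) fun B _ => sm A B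
    have h1 : ∀ y ∈ slab T u₀ u₁, pd 1 (fun y => S.metric i y 0 0) y
        = ∑ A, ∑ B, pd 1 (fun y => S.hinv i A B y
          * (S.metric i y 0 (sph A) * S.metric i y 0 (sph B))) y := by
      intro y hy
      rw [pd_eq_of_eqOn hm.uniq (hm.smooth 0 0) (SmoothAtOn.sum (t := Finset.univ)
        fun A _ => sm1 A) (fun z hz => metric_zero_zero_eq hz) 1 hy,
        pd_sum 1 _ (fun A _ => sm1 A) hy]
      exact Finset.sum_congr rfl fun A _ => pd_sum 1 _ (fun B _ => sm A B) hy
    rw [pd_eq_of_eqOn hm.uniq ((hm.smooth 0 0).pd 1) (SmoothAtOn.sum (t := Finset.univ)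
        fun A _ => SmoothAtOn.sum (t := Finset.univ) fun B _ => (sm A B).pd 1) h1 1 hs,
      pd_sum 1 _ (fun A _ => SmoothAtOn.sum fun B _ => (sm A B).pd 1) hs, ctr, Finset.mul_sum]
    refine Finset.sum_congr rfl fun A _ => ?_
    rw [pd_sum 1 _ (fun B _ => (sm A B).pd 1) hs, Finset.mul_sum]
    refine Finset.sum_congr rfl fun B _ => ?_
    rw [pd_pd_mul_mul hm.uniq (sp A B) (sg A) (sg B) hs (g0 A) (g0 B)]
    simp only [c]
    ring
  have d3 : pd 1 (christoffel1 (S.metric i) 1 0 0) x = -4 * pd 0 (S.w i) x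
      - S.ctr i (fun C D => S.c i C x * S.c i D x) x := by
    rw [hm.pd_christoffel1 hs, d1, d2]
    ring
  rw [H.lowCurv_cone hx, d0, d3]
  simp only [sy _ 1 0, f000, f001, f011, f100, f101, f111, fC00, fC01, fC11]
  simp [ctr, Fin.sum_univ_two]
  ring

/-! ### The vacuum equations on the cone -/

theorem ricci_cone (hx : x ∈ cone T u₀) (b d : Fin 4) : ricci (S.metric i) b d x
    = -(1 / 2) * (lowCurv (S.metric i) 1 b 0 d x + lowCurv (S.metric i) 0 b 1 d x)
      + S.ctr i (fun C D => lowCurv (S.metric i) (sph D) b (sph C) d x) x := by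
  rw [H.metricOn.ricci_eq (H.sub hx), H.sum_inv hx (fun a c => lowCurv (S.metric i) c b a d x)]
  rfl

omit H in
theorem lowCurv_self_right (a b c : Fin 4) : lowCurv (S.metric i) a b c c x = 0 := by
  have := MetricOn.lowCurv_swap_right (G := S.metric i) a b c c x
  linarith

theorem lowCurv_self_left (hx : x ∈ cone T u₀) (a c d : Fin 4) :
    lowCurv (S.metric i) a a c d x = 0 := by
  have := H.metricOn.lowCurv_swap_left (H.sub hx) a a c d
  linarith

/-- Roles of the five contracted equations: R₀₀ yields Raychaudhuri's equation, R_{0A} the transport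
of the torsion, R_{1A} the component β̲, R_{AB} the transport of χ̲, and R₀₁ the transport of ω̲. -/
theorem vacuum_00 (hr : S.IsVacuum) (hx : x ∈ cone T u₀) :
    S.ctr i (fun C D => lowCurv (S.metric i) (sph C) 0 (sph D) 0 x) x = 0 := by
  have h := hr i x (H.sub hx) 0 0
  rw [H.ricci_cone hx, lowCurv_self_right, H.lowCurv_self_left hx] at h
  have e : ∀ C D, lowCurv (S.metric i) (sph D) 0 (sph C) 0 x
      = lowCurv (S.metric i) (sph C) 0 (sph D) 0 x :=
    fun C D => H.metricOn.lowCurv_pair (H.sub hx) _ _ _ _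
  simp only [e] at h
  linarith

theorem vacuum_0A (hr : S.IsVacuum) (hx : x ∈ cone T u₀) (A : Fin 2) :
    lowCurv (S.metric i) 1 0 0 (sph A) x
      = 2 * S.ctr i (fun C D => lowCurv (S.metric i) (sph D) 0 (sph C) (sph A) x) x := by
  have h := hr i x (H.sub hx) 0 (sph A)
  rw [H.ricci_cone hx, H.lowCurv_self_left hx 0] at h
  linarith

theorem vacuum_1A (hr : S.IsVacuum) (hx : x ∈ cone T u₀) (A : Fin 2) :
    lowCurv (S.metric i) 0 1 1 (sph A) x
      = 2 * S.ctr i (fun C D => lowCurv (S.metric i) (sph D) 1 (sph C) (sph A) x) x := by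
  have h := hr i x (H.sub hx) 1 (sph A)
  rw [H.ricci_cone hx, H.lowCurv_self_left hx 1] at h
  linarith

theorem vacuum_AB (hr : S.IsVacuum) (hx : x ∈ cone T u₀) (A B : Fin 2) :
    lowCurv (S.metric i) 1 (sph A) 0 (sph B) x + lowCurv (S.metric i) 1 (sph B) 0 (sph A) x
      = 2 * S.ctr i (fun C D => lowCurv (S.metric i) (sph D) (sph A) (sph C) (sph B) x) x := by
  have h := hr i x (H.sub hx) (sph A) (sph B)
  rw [H.ricci_cone hx, H.metricOn.lowCurv_pair (H.sub hx) 0 (sph A) 1 (sph B)] at h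
  linarith

theorem vacuum_01 (hr : S.IsVacuum) (hx : x ∈ cone T u₀) :
    lowCurv (S.metric i) 1 0 1 0 x
      = -2 * S.ctr i (fun C D => lowCurv (S.metric i) 1 (sph C) 0 (sph D) x) x := by
  have h := hr i x (H.sub hx) 0 1
  rw [H.ricci_cone hx, lowCurv_self_right, MetricOn.lowCurv_swap_right 1 0 0 1] at h
  have e : ∀ C D, lowCurv (S.metric i) (sph D) 0 (sph C) 1 x
      = lowCurv (S.metric i) 1 (sph C) 0 (sph D) x := by
    intro C D
    rw [H.metricOn.lowCurv_pair (H.sub hx), H.metricOn.lowCurv_swap_left (H.sub hx),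
      MetricOn.lowCurv_swap_right]
    ring
  simp only [e] at h
  linarith

/-- The contraction of a Christoffel symbol with a one-form. -/
theorem sum_christoffel_cone (hx : x ∈ cone T u₀) (e a : Fin 4) (r : Fin 4 → ℝ) :
    ∑ f, christoffel (S.metric i) f e a x * r f
      = -(1 / 2) * (christoffel1 (S.metric i) 1 e a x * r 0 + christoffel1 (S.metric i) 0 e a x * r 1)
        + S.ctr i (fun C D => christoffel1 (S.metric i) (sph D) e a x * r (sph C)) x := by
  simp only [MetricOn.christoffel_eq, Finset.sum_mul]
  have := H.sum_inv hx (fun f l => christoffel1 (S.metric i) l e a x * r f)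
  simp only [← mul_assoc] at this
  rw [this]
  simp only [ctr, hinv, mul_assoc]

theorem covCurv_cone (hx : x ∈ cone T u₀) (e a b c d : Fin 4) :
    covCurv (S.metric i) e a b c d x = pd e (lowCurv (S.metric i) a b c d) x
      - ((-(1 / 2) * (christoffel1 (S.metric i) 1 e a x * lowCurv (S.metric i) 0 b c d x
            + christoffel1 (S.metric i) 0 e a x * lowCurv (S.metric i) 1 b c d x)
          + S.ctr i (fun C D => christoffel1 (S.metric i) (sph D) e a x
            * lowCurv (S.metric i) (sph C) b c d x) x)
        + (-(1 / 2) * (christoffel1 (S.metric i) 1 e b x * lowCurv (S.metric i) a 0 c d x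
            + christoffel1 (S.metric i) 0 e b x * lowCurv (S.metric i) a 1 c d x)
          + S.ctr i (fun C D => christoffel1 (S.metric i) (sph D) e b x
            * lowCurv (S.metric i) a (sph C) c d x) x)
        + (-(1 / 2) * (christoffel1 (S.metric i) 1 e c x * lowCurv (S.metric i) a b 0 d x
            + christoffel1 (S.metric i) 0 e c x * lowCurv (S.metric i) a b 1 d x)
          + S.ctr i (fun C D => christoffel1 (S.metric i) (sph D) e c x
            * lowCurv (S.metric i) a b (sph C) d x) x)
        + (-(1 / 2) * (christoffel1 (S.metric i) 1 e d x * lowCurv (S.metric i) a b c 0 x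
            + christoffel1 (S.metric i) 0 e d x * lowCurv (S.metric i) a b c 1 x)
          + S.ctr i (fun C D => christoffel1 (S.metric i) (sph D) e d x
            * lowCurv (S.metric i) a b c (sph C) x) x)) := by
  unfold covCurv
  simp only [Finset.sum_add_distrib]
  rw [H.sum_christoffel_cone hx e a (fun f => lowCurv (S.metric i) f b c d x),
    H.sum_christoffel_cone hx e b (fun f => lowCurv (S.metric i) a f c d x),
    H.sum_christoffel_cone hx e c (fun f => lowCurv (S.metric i) a b f d x),
    H.sum_christoffel_cone hx e d (fun f => lowCurv (S.metric i) a b c f x)]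

/-- R_{1A1B} contains ∂_u² h, so no formula on the cone determines it. The divergence identity
relates ∇₀R_{1A1B} to ∇₁R_{0A1B}, and the uncontracted Bianchi identity trades the latter,
transversal derivative for ∇₀R_{1A1B} and ∇_A R_{1B10}. -/
theorem covCurv_0_1A1B (hr : S.IsVacuum) (hx : x ∈ cone T u₀) (A B : Fin 2) :
    covCurv (S.metric i) 0 1 (sph A) 1 (sph B) x
      = (1 / 2) * covCurv (S.metric i) (sph A) 1 (sph B) 1 0 x
        + S.ctr i (fun C D => covCurv (S.metric i) (sph C) (sph D) (sph A) 1 (sph B) x) x := by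
  have hs := H.sub hx
  have h := H.metricOn.sum_inv_covCurv_div (fun y hy => hr i y hy) hs (sph A) 1 (sph B)
  rw [H.sum_inv hx (fun e c => covCurv (S.metric i) e c (sph A) 1 (sph B) x)] at h
  have h1 := H.metricOn.bianchi hs 1 1 (sph B) 0 (sph A)
  rw [H.metricOn.covCurv_pair hs 1 0 (sph A), H.metricOn.covCurv_pair hs 0 1 (sph A)] at h
  rw [H.metricOn.covCurv_pair hs 0 1 (sph A)]
  rw [H.metricOn.covCurv_swap_right hs 0 1 (sph B) (sph A) 1] at h1
  simp only [ctr, hinv]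
  linarith

/-- The transport equation for `α̲` along the cone. -/
theorem pd_zero_lowCurv_1A1B (hr : S.IsVacuum) (hx : x ∈ cone T u₀) (A B : Fin 2) :
    pd 0 (lowCurv (S.metric i) 1 (sph A) 1 (sph B)) x
      = S.ctr i (fun C D => S.X i D A x * lowCurv (S.metric i) 1 (sph C) 1 (sph B) x) x
        + S.ctr i (fun C D => S.X i D B x * lowCurv (S.metric i) 1 (sph A) 1 (sph C) x) x
        - (1 / 2) * S.ctr i (fun C D => S.c i D x * (lowCurv (S.metric i) (sph C) (sph A) 1 (sph B) x
          + lowCurv (S.metric i) 1 (sph A) (sph C) (sph B) x)) x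
        - (1 / 4) * (S.c i A x * lowCurv (S.metric i) 1 0 1 (sph B) x
          + S.c i B x * lowCurv (S.metric i) 1 (sph A) 1 0 x)
        + (1 / 2) * (pd (sph A) (lowCurv (S.metric i) 1 (sph B) 1 0) x
          - ((1 / 4) * (S.c i A x * lowCurv (S.metric i) 1 (sph B) 1 0 x)
            + S.ctr i (fun C D => S.k i D A x * lowCurv (S.metric i) (sph C) (sph B) 1 0 x) x)
          - ((1 / 2) * (S.k i A B x * lowCurv (S.metric i) 1 0 1 0 x)
            + S.ctr i (fun C D => S.Γs i D A B x * lowCurv (S.metric i) 1 (sph C) 1 0 x) x)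
          - ((1 / 4) * (S.c i A x * lowCurv (S.metric i) 1 (sph B) 1 0 x)
            + S.ctr i (fun C D => S.k i D A x * lowCurv (S.metric i) 1 (sph B) (sph C) 0 x) x)
          - (-(1 / 4) * (S.c i A x * lowCurv (S.metric i) 1 (sph B) 1 0 x)
            + S.ctr i (fun C D => S.X i D A x * lowCurv (S.metric i) 1 (sph B) 1 (sph C) x) x))
        + S.ctr i (fun C D => pd (sph C) (lowCurv (S.metric i) (sph D) (sph A) 1 (sph B)) x
          - ((1 / 2) * (S.k i C D x * lowCurv (S.metric i) 0 (sph A) 1 (sph B) x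
              + S.X i C D x * lowCurv (S.metric i) 1 (sph A) 1 (sph B) x)
            + S.ctr i (fun E F => S.Γs i F C D x * lowCurv (S.metric i) (sph E) (sph A) 1 (sph B) x) x)
          - ((1 / 2) * (S.k i C A x * lowCurv (S.metric i) (sph D) 0 1 (sph B) x
              + S.X i C A x * lowCurv (S.metric i) (sph D) 1 1 (sph B) x)
            + S.ctr i (fun E F => S.Γs i F C A x * lowCurv (S.metric i) (sph D) (sph E) 1 (sph B) x) x)
          - ((1 / 4) * (S.c i C x * lowCurv (S.metric i) (sph D) (sph A) 1 (sph B) x)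
            + S.ctr i (fun E F => S.k i F C x
              * lowCurv (S.metric i) (sph D) (sph A) (sph E) (sph B) x) x)
          - ((1 / 2) * (S.k i C B x * lowCurv (S.metric i) (sph D) (sph A) 1 0 x)
            + S.ctr i (fun E F => S.Γs i F C B x
              * lowCurv (S.metric i) (sph D) (sph A) 1 (sph E) x) x)) x := by
  obtain ⟨f000, f001, f00A, f011, f01A, f0AB, f100, f101, f10A, f111, f11A, f1AB, fC00, fC01, fC0A,
    fC11, fC1A, fCAB⟩ := H.christoffel1_cone hx
  have sy := fun l a b => H.metricOn.christoffel1_symm (H.sub hx) l a b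
  have z1 : ∀ a b c, lowCurv (S.metric i) a b c c x = 0 := fun a b c => lowCurv_self_right a b c
  have z2 : ∀ a c d, lowCurv (S.metric i) a a c d x = 0 := fun a c d => H.lowCurv_self_left hx a c d
  have h := H.covCurv_0_1A1B hr hx A B
  simp only [H.covCurv_cone hx, sy _ (sph _) 0, sy _ (sph _) 1, f00A, f01A, f0AB, f10A, f11A, f1AB,
    fC01, fC0A, fC1A, fCAB, z1, z2, f001, f101] at h
  have h' := eq_add_of_sub_eq h
  rw [h']
  simp only [ctr, Fin.sum_univ_two]
  ring

end ConeGauge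

end Spacetime

end

/-! ### Connection coefficients and null curvature components in coordinates -/

section

theorem riemann_single {n : ℕ} (G : (Fin n → ℝ) → Matrix (Fin n) (Fin n) ℝ) (x : Fin n → ℝ)
    (a b c d : Fin n) : riemann G x (Pi.single a 1) (Pi.single b 1) (Pi.single c 1) (Pi.single d 1)
      = lowCurv G a b c d x := by
  simp [riemann, inner2, lowCurv, Pi.single_apply]

theorem MetricOn.inner2_covVec_single {n : ℕ} {s : Set (Fin n → ℝ)}
    {G : (Fin n → ℝ) → Matrix (Fin n) (Fin n) ℝ} (hG : MetricOn s G) {x : Fin n → ℝ} (hx : x ∈ s)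
    (μ ν : Fin n) (Y : (Fin n → ℝ) → Fin n → ℝ) :
    inner2 G x (covVec G (Pi.single μ 1) Y x) (Pi.single ν 1)
      = ∑ a, G x a ν * pd μ (fun y => Y y a) x + ∑ j, christoffel1 G ν μ j x * Y x j := by
  have h : ∀ j, christoffel1 G ν μ j x * Y x j = ∑ a, G x a ν * (christoffel G a μ j x * Y x j) := by
    intro j
    rw [← hG.lower_christoffel hx, Finset.sum_mul]
    exact Finset.sum_congr rfl fun a _ => by rw [hG.symm x hx ν a]; ring
  simp only [h]
  rw [Finset.sum_comm (s := Finset.univ) (t := Finset.univ), ← Finset.sum_add_distrib]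
  simp [inner2, covVec, Pi.single_apply, mul_add, Finset.mul_sum, Finset.sum_add_distrib]

namespace Spacetime

variable {T u₀ u₁ : ℝ} (S : Spacetime T u₀ u₁) (i : Fin 2)

theorem e3_apply (x : Fin 4 → ℝ) (a : Fin 4) :
    S.e3 i x a = if a = 1 then (S.lapse i x)⁻¹ else 0 := by
  simp [e3, Pi.single_apply]

theorem e4_zero (x : Fin 4 → ℝ) : S.e4 i x 0 = (S.lapse i x)⁻¹ := by
  simp [e4, sph]

theorem e4_one (x : Fin 4 → ℝ) : S.e4 i x 1 = 0 := by
  simp [e4, sph]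

theorem e4_sph (x : Fin 4 → ℝ) (A : Fin 2) :
    S.e4 i x (sph A) = (S.lapse i x)⁻¹ * S.shift i x A := by
  fin_cases A <;> simp [e4, sph]

theorem smoothAtOn_inv_lapse : SmoothAtOn (slab T u₀ u₁) (fun y => (S.lapse i y)⁻¹) :=
  fun x hx => (S.lapse_smooth i x hx).inv (S.lapse_pos i x hx).ne'

namespace ConeGauge

variable {S i} (H : S.ConeGauge i) {x : Fin 4 → ℝ} (hx : x ∈ cone T u₀)
include H

theorem e3_cone (hx : x ∈ cone T u₀) : S.e3 i x = Pi.single 1 1 := by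
  simp [e3, H.lapse x hx]

theorem e4_cone (hx : x ∈ cone T u₀) : S.e4 i x = Pi.single 0 1 := by
  simp [e4, H.lapse x hx, H.shift x hx]

theorem pd_inv_lapse (hx : x ∈ cone T u₀) {μ : Fin 4} (hμ : μ ≠ 1) :
    pd μ (fun y => (S.lapse i y)⁻¹) x = 0 :=
  H.pd_eq_zero (S.smoothAtOn_inv_lapse i) (a := 1) (fun y hy => by simp [H.lapse y hy]) hμ hx

theorem pd_one_inv_lapse (hx : x ∈ cone T u₀) : pd 1 (fun y => (S.lapse i y)⁻¹) x = -S.w i x := by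
  have l := S.smoothAtOn_lapse i
  have h := pd_eq_of_eqOn H.metricOn.uniq ((S.smoothAtOn_inv_lapse i).mul l) (SmoothAtOn.const 1)
    (fun y hy => inv_mul_cancel₀ (S.lapse_pos i y hy).ne') 1 (H.sub hx)
  rw [pd_mul 1 (S.smoothAtOn_inv_lapse i) l (H.sub hx), pd_const, H.lapse x hx] at h
  rw [w]
  linarith

theorem pd_e4 (hx : x ∈ cone T u₀) {μ : Fin 4} (hμ : μ ≠ 1) (a : Fin 4) :
    pd μ (fun y => S.e4 i y a) x = 0 := by
  obtain rfl | rfl | ⟨A, rfl⟩ : a = 0 ∨ a = 1 ∨ ∃ A, a = sph A := by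
    fin_cases a
    · simp
    · simp
    · exact Or.inr (Or.inr ⟨0, rfl⟩)
    · exact Or.inr (Or.inr ⟨1, rfl⟩)
  · simp only [e4_zero]
    exact H.pd_inv_lapse hx hμ
  · simp only [e4_one, pd_const]
  · simp only [e4_sph]
    exact H.pd_eq_zero ((S.smoothAtOn_inv_lapse i).mul (S.smoothAtOn_shift i A)) (a := 0)
      (fun y hy => by simp [H.shift y hy]) hμ hx

theorem pd_e3 (hx : x ∈ cone T u₀) {μ : Fin 4} (hμ : μ ≠ 1) (a : Fin 4) :
    pd μ (fun y => S.e3 i y a) x = 0 := by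
  simp only [e3_apply]
  split_ifs
  · exact H.pd_inv_lapse hx hμ
  · exact pd_const _ _

theorem chi_cone (hx : x ∈ cone T u₀) (A B : Fin 2) : S.chi i x A B = S.X i A B x := by
  rw [chi, eS, eS, H.metricOn.inner2_covVec_single (H.sub hx), H.e4_cone hx]
  simp only [H.pd_e4 hx (sph_ne_one A), H.metricOn.christoffel1_symm (H.sub hx) _ (sph A)]
  simp [Pi.single_apply, (H.christoffel1_cone hx).2.2.2.2.2.2.2.2.2.2.2.2.2.2.1, H.X_symm (H.sub hx) B]

theorem chib_cone (hx : x ∈ cone T u₀) (A B : Fin 2) : S.chib i x A B = S.k i A B x := by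
  rw [chib, eS, eS, H.metricOn.inner2_covVec_single (H.sub hx), H.e3_cone hx]
  simp only [H.pd_e3 hx (sph_ne_one A), H.metricOn.christoffel1_symm (H.sub hx) _ (sph A)]
  simp [Pi.single_apply, (H.christoffel1_cone hx).2.2.2.2.2.2.2.2.2.2.2.2.2.2.2.2.1,
    H.k_symm (H.sub hx) B]

theorem eta_cone (hx : x ∈ cone T u₀) (A : Fin 2) : S.eta i x A = (1 / 4) * S.c i A x := by
  rw [eta, H.e3_cone hx, H.e4_cone hx, H.metricOn.inner2_covVec_single (H.sub hx)]
  simp only [eS, pd_const]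
  simp [Pi.single_apply, (H.christoffel1_cone hx).2.2.2.2.1]
  ring

theorem etab_cone (hx : x ∈ cone T u₀) (A : Fin 2) : S.etab i x A = -(1 / 4) * S.c i A x := by
  rw [etab, H.e3_cone hx, H.e4_cone hx, H.metricOn.inner2_covVec_single (H.sub hx)]
  simp only [eS, pd_const]
  simp [Pi.single_apply, (H.christoffel1_cone hx).2.2.2.2.2.2.2.2.1]
  ring

theorem omega_cone (hx : x ∈ cone T u₀) : S.omega i x = 0 := by
  rw [omega, H.e4_cone hx, H.metricOn.inner2_covVec_single (H.sub hx), H.e3_cone hx]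
  simp only [H.pd_e3 hx zero_ne_one']
  simp [Pi.single_apply, (H.christoffel1_cone hx).2.1]

/-- The differentiation along e₃ is transversal, so ∂_u(Ω⁻¹) = −`w` survives; for ω the
corresponding derivative is tangential and vanishes. -/
theorem omegab_cone (hx : x ∈ cone T u₀) : S.omegab i x = S.w i x := by
  rw [omegab, H.e3_cone hx, H.metricOn.inner2_covVec_single (H.sub hx), H.e4_cone hx,
    sum_four (fun a => S.metric i x a 1 * pd 1 (fun y => S.e4 i y a) x)]
  simp only [e4_zero, metric_zero_one, metric_one_one, metric_sph_one, H.lapse x hx,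
    H.pd_one_inv_lapse hx]
  simp [Pi.single_apply, H.metricOn.christoffel1_symm (H.sub hx) 1 1 0,
    (H.christoffel1_cone hx).2.2.2.2.2.2.2.1]

theorem alpha_cone (hx : x ∈ cone T u₀) (A B : Fin 2) :
    S.alpha i x A B = lowCurv (S.metric i) (sph A) 0 (sph B) 0 x := by
  rw [alpha, H.e4_cone hx, eS, eS, riemann_single]

theorem alphab_cone (hx : x ∈ cone T u₀) (A B : Fin 2) :
    S.alphab i x A B = lowCurv (S.metric i) 1 (sph A) 1 (sph B) x := by
  rw [alphab, H.e3_cone hx, eS, eS, riemann_single, H.metricOn.lowCurv_swap_left (H.sub hx),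
    MetricOn.lowCurv_swap_right, neg_neg]

theorem beta_cone (hx : x ∈ cone T u₀) (A : Fin 2) :
    S.beta i x A = -(1 / 2) * lowCurv (S.metric i) 1 0 0 (sph A) x := by
  rw [beta, H.e3_cone hx, H.e4_cone hx, eS, riemann_single, H.metricOn.lowCurv_pair (H.sub hx),
    MetricOn.lowCurv_swap_right]
  ring

theorem betab_cone (hx : x ∈ cone T u₀) (A : Fin 2) :
    S.betab i x A = (1 / 2) * lowCurv (S.metric i) 0 1 1 (sph A) x := by
  rw [betab, H.e3_cone hx, H.e4_cone hx, eS, riemann_single, H.metricOn.lowCurv_pair (H.sub hx),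
    MetricOn.lowCurv_swap_right, H.metricOn.lowCurv_swap_left (H.sub hx), neg_neg]

theorem rho_cone (hx : x ∈ cone T u₀) :
    S.rho i x = (1 / 4) * lowCurv (S.metric i) 1 0 1 0 x := by
  rw [rho, H.e3_cone hx, H.e4_cone hx, riemann_single]

theorem sigma_cone (hx : x ∈ cone T u₀) : S.sigma i x
    = (1 / 4) * ∑ A, ∑ B, lowCurv (S.metric i) 1 0 (sph A) (sph B) x * S.areaForm i x A B := by
  simp only [sigma, H.e3_cone hx, H.e4_cone hx, eS, riemann_single]

end ConeGauge

end Spacetime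

end

section

/-! ### Families of functions with uniform bounds

A family depends on an index `c`, on the time `t ∈ [0, δ c + 1]` and on the angular coordinates. -/

/-- Families of functions on the cones. -/
abbrev Fam (ι : Type*) := ι → ℝ → (Fin 2 → ℝ) → ℝ

variable {ι : Type*} {δ : ι → ℝ}

/-- The derivative of a family in the direction of an angular coordinate. -/
def Fam.D (A : Fin 2) (f : Fam ι) : Fam ι := fun c t θ => pd A (f c t) θ

/-- Equality of families on the relevant time intervals. -/
def Fam.Eq (δ : ι → ℝ) (f g : Fam ι) : Prop :=
  ∀ c, ∀ t ∈ Set.Icc 0 (δ c + 1), ∀ θ, f c t θ = g c t θ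

theorem Fam.Eq.D {f g : Fam ι} (h : Fam.Eq δ f g) (A : Fin 2) :
    Fam.Eq δ (Fam.D A f) (Fam.D A g) := by
  intro c t ht θ
  have : f c t = g c t := funext (h c t ht)
  simp only [Fam.D, this]

/-- The values are bounded by a multiple of the scale `s`. -/
abbrev Bd0 (δ : ι → ℝ) (s : ι → ℝ → ℝ) (f : Fam ι) : Prop :=
  ∃ C, ∀ c, ∀ t ∈ Set.Icc 0 (δ c + 1), ∀ θ, rsq θ ≤ 4 → |f c t θ| ≤ C * s c t

/-- All derivatives of order at most `j` are bounded by a multiple of the scale `s`. -/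
@[reducible]
def Bd (δ : ι → ℝ) : ℕ → (ι → ℝ → ℝ) → Fam ι → Prop
  | 0, s, f => Bd0 δ s f
  | j + 1, s, f => Bd0 δ s f ∧ ∀ A, Bd δ j s (Fam.D A f)

theorem Bd.zero {j : ℕ} {s : ι → ℝ → ℝ} {f : Fam ι} (h : Bd δ j s f) : Bd δ 0 s f := by
  cases j with
  | zero => exact h
  | succ j => exact h.1

theorem Bd.pred {j : ℕ} {s : ι → ℝ → ℝ} {f : Fam ι} (h : Bd δ (j + 1) s f) : Bd δ j s f := by
  induction j generalizing f with
  | zero => exact h.1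
  | succ j ih => exact ⟨h.1, fun A => ih (h.2 A)⟩

theorem Bd.of_le {j l : ℕ} {s : ι → ℝ → ℝ} {f : Fam ι} (h : Bd δ j s f) (hl : l ≤ j) :
    Bd δ l s f := by
  induction hl with
  | refl => exact h
  | step _ ih => exact ih h.pred

theorem Bd.congr {j : ℕ} {s : ι → ℝ → ℝ} {f g : Fam ι} (h : Bd δ j s f) (e : Fam.Eq δ f g) :
    Bd δ j s g := by
  induction j generalizing f g with
  | zero =>
    obtain ⟨C, hC⟩ := h
    exact ⟨C, fun c t ht θ hθ => by rw [← e c t ht θ]; exact hC c t ht θ hθ⟩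
  | succ j ih =>
    refine ⟨?_, fun A => ih (h.2 A) (e.D A)⟩
    obtain ⟨C, hC⟩ := h.1
    exact ⟨C, fun c t ht θ hθ => by rw [← e c t ht θ]; exact hC c t ht θ hθ⟩

/-- A family which is smooth in the angular variables. -/
def SmF (δ : ι → ℝ) (f : Fam ι) : Prop := ∀ c, ∀ t ∈ Set.Icc 0 (δ c + 1), ContDiff ℝ ∞ (f c t)

/-- A smooth family with control of the derivatives of order at most `j`. -/
structure Ctl (δ : ι → ℝ) (j : ℕ) (s : ι → ℝ → ℝ) (f : Fam ι) : Prop where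
  smooth : SmF δ f
  bd : Bd δ j s f

theorem contDiff_pd {n : ℕ} {f : (Fin n → ℝ) → ℝ} (hf : ContDiff ℝ ∞ f) (A : Fin n) :
    ContDiff ℝ ∞ (pd A f) := by
  have h : ContDiff ℝ ∞ (fderiv ℝ f) := hf.fderiv_right (by simp)
  exact h.clm_apply contDiff_const

theorem SmF.D {f : Fam ι} (hf : SmF δ f) (A : Fin 2) : SmF δ (Fam.D A f) :=
  fun c t ht => contDiff_pd (hf c t ht) A

theorem SmF.smoothAtOn {f : Fam ι} (hf : SmF δ f) {c : ι} {t : ℝ} (ht : t ∈ Set.Icc 0 (δ c + 1)) :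
    SmoothAtOn Set.univ (f c t) := fun _ _ => (hf c t ht).contDiffAt

theorem SmF.add {f g : Fam ι} (hf : SmF δ f) (hg : SmF δ g) : SmF δ (f + g) :=
  fun c t ht => (hf c t ht).add (hg c t ht)

theorem SmF.mul {f g : Fam ι} (hf : SmF δ f) (hg : SmF δ g) : SmF δ (f * g) :=
  fun c t ht => (hf c t ht).mul (hg c t ht)

theorem SmF.congr {f g : Fam ι} (hf : SmF δ f) (e : Fam.Eq δ f g) : SmF δ g := by
  intro c t ht
  have : f c t = g c t := funext (e c t ht)
  rw [← this]
  exact hf c t ht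

theorem Fam.D_add {f g : Fam ι} (hf : SmF δ f) (hg : SmF δ g) (A : Fin 2) :
    Fam.Eq δ (Fam.D A f + Fam.D A g) (Fam.D A (f + g)) :=
  fun _ _ ht θ => (pd_add A (hf.smoothAtOn ht) (hg.smoothAtOn ht) (Set.mem_univ θ)).symm

theorem Fam.D_mul {f g : Fam ι} (hf : SmF δ f) (hg : SmF δ g) (A : Fin 2) :
    Fam.Eq δ (Fam.D A f * g + f * Fam.D A g) (Fam.D A (f * g)) :=
  fun _ _ ht θ => (pd_mul A (hf.smoothAtOn ht) (hg.smoothAtOn ht) (Set.mem_univ θ)).symm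

theorem Bd.add {j : ℕ} {s : ι → ℝ → ℝ} {f g : Fam ι} (hf : Bd δ j s f) (hg : Bd δ j s g)
    (sf : SmF δ f) (sg : SmF δ g) : Bd δ j s (f + g) := by
  have base : ∀ {f g : Fam ι}, Bd δ 0 s f → Bd δ 0 s g → Bd δ 0 s (f + g) := by
    rintro f g ⟨C, hC⟩ ⟨C', hC'⟩
    refine ⟨C + C', fun c t ht θ hθ => ?_⟩
    have h1 := hC c t ht θ hθ
    have h2 := hC' c t ht θ hθ
    rw [add_mul]
    exact (abs_add_le _ _).trans (add_le_add h1 h2)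
  induction j generalizing f g with
  | zero => exact base hf hg
  | succ j ih =>
    exact ⟨base hf.1 hg.1, fun A => (ih (hf.2 A) (hg.2 A) (sf.D A) (sg.D A)).congr
      (Fam.D_add sf sg A)⟩

theorem Bd.mul {j : ℕ} {s s' : ι → ℝ → ℝ} {f g : Fam ι} (hf : Bd δ j s f) (hg : Bd δ j s' g)
    (sf : SmF δ f) (sg : SmF δ g) : Bd δ j (s * s') (f * g) := by
  have base : ∀ {f g : Fam ι}, Bd δ 0 s f → Bd δ 0 s' g → Bd δ 0 (s * s') (f * g) := by
    rintro f g ⟨C, hC⟩ ⟨C', hC'⟩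
    refine ⟨C * C', fun c t ht θ hθ => ?_⟩
    have h1 := hC c t ht θ hθ
    have h2 := hC' c t ht θ hθ
    calc |f c t θ * g c t θ| = |f c t θ| * |g c t θ| := abs_mul _ _
      _ ≤ (C * s c t) * (C' * s' c t) :=
          mul_le_mul h1 h2 (abs_nonneg _) ((abs_nonneg _).trans h1)
      _ = C * C' * (s c t * s' c t) := by ring
  induction j generalizing f g with
  | zero => exact base hf hg
  | succ j ih =>
    exact ⟨base hf.1 hg.1, fun A => ((ih (hf.2 A) hg.pred (sf.D A) sg).add
      (ih hf.pred (hg.2 A) sf (sg.D A)) ((sf.D A).mul sg) (sf.mul (sg.D A))).congr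
      (Fam.D_mul sf sg A)⟩

theorem Bd.mono {j : ℕ} {s s' : ι → ℝ → ℝ} {f : Fam ι} (hf : Bd δ j s f) (K : ℝ)
    (h : ∀ c, ∀ t ∈ Set.Icc 0 (δ c + 1), 0 ≤ s c t ∧ s c t ≤ K * s' c t) : Bd δ j s' f := by
  have base : ∀ {f : Fam ι}, Bd δ 0 s f → Bd δ 0 s' f := by
    rintro f ⟨C, hC⟩
    refine ⟨|C| * K, fun c t ht θ hθ => (hC c t ht θ hθ).trans ?_⟩
    obtain ⟨h0, h1⟩ := h c t ht
    calc C * s c t ≤ |C| * s c t := mul_le_mul_of_nonneg_right (le_abs_self C) h0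
      _ ≤ |C| * (K * s' c t) := mul_le_mul_of_nonneg_left h1 (abs_nonneg C)
      _ = |C| * K * s' c t := by ring
  induction j generalizing f with
  | zero => exact base hf
  | succ j ih => exact ⟨base hf.1, fun A => ih (hf.2 A)⟩

theorem Fam.D_param (a : ι → ℝ → ℝ) (A : Fin 2) :
    Fam.D A (fun c t _ => a c t) = fun _ _ _ => 0 := by
  funext c t θ
  exact pd_const A _

theorem Bd.zero_fam (j : ℕ) {s : ι → ℝ → ℝ} : Bd δ j s (fun _ _ _ => 0) := by
  have base : Bd δ 0 s (fun _ _ _ => 0) := ⟨0, fun c t _ θ _ => by simp⟩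
  induction j with
  | zero => exact base
  | succ j ih =>
    refine ⟨base, fun A => ?_⟩
    rw [Fam.D_param (fun _ _ => 0) A]
    exact ih

namespace Ctl

variable {j l : ℕ} {s s' : ι → ℝ → ℝ} {f g : Fam ι}

theorem congr (hf : Ctl δ j s f) (e : Fam.Eq δ f g) : Ctl δ j s g :=
  ⟨hf.1.congr e, hf.2.congr e⟩

theorem of_le (hf : Ctl δ j s f) (hl : l ≤ j) : Ctl δ l s f := ⟨hf.1, hf.2.of_le hl⟩

theorem D (hf : Ctl δ (j + 1) s f) (A : Fin 2) : Ctl δ j s (Fam.D A f) := ⟨hf.1.D A, hf.2.2 A⟩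

theorem add (hf : Ctl δ j s f) (hg : Ctl δ j s g) : Ctl δ j s (f + g) :=
  ⟨hf.1.add hg.1, hf.2.add hg.2 hf.1 hg.1⟩

theorem mul (hf : Ctl δ j s f) (hg : Ctl δ j s' g) : Ctl δ j (s * s') (f * g) :=
  ⟨hf.1.mul hg.1, hf.2.mul hg.2 hf.1 hg.1⟩

theorem mono (hf : Ctl δ j s f) (K : ℝ)
    (h : ∀ c, ∀ t ∈ Set.Icc 0 (δ c + 1), 0 ≤ s c t ∧ s c t ≤ K * s' c t) : Ctl δ j s' f :=
  ⟨hf.1, hf.2.mono K h⟩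

/-- Functions of the parameters alone. -/
theorem param (a : ι → ℝ → ℝ) (C : ℝ) (h : ∀ c, ∀ t ∈ Set.Icc 0 (δ c + 1), |a c t| ≤ C * s c t) :
    Ctl δ j s (fun c t _ => a c t) := by
  refine ⟨fun c t _ => contDiff_const, ?_⟩
  have base : Bd δ 0 s (fun c t _ => a c t) := ⟨C, fun c t ht _ _ => h c t ht⟩
  cases j with
  | zero => exact base
  | succ j =>
    refine ⟨base, fun A => ?_⟩
    rw [Fam.D_param]
    exact Bd.zero_fam j

theorem const (a : ℝ) : Ctl δ j 1 (fun _ _ _ => a) :=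
  param (fun _ _ => a) |a| (by simp)

theorem const_mul (a : ℝ) (hf : Ctl δ j s f) : Ctl δ j s (fun c t θ => a * f c t θ) := by
  have h := (const (δ := δ) (j := j) a).mul hf
  rw [one_mul] at h
  exact h

theorem neg (hf : Ctl δ j s f) : Ctl δ j s (-f) :=
  (hf.const_mul (-1)).congr fun c t _ θ => by simp

theorem sub (hf : Ctl δ j s f) (hg : Ctl δ j s g) : Ctl δ j s (f - g) := by
  rw [sub_eq_add_neg]
  exact hf.add hg.neg

theorem zero : Ctl δ j s 0 := ⟨fun _ _ _ => contDiff_const, Bd.zero_fam j⟩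

theorem sum {κ : Type*} {t : Finset κ} {f : κ → Fam ι} (h : ∀ a ∈ t, Ctl δ j s (f a)) :
    Ctl δ j s (∑ a ∈ t, f a) := by
  classical
  induction t using Finset.induction_on with
  | empty => simpa using zero
  | insert a t ha ih =>
    rw [Finset.sum_insert ha]
    exact (h a (by simp)).add (ih fun b hb => h b (by simp [hb]))

theorem isCompact_disc : IsCompact {θ : Fin 2 → ℝ | rsq θ ≤ 4} := by
  have hc : Continuous rsq := by unfold rsq; fun_prop
  refine (isCompact_closedBall (0 : Fin 2 → ℝ) 2).of_isClosed_subset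
    (isClosed_le hc continuous_const) fun θ hθ => ?_
  rw [mem_closedBall_zero_iff, pi_norm_le_iff_of_nonneg (by norm_num)]
  intro A
  rw [Real.norm_eq_abs]
  simp only [Set.mem_ofPred_eq, rsq] at hθ
  refine abs_le_of_sq_le_sq (a := θ A) (b := 2) ?_ (by norm_num)
  fin_cases A <;> simp <;> nlinarith [sq_nonneg (θ 0), sq_nonneg (θ 1)]

/-- A fixed smooth function of the angular coordinates. -/
theorem fixed {F : (Fin 2 → ℝ) → ℝ} (hF : ContDiff ℝ ∞ F) : Ctl δ j 1 (fun _ _ θ => F θ) := by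
  refine ⟨fun _ _ _ => hF, ?_⟩
  have base : ∀ {F : (Fin 2 → ℝ) → ℝ}, ContDiff ℝ ∞ F → Bd δ 0 1 (fun _ _ θ => F θ) := by
    intro F hF
    obtain ⟨C, hC⟩ := isCompact_disc.exists_bound_of_continuousOn hF.continuous.continuousOn
    exact ⟨C, fun c t _ θ hθ => by simpa using hC θ hθ⟩
  induction j generalizing F with
  | zero => exact base hF
  | succ j ih => exact ⟨base hF, fun A => ih (contDiff_pd hF A)⟩

/-- Induction through D(1/f) = −Df · f⁻². Nonvanishing is required at every θ for smoothness; the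
quantitative bound only on the closed disc. -/
theorem inv (hf : Ctl δ j 1 f) (hne : ∀ c, ∀ t ∈ Set.Icc 0 (δ c + 1), ∀ θ, f c t θ ≠ 0) {m : ℝ}
    (hm : 0 < m) (hlow : ∀ c, ∀ t ∈ Set.Icc 0 (δ c + 1), ∀ θ, rsq θ ≤ 4 → m ≤ |f c t θ|) :
    Ctl δ j 1 f⁻¹ := by
  have hs : SmF δ f⁻¹ := fun c t ht => (hf.1 c t ht).inv (hne c t ht)
  refine ⟨hs, ?_⟩
  have base : Bd δ 0 1 f⁻¹ := by
    refine ⟨m⁻¹, fun c t ht θ hθ => ?_⟩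
    simp only [Pi.inv_apply, abs_inv, Pi.one_apply, mul_one]
    exact inv_anti₀ hm (hlow c t ht θ hθ)
  induction j with
  | zero => exact base
  | succ j ih =>
    refine ⟨base, fun A => ?_⟩
    have hj : Ctl δ j 1 f⁻¹ := ⟨hs, ih (hf.of_le (Nat.le_succ j))⟩
    have h := (((hf.D A).mul hj).mul hj).neg
    rw [one_mul, one_mul] at h
    refine h.2.congr fun c t ht θ => ?_
    have h1 := hf.1.smoothAtOn ht
    have h2 := hs.smoothAtOn ht
    have h3 : pd A (fun y => f c t y * f⁻¹ c t y) θ = 0 := by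
      have : (fun y => f c t y * f⁻¹ c t y) = fun _ => 1 :=
        funext fun y => mul_inv_cancel₀ (hne c t ht y)
      rw [this, pd_const]
    rw [pd_mul A h1 h2 (Set.mem_univ θ)] at h3
    have hn := hne c t ht θ
    simp only [Fam.D, Pi.neg_apply, Pi.mul_apply] at h3 ⊢
    have h4 : f c t θ * pd A (f⁻¹ c t) θ = -(pd A (f c t) θ * f⁻¹ c t θ) := by linarith
    have h5 : f⁻¹ c t θ * f c t θ = 1 := inv_mul_cancel₀ hn
    calc -(pd A (f c t) θ * f⁻¹ c t θ * f⁻¹ c t θ)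
        = f⁻¹ c t θ * (f c t θ * pd A (f⁻¹ c t) θ) := by rw [h4]; ring
      _ = pd A (f⁻¹ c t) θ := by rw [← mul_assoc, h5, one_mul]

/-- The composition of a function of two variables with two families. -/
def _root_.NullCone.Fam.comp (F : (Fin 2 → ℝ) → ℝ) (q : Fin 2 → Fam ι) : Fam ι :=
  fun c t θ => F (fun a => q a c t θ)

theorem _root_.NullCone.Fam.smF_comp {F : (Fin 2 → ℝ) → ℝ} (hF : ContDiff ℝ ∞ F)
    {q : Fin 2 → Fam ι} (hq : ∀ a, SmF δ (q a)) : SmF δ (Fam.comp F q) :=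
  fun c t ht => hF.comp (contDiff_pi.2 fun a => hq a c t ht)

theorem _root_.NullCone.Fam.D_comp {F : (Fin 2 → ℝ) → ℝ} (hF : ContDiff ℝ ∞ F)
    {q : Fin 2 → Fam ι} (hq : ∀ a, SmF δ (q a)) (A : Fin 2) :
    Fam.Eq δ (∑ a, Fam.comp (pd a F) q * Fam.D A (q a)) (Fam.D A (Fam.comp F q)) := by
  intro c t ht θ
  have hd : ∀ a, HasFDerivAt (q a c t) (fderiv ℝ (q a c t) θ) θ := fun a =>
    ((hq a c t ht).differentiable (by simp) θ).hasFDerivAt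
  have h2 : HasFDerivAt (fun y a => q a c t y)
      (ContinuousLinearMap.pi fun a => fderiv ℝ (q a c t) θ) θ := hasFDerivAt_pi.2 hd
  have h3 : HasFDerivAt F (fderiv ℝ F (fun a => q a c t θ)) (fun a => q a c t θ) :=
    (hF.differentiable (by simp) _).hasFDerivAt
  have h4 := (h3.comp θ h2).fderiv
  change _ = fderiv ℝ (F ∘ fun y a => q a c t y) θ _
  rw [h4, ContinuousLinearMap.comp_apply]
  have h5 : (ContinuousLinearMap.pi fun a => fderiv ℝ (q a c t) θ) (Pi.single A 1)
      = ∑ a, (fderiv ℝ (q a c t) θ (Pi.single A 1)) • (Pi.single a (1 : ℝ) : Fin 2 → ℝ) := by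
    ext b
    fin_cases b <;> simp
  rw [h5, map_sum]
  simp only [Finset.sum_apply, Pi.mul_apply, map_smul, smul_eq_mul, Fam.comp, Fam.D, pd]
  exact Finset.sum_congr rfl fun a _ => mul_comm _ _

/-- Families bounded by the scale 1 take values in one fixed ball, on which the continuous function
F is bounded. -/
theorem exists_bound_comp {F : (Fin 2 → ℝ) → ℝ} (hF : Continuous F) {q : Fin 2 → Fam ι}
    (hq : ∀ a, Bd δ 0 1 (q a)) : ∃ R, ∃ C, 0 ≤ R ∧ (∀ v, ‖v‖ ≤ R → |F v| ≤ C) ∧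
      ∀ c, ∀ t ∈ Set.Icc 0 (δ c + 1), ∀ θ, rsq θ ≤ 4 → ‖fun a => q a c t θ‖ ≤ R := by
  choose C hC using hq
  obtain ⟨K, hK⟩ := (isCompact_closedBall (0 : Fin 2 → ℝ)
    (|C 0| + |C 1|)).exists_bound_of_continuousOn hF.continuousOn
  have hR : 0 ≤ |C 0| + |C 1| := by positivity
  refine ⟨|C 0| + |C 1|, K, hR, fun v hv => hK v (by simpa using hv), fun c t ht θ hθ => ?_⟩
  rw [pi_norm_le_iff_of_nonneg hR]
  intro a
  have := hC a c t ht θ hθ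
  simp only [Pi.one_apply, mul_one] at this
  have h0 := le_abs_self (C 0)
  have h1 := le_abs_self (C 1)
  have h2 := abs_nonneg (C 0)
  have h3 := abs_nonneg (C 1)
  rw [Real.norm_eq_abs]
  fin_cases a <;> simp at this ⊢ <;> linarith

theorem comp {F : (Fin 2 → ℝ) → ℝ} (hF : ContDiff ℝ ∞ F) {q : Fin 2 → Fam ι}
    (hq : ∀ a, Ctl δ j 1 (q a)) : Ctl δ j 1 (Fam.comp F q) := by
  refine ⟨Fam.smF_comp hF fun a => (hq a).1, ?_⟩
  have base : ∀ {F : (Fin 2 → ℝ) → ℝ}, ContDiff ℝ ∞ F → Bd δ 0 1 (Fam.comp F q) := by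
    intro F hF
    obtain ⟨R, C, -, h1, h2⟩ := exists_bound_comp hF.continuous fun a => (hq a).2.zero
    exact ⟨C, fun c t ht θ hθ => by simpa [Fam.comp] using h1 _ (h2 c t ht θ hθ)⟩
  induction j generalizing F with
  | zero => exact base hF
  | succ j ih =>
    refine ⟨base hF, fun A => ?_⟩
    have hq' : ∀ a, Ctl δ j 1 (q a) := fun a => (hq a).of_le (Nat.le_succ j)
    have : Ctl δ j 1 (∑ a, Fam.comp (pd a F) q * Fam.D A (q a)) := by
      refine sum fun a _ => ?_
      have h : Ctl δ j 1 (Fam.comp (pd a F) q) :=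
        ⟨Fam.smF_comp (contDiff_pd hF a) fun a => (hq a).1,
          ih (contDiff_pd hF a) hq'⟩
      have h2 := h.mul ((hq a).D A)
      rwa [one_mul] at h2
    exact this.2.congr (Fam.D_comp hF (fun a => (hq a).1) A)

/-- The mean value inequality makes the value small; the derivatives are small because every term of
the chain rule contains a factor D q. -/
theorem comp_sub {F : (Fin 2 → ℝ) → ℝ} (hF : ContDiff ℝ ∞ F) {q : Fin 2 → Fam ι}
    (hs : ∀ c, ∀ t ∈ Set.Icc 0 (δ c + 1), 0 ≤ s c t ∧ s c t ≤ 1)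
    (hq : ∀ a, Ctl δ j s (q a)) : Ctl δ j s (Fam.comp F q - fun _ _ _ => F 0) := by
  have hq1 : ∀ a, Ctl δ j 1 (q a) := fun a => (hq a).mono 1 (by simpa using hs)
  refine ⟨fun c t ht => (Fam.smF_comp hF (fun a => (hq a).1) c t ht).sub contDiff_const, ?_⟩
  have base : Bd δ 0 s (Fam.comp F q - fun _ _ _ => F 0) := by
    have hF' : Continuous (fun v => ‖fderiv ℝ F v‖) :=
      (hF.continuous_fderiv (by simp)).norm
    obtain ⟨R, C, hR, h1, h2⟩ := exists_bound_comp hF' fun a => (hq1 a).2.zero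
    choose K hK using fun a => (hq a).2.zero
    have hC : 0 ≤ C := (abs_nonneg _).trans (h1 0 (by simpa using hR))
    refine ⟨C * (|K 0| + |K 1|), fun c t ht θ hθ => ?_⟩
    have h3 := (convex_closedBall (0 : Fin 2 → ℝ) R).norm_image_sub_le_of_norm_fderiv_le
      (f := F) (𝕜 := ℝ) (C := C) (x := 0) (y := fun a => q a c t θ)
      (fun x _ => hF.differentiable (by simp) x)
      (fun x hx => by simpa using h1 x (by simpa using hx))
      (by simpa using hR) (by simpa using h2 c t ht θ hθ)
    have h4 : ‖(fun a => q a c t θ) - 0‖ ≤ (|K 0| + |K 1|) * s c t := by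
      have h0 := (hs c t ht).1
      have n0 := mul_nonneg (abs_nonneg (K 0)) h0
      have n1 := mul_nonneg (abs_nonneg (K 1)) h0
      rw [sub_zero, pi_norm_le_iff_of_nonneg (by positivity)]
      intro a
      have := (hK a c t ht θ hθ).trans (mul_le_mul_of_nonneg_right (le_abs_self (K a)) h0)
      rw [Real.norm_eq_abs]
      fin_cases a <;> simp at this ⊢ <;> linarith
    calc |F (fun a => q a c t θ) - F 0| ≤ C * ‖(fun a => q a c t θ) - 0‖ := h3
      _ ≤ C * ((|K 0| + |K 1|) * s c t) := mul_le_mul_of_nonneg_left h4 hC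
      _ = C * (|K 0| + |K 1|) * s c t := by ring
  cases j with
  | zero => exact base
  | succ j =>
    refine ⟨base, fun A => ?_⟩
    have : Ctl δ j s (∑ a, Fam.comp (pd a F) q * Fam.D A (q a)) := by
      refine sum fun a _ => ?_
      have h2 := (comp (contDiff_pd hF a) fun a => (hq1 a).of_le (Nat.le_succ j)).mul ((hq a).D A)
      rwa [one_mul] at h2
    refine this.2.congr fun c t ht θ => ?_
    rw [Fam.D_comp hF (fun a => (hq a).1) A c t ht θ]
    have h1 := (Fam.smF_comp hF (fun a => (hq a).1)).smoothAtOn ht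
    have h2 := pd_sub A h1 (SmoothAtOn.const (F 0)) (Set.mem_univ θ)
    rw [pd_const, sub_zero] at h2
    exact h2.symm

end Ctl

end

section

variable {ι : Type*} {δ : ι → ℝ}

/-! ### Linear transport equations -/

/-- Joint smoothness in time and angle. -/
def JS (δ : ι → ℝ) (y : Fam ι) : Prop := ∀ c, ∀ t ∈ Set.Icc 0 (δ c + 1), ∀ θ,
  ContDiffAt ℝ ∞ (fun p : ℝ × (Fin 2 → ℝ) => y c p.1 p.2) (t, θ)

/-- The time derivative of a family. -/
def Fam.dt (y : Fam ι) : Fam ι := fun c t θ => deriv (fun s => y c s θ) t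

namespace JS

variable {y z : Fam ι}

theorem add (hy : JS δ y) (hz : JS δ z) : JS δ (y + z) :=
  fun c t ht θ => (hy c t ht θ).add (hz c t ht θ)

theorem sub (hy : JS δ y) (hz : JS δ z) : JS δ (y - z) :=
  fun c t ht θ => (hy c t ht θ).sub (hz c t ht θ)

theorem mul (hy : JS δ y) (hz : JS δ z) : JS δ (y * z) :=
  fun c t ht θ => (hy c t ht θ).mul (hz c t ht θ)

theorem smF (hy : JS δ y) : SmF δ y := fun c t ht => contDiff_iff_contDiffAt.2 fun θ =>
  ContDiffAt.comp (f := fun q => (t, q)) θ (hy c t ht θ) (contDiffAt_const.prodMk contDiffAt_id)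

theorem hasDerivAt (hy : JS δ y) {c : ι} {t : ℝ} (ht : t ∈ Set.Icc 0 (δ c + 1)) (θ : Fin 2 → ℝ) :
    HasDerivAt (fun s => y c s θ) (Fam.dt y c t θ) t := by
  have h : ContDiffAt ℝ ∞ (fun s => y c s θ) t :=
    ContDiffAt.comp (f := fun s => (s, θ)) t (hy c t ht θ) (contDiffAt_id.prodMk contDiffAt_const)
  exact (h.differentiableAt (by simp)).hasDerivAt

theorem eventually_diff (hy : JS δ y) {c : ι} {t : ℝ} (ht : t ∈ Set.Icc 0 (δ c + 1))
    (θ : Fin 2 → ℝ) : ∀ᶠ p in nhds (t, θ),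
      DifferentiableAt ℝ (fun p : ℝ × (Fin 2 → ℝ) => y c p.1 p.2) p := by
  have := ((hy c t ht θ).of_le (m := 1) (by simp)).eventually (by simp)
  exact this.mono fun p hp => hp.differentiableAt (by simp)

theorem D_eq (hy : JS δ y) (A : Fin 2) {c : ι} {t : ℝ} (ht : t ∈ Set.Icc 0 (δ c + 1))
    (θ : Fin 2 → ℝ) : (fun p : ℝ × (Fin 2 → ℝ) => Fam.D A y c p.1 p.2) =ᶠ[nhds (t, θ)]
      fun p => fderiv ℝ (fun p : ℝ × (Fin 2 → ℝ) => y c p.1 p.2) p (0, Pi.single A 1) := by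
  filter_upwards [hy.eventually_diff ht θ] with p hp
  have h1 : HasFDerivAt (fun q : Fin 2 → ℝ => (p.1, q))
      ((0 : (Fin 2 → ℝ) →L[ℝ] ℝ).prod (ContinuousLinearMap.id ℝ _)) p.2 :=
    (hasFDerivAt_const p.1 p.2).prodMk (hasFDerivAt_id p.2)
  have h2 := (HasFDerivAt.comp p.2 (f := fun q : Fin 2 → ℝ => (p.1, q)) hp.hasFDerivAt h1).fderiv
  change fderiv ℝ ((fun p : ℝ × (Fin 2 → ℝ) => y c p.1 p.2) ∘ fun q => (p.1, q)) p.2 _ = _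
  rw [h2]
  simp

theorem dt_eq (hy : JS δ y) {c : ι} {t : ℝ} (ht : t ∈ Set.Icc 0 (δ c + 1))
    (θ : Fin 2 → ℝ) : (fun p : ℝ × (Fin 2 → ℝ) => Fam.dt y c p.1 p.2) =ᶠ[nhds (t, θ)]
      fun p => fderiv ℝ (fun p : ℝ × (Fin 2 → ℝ) => y c p.1 p.2) p (1, 0) := by
  filter_upwards [hy.eventually_diff ht θ] with p hp
  have h1 : HasDerivAt (fun s : ℝ => (s, p.2)) ((1 : ℝ), (0 : Fin 2 → ℝ)) p.1 :=
    (hasDerivAt_id p.1).prodMk (hasDerivAt_const p.1 p.2)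
  have h2 := HasFDerivAt.comp_hasDerivAt p.1 (f := fun s : ℝ => (s, p.2)) hp.hasFDerivAt h1
  exact h2.deriv

theorem D (hy : JS δ y) (A : Fin 2) : JS δ (Fam.D A y) := by
  intro c t ht θ
  have h := ((hy c t ht θ).fderiv_right (m := ∞) (by simp)).clm_apply
    (contDiffAt_const (c := ((0 : ℝ), (Pi.single A 1 : Fin 2 → ℝ))))
  exact h.congr_of_eventuallyEq (hy.D_eq A ht θ)

theorem dt (hy : JS δ y) : JS δ (Fam.dt y) := by
  intro c t ht θ
  have h := ((hy c t ht θ).fderiv_right (m := ∞) (by simp)).clm_apply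
    (contDiffAt_const (c := ((1 : ℝ), (0 : Fin 2 → ℝ))))
  exact h.congr_of_eventuallyEq (hy.dt_eq ht θ)

/-- Symmetry of the second derivative of the jointly smooth function. It is what allows transport
equations to be differentiated in the angles. -/
theorem dt_D (hy : JS δ y) (A : Fin 2) : Fam.Eq δ (Fam.dt (Fam.D A y)) (Fam.D A (Fam.dt y)) := by
  intro c t ht θ
  have h := hy c t ht θ
  have hd : DifferentiableAt ℝ (fderiv ℝ (fun p : ℝ × (Fin 2 → ℝ) => y c p.1 p.2)) (t, θ) :=
    (h.fderiv_right (m := ∞) (by simp)).differentiableAt (by simp)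
  have key : ∀ v w, fderiv ℝ (fun p => fderiv ℝ (fun p : ℝ × (Fin 2 → ℝ) => y c p.1 p.2) p v) (t, θ) w
      = fderiv ℝ (fderiv ℝ (fun p : ℝ × (Fin 2 → ℝ) => y c p.1 p.2)) (t, θ) w v := by
    intro v w
    rw [fderiv_clm_apply hd (differentiableAt_const v)]
    simp
  rw [((hy.D A).dt_eq ht θ).eq_of_nhds, (hy.dt.D_eq A ht θ).eq_of_nhds]
  rw [(hy.D_eq A ht θ).fderiv_eq, (hy.dt_eq ht θ).fderiv_eq, key, key]
  exact (h.isSymmSndFDerivAt (by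
    simp only [minSmoothness_of_isRCLikeNormedField]
    exact WithTop.coe_le_coe.2 le_top)) _ _

end JS

theorem gronwallBound_le {d K e x : ℝ} (hK : 0 < K) (he : 0 ≤ e) :
    gronwallBound d K e x ≤ (d + e / K) * Real.exp (K * x) := by
  rw [gronwallBound_of_K_ne_0 hK.ne']
  have : 0 ≤ e / K := by positivity
  simp only
  linarith

/-- The weight of the short pulse. -/
def μ (δ : ι → ℝ) : ι → ℝ → ℝ := fun c t => if t < δ c then (δ c)⁻¹ else 1

/-- Bound for a system of linear ordinary differential equations with coefficients which are
large on a short time interval. -/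
theorem norm_le_of_pulse_ode {κ : Type*} [Fintype κ] {d K F σ : ℝ} (hd : 0 < d) (hK : 1 ≤ K)
    (hF : 0 ≤ F) (hσ : 0 ≤ σ) {Y Y' : ℝ → κ → ℝ}
    (hY : ∀ t ∈ Set.Icc 0 (d + 1), HasDerivAt Y (Y' t) t)
    (hb : ∀ t ∈ Set.Icc 0 (d + 1), ‖Y' t‖
      ≤ (if t < d then d⁻¹ else 1) * (K * ‖Y t‖ + F * σ)) {C : ℝ} (h0 : ‖Y 0‖ ≤ C * σ) :
    ∀ t ∈ Set.Icc 0 (d + 1), ‖Y t‖ ≤ (((C + F) * Real.exp K + F) * Real.exp K) * σ := by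
  have hKpos : 0 < K := by linarith
  have hC0 : 0 ≤ C * σ := (norm_nonneg _).trans h0
  -- The assumption 1 ≤ K absorbs the division by K in the Gronwall bound.
  have hFK : F * σ / K ≤ F * σ := div_le_self (by positivity) hK
  -- During the pulse the rate is K/d and the time at most d, so the exponential factor exp K does
  -- not depend on d.
  have first : ∀ t ∈ Set.Icc 0 d, ‖Y t‖ ≤ (C + F) * Real.exp K * σ := by
    intro t ht
    have h := norm_le_gronwallBound_of_norm_deriv_right_le (f := Y) (f' := Y') (δ := C * σ)
      (K := K / d) (ε := F * σ / d) (a := 0) (b := d)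
      (fun s hs => (hY s ⟨hs.1, by linarith [hs.2]⟩).continuousAt.continuousWithinAt)
      (fun s hs => (hY s ⟨hs.1, by linarith [hs.2]⟩).hasDerivWithinAt) h0
      (fun s hs => by
        have := hb s ⟨hs.1, by linarith [hs.2]⟩
        rw [if_pos hs.2] at this
        calc ‖Y' s‖ ≤ d⁻¹ * (K * ‖Y s‖ + F * σ) := this
          _ = K / d * ‖Y s‖ + F * σ / d := by ring) t ht
    refine h.trans ((gronwallBound_le (by positivity) (by positivity)).trans ?_)
    have e1 : F * σ / d / (K / d) = F * σ / K := by field_simp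
    have e2 : Real.exp (K / d * (t - 0)) ≤ Real.exp K := by
      refine Real.exp_le_exp.2 ?_
      rw [sub_zero, div_mul_eq_mul_div, div_le_iff₀ hd]
      exact mul_le_mul_of_nonneg_left ht.2 hKpos.le
    rw [e1]
    calc (C * σ + F * σ / K) * Real.exp (K / d * (t - 0))
        ≤ (C * σ + F * σ) * Real.exp K := mul_le_mul (by linarith) e2 (Real.exp_pos _).le (by positivity)
      _ = (C + F) * Real.exp K * σ := by ring
  have hexp : 1 ≤ Real.exp K := Real.one_le_exp hKpos.le
  have hCF : 0 ≤ (C + F) * Real.exp K * σ := (norm_nonneg _).trans (first 0 ⟨le_rfl, hd.le⟩)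
  have hFs : 0 ≤ F * σ := by positivity
  intro t ht
  rcases le_total t d with h | h
  · refine (first t ⟨ht.1, h⟩).trans ?_
    have : (C + F) * Real.exp K * σ + F * σ
      ≤ ((C + F) * Real.exp K * σ + F * σ) * Real.exp K := le_mul_of_one_le_right (by linarith) hexp
    nlinarith
  -- After the pulse the rate is K and the time at most 1, which costs a second factor exp K.
  · have hg := norm_le_gronwallBound_of_norm_deriv_right_le (f := Y) (f' := Y')
      (δ := (C + F) * Real.exp K * σ) (K := K) (ε := F * σ) (a := d) (b := d + 1)
      (fun s hs => (hY s ⟨by linarith [hs.1], hs.2⟩).continuousAt.continuousWithinAt)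
      (fun s hs => (hY s ⟨by linarith [hs.1], hs.2.le⟩).hasDerivWithinAt)
      (first d ⟨hd.le, le_rfl⟩)
      (fun s hs => by
        have := hb s ⟨by linarith [hs.1], hs.2.le⟩
        rwa [if_neg (not_lt.2 hs.1), one_mul] at this) t ⟨h, ht.2⟩
    refine hg.trans ((gronwallBound_le hKpos (by positivity)).trans ?_)
    have e2 : Real.exp (K * (t - d)) ≤ Real.exp K := by
      refine Real.exp_le_exp.2 ?_
      have := ht.2
      nlinarith
    calc ((C + F) * Real.exp K * σ + F * σ / K) * Real.exp (K * (t - d))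
        ≤ ((C + F) * Real.exp K * σ + F * σ) * Real.exp K :=
          mul_le_mul (by linarith) e2 (Real.exp_pos _).le (by linarith)
      _ = (((C + F) * Real.exp K + F) * Real.exp K) * σ := by ring

/-- Solutions of linear transport equations inherit the bounds of the initial values and of the
inhomogeneity. -/
theorem Ctl.ode {κ : Type*} [Fintype κ] (hδ : ∀ c, 0 < δ c) {σ : ι → ℝ} (hσ : ∀ c, 0 ≤ σ c)
    {y f : κ → Fam ι} {M : κ → κ → Fam ι} (hy : ∀ a, JS δ (y a))
    (heq : ∀ a, Fam.Eq δ (Fam.dt (y a)) (∑ b, M a b * y b + f a)) {j : ℕ}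
    (hM : ∀ a b, Ctl δ j (μ δ) (M a b))
    (hf : ∀ a, Ctl δ j (fun c t => μ δ c t * σ c) (f a))
    (h0 : ∀ a, Ctl δ j (fun c _ => σ c) (fun c _ θ => y a c 0 θ)) (a : κ) :
    Ctl δ j (fun c _ => σ c) (y a) := by
  refine ⟨(hy a).smF, ?_⟩
  have hμ : ∀ c t, 0 ≤ μ δ c t := by
    intro c t
    unfold μ
    have := hδ c
    split_ifs <;> positivity
  -- The order-zero bound is proved for arbitrary solutions and sources with this matrix, since it
  -- is reused for the differentiated systems.
  have base : ∀ {y f : κ → Fam ι}, (∀ a, JS δ (y a)) →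
      (∀ a, Fam.Eq δ (Fam.dt (y a)) (∑ b, M a b * y b + f a)) →
      (∀ a, Ctl δ 0 (fun c t => μ δ c t * σ c) (f a)) →
      (∀ a, Ctl δ 0 (fun c _ => σ c) (fun c _ θ => y a c 0 θ)) → ∀ a,
      Bd0 δ (fun c _ => σ c) (y a) := by
    intro y f hy heq hf h0 a
    choose KM hKM using fun a b => (hM a b).2.zero
    choose KF hKF using fun a => (hf a).2
    choose K0 hK0 using fun a => (h0 a).2
    refine ⟨((∑ a, |K0 a| + ∑ a, |KF a|) * Real.exp (1 + ∑ a, ∑ b, |KM a b|) + ∑ a, |KF a|)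
      * Real.exp (1 + ∑ a, ∑ b, |KM a b|), fun c t ht θ hθ => ?_⟩
    have hsum : ∀ (u : κ → ℝ) a, |u a| ≤ ∑ a, |u a| := fun u a =>
      Finset.single_le_sum (f := fun a => |u a|) (fun _ _ => abs_nonneg _) (Finset.mem_univ a)
    have hS : 0 ≤ ∑ a, ∑ b, |KM a b| :=
      Finset.sum_nonneg fun _ _ => Finset.sum_nonneg fun _ _ => abs_nonneg _
    have hF0 : 0 ≤ ∑ a, |KF a| := Finset.sum_nonneg fun _ _ => abs_nonneg _
    have main := norm_le_of_pulse_ode (d := δ c) (K := 1 + ∑ a, ∑ b, |KM a b|) (F := ∑ a, |KF a|)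
      (σ := σ c) (hδ c) (by linarith) hF0 (hσ c) (Y := fun t a => y a c t θ)
      (Y' := fun t a => Fam.dt (y a) c t θ)
      (fun t ht => hasDerivAt_pi.2 fun a => (hy a).hasDerivAt ht θ)
      (C := ∑ a, |K0 a|) ?_ ?_ t ht
    · refine le_trans ?_ main
      exact norm_le_pi_norm (fun a => y a c t θ) a
    · intro t ht
      have hm := hμ c t
      have hmu : (if t < δ c then (δ c)⁻¹ else 1) = μ δ c t := rfl
      rw [hmu]
      have hrhs : 0 ≤ μ δ c t * ((1 + ∑ a, ∑ b, |KM a b|) * ‖fun a => y a c t θ‖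
          + (∑ a, |KF a|) * σ c) := by
        have := hσ c
        positivity
      rw [pi_norm_le_iff_of_nonneg hrhs]
      intro a
      rw [heq a c t ht θ, Real.norm_eq_abs]
      simp only [Pi.add_apply, Finset.sum_apply, Pi.mul_apply]
      have h1 : |∑ b, M a b c t θ * y b c t θ| ≤ μ δ c t * ((∑ a, ∑ b, |KM a b|)
          * ‖fun a => y a c t θ‖) := by
        calc |∑ b, M a b c t θ * y b c t θ| ≤ ∑ b, |M a b c t θ * y b c t θ| :=
              Finset.abs_sum_le_sum_abs _ _
          _ ≤ ∑ b, (|KM a b| * μ δ c t) * ‖fun a => y a c t θ‖ := by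
              refine Finset.sum_le_sum fun b _ => ?_
              rw [abs_mul]
              refine mul_le_mul ?_ (norm_le_pi_norm (fun a => y a c t θ) b) (abs_nonneg _)
                (by positivity)
              exact (hKM a b c t ht θ hθ).trans (mul_le_mul_of_nonneg_right (le_abs_self _) hm)
          _ = μ δ c t * ((∑ b, |KM a b|) * ‖fun a => y a c t θ‖) := by
              rw [← Finset.sum_mul, ← Finset.sum_mul]
              ring
          _ ≤ _ := by
              refine mul_le_mul_of_nonneg_left (mul_le_mul_of_nonneg_right ?_ (norm_nonneg _)) hm
              exact Finset.single_le_sum (f := fun a => ∑ b, |KM a b|)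
                (fun _ _ => Finset.sum_nonneg fun _ _ => abs_nonneg _) (Finset.mem_univ a)
      have h2 : |f a c t θ| ≤ μ δ c t * ((∑ a, |KF a|) * σ c) := by
        have hms : 0 ≤ μ δ c t * σ c := mul_nonneg hm (hσ c)
        calc |f a c t θ| ≤ KF a * (μ δ c t * σ c) := hKF a c t ht θ hθ
          _ ≤ (∑ a, |KF a|) * (μ δ c t * σ c) :=
              mul_le_mul_of_nonneg_right ((le_abs_self _).trans (hsum KF a)) hms
          _ = _ := by ring
      have h3 : 0 ≤ μ δ c t * ‖fun a => y a c t θ‖ := mul_nonneg hm (norm_nonneg _)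
      calc _ ≤ |∑ b, M a b c t θ * y b c t θ| + |f a c t θ| := abs_add_le _ _
        _ ≤ _ := by nlinarith
    · have h4 : 0 ≤ (∑ a, |K0 a|) * σ c :=
        mul_nonneg (Finset.sum_nonneg fun _ _ => abs_nonneg _) (hσ c)
      rw [pi_norm_le_iff_of_nonneg h4]
      intro a
      have hm0 : (0 : ℝ) ∈ Set.Icc 0 (δ c + 1) := ⟨le_rfl, by linarith [hδ c]⟩
      calc ‖y a c 0 θ‖ ≤ K0 a * σ c := hK0 a c 0 hm0 θ hθ
        _ ≤ (∑ a, |K0 a|) * σ c :=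
          mul_le_mul_of_nonneg_right ((le_abs_self _).trans (hsum K0 a)) (hσ c)
  induction j generalizing y f a with
  | zero => exact base hy heq hf h0 a
  | succ j ih =>
    have hle := Nat.le_succ j
    have hMj : ∀ a b, Ctl δ j (μ δ) (M a b) := fun a b => (hM a b).of_le hle
    have hyj : ∀ a, Ctl δ j (fun c _ => σ c) (y a) := fun a => ⟨(hy a).smF,
      ih hy heq hMj (fun a => (hf a).of_le hle) (fun a => (h0 a).of_le hle) a⟩
    refine ⟨base hy heq (fun a => (hf a).of_le (Nat.zero_le _))
      (fun a => (h0 a).of_le (Nat.zero_le _)) a, fun A => ?_⟩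
    -- The derivative solves a system with the same matrix. Its source ∑ D_A M · y + D_A f is
    -- admissible because `y` is already controlled to order j.
    refine ih (y := fun a => Fam.D A (y a))
      (f := fun a => ∑ b, Fam.D A (M a b) * y b + Fam.D A (f a)) (fun a => (hy a).D A) ?_ hMj ?_ ?_ a
    · intro a c t ht θ
      rw [(hy a).dt_D A c t ht θ]
      have e1 : Fam.Eq δ (Fam.D A (Fam.dt (y a))) (Fam.D A (∑ b, M a b * y b + f a)) := (heq a).D A
      rw [e1 c t ht θ]
      have s1 : ∀ b, SmoothAtOn Set.univ (fun y' => M a b c t y' * y b c t y') := fun b =>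
        ((hM a b).1.smoothAtOn ht).mul ((hy b).smF.smoothAtOn ht)
      have e2 : (∑ b, M a b * y b + f a) c t
          = fun y' => (∑ b, M a b c t y' * y b c t y') + f a c t y' := by
        funext y'
        simp
      simp only [Fam.D]
      rw [e2, pd_add A (SmoothAtOn.sum fun b _ => s1 b) ((hf a).1.smoothAtOn ht) (Set.mem_univ θ),
        pd_sum A _ (fun b _ => s1 b) (Set.mem_univ θ)]
      simp only [Pi.add_apply, Finset.sum_apply, Pi.mul_apply]
      rw [← add_assoc, ← Finset.sum_add_distrib]
      congr 1
      refine Finset.sum_congr rfl fun b _ => ?_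
      rw [pd_mul A ((hM a b).1.smoothAtOn ht) ((hy b).smF.smoothAtOn ht) (Set.mem_univ θ)]
      simp only [Fam.D]
      ring
    · intro a
      exact (Ctl.sum fun b _ => ((hM a b).D A).mul (hyj b)).add ((hf a).D A)
    · intro a
      exact (h0 a).D A

end

section

variable {ι : Type*} {δ : ι → ℝ}

/-! ### Approximation of families -/

/-- The scale `δ^{1/2}`. -/
def ε (δ : ι → ℝ) : ι → ℝ := fun c => Real.sqrt (δ c)

/-- The weight `1/δ` during the pulse and `0` afterwards. -/
def lam (δ : ι → ℝ) : ι → ℝ → ℝ := fun c t => if t < δ c then (δ c)⁻¹ else 0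

/-- The two error scales: `δ^{1/2}` (`false`), and `δ^{1/2}` weighted by the pulse (`true`). -/
def errScale (δ : ι → ℝ) : Bool → ι → ℝ → ℝ
  | false => fun c _ => ε δ c
  | true => fun c t => μ δ c t * ε δ c

/-- The standing assumption on the length of the pulse. -/
def Short (δ : ι → ℝ) : Prop := ∀ c, 0 < δ c ∧ δ c < 1

namespace Short

variable (hδ : Short δ)
include hδ

theorem ε_pos (c : ι) : 0 < ε δ c := Real.sqrt_pos.2 (hδ c).1

theorem ε_le_one (c : ι) : ε δ c ≤ 1 := Real.sqrt_le_one.2 (hδ c).2.le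

theorem ε_sq (c : ι) : ε δ c * ε δ c = δ c := Real.mul_self_sqrt (hδ c).1.le

theorem one_le_μ (c : ι) (t : ℝ) : 1 ≤ μ δ c t := by
  unfold μ
  split_ifs
  · exact (one_le_inv₀ (hδ c).1).2 (hδ c).2.le
  · exact le_rfl

theorem lam_nonneg (c : ι) (t : ℝ) : 0 ≤ lam δ c t := by
  unfold lam
  have := (hδ c).1
  split_ifs <;> positivity

omit hδ in
theorem lam_le_μ (c : ι) (t : ℝ) : lam δ c t ≤ μ δ c t := by
  unfold lam μ
  split_ifs
  · exact le_rfl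
  · norm_num

theorem errScale_pos (b : Bool) (c : ι) (t : ℝ) : 0 < errScale δ b c t := by
  have h1 := hδ.ε_pos c
  have h2 := hδ.one_le_μ c t
  cases b
  · exact h1
  · exact mul_pos (by linarith) h1

theorem errScale_le (b : Bool) (c : ι) (t : ℝ) : errScale δ b c t ≤ μ δ c t * ε δ c := by
  cases b
  · exact le_mul_of_one_le_left (hδ.ε_pos c).le (hδ.one_le_μ c t)
  · exact le_rfl

theorem ε_le_errScale (b : Bool) (c : ι) (t : ℝ) : ε δ c ≤ errScale δ b c t := by
  cases b
  · exact le_rfl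
  · exact le_mul_of_one_le_left (hδ.ε_pos c).le (hδ.one_le_μ c t)

theorem errScale_le_μ (b : Bool) (c : ι) (t : ℝ) : errScale δ b c t ≤ μ δ c t := by
  refine (hδ.errScale_le b c t).trans (mul_le_of_le_one_right ?_ (hδ.ε_le_one c))
  linarith [hδ.one_le_μ c t]

/-- During the pulse `1` is bounded by the weighted error scale. -/
theorem one_le_μ_mul_ε {c : ι} {t : ℝ} (h : t < δ c) : 1 ≤ μ δ c t * ε δ c := by
  have h1 := hδ.ε_pos c
  have h2 := hδ.ε_sq c
  have h3 := hδ.ε_le_one c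
  rw [μ, if_pos h, ← h2]
  have : (ε δ c * ε δ c)⁻¹ * ε δ c = (ε δ c)⁻¹ := by field_simp
  rw [this]
  exact (one_le_inv₀ h1).2 h3

end Short

/-- `f` is approximated by the bounded family `f₀`. -/
structure Ap (δ : ι → ℝ) (j : ℕ) (b : Bool) (f f₀ : Fam ι) : Prop where
  ref : Ctl δ j 1 f₀
  err : Ctl δ j (errScale δ b) (f - f₀)

namespace Ap

variable {j l : ℕ} {b : Bool} {f f₀ g g₀ : Fam ι}

theorem ctl_μ (hδ : Short δ) (h : Ap δ j b f f₀) : Ctl δ j (μ δ) f := by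
  have h1 : Ctl δ j (μ δ) f₀ := h.1.mono 1 fun c t _ => ⟨by simp, by simpa using hδ.one_le_μ c t⟩
  have h2 : Ctl δ j (μ δ) (f - f₀) := h.2.mono 1 fun c t _ =>
    ⟨(hδ.errScale_pos b c t).le, by simpa using hδ.errScale_le_μ b c t⟩
  exact (h1.add h2).congr fun c t _ θ => by simp

theorem ctl (hδ : Short δ) (h : Ap δ j false f f₀) : Ctl δ j 1 f := by
  have h2 : Ctl δ j 1 (f - f₀) := h.2.mono 1 fun c t _ =>
    ⟨(hδ.errScale_pos _ c t).le, by simpa [errScale] using hδ.ε_le_one c⟩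
  exact (h.1.add h2).congr fun c t _ θ => by simp

theorem weaken (hδ : Short δ) (h : Ap δ j false f f₀) (b : Bool) : Ap δ j b f f₀ :=
  ⟨h.1, h.2.mono 1 fun c t _ => ⟨(hδ.errScale_pos _ c t).le, by
    simpa [errScale] using hδ.ε_le_errScale b c t⟩⟩

theorem congr (h : Ap δ j b f f₀) (e : Fam.Eq δ f g) (e₀ : Fam.Eq δ f₀ g₀) : Ap δ j b g g₀ :=
  ⟨h.1.congr e₀, h.2.congr fun c t ht θ => by
    simp only [Pi.sub_apply, e c t ht θ, e₀ c t ht θ]⟩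

theorem add (h : Ap δ j b f f₀) (h' : Ap δ j b g g₀) : Ap δ j b (f + g) (f₀ + g₀) :=
  ⟨h.1.add h'.1, (h.2.add h'.2).congr fun c t _ θ => by simp; ring⟩

theorem neg (h : Ap δ j b f f₀) : Ap δ j b (-f) (-f₀) :=
  ⟨h.1.neg, h.2.neg.congr fun c t _ θ => by simp; ring⟩

theorem sub (h : Ap δ j b f f₀) (h' : Ap δ j b g g₀) : Ap δ j b (f - g) (f₀ - g₀) := by
  rw [sub_eq_add_neg, sub_eq_add_neg]
  exact h.add h'.neg

theorem smul (a : ℝ) (h : Ap δ j b f f₀) : Ap δ j b (a • f) (a • f₀) :=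
  ⟨h.1.const_mul a, (h.2.const_mul a).congr fun c t _ θ => by simp; ring⟩

/-- Only the first factor may carry the weighted error. During the pulse a product of two weighted
errors would have size (μ ε)² = 1/δ, which exceeds the allowed μ ε = δ^{-1/2}. -/
theorem mul (hδ : Short δ) (h : Ap δ j b f f₀) (h' : Ap δ j false g g₀) :
    Ap δ j b (f * g) (f₀ * g₀) := by
  refine ⟨by simpa using h.1.mul h'.1, ?_⟩
  have h1 : Ctl δ j (errScale δ b) ((f - f₀) * g) := by
    have := h.2.mul (h'.ctl hδ)
    rwa [mul_one] at this
  have h2 : Ctl δ j (errScale δ b) (f₀ * (g - g₀)) := by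
    have := h.1.mul (h'.weaken hδ b).2
    rwa [one_mul] at this
  exact (h1.add h2).congr fun c t _ θ => by simp; ring

theorem sum {κ : Type*} {s : Finset κ} {f f₀ : κ → Fam ι} (h : ∀ a ∈ s, Ap δ j b (f a) (f₀ a)) :
    Ap δ j b (∑ a ∈ s, f a) (∑ a ∈ s, f₀ a) := by
  refine ⟨Ctl.sum fun a ha => (h a ha).1, ?_⟩
  rw [← Finset.sum_sub_distrib]
  exact Ctl.sum fun a ha => (h a ha).2

theorem D (h : Ap δ (j + 1) b f f₀) (A : Fin 2) :
    Ap δ j b (Fam.D A f) (Fam.D A f₀) := by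
  refine ⟨h.1.D A, (h.2.D A).congr fun c t ht θ => ?_⟩
  have s2 := h.1.1.smoothAtOn ht
  have s1 := (h.2.1.add h.1.1).smoothAtOn ht
  have e : f - f₀ + f₀ = f := sub_add_cancel f f₀
  rw [e] at s1
  exact pd_sub A s1 s2 (Set.mem_univ θ)

theorem exact' (h : Ctl δ j 1 f) : Ap δ j b f f :=
  ⟨h, (Ctl.zero (δ := δ) (j := j) (s := errScale δ b)).congr fun c t _ θ => by simp⟩

theorem zero_iff : Ap δ j b f 0 ↔ Ctl δ j (errScale δ b) f :=
  ⟨fun h => by simpa using h.2, fun h => ⟨Ctl.zero, by simpa using h⟩⟩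

theorem inv (hδ : Short δ) (h : Ap δ j false f f₀)
    (hne : ∀ c, ∀ t ∈ Set.Icc 0 (δ c + 1), ∀ θ, f c t θ ≠ 0)
    (hne₀ : ∀ c, ∀ t ∈ Set.Icc 0 (δ c + 1), ∀ θ, f₀ c t θ ≠ 0) {m : ℝ} (hm : 0 < m)
    (hlow : ∀ c, ∀ t ∈ Set.Icc 0 (δ c + 1), ∀ θ, rsq θ ≤ 4 → m ≤ |f c t θ|)
    (hlow₀ : ∀ c, ∀ t ∈ Set.Icc 0 (δ c + 1), ∀ θ, rsq θ ≤ 4 → m ≤ |f₀ c t θ|) :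
    Ap δ j false f⁻¹ f₀⁻¹ := by
  have h1 : Ctl δ j 1 f⁻¹ := (h.ctl hδ).inv hne hm hlow
  have h2 : Ctl δ j 1 f₀⁻¹ := h.1.inv hne₀ hm hlow₀
  refine ⟨h2, ?_⟩
  have h3 := ((h.2.mul h1).mul h2).neg
  rw [mul_one, mul_one] at h3
  refine h3.congr fun c t ht θ => ?_
  have n1 := hne c t ht θ
  have n2 := hne₀ c t ht θ
  simp only [Pi.neg_apply, Pi.mul_apply, Pi.sub_apply, Pi.inv_apply]
  field_simp
  ring

/-- Linear transport equations preserve approximations. -/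
theorem ode {κ : Type*} [Fintype κ] (hδ : Short δ) {y y₀ f f₀ : κ → Fam ι} {M M₀ : κ → κ → Fam ι}
    (hy : ∀ a, JS δ (y a)) (hy₀ : ∀ a, JS δ (y₀ a))
    (heq : ∀ a, Fam.Eq δ (Fam.dt (y a)) (∑ b, M a b * y b + f a))
    (heq₀ : ∀ a, Fam.Eq δ (Fam.dt (y₀ a)) (∑ b, M₀ a b * y₀ b + f₀ a))
    (hc : ∀ a, Ctl δ j 1 (y₀ a))
    (hM : ∀ a b, Ap δ j true (M a b) (M₀ a b)) (hf : ∀ a, Ap δ j true (f a) (f₀ a))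
    (h0 : ∀ a, Ctl δ j (fun c _ => ε δ c) (fun c _ θ => y a c 0 θ - y₀ a c 0 θ)) (a : κ) :
    Ap δ j false (y a) (y₀ a) := by
  -- The difference solves the system with the true matrix `M`. Its source pairs the error of the
  -- coefficients with the bounded reference solution `y₀`, hence has size μ ε.
  refine ⟨hc a, Ctl.ode (fun c => (hδ c).1) (σ := ε δ) (fun c => (hδ.ε_pos c).le)
    (y := fun a => y a - y₀ a) (M := M)
    (f := fun a => ∑ b, (M a b - M₀ a b) * y₀ b + (f a - f₀ a))
    (fun a => (hy a).sub (hy₀ a)) ?_ (fun a b => (hM a b).ctl_μ hδ) ?_ h0 a⟩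
  · intro a c t ht θ
    have e := ((hy a).hasDerivAt ht θ).sub ((hy₀ a).hasDerivAt ht θ)
    have e2 : Fam.dt (y a - y₀ a) c t θ = Fam.dt (y a) c t θ - Fam.dt (y₀ a) c t θ := e.deriv
    rw [e2, heq a c t ht θ, heq₀ a c t ht θ]
    simp only [Pi.add_apply, Finset.sum_apply, Pi.mul_apply, Pi.sub_apply, mul_sub, sub_mul,
      Finset.sum_sub_distrib]
    ring
  · intro a
    refine Ctl.add (Ctl.sum fun b _ => ?_) (hf a).2
    have := (hM a b).2.mul (hc b)
    rw [mul_one] at this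
    exact this

end Ap

end

section

/-! ### The short pulse -/

theorem norm_iteratedFDeriv_dir_le {E : Type*} [NormedAddCommGroup E] [NormedSpace ℝ E]
    {F : E → ℝ} (hF : ContDiff ℝ ∞ F) (v : E) (j : ℕ) (x : E) :
    ‖iteratedFDeriv ℝ j (fun p => fderiv ℝ F p v) x‖ ≤ ‖v‖ * ‖iteratedFDeriv ℝ (j + 1) F x‖ := by
  have h : ContDiff ℝ ∞ (fderiv ℝ F) := hF.fderiv_right (by simp)
  rw [← norm_iteratedFDeriv_fderiv]
  exact norm_iteratedFDeriv_clm_apply_const (N := ∞) h.contDiffAt (by exact_mod_cast le_top)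

theorem contDiff_dir {E : Type*} [NormedAddCommGroup E] [NormedSpace ℝ E]
    {F : E → ℝ} (hF : ContDiff ℝ ∞ F) (v : E) : ContDiff ℝ ∞ (fun p => fderiv ℝ F p v) :=
  (hF.fderiv_right (m := ∞) (by simp)).clm_apply contDiff_const

variable {ι : Type*} {δ : ι → ℝ}

/-- A rescaled family `a F(t/δ, θ)`. -/
def Fam.scaled (δ a : ι → ℝ) (F : ι → ℝ × (Fin 2 → ℝ) → ℝ) : Fam ι :=
  fun c t θ => a c * F c (t / δ c, θ)

theorem Fam.D_scaled (δ a : ι → ℝ) {F : ι → ℝ × (Fin 2 → ℝ) → ℝ}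
    (hF : ∀ c, ContDiff ℝ ∞ (F c)) (A : Fin 2) : Fam.D A (Fam.scaled δ a F)
      = Fam.scaled δ a fun c p => fderiv ℝ (F c) p (0, Pi.single A 1) := by
  funext c t θ
  have h1 : HasFDerivAt (fun q : Fin 2 → ℝ => (t / δ c, q))
      ((0 : (Fin 2 → ℝ) →L[ℝ] ℝ).prod (ContinuousLinearMap.id ℝ _)) θ :=
    (hasFDerivAt_const _ θ).prodMk (hasFDerivAt_id θ)
  have h2 := (HasFDerivAt.comp θ (f := fun q : Fin 2 → ℝ => (t / δ c, q))
    ((hF c).differentiable (by simp) _).hasFDerivAt h1).const_mul (a c)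
  have h3 := h2.fderiv
  change fderiv ℝ (fun q => a c * (F c ∘ fun q => (t / δ c, q)) q) θ _ = _
  rw [h3]
  simp [Fam.scaled]

theorem Fam.dt_scaled (δ a : ι → ℝ) {F : ι → ℝ × (Fin 2 → ℝ) → ℝ}
    (hF : ∀ c, ContDiff ℝ ∞ (F c)) : Fam.dt (Fam.scaled δ a F)
      = Fam.scaled δ (fun c => a c / δ c) fun c p => fderiv ℝ (F c) p (1, 0) := by
  funext c t θ
  have h1 : HasDerivAt (fun s : ℝ => (s / δ c, θ)) ((1 / δ c : ℝ), (0 : Fin 2 → ℝ)) t :=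
    ((hasDerivAt_id t).div_const _).prodMk (hasDerivAt_const t θ)
  have h2 := (HasFDerivAt.comp_hasDerivAt t (f := fun s : ℝ => (s / δ c, θ))
    ((hF c).differentiable (by simp) _).hasFDerivAt h1).const_mul (a c)
  have h3 := h2.deriv
  change deriv (fun s => a c * (F c ∘ fun s => (s / δ c, θ)) s) t = _
  rw [h3]
  have : ((1 / δ c : ℝ), (0 : Fin 2 → ℝ)) = (1 / δ c) • ((1 : ℝ), (0 : Fin 2 → ℝ)) := by simp
  rw [this, map_smul]
  simp only [Fam.scaled, smul_eq_mul]
  ring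

theorem Fam.contDiff_scaled (δ a : ι → ℝ) {F : ι → ℝ × (Fin 2 → ℝ) → ℝ}
    (hF : ∀ c, ContDiff ℝ ∞ (F c)) (c : ι) :
    ContDiff ℝ ∞ (fun p : ℝ × (Fin 2 → ℝ) => Fam.scaled δ a F c p.1 p.2) :=
  contDiff_const.mul ((hF c).comp ((contDiff_fst.div_const _).prodMk contDiff_snd))

/-- Angular derivatives do not see the rescaling of time, so the bounds of the seed pass to the
pulse without powers of 1/δ. -/
theorem Ctl.scaled {a : ι → ℝ} (ha : ∀ c, 0 ≤ a c) {F : ι → ℝ × (Fin 2 → ℝ) → ℝ}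
    (hF : ∀ c, ContDiff ℝ ∞ (F c)) {n : ℕ} {B : ℝ}
    (hB : ∀ c, ∀ j ≤ n, ∀ s θ, rsq θ ≤ 4 → ‖iteratedFDeriv ℝ j (F c) (s, θ)‖ ≤ B) :
    Ctl δ n (fun c _ => a c) (Fam.scaled δ a F) := by
  have hs : ∀ {F : ι → ℝ × (Fin 2 → ℝ) → ℝ}, (∀ c, ContDiff ℝ ∞ (F c)) →
      SmF δ (Fam.scaled δ a F) := fun hF c t _ =>
    (Fam.contDiff_scaled δ a hF c).comp (contDiff_const.prodMk contDiff_id)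
  refine ⟨hs hF, ?_⟩
  have base : ∀ {F : ι → ℝ × (Fin 2 → ℝ) → ℝ},
      (∀ c s θ, rsq θ ≤ 4 → ‖iteratedFDeriv ℝ 0 (F c) (s, θ)‖ ≤ B) →
      Bd0 δ (fun c _ => a c) (Fam.scaled δ a F) := by
    intro F hB
    refine ⟨B, fun c t _ θ hθ => ?_⟩
    have h := hB c (t / δ c) θ hθ
    rw [norm_iteratedFDeriv_zero, Real.norm_eq_abs] at h
    rw [Fam.scaled, abs_mul, abs_of_nonneg (ha c), mul_comm]
    exact mul_le_mul_of_nonneg_right h (ha c)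
  induction n generalizing F with
  | zero => exact base fun c => hB c 0 le_rfl
  | succ n ih =>
    refine ⟨base fun c => hB c 0 (Nat.zero_le _), fun A => ?_⟩
    rw [Fam.D_scaled δ a hF]
    refine ih (fun c => contDiff_dir (hF c) _) fun c j hj s θ hθ => ?_
    refine (norm_iteratedFDeriv_dir_le (hF c) _ j _).trans ?_
    have h1 : ‖((0 : ℝ), (Pi.single A 1 : Fin 2 → ℝ))‖ ≤ 1 := by
      rw [Prod.norm_def, max_le_iff, pi_norm_le_iff_of_nonneg zero_le_one]
      refine ⟨by simp, fun b => ?_⟩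
      change ‖(Pi.single A 1 : Fin 2 → ℝ) b‖ ≤ 1
      rw [Pi.single_apply]
      split_ifs <;> simp
    have h2 := hB c (j + 1) (by omega) s θ hθ
    have h3 := norm_nonneg (iteratedFDeriv ℝ (j + 1) (F c) (s, θ))
    nlinarith

/-- Families which vanish after the pulse. -/
theorem Ctl.cutoff {j : ℕ} {s : ι → ℝ → ℝ} {f : Fam ι} (hf : Ctl δ j s f)
    (h0 : ∀ c t, δ c ≤ t → ∀ θ, f c t θ = 0) :
    Ctl δ j (fun c t => if t < δ c then s c t else 0) f := by
  refine ⟨hf.1, ?_⟩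
  have base : ∀ {f : Fam ι}, Bd0 δ s f → (∀ c t, δ c ≤ t → ∀ θ, f c t θ = 0) →
      Bd0 δ (fun c t => if t < δ c then s c t else 0) f := by
    rintro f ⟨C, hC⟩ h0
    refine ⟨C, fun c t ht θ hθ => ?_⟩
    beta_reduce
    split_ifs with h
    · exact hC c t ht θ hθ
    · simp [h0 c t (not_lt.1 h) θ]
  have hj := hf.2
  have hs := hf.1
  clear hf
  induction j generalizing f with
  | zero => exact base hj h0
  | succ j ih =>
    refine ⟨base hj.1 h0, fun A => ih (fun c t ht θ => ?_) (hj.2 A) (hs.D A)⟩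
    have : f c t = fun _ => 0 := funext (h0 c t ht)
    rw [Fam.D, this, pd_const]

/-- A solution of the characteristic initial value problem together with a stereographic chart. -/
structure Config (u₀ m₀ : ℝ) where
  ψ : SeedData
  δ : ℝ
  u₁ : ℝ
  S : Spacetime (δ + 1) u₀ u₁
  i : Fin 2
  mass : ψ.HasMass m₀
  δ_pos : 0 < δ
  lt : u₀ < u₁
  vacuum : S.IsVacuum
  data : S.HasShortPulseData ψ

namespace Config

variable {u₀ m₀ : ℝ} (Γ : ι → Config u₀ m₀)

/-- The durations of the pulses. -/
def dl : ι → ℝ := fun c => (Γ c).δ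

/-- The two independent components of the pulse. -/
def q (a : Fin 2) : Fam ι := fun c t θ => (Γ c).ψ.pulse (Γ c).δ u₀ (Γ c).i t θ 0 a

theorem q_eq (a : Fin 2) : q Γ a = Fam.scaled (dl Γ) (fun c => ε (dl Γ) c / |u₀|)
    fun c p => (Γ c).ψ.toFun (Γ c).i p.1 p.2 0 a := by
  funext c t θ
  simp [q, SeedData.pulse, Fam.scaled, dl, ε]

theorem contDiff_q (a : Fin 2) (c : ι) :
    ContDiff ℝ ∞ (fun p : ℝ × (Fin 2 → ℝ) => q Γ a c p.1 p.2) := by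
  rw [q_eq]
  exact Fam.contDiff_scaled _ _ (fun c => (Γ c).ψ.smooth _ _ _) c

theorem js_q (a : Fin 2) : JS (dl Γ) (q Γ a) := fun c _ _ _ => (contDiff_q Γ a c).contDiffAt

theorem pulse_apply (c : ι) (t : ℝ) (θ : Fin 2 → ℝ) :
    (Γ c).ψ.pulse (Γ c).δ u₀ (Γ c).i t θ = !![q Γ 0 c t θ, q Γ 1 c t θ; q Γ 1 c t θ, -q Γ 0 c t θ] := by
  have h1 := (Γ c).ψ.symm (Γ c).i (t / (Γ c).δ) θ
  have h2 := (Γ c).ψ.traceFree (Γ c).i (t / (Γ c).δ) θ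
  have h3 := h1.apply 0 1
  rw [Matrix.trace_fin_two] at h2
  ext A B
  fin_cases A <;> fin_cases B <;> simp [q, SeedData.pulse, h3]
  rw [← mul_neg]
  congr 1
  linarith

theorem q_eq_zero (a : Fin 2) (c : ι) {t : ℝ} (ht : dl Γ c ≤ t ∨ t ≤ 0) (θ : Fin 2 → ℝ) :
    q Γ a c t θ = 0 := by
  obtain ⟨x, y, hx, hy, h⟩ := (Γ c).ψ.support
  have hd := (Γ c).δ_pos
  have h2 : t / (Γ c).δ ∉ Set.Icc x y := by
    rintro ⟨k1, k2⟩
    rcases ht with ht | ht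
    · have : 1 ≤ t / (Γ c).δ := (one_le_div hd).2 ht
      linarith
    · have : t / (Γ c).δ ≤ 0 := div_nonpos_of_nonpos_of_nonneg ht hd.le
      linarith
  simp [q, SeedData.pulse, h _ _ θ h2]

theorem dt_q_eq_zero (a : Fin 2) (c : ι) {t : ℝ} (ht : dl Γ c ≤ t ∨ t ≤ 0) (θ : Fin 2 → ℝ) :
    Fam.dt (q Γ a) c t θ = 0 := by
  obtain ⟨x, y, hx, hy, h⟩ := (Γ c).ψ.support
  have hd := (Γ c).δ_pos
  have h2 : t / (Γ c).δ ∉ Set.Icc x y := by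
    rintro ⟨k1, k2⟩
    rcases ht with ht | ht
    · have : 1 ≤ t / (Γ c).δ := (one_le_div hd).2 ht
      linarith
    · have : t / (Γ c).δ ≤ 0 := div_nonpos_of_nonpos_of_nonneg ht hd.le
      linarith
  have h3 : ∀ᶠ s in nhds t, s / (Γ c).δ ∉ Set.Icc x y := by
    have : ContinuousAt (fun s => s / (Γ c).δ) t := by fun_prop
    exact this.eventually (isClosed_Icc.isOpen_compl.mem_nhds h2)
  have h4 : (fun s => q Γ a c s θ) =ᶠ[nhds t] fun _ => 0 := by
    filter_upwards [h3] with s hs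
    simp [q, SeedData.pulse, h _ _ θ hs]
  rw [Fam.dt, h4.deriv_eq]
  simp

variable {Γ} {n : ℕ} {B : ℝ}

theorem ctl_q (hu : u₀ < -2) (hB : ∀ c, (Γ c).ψ.CnBound n B) (a : Fin 2) :
    Ctl (dl Γ) n (fun c _ => ε (dl Γ) c) (q Γ a) := by
  have h0 : 0 < |u₀| := abs_pos.2 (by linarith)
  have h1 : 1 ≤ |u₀| := by rw [abs_of_neg (by linarith)]; linarith
  rw [q_eq]
  refine (Ctl.scaled (fun c => ?_) (fun c => (Γ c).ψ.smooth _ _ _) (B := B)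
    fun c j hj s θ hθ => hB c j hj _ _ _ s θ hθ).mono 1 fun c t _ => ?_
  · exact div_nonneg (Real.sqrt_nonneg _) h0.le
  · exact ⟨div_nonneg (Real.sqrt_nonneg _) h0.le, by
      rw [one_mul]; exact div_le_self (Real.sqrt_nonneg _) h1⟩

/-- The chain rule in time gives 1/δ and uses one derivative of the seed, whence `n + 1`. The
compact support in s confines this to the pulse, so `lam` appears in place of `μ`. -/
theorem ctl_dt_q (hu : u₀ < -2) (hB : ∀ c, (Γ c).ψ.CnBound (n + 1) B) (a : Fin 2) :
    Ctl (dl Γ) n (fun c t => lam (dl Γ) c t * ε (dl Γ) c) (Fam.dt (q Γ a)) := by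
  have h0 : 0 < |u₀| := abs_pos.2 (by linarith)
  have h1 : 1 ≤ |u₀| := by rw [abs_of_neg (by linarith)]; linarith
  have e := Fam.dt_scaled (dl Γ) (fun c => ε (dl Γ) c / |u₀|)
    (F := fun c p => (Γ c).ψ.toFun (Γ c).i p.1 p.2 0 a) (fun c => (Γ c).ψ.smooth _ _ _)
  rw [← q_eq] at e
  have hpos : ∀ c, 0 ≤ ε (dl Γ) c / |u₀| / dl Γ c := fun c =>
    div_nonneg (div_nonneg (Real.sqrt_nonneg _) h0.le) (Γ c).δ_pos.le
  have h := Ctl.scaled (δ := dl Γ) (a := fun c => ε (dl Γ) c / |u₀| / dl Γ c) (n := n) (B := B) hpos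
    (F := fun c p => fderiv ℝ (fun p : ℝ × (Fin 2 → ℝ) => (Γ c).ψ.toFun (Γ c).i p.1 p.2 0 a) p (1, 0))
    (fun c => contDiff_dir ((Γ c).ψ.smooth _ _ _) _) (fun c j hj s θ hθ => by
      refine (norm_iteratedFDeriv_dir_le ((Γ c).ψ.smooth _ _ _) _ j _).trans ?_
      have h1 : ‖((1 : ℝ), (0 : Fin 2 → ℝ))‖ = 1 := by
        rw [Prod.norm_def]
        simp
      rw [h1, one_mul]
      exact hB c (j + 1) (by omega) _ _ _ s θ hθ)
  rw [← e] at h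
  refine (h.cutoff fun c t ht θ => dt_q_eq_zero Γ a c (Or.inl ht) θ).mono 1 fun c t _ => ?_
  unfold lam
  split_ifs
  · refine ⟨hpos c, ?_⟩
    rw [one_mul, div_eq_mul_inv, mul_comm]
    exact mul_le_mul_of_nonneg_left (div_le_self (Real.sqrt_nonneg _) h1)
      (inv_nonneg.2 (Γ c).δ_pos.le)
  · simp

end Config

end

section

/-! ### The exponential of symmetric trace-free matrices -/

/-- The symmetric trace-free matrix with first row `v`. -/
def symTF (v : Fin 2 → ℝ) : Matrix (Fin 2) (Fin 2) ℝ := !![v 0, v 1; v 1, -v 0]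

/-- The components of the exponential of a symmetric trace-free matrix. -/
def expF (A B : Fin 2) (v : Fin 2 → ℝ) : ℝ := NormedSpace.exp (symTF v) A B

section

attribute [local instance] Matrix.linftyOpNormedRing Matrix.linftyOpNormedAlgebra

/-- `symTF` as a continuous linear map. -/
def symTFL : (Fin 2 → ℝ) →L[ℝ] Matrix (Fin 2) (Fin 2) ℝ :=
  LinearMap.toContinuousLinearMap
    { toFun := symTF
      map_add' := fun v w => by
        ext A B; fin_cases A <;> fin_cases B <;> simp [symTF]; ring
      map_smul' := fun a v => by
        ext A B; fin_cases A <;> fin_cases B <;> simp [symTF] }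

/-- A matrix entry as a continuous linear map. -/
def entryL (A B : Fin 2) : Matrix (Fin 2) (Fin 2) ℝ →L[ℝ] ℝ :=
  LinearMap.toContinuousLinearMap
    { toFun := fun M => M A B, map_add' := fun _ _ => rfl, map_smul' := fun _ _ => rfl }

theorem contDiff_expF (A B : Fin 2) : ContDiff ℝ ∞ (expF A B) := by
  have h : ContDiff ℝ ∞ (NormedSpace.exp : Matrix (Fin 2) (Fin 2) ℝ → _) := by
    refine contDiff_iff_contDiffAt.2 fun x => ?_
    exact (NormedSpace.exp_analytic (𝕂 := ℝ) x).contDiffAt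
  exact (entryL A B).contDiff.comp (h.comp symTFL.contDiff)

theorem pd_expF_zero (A B a : Fin 2) : pd a (expF A B) 0 = symTF (Pi.single a 1) A B := by
  have h1 : HasFDerivAt (NormedSpace.exp : Matrix (Fin 2) (Fin 2) ℝ → _)
      (1 : Matrix (Fin 2) (Fin 2) ℝ →L[ℝ] _) (symTFL 0) := by
    rw [map_zero]
    exact hasFDerivAt_exp_zero
  have h2 := ((entryL A B).hasFDerivAt.comp _ (h1.comp (0 : Fin 2 → ℝ) symTFL.hasFDerivAt)).fderiv
  change fderiv ℝ (entryL A B ∘ (NormedSpace.exp ∘ symTFL)) 0 _ = _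
  rw [h2]
  rfl

end

theorem expF_zero (A B : Fin 2) : expF A B 0 = (1 : Matrix (Fin 2) (Fin 2) ℝ) A B := by
  have : symTF 0 = 0 := by
    ext A B; fin_cases A <;> fin_cases B <;> simp [symTF]
  rw [expF, this, NormedSpace.exp_zero]

theorem expF_symm (A B : Fin 2) (v : Fin 2 → ℝ) : expF A B v = expF B A v := by
  have h : (symTF v)ᵀ = symTF v := by
    ext A B; fin_cases A <;> fin_cases B <;> simp [symTF]
  have h2 := Matrix.exp_transpose (symTF v)
  rw [h] at h2
  exact congrFun (congrFun h2 A) B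

/-- Conjugation by the quarter turn J sends a symmetric trace-free S to −S. Hence e^S · J e^S J⁻¹ =
1, and the upper left entry of this identity is the determinant. -/
theorem det_expF (v : Fin 2 → ℝ) : expF 0 0 v * expF 1 1 v - expF 0 1 v * expF 0 1 v = 1 := by
  let J : Matrix (Fin 2) (Fin 2) ℝ := !![0, 1; -1, 0]
  have hJ : J⁻¹ = !![0, -1; 1, 0] := by
    refine Matrix.inv_eq_left_inv ?_
    ext A B; fin_cases A <;> fin_cases B <;> simp [J, Matrix.mul_apply, Fin.sum_univ_two]
  have hJu : IsUnit J := by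
    rw [Matrix.isUnit_iff_isUnit_det, Matrix.det_fin_two]
    simp [J]
  have h1 := Matrix.exp_conj J (symTF v) hJu
  have h2 : J * symTF v * J⁻¹ = -symTF v := by
    rw [hJ]
    ext A B; fin_cases A <;> fin_cases B <;> simp [J, symTF, Matrix.mul_apply, Fin.sum_univ_two]
  have h3 : NormedSpace.exp (symTF v) * NormedSpace.exp (-symTF v) = 1 := by
    rw [Matrix.exp_neg]
    exact Matrix.mul_nonsing_inv _ ((Matrix.isUnit_iff_isUnit_det _).1 (Matrix.isUnit_exp _))
  rw [← h2, h1, hJ] at h3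
  have h4 := congrFun (congrFun h3 0) 0
  simp only [expF]
  simp [J, Matrix.mul_apply, Fin.sum_univ_two, Matrix.vecMul, dotProduct] at h4
  linear_combination h4

end

/-! ### Joint smoothness and restriction of space-time functions to the cone -/

section

theorem rsq_nonneg (θ : Fin 2 → ℝ) : 0 ≤ rsq θ := by unfold rsq; positivity

theorem roundFactor_pos (θ : Fin 2 → ℝ) : 0 < roundFactor θ := by
  have := rsq_nonneg θ
  unfold roundFactor
  positivity

theorem contDiff_rsq : ContDiff ℝ ∞ rsq := by
  unfold rsq
  fun_prop

theorem contDiff_roundFactor : ContDiff ℝ ∞ roundFactor := by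
  unfold roundFactor
  refine contDiff_const.div ((contDiff_const.add (contDiff_rsq.div_const _)).pow 2) fun θ => ?_
  have := rsq_nonneg θ
  positivity

theorem contDiff_pt (u : ℝ) : ContDiff ℝ ∞ (fun p : ℝ × (Fin 2 → ℝ) => pt p.1 u p.2) := by
  refine contDiff_pi.2 fun μ => ?_
  fin_cases μ <;> simp only [pt] <;> simp <;> fun_prop

variable {ι : Type*} {δ : ι → ℝ}

namespace JS

variable {y z : Fam ι}

theorem dt_congr (hδ : ∀ c, 0 < δ c) (hy : JS δ y) (hz : JS δ z) (h : Fam.Eq δ y z) :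
    Fam.Eq δ (Fam.dt y) (Fam.dt z) := by
  intro c t ht θ
  have hu : UniqueDiffWithinAt ℝ (Set.Icc 0 (δ c + 1)) t :=
    uniqueDiffOn_Icc (by linarith [hδ c]) t ht
  have h1 := (hy.hasDerivAt ht θ).hasDerivWithinAt (s := Set.Icc 0 (δ c + 1))
  have h2 := (hz.hasDerivAt ht θ).hasDerivWithinAt (s := Set.Icc 0 (δ c + 1))
  exact hu.eq_deriv _ h1 (h2.congr (fun s hs => h c s hs θ) (h c t ht θ))

theorem dt_mul (hy : JS δ y) (hz : JS δ z) :
    Fam.Eq δ (Fam.dt (y * z)) (Fam.dt y * z + y * Fam.dt z) :=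
  fun _ _ ht θ => ((hy.hasDerivAt ht θ).mul (hz.hasDerivAt ht θ)).deriv

theorem dt_add (hy : JS δ y) (hz : JS δ z) : Fam.Eq δ (Fam.dt (y + z)) (Fam.dt y + Fam.dt z) :=
  fun _ _ ht θ => ((hy.hasDerivAt ht θ).add (hz.hasDerivAt ht θ)).deriv

theorem dt_sub (hy : JS δ y) (hz : JS δ z) : Fam.Eq δ (Fam.dt (y - z)) (Fam.dt y - Fam.dt z) :=
  fun _ _ ht θ => ((hy.hasDerivAt ht θ).sub (hz.hasDerivAt ht θ)).deriv

theorem fixed {F : (Fin 2 → ℝ) → ℝ} (hF : ContDiff ℝ ∞ F) : JS δ (fun _ _ θ => F θ) :=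
  fun _ _ _ _ => (hF.comp contDiff_snd).contDiffAt

theorem param {a : ι → ℝ → ℝ} (ha : ∀ c, ∀ t ∈ Set.Icc 0 (δ c + 1), ContDiffAt ℝ ∞ (a c) t) :
    JS δ (fun c t _ => a c t) :=
  fun c t ht _ => (ha c t ht).comp (g := a c) (t, _) contDiffAt_fst

theorem comp {F : (Fin 2 → ℝ) → ℝ} (hF : ContDiff ℝ ∞ F) {q : Fin 2 → Fam ι}
    (hq : ∀ a, JS δ (q a)) : JS δ (Fam.comp F q) :=
  fun c t ht θ => ContDiffAt.comp (g := F) (f := fun p : ℝ × (Fin 2 → ℝ) => fun a => q a c p.1 p.2)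
    (t, θ) hF.contDiffAt (contDiffAt_pi.2 fun a => hq a c t ht θ)

theorem dt_comp {F : (Fin 2 → ℝ) → ℝ} (hF : ContDiff ℝ ∞ F) {q : Fin 2 → Fam ι}
    (hq : ∀ a, JS δ (q a)) :
    Fam.Eq δ (Fam.dt (Fam.comp F q)) (∑ a, Fam.comp (pd a F) q * Fam.dt (q a)) := by
  intro c t ht θ
  have h2 : HasDerivAt (fun s a => q a c s θ) (fun a => Fam.dt (q a) c t θ) t :=
    hasDerivAt_pi.2 fun a => (hq a).hasDerivAt ht θ
  have h3 : HasFDerivAt F (fderiv ℝ F (fun a => q a c t θ)) (fun a => q a c t θ) :=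
    (hF.differentiable (by simp) _).hasFDerivAt
  have h4 := (h3.comp_hasDerivAt t h2).deriv
  change deriv (F ∘ fun s a => q a c s θ) t = _
  rw [h4]
  have h5 : (fun a => Fam.dt (q a) c t θ)
      = ∑ a, (Fam.dt (q a) c t θ) • (Pi.single a (1 : ℝ) : Fin 2 → ℝ) := by
    ext b
    fin_cases b <;> simp
  rw [h5, map_sum]
  simp only [Finset.sum_apply, Pi.mul_apply, map_smul, smul_eq_mul, Fam.comp, pd]
  exact Finset.sum_congr rfl fun a _ => mul_comm _ _

end JS

namespace Config

variable {u₀ m₀ : ℝ} (Γ : ι → Config u₀ m₀)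

/-- The restriction of functions on the space-times to the cones `u = u₀`. -/
def fam (_ : ι → Config u₀ m₀) (F : ι → (Fin 4 → ℝ) → ℝ) : Fam ι := fun c t θ => F c (pt t u₀ θ)

/-- Smoothness of functions on the space-times. -/
def Sm (F : ι → (Fin 4 → ℝ) → ℝ) : Prop :=
  ∀ c, SmoothAtOn (slab ((Γ c).δ + 1) u₀ (Γ c).u₁) (F c)

variable {Γ}

theorem dl_pos (c : ι) : 0 < dl Γ c := (Γ c).δ_pos

theorem mem_cone {c : ι} {t : ℝ} (ht : t ∈ Set.Icc 0 (dl Γ c + 1)) (θ : Fin 2 → ℝ) :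
    pt t u₀ θ ∈ Spacetime.cone ((Γ c).δ + 1) u₀ := Spacetime.pt_mem_cone ht θ

theorem gauge (c : ι) : (Γ c).S.ConeGauge (Γ c).i where
  pos := by linarith [(Γ c).δ_pos]
  lt := (Γ c).lt
  lapse x hx := by
    have := (Γ c).data.lapse_outgoing (Γ c).i (x 0) hx.1 (ang x)
    rwa [Spacetime.pt_ang hx] at this
  shift x hx := by
    have := (Γ c).data.shift_outgoing (Γ c).i (x 0) hx.1 (ang x)
    rwa [Spacetime.pt_ang hx] at this

theorem mem_slab {c : ι} {t : ℝ} (ht : t ∈ Set.Icc 0 (dl Γ c + 1)) (θ : Fin 2 → ℝ) :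
    pt t u₀ θ ∈ slab ((Γ c).δ + 1) u₀ (Γ c).u₁ := (gauge c).sub (mem_cone ht θ)

variable {F G : ι → (Fin 4 → ℝ) → ℝ}

theorem js_fam (hF : Sm Γ F) : JS (dl Γ) (fam Γ F) := fun c t ht θ =>
  ContDiffAt.comp (g := F c) (f := fun p : ℝ × (Fin 2 → ℝ) => pt p.1 u₀ p.2) (t, θ)
    (hF c _ (mem_slab ht θ)) (contDiff_pt u₀).contDiffAt

theorem dt_fam (hF : Sm Γ F) :
    Fam.Eq (dl Γ) (Fam.dt (fam Γ F)) (fam Γ fun c => pd 0 (F c)) := by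
  intro c t ht θ
  have h1 : HasDerivAt (fun s => pt s u₀ θ) (Pi.single 0 1) t := by
    refine hasDerivAt_pi.2 fun μ => ?_
    fin_cases μ
    · simpa [pt] using hasDerivAt_id' t
    · simpa [pt] using hasDerivAt_const t u₀
    · simpa [pt] using hasDerivAt_const t (θ 0)
    · simpa [pt] using hasDerivAt_const t (θ 1)
  have h2 := ((hF c).differentiableAt (mem_slab ht θ)).hasFDerivAt
  exact (h2.comp_hasDerivAt t h1).deriv

theorem D_fam (hF : Sm Γ F) (A : Fin 2) :
    Fam.Eq (dl Γ) (Fam.D A (fam Γ F)) (fam Γ fun c => pd (sph A) (F c)) := by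
  intro c t ht θ
  let L : (Fin 2 → ℝ) →L[ℝ] (Fin 4 → ℝ) := ContinuousLinearMap.pi
    ![0, 0, ContinuousLinearMap.proj 0, ContinuousLinearMap.proj 1]
  have h1 : HasFDerivAt (fun y => pt t u₀ y) L θ := by
    have : (fun y => pt t u₀ y) = fun y => L y + pt t u₀ 0 := by
      funext y
      ext μ
      fin_cases μ <;> simp [pt, L]
    rw [this]
    exact L.hasFDerivAt.add_const _
  have h2 := ((hF c).differentiableAt (mem_slab ht θ)).hasFDerivAt
  have h3 := (h2.comp θ h1).fderiv
  change fderiv ℝ (F c ∘ fun y => pt t u₀ y) θ _ = _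
  rw [h3, ContinuousLinearMap.comp_apply]
  have h4 : L (Pi.single A 1) = Pi.single (sph A) 1 := by
    ext μ
    fin_cases A <;> fin_cases μ <;> simp [L, sph]
  rw [h4]
  rfl

end Config

end

section

namespace Config

variable {ι : Type*} {u₀ m₀ : ℝ} (Γ : ι → Config u₀ m₀)

/-! ### The metric on the outgoing cone -/

/-- The metric of the spheres. -/
def gm (A B : Fin 2) : Fam ι := fam Γ fun c x => (Γ c).S.sphereMetric (Γ c).i x A B

/-- The inverse metric of the spheres. -/
def gi (A B : Fin 2) : Fam ι := fam Γ fun c => (Γ c).S.hinv (Γ c).i A B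

/-- The second fundamental form `χ`. -/
def fX (A B : Fin 2) : Fam ι := fam Γ fun c => (Γ c).S.X (Γ c).i A B

/-- The exponential of the pulse. -/
def em (A B : Fin 2) : Fam ι := Fam.comp (expF A B) (q Γ)

/-- The conformal factor `φ`. -/
def phi : Fam ι := fun c t θ =>
  Real.sqrt (Real.sqrt (gm Γ 0 0 c t θ * gm Γ 1 1 c t θ - gm Γ 0 1 c t θ * gm Γ 1 0 c t θ)
    / (u₀ ^ 2 * roundFactor θ))

/-- The area density of the spheres relative to the coordinates, up to the factor `m`. -/
def pf : Fam ι := phi Γ * phi Γ * fun _ _ θ => u₀ ^ 2 * roundFactor θ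

variable {Γ}

theorem js_gm (A B : Fin 2) : JS (dl Γ) (gm Γ A B) :=
  js_fam fun c => (Γ c).S.smoothAtOn_sphereMetric _ A B

theorem sm_X (A B : Fin 2) : Sm Γ fun c => (Γ c).S.X (Γ c).i A B :=
  fun c => (Γ c).S.smoothAtOn_X _ A B

theorem js_fX (A B : Fin 2) : JS (dl Γ) (fX Γ A B) := js_fam (sm_X A B)

theorem js_em (A B : Fin 2) : JS (dl Γ) (em Γ A B) := JS.comp (contDiff_expF A B) (js_q Γ)

theorem det_gm_pos {c : ι} {t : ℝ} (ht : t ∈ Set.Icc 0 (dl Γ c + 1)) (θ : Fin 2 → ℝ) :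
    0 < gm Γ 0 0 c t θ * gm Γ 1 1 c t θ - gm Γ 0 1 c t θ * gm Γ 1 0 c t θ := by
  have := (Γ c).S.sphereMetric_det_pos (Γ c).i (mem_slab ht θ)
  rwa [Matrix.det_fin_two] at this

theorem fX_symm {c : ι} {t : ℝ} (ht : t ∈ Set.Icc 0 (dl Γ c + 1)) (θ : Fin 2 → ℝ) (A B : Fin 2) :
    fX Γ A B c t θ = fX Γ B A c t θ := (gauge c).X_symm (mem_slab ht θ) A B

theorem gi_eq {c : ι} {t : ℝ} {θ : Fin 2 → ℝ} :
    gi Γ 0 0 c t θ = gm Γ 1 1 c t θ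
        / (gm Γ 0 0 c t θ * gm Γ 1 1 c t θ - gm Γ 0 1 c t θ * gm Γ 1 0 c t θ) ∧
    gi Γ 0 1 c t θ = -gm Γ 0 1 c t θ
        / (gm Γ 0 0 c t θ * gm Γ 1 1 c t θ - gm Γ 0 1 c t θ * gm Γ 1 0 c t θ) ∧
    gi Γ 1 0 c t θ = -gm Γ 1 0 c t θ
        / (gm Γ 0 0 c t θ * gm Γ 1 1 c t θ - gm Γ 0 1 c t θ * gm Γ 1 0 c t θ) ∧
    gi Γ 1 1 c t θ = gm Γ 0 0 c t θ
        / (gm Γ 0 0 c t θ * gm Γ 1 1 c t θ - gm Γ 0 1 c t θ * gm Γ 1 0 c t θ) := by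
  simp only [gi, gm, fam, Spacetime.hinv, Matrix.inv_def, Matrix.adjugate_fin_two,
    Matrix.smul_apply, Matrix.det_fin_two, Ring.inverse_eq_inv', smul_eq_mul]
  refine ⟨?_, ?_, ?_, ?_⟩ <;> simp <;> ring

theorem js_phi (hu : u₀ < -2) : JS (dl Γ) (phi Γ) := by
  intro c t ht θ
  have hd := det_gm_pos ht θ
  have hr := roundFactor_pos θ
  have hu' : 0 < u₀ ^ 2 := by nlinarith
  have h1 := (((js_gm (Γ := Γ) 0 0).mul (js_gm 1 1)).sub ((js_gm 0 1).mul (js_gm 1 0))) c t ht θ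
  refine ((h1.sqrt hd.ne').div ?_ ?_).sqrt ?_
  · exact (contDiff_const.mul (contDiff_roundFactor.comp contDiff_snd)).contDiffAt
  · positivity
  · exact (div_pos (Real.sqrt_pos.2 hd) (mul_pos hu' hr)).ne'

theorem em_symm (A B : Fin 2) : em Γ A B = em Γ B A := by
  funext c t θ
  exact expF_symm A B _

theorem det_em (c : ι) (t : ℝ) (θ : Fin 2 → ℝ) :
    em Γ 0 0 c t θ * em Γ 1 1 c t θ - em Γ 0 1 c t θ * em Γ 0 1 c t θ = 1 := det_expF _

/-- The factor supplied by the data carries no regularity. It is recovered from the determinant of h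
and so coincides with the smooth function `phi`. -/
theorem conformal (hu : u₀ < -2) {c : ι} {t : ℝ} (ht : t ∈ Set.Icc 0 (dl Γ c + 1))
    (θ : Fin 2 → ℝ) : 0 < phi Γ c t θ ∧ ∀ A B, gm Γ A B c t θ = (pf Γ * em Γ A B) c t θ := by
  obtain ⟨φ, hφ⟩ := (Γ c).data.conformal_outgoing
  obtain ⟨h1, h2⟩ := hφ (Γ c).i t ht θ
  have hr := roundFactor_pos θ
  have hu' : 0 < u₀ ^ 2 := by nlinarith
  have hab : |u₀| ^ 2 = u₀ ^ 2 := sq_abs u₀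
  rw [hab] at h2
  have h3 : ∀ A B, gm Γ A B c t θ = (φ (Γ c).i t θ ^ 2 * (u₀ ^ 2 * roundFactor θ)) * em Γ A B c t θ := by
    intro A B
    rw [gm, fam, h2, Matrix.smul_apply, smul_eq_mul, em, Fam.comp, expF]
    congr 2
    rw [pulse_apply]
    rfl
  -- Since det e^ψ = 1, the determinant of h is the square of φ²|u₀|² times the round factor, and
  -- two square roots of positive quantities isolate φ.
  have h4 : phi Γ c t θ = φ (Γ c).i t θ := by
    have hs : em Γ 1 0 c t θ = em Γ 0 1 c t θ := by rw [em_symm]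
    have hd := det_em (Γ := Γ) c t θ
    rw [phi, h3, h3, h3, h3, hs]
    have e : φ (Γ c).i t θ ^ 2 * (u₀ ^ 2 * roundFactor θ) * em Γ 0 0 c t θ *
            (φ (Γ c).i t θ ^ 2 * (u₀ ^ 2 * roundFactor θ) * em Γ 1 1 c t θ) -
          φ (Γ c).i t θ ^ 2 * (u₀ ^ 2 * roundFactor θ) * em Γ 0 1 c t θ *
            (φ (Γ c).i t θ ^ 2 * (u₀ ^ 2 * roundFactor θ) * em Γ 0 1 c t θ)
        = (φ (Γ c).i t θ ^ 2 * (u₀ ^ 2 * roundFactor θ)) ^ 2 := by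
      linear_combination (φ (Γ c).i t θ ^ 2 * (u₀ ^ 2 * roundFactor θ)) ^ 2 * hd
    rw [e, Real.sqrt_sq (by positivity), mul_div_assoc, div_self (by positivity), mul_one,
      Real.sqrt_sq h1.le]
  refine ⟨h4 ▸ h1, fun A B => ?_⟩
  rw [h3, Pi.mul_apply, Pi.mul_apply, Pi.mul_apply, pf]
  simp only [Pi.mul_apply, h4]
  ring

theorem js_P : JS (dl Γ) (fun _ _ θ => u₀ ^ 2 * roundFactor θ) :=
  JS.fixed (contDiff_const.mul contDiff_roundFactor)

theorem js_pf (hu : u₀ < -2) : JS (dl Γ) (pf Γ) := ((js_phi hu).mul (js_phi hu)).mul js_P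

/-- The algebraic content of Raychaudhuri's equation. -/
theorem raychaudhuri_algebra {p p1 p2 a b d a1 b1 d1 a2 b2 d2 : ℝ}
    (h0 : a * d - b * b = 1) (h1 : a1 * d + a * d1 - 2 * b * b1 = 0)
    (h2 : a2 * d + 2 * a1 * d1 + a * d2 - 2 * b1 * b1 - 2 * b * b2 = 0)
    {X00 X01 X11 Y00 Y01 Y11 : ℝ}
    (x00 : X00 = (p1 * a + p * a1) / 2) (x01 : X01 = (p1 * b + p * b1) / 2)
    (x11 : X11 = (p1 * d + p * d1) / 2)
    (y00 : Y00 = (p2 * a + 2 * p1 * a1 + p * a2) / 2)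
    (y01 : Y01 = (p2 * b + 2 * p1 * b1 + p * b2) / 2)
    (y11 : Y11 = (p2 * d + 2 * p1 * d1 + p * d2) / 2)
    (hE : -(d * Y00 - 2 * b * Y01 + a * Y11) * p + (d * (d * X00 * X00 - 2 * b * X00 * X01 + a * X01 * X01)
      - 2 * b * (d * X00 * X01 - b * (X01 * X01 + X00 * X11) + a * X01 * X11)
      + a * (d * X01 * X01 - 2 * b * X01 * X11 + a * X11 * X11)) = 0) :
    p * p2 - p1 ^ 2 / 2 = p ^ 2 / 2 * (a1 * d1 - b1 ^ 2) := by
  subst x00 x01 x11 y00 y01 y11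
  -- The multiples of `h0`, `h1`, `h2` use det m = 1 and its first two time derivatives, which
  -- remove the second derivatives of the matrix.
  linear_combination -hE + (-(p * p2) - p ^ 2 / 2 * (a1 * d1 - b1 ^ 2)
      + p1 ^ 2 / 2 * (a * d - b * b + 1)) * h0
    + (-(p * p1) + p * p1 / 2 * (a * d - b * b) + p ^ 2 / 4 * (a1 * d + a * d1 - 2 * b * b1)) * h1
    - p ^ 2 / 2 * h2

end Config

end

/-! ### Raychaudhuri's equation for the conformal factor -/

section

namespace Config

variable {ι : Type*} {u₀ m₀ : ℝ} {Γ : ι → Config u₀ m₀}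

theorem dt_gm (A B : Fin 2) : Fam.Eq (dl Γ) (Fam.dt (gm Γ A B)) ((2 : ℝ) • fX Γ A B) := by
  intro c t ht θ
  have h := dt_fam (Γ := Γ) (F := fun c x => (Γ c).S.sphereMetric (Γ c).i x A B)
    (fun c => (Γ c).S.smoothAtOn_sphereMetric _ A B) c t ht θ
  refine h.trans ?_
  simp only [fam, fX, Pi.smul_apply, smul_eq_mul, Spacetime.X]
  ring

theorem fX_eq (hu : u₀ < -2) (A B : Fin 2) : Fam.Eq (dl Γ) (fX Γ A B)
    ((1 / 2 : ℝ) • (Fam.dt (pf Γ) * em Γ A B + pf Γ * Fam.dt (em Γ A B))) := by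
  intro c t ht θ
  have h1 := JS.dt_congr dl_pos (js_gm A B) ((js_pf hu).mul (js_em A B))
    (fun c t ht θ => (conformal (Γ := Γ) hu ht θ).2 A B) c t ht θ
  rw [dt_gm A B c t ht θ, (js_pf hu).dt_mul (js_em A B) c t ht θ] at h1
  rw [Pi.smul_apply, Pi.smul_apply, Pi.smul_apply, smul_eq_mul] at h1 ⊢
  linarith

theorem js_smul {y : Fam ι} (a : ℝ) (hy : JS (dl Γ) y) : JS (dl Γ) (a • y) :=
  fun c t ht θ => contDiffAt_const.mul (hy c t ht θ)

theorem dt_smul {y : Fam ι} (a : ℝ) (hy : JS (dl Γ) y) :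
    Fam.Eq (dl Γ) (Fam.dt (a • y)) (a • Fam.dt y) :=
  fun _ _ ht θ => ((hy.hasDerivAt ht θ).const_mul a).deriv

theorem dt_fX (hu : u₀ < -2) (A B : Fin 2) : Fam.Eq (dl Γ) (Fam.dt (fX Γ A B))
    ((1 / 2 : ℝ) • (Fam.dt (Fam.dt (pf Γ)) * em Γ A B
      + (2 : ℝ) • (Fam.dt (pf Γ) * Fam.dt (em Γ A B)) + pf Γ * Fam.dt (Fam.dt (em Γ A B)))) := by
  intro c t ht θ
  have hp := js_pf (Γ := Γ) hu
  have hm := js_em (Γ := Γ) A B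
  have j1 := hp.dt.mul hm
  have j2 := hp.mul hm.dt
  have h1 := JS.dt_congr dl_pos (js_fX A B) (js_smul _ (j1.add j2)) (fX_eq hu A B) c t ht θ
  rw [h1, dt_smul _ (j1.add j2) c t ht θ]
  simp only [Pi.smul_apply, smul_eq_mul, Pi.add_apply]
  rw [j1.dt_add j2 c t ht θ, Pi.add_apply, Pi.add_apply, Pi.add_apply,
    hp.dt.dt_mul hm c t ht θ, hp.dt_mul hm.dt c t ht θ]
  simp only [Pi.add_apply, Pi.mul_apply]
  ring

theorem dt_P : Fam.Eq (dl Γ) (Fam.dt fun _ _ θ => u₀ ^ 2 * roundFactor θ) 0 :=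
  fun _ _ _ _ => by simp [Fam.dt]

theorem dt_pf (hu : u₀ < -2) : Fam.Eq (dl Γ) (Fam.dt (pf Γ))
    ((2 : ℝ) • (phi Γ * Fam.dt (phi Γ)) * fun _ _ θ => u₀ ^ 2 * roundFactor θ) := by
  intro c t ht θ
  have hp := js_phi (Γ := Γ) hu
  rw [pf, (hp.mul hp).dt_mul js_P c t ht θ]
  simp only [Pi.add_apply, Pi.mul_apply, Pi.smul_apply, smul_eq_mul]
  rw [hp.dt_mul hp c t ht θ, dt_P c t ht θ]
  simp only [Pi.add_apply, Pi.mul_apply, Pi.zero_apply]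
  ring

theorem dt_dt_pf (hu : u₀ < -2) : Fam.Eq (dl Γ) (Fam.dt (Fam.dt (pf Γ)))
    ((2 : ℝ) • (Fam.dt (phi Γ) * Fam.dt (phi Γ) + phi Γ * Fam.dt (Fam.dt (phi Γ)))
      * fun _ _ θ => u₀ ^ 2 * roundFactor θ) := by
  intro c t ht θ
  have hp := js_phi (Γ := Γ) hu
  have j := js_smul (2 : ℝ) (hp.mul hp.dt)
  have h1 := JS.dt_congr dl_pos (js_pf hu).dt (j.mul js_P) (dt_pf hu) c t ht θ
  rw [h1, j.dt_mul js_P c t ht θ]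
  simp only [Pi.add_apply, Pi.mul_apply, Pi.smul_apply, smul_eq_mul]
  rw [dt_smul _ (hp.mul hp.dt) c t ht θ, dt_P c t ht θ]
  simp only [Pi.zero_apply, Pi.smul_apply, smul_eq_mul]
  rw [hp.dt_mul hp.dt c t ht θ]
  simp only [Pi.add_apply, Pi.mul_apply]
  ring

/-- Time derivatives of det e^ψ = 1 are the constraints that eliminate the cross term and the second
derivatives of the pulse from Raychaudhuri's equation. -/
theorem em_det_dt : Fam.Eq (dl Γ) (Fam.dt (em Γ 0 0) * em Γ 1 1 + em Γ 0 0 * Fam.dt (em Γ 1 1)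
    - (2 : ℝ) • (em Γ 0 1 * Fam.dt (em Γ 0 1))) 0 := by
  intro c t ht θ
  have h00 := js_em (Γ := Γ) 0 0
  have h01 := js_em (Γ := Γ) 0 1
  have h11 := js_em (Γ := Γ) 1 1
  have h := ((h00.mul h11).sub (h01.mul h01)).dt_congr dl_pos
    (JS.fixed (F := fun _ => 1) contDiff_const) (fun c t _ θ => det_em c t θ) c t ht θ
  rw [(h00.mul h11).dt_sub (h01.mul h01) c t ht θ] at h
  simp only [Pi.sub_apply] at h
  rw [h00.dt_mul h11 c t ht θ, h01.dt_mul h01 c t ht θ] at h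
  have e : Fam.dt (fun _ _ _ => (1 : ℝ)) c t θ = 0 := by simp [Fam.dt]
  rw [e] at h
  simp only [Pi.sub_apply, Pi.add_apply, Pi.mul_apply, Pi.smul_apply, smul_eq_mul,
    Pi.zero_apply] at h ⊢
  linarith

theorem em_det_dt_dt : Fam.Eq (dl Γ) (Fam.dt (Fam.dt (em Γ 0 0)) * em Γ 1 1
    + (2 : ℝ) • (Fam.dt (em Γ 0 0) * Fam.dt (em Γ 1 1)) + em Γ 0 0 * Fam.dt (Fam.dt (em Γ 1 1))
    - (2 : ℝ) • (Fam.dt (em Γ 0 1) * Fam.dt (em Γ 0 1))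
    - (2 : ℝ) • (em Γ 0 1 * Fam.dt (Fam.dt (em Γ 0 1)))) 0 := by
  intro c t ht θ
  have h00 := js_em (Γ := Γ) 0 0
  have h01 := js_em (Γ := Γ) 0 1
  have h11 := js_em (Γ := Γ) 1 1
  have j1 := h00.dt.mul h11
  have j2 := h00.mul h11.dt
  have j3 := h01.mul h01.dt
  have h := ((j1.add j2).sub (js_smul 2 j3)).dt_congr dl_pos
    (JS.fixed (F := fun _ => 0) contDiff_const) em_det_dt c t ht θ
  rw [(j1.add j2).dt_sub (js_smul 2 j3) c t ht θ] at h
  simp only [Pi.sub_apply] at h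
  rw [j1.dt_add j2 c t ht θ, dt_smul 2 j3 c t ht θ] at h
  simp only [Pi.add_apply, Pi.smul_apply] at h
  rw [h00.dt.dt_mul h11 c t ht θ, h00.dt_mul h11.dt c t ht θ, h01.dt_mul h01.dt c t ht θ] at h
  have e : Fam.dt (fun _ _ _ => (0 : ℝ)) c t θ = 0 := by simp [Fam.dt]
  rw [e] at h
  simp only [Pi.sub_apply, Pi.add_apply, Pi.mul_apply, Pi.smul_apply, smul_eq_mul,
    Pi.zero_apply] at h ⊢
  linarith

theorem gi_conformal (hu : u₀ < -2) {c : ι} {t : ℝ} (ht : t ∈ Set.Icc 0 (dl Γ c + 1))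
    (θ : Fin 2 → ℝ) : gi Γ 0 0 c t θ = em Γ 1 1 c t θ / pf Γ c t θ ∧
      gi Γ 0 1 c t θ = -em Γ 0 1 c t θ / pf Γ c t θ ∧
      gi Γ 1 0 c t θ = -em Γ 0 1 c t θ / pf Γ c t θ ∧
      gi Γ 1 1 c t θ = em Γ 0 0 c t θ / pf Γ c t θ := by
  obtain ⟨hpos, hc⟩ := conformal (Γ := Γ) hu ht θ
  have hr := roundFactor_pos θ
  have hu' : 0 < u₀ ^ 2 := by nlinarith
  have hp : 0 < pf Γ c t θ := mul_pos (mul_pos hpos hpos) (mul_pos hu' hr)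
  obtain ⟨g1, g2, g3, g4⟩ := gi_eq (Γ := Γ) (c := c) (t := t) (θ := θ)
  have hs : em Γ 1 0 c t θ = em Γ 0 1 c t θ := by rw [em_symm]
  have hd := det_em (Γ := Γ) c t θ
  have e : gm Γ 0 0 c t θ * gm Γ 1 1 c t θ - gm Γ 0 1 c t θ * gm Γ 1 0 c t θ = pf Γ c t θ ^ 2 := by
    simp only [hc, Pi.mul_apply, hs]
    linear_combination (pf Γ c t θ) ^ 2 * hd
  rw [e] at g1 g2 g3 g4
  simp only [hc, Pi.mul_apply, hs] at g1 g2 g3 g4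
  rw [g1, g2, g3, g4]
  refine ⟨?_, ?_, ?_, ?_⟩ <;> field_simp

theorem pf_pos (hu : u₀ < -2) {c : ι} {t : ℝ} (ht : t ∈ Set.Icc 0 (dl Γ c + 1))
    (θ : Fin 2 → ℝ) : 0 < pf Γ c t θ := by
  have hr := roundFactor_pos θ
  have hu' : 0 < u₀ ^ 2 := by nlinarith
  have hpos := (conformal (Γ := Γ) hu ht θ).1
  exact mul_pos (mul_pos hpos hpos) (mul_pos hu' hr)

/-- Raychaudhuri's equation for the conformal factor. -/
theorem dt_dt_phi (hu : u₀ < -2) : Fam.Eq (dl Γ) (Fam.dt (Fam.dt (phi Γ)))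
    ((1 / 4 : ℝ) • (Fam.dt (em Γ 0 0) * Fam.dt (em Γ 1 1) - Fam.dt (em Γ 0 1) * Fam.dt (em Γ 0 1))
      * phi Γ) := by
  intro c t ht θ
  have hpos := (conformal (Γ := Γ) hu ht θ).1
  have hr := roundFactor_pos θ
  have hu' : 0 < u₀ ^ 2 := by nlinarith
  have hp := pf_pos (Γ := Γ) hu ht θ
  obtain ⟨g1, g2, g3, g4⟩ := gi_conformal (Γ := Γ) hu ht θ
  have hx := mem_cone (Γ := Γ) ht θ
  have hv := (gauge c).vacuum_00 (Γ c).vacuum hx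
  have h0 := det_em (Γ := Γ) c t θ
  have h1 := em_det_dt (Γ := Γ) c t ht θ
  have h2 := em_det_dt_dt (Γ := Γ) c t ht θ
  have hX := fun A B => dt_fX (Γ := Γ) hu A B c t ht θ
  have hX' := fun A B => (dt_fam (Γ := Γ) (sm_X A B) c t ht θ).symm.trans (hX A B)
  have hXe := fun A B => fX_eq (Γ := Γ) hu A B c t ht θ
  have e1 := dt_pf (Γ := Γ) hu c t ht θ
  have e2 := dt_dt_pf (Γ := Γ) hu c t ht θ
  have hgi : ∀ A B, (Γ c).S.hinv (Γ c).i A B (pt t u₀ θ) = gi Γ A B c t θ := fun _ _ => rfl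
  have hfX : ∀ A B, (Γ c).S.X (Γ c).i A B (pt t u₀ θ) = fX Γ A B c t θ := fun _ _ => rfl
  have hY : ∀ A B, pd 0 ((Γ c).S.X (Γ c).i A B) (pt t u₀ θ) = _ := hX'
  simp only [(gauge c).lowCurv_A0B0 hx, Spacetime.ctr, Fin.sum_univ_two, hgi, hfX, hY,
    em_symm 1 0, fX_symm ht θ 1 0] at hv
  have e3 : pf Γ c t θ = phi Γ c t θ * phi Γ c t θ * (u₀ ^ 2 * roundFactor θ) := rfl
  simp only [Pi.sub_apply, Pi.add_apply, Pi.mul_apply, Pi.smul_apply, smul_eq_mul,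
    Pi.zero_apply] at h1 h2 hXe e1 e2 hv ⊢
  rw [g1, g2, g3, g4] at hv
  have key := raychaudhuri_algebra (p := pf Γ c t θ) (p1 := Fam.dt (pf Γ) c t θ)
    (p2 := Fam.dt (Fam.dt (pf Γ)) c t θ) h0
    (a1 := Fam.dt (em Γ 0 0) c t θ) (b1 := Fam.dt (em Γ 0 1) c t θ) (d1 := Fam.dt (em Γ 1 1) c t θ)
    (a2 := Fam.dt (Fam.dt (em Γ 0 0)) c t θ) (b2 := Fam.dt (Fam.dt (em Γ 0 1)) c t θ)
    (d2 := Fam.dt (Fam.dt (em Γ 1 1)) c t θ)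
    (by linarith) (by linarith) (X00 := fX Γ 0 0 c t θ) (X01 := fX Γ 0 1 c t θ)
    (X11 := fX Γ 1 1 c t θ) (by rw [hXe]; ring) (by rw [hXe]; ring) (by rw [hXe]; ring)
    rfl rfl rfl (by
      field_simp at hv
      linear_combination (1/2) * hv)
  -- With p = φ²P and P independent of time, p p'' − p'²/2 equals 2φ³φ''P². The quadratic
  -- first-order terms disappear and the equation is linear in φ.
  rw [e2, e1, e3] at key
  have hne : phi Γ c t θ ≠ 0 := hpos.ne'
  have hP : 0 < phi Γ c t θ ^ 3 * (u₀ ^ 2 * roundFactor θ) ^ 2 := by positivity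
  refine mul_left_cancel₀ hP.ne' ?_
  linear_combination (1/2) * key

end Config

end

/-! ### Parameters and the mass function of the pulse -/

section

/-- Primitives of smooth functions of time and angle. -/
theorem contDiff_primitive {G : ℝ × (Fin 2 → ℝ) → ℝ} (hG : ContDiff ℝ ∞ G) {d : ℝ}
    (h0 : ∀ t θ, t ∉ Set.Icc 0 d → G (t, θ) = 0) :
    ContDiff ℝ ∞ (fun p : ℝ × (Fin 2 → ℝ) => ∫ s in (0 : ℝ)..p.1, G (s, p.2)) := by
  -- The primitive is the convolution of G with the Heaviside function, so joint smoothness follows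
  -- from the smoothness of convolutions with parameters.
  let f : ℝ → ℝ := (Set.Ici (0 : ℝ)).indicator fun _ => 1
  have hf : MeasureTheory.LocallyIntegrable f :=
    (MeasureTheory.locallyIntegrable_const (1 : ℝ)).indicator measurableSet_Ici
  have h := MeasureTheory.contDiffOn_convolution_left_with_param (μ := MeasureTheory.volume) (n := ⊤)
    (ContinuousLinearMap.mul ℝ ℝ)
    (f := f) (g := fun (θ : Fin 2 → ℝ) t => G (t, θ)) (s := Set.univ) (k := Set.Icc 0 d) isOpen_univ
    isCompact_Icc (fun θ t _ ht => h0 t θ ht) hf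
    ((hG.comp (contDiff_snd.prodMk contDiff_fst)).contDiffOn)
  rw [Set.univ_prod_univ, contDiffOn_univ] at h
  have h2 := h.comp (contDiff_snd.prodMk contDiff_fst : ContDiff ℝ ∞
    fun p : ℝ × (Fin 2 → ℝ) => (p.2, p.1))
  convert h2 using 1
  funext ⟨t, θ⟩
  have hint : ∀ a, MeasureTheory.IntegrableOn (fun s => G (s, θ)) (Set.Iic a) := by
    intro a
    refine MeasureTheory.Integrable.integrableOn ?_
    refine Continuous.integrable_of_hasCompactSupport
      (hG.continuous.comp (continuous_id.prodMk continuous_const)) ?_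
    exact HasCompactSupport.intro isCompact_Icc fun s hs => h0 s θ hs
  -- G vanishes at negative times, so integrating from −∞ or from 0 makes no difference.
  have h3 : ∫ s in Set.Iic (0 : ℝ), G (s, θ) = 0 := by
    have hs : ∀ s ∈ Set.Iio (0 : ℝ), G (s, θ) = 0 := fun s hs =>
      h0 s θ fun h => absurd h.1 (not_le.2 hs)
    rw [MeasureTheory.integral_Iic_eq_integral_Iio]
    exact MeasureTheory.setIntegral_eq_zero_of_forall_eq_zero hs
  have h4 := intervalIntegral.integral_Iic_sub_Iic (hint 0) (hint t)
  rw [h3, sub_zero] at h4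
  change (∫ s in (0 : ℝ)..t, G (s, θ)) = (MeasureTheory.convolution (fun s => G (s, θ)) f (ContinuousLinearMap.mul ℝ ℝ) _) t
  rw [← h4, MeasureTheory.convolution_def, ← MeasureTheory.integral_indicator measurableSet_Iic]
  refine MeasureTheory.integral_congr_ae (Filter.Eventually.of_forall fun s => ?_)
  simp only [ContinuousLinearMap.mul_apply', f, Set.indicator_apply, Set.mem_Iic, Set.mem_Ici,
    sub_nonneg]
  split_ifs <;> simp

/-- The standing assumptions on the parameters. -/
structure Admissible (u₀ m₀ : ℝ) : Prop where
  lt : u₀ < -2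
  pos : 0 < m₀
  mass : 2 * m₀ < |u₀|

namespace Admissible

variable {u₀ m₀ : ℝ} (hA : Admissible u₀ m₀)
include hA

theorem abs_gt : 2 < |u₀| := by
  rw [abs_of_neg (by linarith [hA.lt])]
  linarith [hA.lt]

theorem f_pos : 0 < 1 - 2 * m₀ / |u₀| := by
  have h := hA.abs_gt
  rw [sub_pos, div_lt_one (by linarith)]
  exact hA.mass

theorem f_lt_one : 1 - 2 * m₀ / |u₀| < 1 := by
  have h := hA.abs_gt
  have := hA.pos
  have : 0 < 2 * m₀ / |u₀| := by positivity
  linarith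

/-- The radius is at least |u₀| − δ, with |u₀| > 2 and δ < 1. -/
theorem one_le_schwR {d t : ℝ} (hd : d < 1) (ht : 0 ≤ t) : 1 ≤ schwR m₀ u₀ d t := by
  have h1 := hA.f_pos
  have h2 := hA.f_lt_one
  have h3 := hA.abs_gt
  unfold schwR
  nlinarith

theorem schwR_le {d t : ℝ} (ht : t ≤ d + 1) : schwR m₀ u₀ d t ≤ |u₀| + 1 := by
  have h1 := hA.f_pos
  have h2 := hA.f_lt_one
  unfold schwR
  nlinarith

end Admissible

namespace Config

variable {ι : Type*} {u₀ m₀ : ℝ} (Γ : ι → Config u₀ m₀)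

/-- The energy density of the pulse. -/
def en : Fam ι := (1 / 4 : ℝ) • (Fam.dt (q Γ 0) * Fam.dt (q Γ 0) + Fam.dt (q Γ 1) * Fam.dt (q Γ 1))

/-- The mass carried by the pulse up to the time `t`. -/
def mf : Fam ι := fun c t θ => ∫ s in (0 : ℝ)..t, en Γ c s θ

/-- The determinant of the derivative of the exponential of the pulse. -/
def dem : Fam ι := Fam.dt (em Γ 0 0) * Fam.dt (em Γ 1 1) - Fam.dt (em Γ 0 1) * Fam.dt (em Γ 0 1)

/-- The area radius of the reference space-time. -/
def rr : Fam ι := fun c t _ => schwR m₀ u₀ (dl Γ c) t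

variable {Γ}

theorem contDiff_dt_q (a : Fin 2) (c : ι) :
    ContDiff ℝ ∞ (fun p : ℝ × (Fin 2 → ℝ) => Fam.dt (q Γ a) c p.1 p.2) := by
  rw [q_eq, Fam.dt_scaled _ _ (fun c => (Γ c).ψ.smooth _ _ _)]
  exact Fam.contDiff_scaled _ _ (fun c => contDiff_dir ((Γ c).ψ.smooth _ _ _) _) c

theorem contDiff_en (c : ι) : ContDiff ℝ ∞ (fun p : ℝ × (Fin 2 → ℝ) => en Γ c p.1 p.2) :=
  contDiff_const.mul (((contDiff_dt_q 0 c).mul (contDiff_dt_q 0 c)).add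
    ((contDiff_dt_q 1 c).mul (contDiff_dt_q 1 c)))

theorem en_eq_zero (c : ι) {t : ℝ} (ht : dl Γ c ≤ t ∨ t ≤ 0) (θ : Fin 2 → ℝ) :
    en Γ c t θ = 0 := by
  simp [en, dt_q_eq_zero Γ _ c ht θ]

theorem contDiff_mf (c : ι) : ContDiff ℝ ∞ (fun p : ℝ × (Fin 2 → ℝ) => mf Γ c p.1 p.2) := by
  refine contDiff_primitive (G := fun p => en Γ c p.1 p.2) (contDiff_en c) (d := dl Γ c)
    fun t θ ht => en_eq_zero c ?_ θ
  by_contra h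
  push Not at h
  exact ht ⟨h.2.le, h.1.le⟩

theorem js_mf : JS (dl Γ) (mf Γ) := fun c _ _ _ => (contDiff_mf c).contDiffAt

theorem continuous_en (c : ι) (θ : Fin 2 → ℝ) : Continuous fun s => en Γ c s θ :=
  (contDiff_en c).continuous.comp (continuous_id.prodMk continuous_const)

theorem dt_mf : Fam.dt (mf Γ) = en Γ := by
  funext c t θ
  exact ((continuous_en c θ).integral_hasStrictDerivAt 0 t).hasDerivAt.deriv

theorem mf_zero (c : ι) (θ : Fin 2 → ℝ) : mf Γ c 0 θ = 0 := by simp [mf]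

/-- The norm |∂_sψ₀|² counts each of the two independent components twice, so the energy density is
|∂_sψ₀|²/(8u₀²δ). Substituting s = t/δ gives 16m₀/(8u₀²). The result does not depend on θ, which is
why the cone after the pulse is nearly spherically symmetric. -/
theorem mf_eq (hA : Admissible u₀ m₀) (c : ι) {t : ℝ} (ht : dl Γ c ≤ t) (θ : Fin 2 → ℝ) :
    mf Γ c t θ = 2 * m₀ / u₀ ^ 2 := by
  have hd : 0 < dl Γ c := dl_pos c
  have hu : u₀ ≠ 0 := by linarith [hA.lt]
  have hi := fun a b => (continuous_en (Γ := Γ) c θ).intervalIntegrable (μ := MeasureTheory.volume) a b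
  have h1 : ∫ s in dl Γ c..t, en Γ c s θ = 0 := by
    refine intervalIntegral.integral_zero_ae (Filter.Eventually.of_forall fun s hs => ?_)
    rw [Set.uIoc_of_le ht] at hs
    exact en_eq_zero c (Or.inl hs.1.le) θ
  have h2 := (Γ c).mass (Γ c).i θ
  let E : ℝ → ℝ := fun s => ∑ A, ∑ B, (deriv (fun t => (Γ c).ψ.toFun (Γ c).i t θ A B) s) ^ 2
  have hE : ∀ s, E s = ∑ A, ∑ B, (deriv (fun t => (Γ c).ψ.toFun (Γ c).i t θ A B) s) ^ 2 :=
    fun _ => rfl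
  have h3 : ∀ s, en Γ c s θ = (1 / (8 * u₀ ^ 2 * dl Γ c)) * E (s / dl Γ c) := by
    intro s
    rw [hE]
    have e : ∀ a, Fam.dt (q Γ a) c s θ = Real.sqrt (dl Γ c) / |u₀| / dl Γ c
        * deriv (fun t => (Γ c).ψ.toFun (Γ c).i t θ 0 a) (s / dl Γ c) := by
      intro a
      have hdiff : Differentiable ℝ fun t => (Γ c).ψ.toFun (Γ c).i t θ 0 a :=
        (((Γ c).ψ.smooth (Γ c).i 0 a).comp (contDiff_id.prodMk contDiff_const)).differentiable
          (by simp)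
      have k1 : HasDerivAt (fun s : ℝ => s / dl Γ c) (1 / dl Γ c) s :=
        (hasDerivAt_id s).div_const _
      have k2 := ((hdiff (s / dl Γ c)).hasDerivAt.comp s k1).const_mul (Real.sqrt (dl Γ c) / |u₀|)
      have k3 := k2.deriv
      have k4 : Fam.dt (q Γ a) c s θ = deriv (fun y => Real.sqrt (dl Γ c) / |u₀| *
        ((fun t => (Γ c).ψ.toFun (Γ c).i t θ 0 a) ∘ fun s => s / dl Γ c) y) s := rfl
      rw [k4, k3]
      ring
    have s1 : (fun t => (Γ c).ψ.toFun (Γ c).i t θ 1 0) = fun t => (Γ c).ψ.toFun (Γ c).i t θ 0 1 :=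
      funext fun t => ((Γ c).ψ.symm (Γ c).i t θ).apply 0 1
    have s2 : (fun t => (Γ c).ψ.toFun (Γ c).i t θ 1 1) = fun t => -(Γ c).ψ.toFun (Γ c).i t θ 0 0 := by
      funext t
      have := (Γ c).ψ.traceFree (Γ c).i t θ
      rw [Matrix.trace_fin_two] at this
      linarith
    have hsq := Real.sq_sqrt hd.le
    have hab := sq_abs u₀
    have hn : |u₀| ≠ 0 := abs_ne_zero.2 hu
    simp only [en, Pi.smul_apply, Pi.add_apply, Pi.mul_apply, smul_eq_mul, e, Fin.sum_univ_two, s1,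
      s2, deriv.fun_neg, ← hab]
    field_simp
    rw [hsq]
    ring
  have h4 : ∫ s in (0 : ℝ)..dl Γ c, en Γ c s θ = 2 * m₀ / u₀ ^ 2 := by
    have h5 := intervalIntegral.integral_comp_div (a := 0) (b := dl Γ c) E hd.ne'
    have h6 : ∫ s in (0 : ℝ)..1, E s = 16 * m₀ := h2
    rw [intervalIntegral.integral_congr (fun s _ => h3 s), intervalIntegral.integral_const_mul, h5,
      zero_div, div_self hd.ne', h6, smul_eq_mul]
    field_simp
    ring
  rw [mf, ← intervalIntegral.integral_add_adjacent_intervals (hi 0 (dl Γ c)) (hi _ t), h1, h4,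
    add_zero]

end Config

end

/-! ### Size of the pulse and of its energy -/

section

variable {ι : Type*} {δ : ι → ℝ}

namespace Short

variable (hδ : Short δ)
include hδ

/-- Time derivatives of the pulse have size δ^{-1/2}. A product of two of them has size 1/δ and
integrates over the pulse to a finite mass. -/
theorem lam_mul_ε_sq (c : ι) (t : ℝ) :
    (lam δ c t * ε δ c) * (lam δ c t * ε δ c) = lam δ c t := by
  have h1 := hδ.ε_sq c
  have h2 := (hδ c).1
  unfold lam
  split_ifs
  · calc (δ c)⁻¹ * ε δ c * ((δ c)⁻¹ * ε δ c) = (δ c)⁻¹ * (δ c)⁻¹ * (ε δ c * ε δ c) := by ring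
      _ = (δ c)⁻¹ := by rw [h1]; field_simp
  · simp

theorem lam_mul_ε_le (c : ι) (t : ℝ) : lam δ c t * ε δ c ≤ μ δ c t * ε δ c :=
  mul_le_mul_of_nonneg_right (lam_le_μ c t) (hδ.ε_pos c).le

theorem lam_mul_ε_nonneg (c : ι) (t : ℝ) : 0 ≤ lam δ c t * ε δ c :=
  mul_nonneg (hδ.lam_nonneg c t) (hδ.ε_pos c).le

end Short

namespace Config

variable {u₀ m₀ : ℝ} {Γ : ι → Config u₀ m₀} {n : ℕ} {B : ℝ}

variable (hA : Admissible u₀ m₀) (hδ : Short (dl Γ)) (hB : ∀ c, (Γ c).ψ.CnBound (n + 1) B)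
include hA hδ hB

omit hδ in
theorem ctl_q' (a : Fin 2) : Ctl (dl Γ) n (fun c _ => ε (dl Γ) c) (q Γ a) :=
  (ctl_q hA.lt hB a).of_le (Nat.le_succ n)

omit hδ in
theorem ctl_dt_q' (a : Fin 2) :
    Ctl (dl Γ) n (fun c t => lam (dl Γ) c t * ε (dl Γ) c) (Fam.dt (q Γ a)) :=
  ctl_dt_q hA.lt hB a

theorem ap_em (A C : Fin 2) : Ap (dl Γ) n false (em Γ A C)
    (fun _ _ _ => (1 : Matrix (Fin 2) (Fin 2) ℝ) A C) := by
  refine ⟨Ctl.const _, ?_⟩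
  have h := Ctl.comp_sub (contDiff_expF A C)
    (fun c t _ => ⟨(hδ.ε_pos c).le, hδ.ε_le_one c⟩) (ctl_q' hA hB)
  rw [expF_zero] at h
  exact h

theorem ctl_comp_pd (A C a : Fin 2) : Ctl (dl Γ) n (fun c _ => ε (dl Γ) c)
    (Fam.comp (pd a (expF A C)) (q Γ) - fun _ _ _ => symTF (Pi.single a 1) A C) := by
  have h := Ctl.comp_sub (contDiff_pd (contDiff_expF A C) a)
    (fun c t _ => ⟨(hδ.ε_pos c).le, hδ.ε_le_one c⟩) (ctl_q' hA hB)
  rw [pd_expF_zero] at h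
  exact h

/-- The linearization of the derivative of the exponential. -/
theorem ctl_dt_em_sub (A C : Fin 2) : Ctl (dl Γ) n (fun c t => lam (dl Γ) c t * ε (dl Γ) c * ε (dl Γ) c)
    (Fam.dt (em Γ A C) - ∑ a, (symTF (Pi.single a 1) A C) • Fam.dt (q Γ a)) := by
  have h : Ctl (dl Γ) n (fun c t => lam (dl Γ) c t * ε (dl Γ) c * ε (dl Γ) c)
      (∑ a, (Fam.dt (q Γ a) * (Fam.comp (pd a (expF A C)) (q Γ)
        - fun _ _ _ => symTF (Pi.single a 1) A C))) :=
    Ctl.sum fun a _ => (ctl_dt_q' hA hB a).mul (ctl_comp_pd hA hδ hB A C a)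
  refine h.congr fun c t ht θ => ?_
  have e := JS.dt_comp (contDiff_expF A C) (js_q Γ) c t ht θ
  simp only [Finset.sum_apply, Pi.mul_apply, Pi.sub_apply, Pi.smul_apply, smul_eq_mul] at e ⊢
  rw [em, e, ← Finset.sum_sub_distrib]
  exact Finset.sum_congr rfl fun a _ => by ring

theorem ctl_dt_em (A C : Fin 2) :
    Ctl (dl Γ) n (fun c t => lam (dl Γ) c t * ε (dl Γ) c) (Fam.dt (em Γ A C)) := by
  have h1 := (ctl_dt_em_sub hA hδ hB A C).mono
    (s' := fun c t => lam (dl Γ) c t * ε (dl Γ) c) 1 fun c t _ =>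
      ⟨mul_nonneg (hδ.lam_mul_ε_nonneg c t) (hδ.ε_pos c).le, by
        rw [one_mul]
        exact mul_le_of_le_one_right (hδ.lam_mul_ε_nonneg c t) (hδ.ε_le_one c)⟩
  have h2 : Ctl (dl Γ) n (fun c t => lam (dl Γ) c t * ε (dl Γ) c)
      (∑ a, (symTF (Pi.single a 1) A C) • Fam.dt (q Γ a)) :=
    Ctl.sum fun a _ => (ctl_dt_q' hA hB a).const_mul _
  exact (h1.add h2).congr fun c t _ θ => by simp

theorem ap_dt_em (A C : Fin 2) : Ap (dl Γ) n true (Fam.dt (em Γ A C)) 0 :=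
  Ap.zero_iff.2 ((ctl_dt_em hA hδ hB A C).mono 1 fun c t _ =>
    ⟨hδ.lam_mul_ε_nonneg c t, by rw [one_mul]; exact hδ.lam_mul_ε_le c t⟩)

theorem ctl_en : Ctl (dl Γ) n (lam (dl Γ)) (en Γ) := by
  have h := fun a => ((ctl_dt_q' hA hB a).mul (ctl_dt_q' hA hB a)).mono (s' := lam (dl Γ)) 1
    fun c t _ => ⟨mul_nonneg (hδ.lam_mul_ε_nonneg c t) (hδ.lam_mul_ε_nonneg c t), by
      rw [one_mul]; exact (hδ.lam_mul_ε_sq c t).le⟩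
  exact ((h 0).add (h 1)).const_mul (1 / 4)

theorem ctl_dem : Ctl (dl Γ) n (lam (dl Γ)) (dem Γ) := by
  have h := fun A C A' C' => ((ctl_dt_em hA hδ hB A C).mul (ctl_dt_em hA hδ hB A' C')).mono
    (s' := lam (dl Γ)) 1
    fun c t _ => ⟨mul_nonneg (hδ.lam_mul_ε_nonneg c t) (hδ.lam_mul_ε_nonneg c t), by
      rw [one_mul]; exact (hδ.lam_mul_ε_sq c t).le⟩
  exact (h 0 0 1 1).sub (h 0 1 0 1)

/-- The linearized ∂e^ψ is ∂ψ, whose determinant is −4`en`. The remainder `r` has an additional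
factor ε, so after this cancellation 1/δ is improved to δ^{-1/2}. -/
theorem ctl_dem_add_en :
    Ctl (dl Γ) n (errScale (dl Γ) true) ((1 / 4 : ℝ) • dem Γ + en Γ) := by
  let r : Fin 2 → Fin 2 → Fam ι := fun A C =>
    Fam.dt (em Γ A C) - ∑ a, (symTF (Pi.single a 1) A C) • Fam.dt (q Γ a)
  have hr : ∀ A C, Ctl (dl Γ) n (fun c t => lam (dl Γ) c t * ε (dl Γ) c * ε (dl Γ) c) (r A C) :=
    ctl_dt_em_sub hA hδ hB
  have hr' := fun A C => (hr A C).mono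
    (s' := fun c t => lam (dl Γ) c t * ε (dl Γ) c) 1 fun c t _ =>
      ⟨mul_nonneg (hδ.lam_mul_ε_nonneg c t) (hδ.ε_pos c).le, by
        rw [one_mul]
        exact mul_le_of_le_one_right (hδ.lam_mul_ε_nonneg c t) (hδ.ε_le_one c)⟩
  have hm : ∀ {f : Fam ι} (A C : Fin 2), Ctl (dl Γ) n (fun c t => lam (dl Γ) c t * ε (dl Γ) c) f →
      Ctl (dl Γ) n (errScale (dl Γ) true) (f * r A C) := fun A C hf =>
    (hf.mul (hr A C)).mono 1 fun c t _ => ⟨mul_nonneg (hδ.lam_mul_ε_nonneg c t)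
      (mul_nonneg (hδ.lam_mul_ε_nonneg c t) (hδ.ε_pos c).le), by
        have h1 := hδ.lam_mul_ε_sq c t
        have h2 := hδ.lam_mul_ε_le c t
        simp only [Pi.mul_apply, errScale, one_mul]
        calc lam (dl Γ) c t * ε (dl Γ) c * (lam (dl Γ) c t * ε (dl Γ) c * ε (dl Γ) c)
            = (lam (dl Γ) c t * ε (dl Γ) c) * (lam (dl Γ) c t * ε (dl Γ) c) * ε (dl Γ) c := by ring
          _ = lam (dl Γ) c t * ε (dl Γ) c := by rw [h1]
          _ ≤ _ := h2⟩
  have h := ((((hm 1 1 (ctl_dt_q' hA hB 0)).sub (hm 0 0 (ctl_dt_q' hA hB 0))).add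
    (hm 1 1 (hr' 0 0))).sub ((hm 0 1 (ctl_dt_q' hA hB 1)).const_mul 2)).sub (hm 0 1 (hr' 0 1))
  refine (h.const_mul (1 / 4)).congr fun c t _ θ => ?_
  simp only [r, dem, en, symTF, Fin.sum_univ_two, Pi.add_apply, Pi.sub_apply, Pi.mul_apply,
    Pi.smul_apply, smul_eq_mul]
  simp
  ring

theorem ctl_mf : Ctl (dl Γ) n 1 (mf Γ) := by
  have h := Ctl.ode (κ := Unit) (δ := dl Γ) dl_pos (σ := fun _ => 1) (fun _ => zero_le_one)
    (y := fun _ => mf Γ) (f := fun _ => en Γ) (M := 0) (fun _ => js_mf)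
    (fun _ c t _ θ => by simp [dt_mf]) (j := n) (fun _ _ => Ctl.zero)
    (fun _ => (ctl_en hA hδ hB).mono 1 fun c t _ => ⟨hδ.lam_nonneg c t, by
      simpa using Short.lam_le_μ c t⟩)
    (fun _ => Ctl.zero.congr fun c t _ θ => by simp [mf_zero]) ()
  exact h

end Config

end

/-! ### The conformal factor against the Schwarzschild radius -/

section

variable {ι : Type*} {δ : ι → ℝ}

namespace Config

variable {u₀ m₀ : ℝ} {Γ : ι → Config u₀ m₀} {n : ℕ} {B : ℝ}

theorem zero_mem (c : ι) : (0 : ℝ) ∈ Set.Icc 0 (dl Γ c + 1) :=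
  ⟨le_rfl, by linarith [dl_pos (Γ := Γ) c]⟩

theorem gm_corner (c : ι) (θ : Fin 2 → ℝ) (A C : Fin 2) : gm Γ A C c 0 θ
    = u₀ ^ 2 * roundFactor θ * (1 : Matrix (Fin 2) (Fin 2) ℝ) A C := by
  have h := (Γ c).data.sphereMetric_incoming (Γ c).i u₀ ⟨le_rfl, (Γ c).lt.le⟩ θ
  rw [gm, fam, h, Matrix.smul_apply, smul_eq_mul, sq_abs]

theorem phi_corner (hu : u₀ < -2) (c : ι) (θ : Fin 2 → ℝ) : phi Γ c 0 θ = 1 := by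
  have hr := roundFactor_pos θ
  have hu' : 0 < u₀ ^ 2 := by nlinarith
  rw [phi]
  simp only [gm_corner]
  simp
  rw [Real.sqrt_mul_self (by positivity), div_self (by positivity)]

theorem em_zero (c : ι) (θ : Fin 2 → ℝ) (A C : Fin 2) :
    em Γ A C c 0 θ = (1 : Matrix (Fin 2) (Fin 2) ℝ) A C := by
  have : (fun a => q Γ a c 0 θ) = 0 := funext fun a => q_eq_zero Γ a c (Or.inr le_rfl) θ
  rw [em, Fam.comp, this, expF_zero]

/-- The unimodular matrix e^ψ contributes nothing to the trace, so tr χ = 2φ'/φ; at the corner φ = 1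
and tr χ = 2/|u₀|. -/
theorem dt_phi_corner (hu : u₀ < -2) (c : ι) (θ : Fin 2 → ℝ) :
    Fam.dt (phi Γ) c 0 θ = 1 / |u₀| := by
  have h0 := zero_mem (Γ := Γ) c
  have h := (Γ c).data.trchi_corner (Γ c).i θ
  have hx := mem_cone (Γ := Γ) h0 θ
  have hr := roundFactor_pos θ
  have hu' : 0 < u₀ ^ 2 := by nlinarith
  obtain ⟨g1, g2, g3, g4⟩ := gi_conformal (Γ := Γ) hu h0 θ
  have hgi : ∀ A B, ((Γ c).S.sphereMetric (Γ c).i (pt 0 u₀ θ))⁻¹ A B = gi Γ A B c 0 θ :=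
    fun _ _ => rfl
  have hfX : ∀ A B, (Γ c).S.X (Γ c).i A B (pt 0 u₀ θ) = fX Γ A B c 0 θ := fun _ _ => rfl
  have hXe := fun A B => fX_eq (Γ := Γ) hu A B c 0 h0 θ
  have e1 := dt_pf (Γ := Γ) hu c 0 h0 θ
  have h1 := em_det_dt (Γ := Γ) c 0 h0 θ
  have e3 : pf Γ c 0 θ = phi Γ c 0 θ * phi Γ c 0 θ * (u₀ ^ 2 * roundFactor θ) := rfl
  simp only [Pi.add_apply, Pi.sub_apply, Pi.mul_apply, Pi.smul_apply, smul_eq_mul,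
    phi_corner hu, Pi.zero_apply] at e1 e3 hXe h1
  have hn : u₀ ^ 2 * roundFactor θ ≠ 0 := by positivity
  simp only [Spacetime.trchi, (gauge c).chi_cone hx, Fin.sum_univ_two, hgi, hfX, g1, g2, g3, g4,
    hXe, em_zero, e3, e1] at h
  simp only [em_zero] at h1
  simp at h h1
  have hu0 : u₀ ≠ 0 := by linarith
  have h2 : |u₀| ≠ 0 := abs_ne_zero.2 hu0
  field_simp at h ⊢
  linear_combination (1 / 4) * h - |u₀| / 4 * h1

/-- The reference value of `φ`. -/
def phi0 (Γ : ι → Config u₀ m₀) : Fam ι := fun c t θ => rr Γ c t θ / |u₀|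

variable (hA : Admissible u₀ m₀) (hδ : Short (dl Γ))
include hA hδ

theorem ctl_rr : Ctl (dl Γ) n 1 (rr Γ) := by
  refine Ctl.param (fun c t => schwR m₀ u₀ (dl Γ c) t) (|u₀| + 1) fun c t ht => ?_
  have h1 := hA.one_le_schwR (hδ c).2 ht.1
  have h2 := hA.schwR_le ht.2
  simp only [Pi.one_apply, mul_one]
  rw [abs_of_nonneg (by linarith)]
  exact h2

theorem rr_pos {c : ι} {t : ℝ} (ht : t ∈ Set.Icc 0 (dl Γ c + 1)) (θ : Fin 2 → ℝ) :
    1 ≤ rr Γ c t θ := hA.one_le_schwR (hδ c).2 ht.1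

omit hA hδ in
theorem contDiff_rr (c : ι) : ContDiff ℝ ∞ (schwR m₀ u₀ (dl Γ c)) := by
  unfold schwR
  fun_prop

theorem ctl_phi0 : Ctl (dl Γ) n 1 (phi0 Γ) :=
  ((ctl_rr hA hδ).const_mul (|u₀|)⁻¹).congr fun c t _ θ => by simp [phi0]; ring

omit hA hδ in
theorem phi0_sub_one (hA : Admissible u₀ m₀) (c : ι) (t : ℝ) (θ : Fin 2 → ℝ) :
    phi0 Γ c t θ - 1 = (1 - 2 * m₀ / |u₀|) / |u₀| * (t - dl Γ c) := by
  have := hA.abs_gt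
  have h2 : |u₀| ≠ 0 := by linarith
  simp only [phi0, rr, schwR]
  field_simp
  ring

variable (hB : ∀ c, (Γ c).ψ.CnBound (n + 1) B)
include hB

/-- The part of the mass function which has not yet arrived. -/
theorem ctl_mass_sub : Ctl (dl Γ) n (errScale (dl Γ) true)
    ((fun _ _ _ => 2 * m₀ / u₀ ^ 2) - mf Γ) := by
  have h := ((Ctl.const (2 * m₀ / u₀ ^ 2)).sub (ctl_mf hA hδ hB)).cutoff
    (fun c t ht θ => by simp [mf_eq hA c ht θ])
  refine h.mono 1 fun c t _ => ?_
  split_ifs with hlt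
  · exact ⟨zero_le_one, by simpa [errScale] using hδ.one_le_μ_mul_ε hlt⟩
  · exact ⟨le_rfl, by simpa using (hδ.errScale_pos true c t).le⟩

/-- φ'' has size 1/δ during the pulse, too large for an error source. Adding the accumulated mass to
φ' removes the leading part −`en`. For y₀ = φ − φ₀ and y₁ = φ' + m − 1/|u₀| one gets y₀' = y₁ +
(2m₀/u₀² − m) and y₁' = ¼ det(∂e^ψ) y₀ + ¼ det(∂e^ψ)(φ₀ − 1) + (¼ det(∂e^ψ) + `en`), and both
sources are of size μ ε. -/
theorem ctl_phi_sub_aux : ∀ a : Fin 2, Ctl (dl Γ) n (fun c _ => ε (dl Γ) c)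
    ((![phi Γ - phi0 Γ, Fam.dt (phi Γ) + mf Γ - fun _ _ _ => 1 / |u₀|] : Fin 2 → Fam ι) a) := by
  have hu := hA.lt
  have hab := hA.abs_gt
  have jp := js_phi (Γ := Γ) hu
  have jp0 : JS (dl Γ) (phi0 Γ) := JS.param (a := fun c t => schwR m₀ u₀ (dl Γ c) t / |u₀|)
    fun c _ _ => ((contDiff_rr c).div_const _).contDiffAt
  have jc : JS (dl Γ) (fun _ _ _ => 1 / |u₀|) := JS.fixed (F := fun _ => 1 / |u₀|) contDiff_const
  have dphi0 : ∀ c t θ, Fam.dt (phi0 Γ) c t θ = (1 - 2 * m₀ / |u₀|) / |u₀| := by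
    intro c t θ
    have h2 : HasDerivAt (fun s => (|u₀| + (1 - 2 * m₀ / |u₀|) * (s - dl Γ c)) / |u₀|)
      ((1 - 2 * m₀ / |u₀|) * 1 / |u₀|) t :=
      ((((hasDerivAt_id' t).sub_const _).const_mul _).const_add _).div_const _
    rw [mul_one] at h2
    exact h2.deriv
  -- During the pulse φ₀ − 1 = O(δ) compensates the size 1/δ of the determinant; after the pulse the
  -- determinant vanishes.
  have hdem : Ctl (dl Γ) n (errScale (dl Γ) true) ((1 / 4 : ℝ) • dem Γ * (phi0 Γ - 1)
      + ((1 / 4 : ℝ) • dem Γ + en Γ)) := by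
    refine Ctl.add ?_ (ctl_dem_add_en hA hδ hB)
    have h1 : Ctl (dl Γ) n (fun c t => if t < dl Γ c then dl Γ c else 1) (phi0 Γ - 1) := by
      refine (Ctl.param (fun c t => (1 - 2 * m₀ / |u₀|) / |u₀| * (t - dl Γ c)) 1
        fun c t ht => ?_).congr fun c t _ θ => (phi0_sub_one hA c t θ).symm
      have f1 := hA.f_pos
      have f2 := hA.f_lt_one
      have f3 : (1 - 2 * m₀ / |u₀|) / |u₀| ≤ 1 := (div_le_one (by linarith)).2 (by linarith)
      have f4 : 0 ≤ (1 - 2 * m₀ / |u₀|) / |u₀| := div_nonneg f1.le (by linarith)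
      rw [abs_mul, abs_of_nonneg f4, one_mul]
      have hd := (hδ c).1
      refine (mul_le_of_le_one_left (abs_nonneg _) f3).trans ?_
      split_ifs with hlt
      · rw [abs_of_nonpos (by linarith)]; linarith [ht.1]
      · rw [abs_of_nonneg (by linarith)]; linarith [ht.2]
    have h2 := ((ctl_dem hA hδ hB).const_mul (1 / 4)).mul h1
    refine h2.mono 1 fun c t _ => ?_
    have hd := (hδ c).1
    simp only [Pi.mul_apply, lam, one_mul]
    split_ifs with hlt
    · rw [inv_mul_cancel₀ hd.ne']
      exact ⟨zero_le_one, hδ.one_le_μ_mul_ε hlt⟩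
    · simpa using (hδ.errScale_pos true c t).le
  have hone : ∀ c t, 1 ≤ μ (dl Γ) c t := hδ.one_le_μ
  refine Ctl.ode (fun c => (hδ c).1) (σ := ε (dl Γ)) (fun c => (hδ.ε_pos c).le)
    (f := ![(fun _ _ _ => 2 * m₀ / u₀ ^ 2) - mf Γ,
      (1 / 4 : ℝ) • dem Γ * (phi0 Γ - 1) + ((1 / 4 : ℝ) • dem Γ + en Γ)])
    (M := ![![0, 1], ![(1 / 4 : ℝ) • dem Γ, 0]]) ?_ ?_ ?_ ?_ ?_
  · intro a
    fin_cases a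
    · exact jp.sub jp0
    · exact (jp.dt.add js_mf).sub jc
  · intro a c t ht θ
    fin_cases a
    · simp only [Fin.zero_eta, Fin.isValue, Matrix.cons_val_zero, Fin.sum_univ_two,
        Matrix.cons_val_one, Pi.add_apply, Pi.mul_apply, Pi.sub_apply]
      rw [jp.dt_sub jp0 c t ht θ, Pi.sub_apply, Pi.sub_apply, Pi.sub_apply, dphi0]
      have hsq := sq_abs u₀
      have hn : |u₀| ≠ 0 := by linarith
      simp only [Pi.zero_apply, Pi.one_apply, ← hsq]
      field_simp
      ring
    · simp only [Fin.mk_one, Fin.isValue, Matrix.cons_val_zero, Fin.sum_univ_two,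
        Matrix.cons_val_one, Pi.add_apply, Pi.mul_apply, Pi.sub_apply]
      rw [(jp.dt.add js_mf).dt_sub jc c t ht θ]
      simp only [Pi.sub_apply]
      rw [jp.dt.dt_add js_mf c t ht θ]
      simp only [Pi.add_apply]
      rw [dt_dt_phi hu c t ht θ, dt_mf]
      have : Fam.dt (fun _ _ _ => 1 / |u₀|) c t θ = 0 := by simp [Fam.dt]
      rw [this]
      simp only [dem, Pi.smul_apply, Pi.mul_apply, Pi.sub_apply, smul_eq_mul, Pi.zero_apply,
        Pi.one_apply]
      ring
  · intro a b
    have h1 : Ctl (dl Γ) n (μ (dl Γ)) (1 : Fam ι) := by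
      refine (Ctl.const 1).mono 1 fun c t _ => ⟨zero_le_one, ?_⟩
      simpa using hone c t
    fin_cases a <;> fin_cases b
    · exact Ctl.zero
    · exact h1
    · exact ((ctl_dem hA hδ hB).mono 1 fun c t _ =>
        ⟨hδ.lam_nonneg c t, by simpa using Short.lam_le_μ c t⟩).const_mul (1 / 4)
    · exact Ctl.zero
  · intro a
    fin_cases a
    · exact ctl_mass_sub hA hδ hB
    · exact hdem
  · intro a
    fin_cases a
    · refine (Ctl.param (fun c _ => (1 - 2 * m₀ / |u₀|) / |u₀| * dl Γ c) 1 fun c t _ => ?_).congr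
        fun c t _ θ => ?_
      · have f1 := hA.f_pos
        have f2 := hA.f_lt_one
        have f3 : (1 - 2 * m₀ / |u₀|) / |u₀| ≤ 1 := (div_le_one (by linarith)).2 (by linarith)
        have f4 : 0 ≤ (1 - 2 * m₀ / |u₀|) / |u₀| := div_nonneg f1.le (by linarith)
        have e1 := hδ.ε_sq c
        have e2 := hδ.ε_le_one c
        have e3 := hδ.ε_pos c
        have hd := (hδ c).1
        rw [abs_of_nonneg (by positivity), one_mul]
        calc _ ≤ dl Γ c := mul_le_of_le_one_left hd.le f3
          _ = ε (dl Γ) c * ε (dl Γ) c := e1.symm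
          _ ≤ _ := mul_le_of_le_one_right e3.le e2
      · have := phi0_sub_one (Γ := Γ) hA c 0 θ
        simp only [Fin.zero_eta, Fin.isValue, Matrix.cons_val_zero, Pi.sub_apply,
          phi_corner hu]
        linarith
    · refine Ctl.zero.congr fun c t _ θ => ?_
      simp [dt_phi_corner hu, mf_zero]

theorem ap_phi : Ap (dl Γ) n false (phi Γ) (phi0 Γ) :=
  ⟨ctl_phi0 hA hδ, ctl_phi_sub_aux hA hδ hB 0⟩

theorem ap_dt_phi : Ap (dl Γ) n true (Fam.dt (phi Γ))
    (fun _ _ _ => (1 - 2 * m₀ / |u₀|) / |u₀|) := by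
  refine ⟨Ctl.const _, ?_⟩
  have h1 := (ctl_phi_sub_aux hA hδ hB 1).mono (s' := errScale (dl Γ) true) 1 fun c t _ =>
    ⟨(hδ.ε_pos c).le, by simpa using hδ.ε_le_errScale true c t⟩
  refine (h1.add (ctl_mass_sub hA hδ hB)).congr fun c t _ θ => ?_
  have hab := hA.abs_gt
  have hsq := sq_abs u₀
  have hn : |u₀| ≠ 0 := by linarith
  simp only [Fin.isValue, Matrix.cons_val_one, Matrix.cons_val_fin_one, Pi.add_apply,
    Pi.sub_apply, ← hsq]
  field_simp
  ring

/-- A lower bound of the conformal factor for short pulses. -/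
theorem exists_phi_lower : ∃ d > 0, ∀ c, dl Γ c < d → ∀ t ∈ Set.Icc 0 (dl Γ c + 1),
    ∀ θ, rsq θ ≤ 4 → 1 / 4 ≤ phi Γ c t θ := by
  obtain ⟨C, hC⟩ := (ap_phi hA hδ hB).2.2.zero
  -- For such δ the error of φ is at most 1/4. The reference φ₀ is at least 1/2, because its slope
  -- is at most 1/2 and it equals 1 at time δ < 1.
  refine ⟨(1 / (4 * (|C| + 1))) ^ 2, by positivity, fun c hc t ht θ hθ => ?_⟩
  have h1 := hC c t ht θ hθ
  have h2 : ε (dl Γ) c ≤ 1 / (4 * (|C| + 1)) := by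
    refine Real.sqrt_le_iff.2 ⟨by positivity, hc.le⟩
  have h3 : C * ε (dl Γ) c ≤ 1 / 4 := by
    calc C * ε (dl Γ) c ≤ (|C| + 1) * ε (dl Γ) c :=
          mul_le_mul_of_nonneg_right (by linarith [le_abs_self C]) (hδ.ε_pos c).le
      _ ≤ (|C| + 1) * (1 / (4 * (|C| + 1))) :=
          mul_le_mul_of_nonneg_left h2 (by positivity)
      _ = 1 / 4 := by field_simp
  have h4 := phi0_sub_one (Γ := Γ) hA c t θ
  have f1 := hA.f_pos
  have f2 := hA.f_lt_one
  have hab := hA.abs_gt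
  have f3 : (1 - 2 * m₀ / |u₀|) / |u₀| ≤ 1 / 2 :=
    (div_le_div_iff₀ (by linarith) (by norm_num)).2 (by linarith)
  have f4 : 0 ≤ (1 - 2 * m₀ / |u₀|) / |u₀| := div_nonneg f1.le (by linarith)
  have h5 := (abs_le.1 (h1.trans h3)).1
  simp only [Pi.sub_apply] at h5
  have hd := hδ c
  have h6 := ht.1
  nlinarith

end Config

end

/-! ### Sphere metric and χ against their reference values -/

section

theorem roundFactor_ge {θ : Fin 2 → ℝ} (h : rsq θ ≤ 4) : 1 / 4 ≤ roundFactor θ := by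
  have h0 := rsq_nonneg θ
  unfold roundFactor
  rw [div_le_div_iff₀ (by norm_num) (by positivity)]
  nlinarith

variable {ι : Type*} {δ : ι → ℝ}

/-- The Kronecker symbol. -/
def kd (A C : Fin 2) : ℝ := (1 : Matrix (Fin 2) (Fin 2) ℝ) A C

namespace Config

variable {u₀ m₀ : ℝ} {Γ : ι → Config u₀ m₀} {n : ℕ} {B : ℝ}

/-- A lower bound for the conformal factor. -/
def Low (Γ : ι → Config u₀ m₀) : Prop := ∀ c, ∀ t ∈ Set.Icc 0 (dl Γ c + 1), ∀ θ, rsq θ ≤ 4 →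
  1 / 4 ≤ phi Γ c t θ

variable (Γ) in
/-- The reference value of the metric. -/
def gm0 (A C : Fin 2) : Fam ι := fun c t θ => rr Γ c t θ ^ 2 * roundFactor θ * kd A C

variable (Γ) in
/-- The reference value of the inverse metric. -/
def gi0 (A C : Fin 2) : Fam ι := fun c t θ => kd A C / (rr Γ c t θ ^ 2 * roundFactor θ)

variable (Γ) in
/-- The reference value of `χ`. -/
def fX0 (A C : Fin 2) : Fam ι :=
  fun c t θ => (1 - 2 * m₀ / |u₀|) * rr Γ c t θ * roundFactor θ * kd A C

variable (hA : Admissible u₀ m₀) (hδ : Short (dl Γ)) (hB : ∀ c, (Γ c).ψ.CnBound (n + 1) B)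
include hA hδ hB

omit hA hδ hB in
theorem ap_P : Ap (dl Γ) n false (fun _ _ θ => u₀ ^ 2 * roundFactor θ)
    (fun _ _ θ => u₀ ^ 2 * roundFactor θ) :=
  Ap.exact' (Ctl.fixed (contDiff_const.mul contDiff_roundFactor))

theorem ap_pf : Ap (dl Γ) n false (pf Γ) (fun c t θ => rr Γ c t θ ^ 2 * roundFactor θ) := by
  have h := ap_phi hA hδ hB
  refine ((h.mul hδ h).mul hδ ap_P).congr (fun _ _ _ _ => rfl) fun c t _ θ => ?_
  have hab := hA.abs_gt
  have hsq := sq_abs u₀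
  have hn : |u₀| ≠ 0 := by linarith
  simp only [Pi.mul_apply, phi0, ← hsq]
  field_simp

theorem ap_dt_pf : Ap (dl Γ) n true (Fam.dt (pf Γ))
    (fun c t θ => 2 * (1 - 2 * m₀ / |u₀|) * rr Γ c t θ * roundFactor θ) := by
  have h := ap_phi hA hδ hB
  have h' := ap_dt_phi hA hδ hB
  refine (((h'.mul hδ h).mul hδ ap_P).smul 2).congr (fun c t ht θ => ?_)
    fun c t _ θ => ?_
  · rw [dt_pf hA.lt c t ht θ]
    simp only [Pi.smul_apply, Pi.mul_apply, smul_eq_mul]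
    ring
  · have hab := hA.abs_gt
    have hsq := sq_abs u₀
    have hn : |u₀| ≠ 0 := by linarith
    simp only [Pi.smul_apply, Pi.mul_apply, smul_eq_mul, phi0, ← hsq]
    field_simp

theorem ap_gm (A C : Fin 2) : Ap (dl Γ) n false (gm Γ A C) (gm0 Γ A C) :=
  ((ap_pf hA hδ hB).mul hδ (ap_em hA hδ hB A C)).congr
    (fun _ _ ht θ => ((conformal hA.lt ht θ).2 A C).symm) fun _ _ _ _ => rfl

/-- The term φ²∂e^ψ is of size δ^{-1/2} during the pulse and absent afterwards, so χ is approximated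
in the weighted scale only. -/
theorem ap_fX (A C : Fin 2) : Ap (dl Γ) n true (fX Γ A C) (fX0 Γ A C) := by
  have h1 := (ap_dt_pf hA hδ hB).mul hδ (ap_em hA hδ hB A C)
  have h2 := (ap_dt_em hA hδ hB A C).mul hδ (ap_pf hA hδ hB)
  refine ((h1.add h2).smul (1 / 2)).congr (fun c t ht θ => ?_) fun c t _ θ => ?_
  · rw [fX_eq hA.lt A C c t ht θ]
    simp only [Pi.smul_apply, Pi.add_apply, Pi.mul_apply, smul_eq_mul]
    ring
  · simp only [Pi.smul_apply, Pi.add_apply, Pi.mul_apply, smul_eq_mul, Pi.zero_apply, fX0, kd]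
    ring

theorem ap_inv_pf (hL : Low Γ) : Ap (dl Γ) n false (pf Γ)⁻¹
    (fun c t θ => rr Γ c t θ ^ 2 * roundFactor θ)⁻¹ := by
  have hsq : 4 ≤ u₀ ^ 2 := by nlinarith [hA.lt]
  -- 1/16 comes from φ ≥ 1/4, together with u₀² ≥ 4 and a round factor at least 1/4 on the closed
  -- disc.
  refine (ap_pf hA hδ hB).inv hδ (fun c t ht θ => (pf_pos hA.lt ht θ).ne')
    (fun c t ht θ => ?_) (m := 1 / 16) (by norm_num) (fun c t ht θ hθ => ?_)
    fun c t ht θ hθ => ?_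
  · have h1 := rr_pos hA hδ ht θ
    have h2 := roundFactor_pos θ
    have : 0 < rr Γ c t θ ^ 2 * roundFactor θ := by positivity
    exact this.ne'
  · rw [abs_of_pos (pf_pos hA.lt ht θ)]
    have h1 := hL c t ht θ hθ
    have h2 := roundFactor_ge hθ
    have h3 : 1 / 16 ≤ phi Γ c t θ * phi Γ c t θ := by nlinarith
    have h4 : 1 ≤ u₀ ^ 2 * roundFactor θ := by nlinarith
    exact h3.trans (le_mul_of_one_le_right (by linarith) h4)
  · have h1 := rr_pos hA hδ ht θ
    have h2 := roundFactor_ge hθ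
    refine le_trans ?_ (le_abs_self _)
    nlinarith

theorem ap_gi (hL : Low Γ) (A C : Fin 2) : Ap (dl Γ) n false (gi Γ A C) (gi0 Γ A C) := by
  have h := ap_inv_pf hA hδ hB hL
  have he := ap_em hA hδ hB
  have e := fun {c : ι} {t : ℝ} (ht : t ∈ Set.Icc 0 (dl Γ c + 1)) θ => gi_conformal (Γ := Γ) hA.lt ht θ
  fin_cases A <;> fin_cases C
  · refine ((he 1 1).mul hδ h).congr (fun c t ht θ => ?_) fun c t _ θ => ?_
    · simpa [div_eq_mul_inv] using (e ht θ).1.symm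
    · simp [gi0, kd]
  · refine ((he 0 1).neg.mul hδ h).congr (fun c t ht θ => ?_) fun c t _ θ => ?_
    · simpa [div_eq_mul_inv] using (e ht θ).2.1.symm
    · simp [gi0, kd]
  · refine ((he 0 1).neg.mul hδ h).congr (fun c t ht θ => ?_) fun c t _ θ => ?_
    · simpa [div_eq_mul_inv] using (e ht θ).2.2.1.symm
    · simp [gi0, kd]
  · refine ((he 0 0).mul hδ h).congr (fun c t ht θ => ?_) fun c t _ θ => ?_
    · simpa [div_eq_mul_inv] using (e ht θ).2.2.2.symm
    · simp [gi0, kd]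

end Config

end

section

/-! ### The round metric -/

/-- The first derivatives of the conformal factor of the round metric. -/
def rfD (A : Fin 2) : (Fin 2 → ℝ) → ℝ := pd A roundFactor

/-- The second derivatives of the conformal factor of the round metric. -/
def rfDD (A C : Fin 2) : (Fin 2 → ℝ) → ℝ := pd A (rfD C)

theorem contDiff_rfD (A : Fin 2) : ContDiff ℝ ∞ (rfD A) := contDiff_pd contDiff_roundFactor A

/-- The inverse square root of `roundFactor`. -/
def rq (θ : Fin 2 → ℝ) : ℝ := 1 / (1 + rsq θ / 4)

theorem hasFDerivAt_coord (A : Fin 2) (θ : Fin 2 → ℝ) :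
    HasFDerivAt (fun y : Fin 2 → ℝ => y A) (ContinuousLinearMap.proj (R := ℝ) A) θ :=
  (ContinuousLinearMap.proj (R := ℝ) (φ := fun _ : Fin 2 => ℝ) A).hasFDerivAt

theorem hasFDerivAt_rq (θ : Fin 2 → ℝ) : HasFDerivAt rq
    ((-(rq θ ^ 2 / 2)) • (θ 0 • ContinuousLinearMap.proj (R := ℝ) (φ := fun _ : Fin 2 => ℝ) 0
      + θ 1 • ContinuousLinearMap.proj (R := ℝ) (φ := fun _ : Fin 2 => ℝ) 1)) θ := by
  have h0 := hasFDerivAt_coord 0 θ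
  have h1 := hasFDerivAt_coord 1 θ
  have hpos : 1 + rsq θ / 4 ≠ 0 := by have := rsq_nonneg θ; positivity
  have h2 : HasFDerivAt (fun y : Fin 2 → ℝ => 1 + (1 / 4) * (y 0 * y 0 + y 1 * y 1)) _ θ :=
    (((h0.mul h0).add (h1.mul h1)).const_mul (1 / 4)).const_add 1
  have e : rq = fun y : Fin 2 → ℝ => (1 + (1 / 4) * (y 0 * y 0 + y 1 * y 1))⁻¹ := by
    funext y
    simp only [rq, rsq, one_div]
    ring_nf
  have e2 : 1 + (1 / 4) * (θ 0 * θ 0 + θ 1 * θ 1) = 1 + rsq θ / 4 := by simp only [rsq]; ring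
  have h3 := (hasDerivAt_inv (x := 1 + (1 / 4) * (θ 0 * θ 0 + θ 1 * θ 1))
    (by rw [e2]; exact hpos)).comp_hasFDerivAt θ h2
  rw [e]
  refine h3.congr_fderiv ?_
  ext v
  simp only [e2, smul_apply, add_apply,
    ContinuousLinearMap.proj_apply, smul_eq_mul]
  field_simp
  ring

theorem pd_rq (A : Fin 2) (θ : Fin 2 → ℝ) : pd A rq θ = -(rq θ ^ 2 / 2) * θ A := by
  rw [pd, (hasFDerivAt_rq θ).fderiv]
  fin_cases A <;> simp

theorem smoothAtOn_rq : SmoothAtOn Set.univ rq := by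
  intro θ _
  refine ContDiff.contDiffAt ?_
  unfold rq
  refine contDiff_const.div (contDiff_const.add (contDiff_rsq.div_const _)) fun θ => ?_
  have := rsq_nonneg θ
  positivity

theorem roundFactor_eq : roundFactor = fun θ => rq θ * rq θ := by
  funext θ
  simp only [roundFactor, rq, pow_two, one_div, mul_inv]

theorem rfD_eq (A : Fin 2) : rfD A = fun θ => -(rq θ * rq θ * rq θ) * θ A := by
  funext θ
  rw [rfD, roundFactor_eq, pd_mul A smoothAtOn_rq smoothAtOn_rq (Set.mem_univ θ), pd_rq]
  ring

theorem rfDD_eq (A C : Fin 2) (θ : Fin 2 → ℝ) : rfDD A C θ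
    = (3 / 2) * rq θ ^ 4 * θ A * θ C - rq θ ^ 3 * kd A C := by
  have hc : SmoothAtOn Set.univ (fun y : Fin 2 → ℝ => y C) := fun θ _ =>
    (contDiff_apply ℝ ℝ C).contDiffAt
  have hq := smoothAtOn_rq
  have e : pd A (fun y : Fin 2 → ℝ => y C) θ = kd A C := by
    rw [pd, (hasFDerivAt_coord C θ).fderiv]
    fin_cases A <;> fin_cases C <;> simp [kd]
  rw [rfDD, rfD_eq, pd_mul A ((hq.mul hq).mul hq).neg hc (Set.mem_univ θ), e,
    pd_neg, pd_mul A (hq.mul hq) hq (Set.mem_univ θ), pd_mul A hq hq (Set.mem_univ θ), pd_rq]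
  ring

theorem rfDD_symm (A C : Fin 2) (θ : Fin 2 → ℝ) : rfDD A C θ = rfDD C A θ := by
  rw [rfDD_eq, rfDD_eq, kd, kd, Matrix.one_apply, Matrix.one_apply]
  simp only [eq_comm (a := A) (b := C)]
  ring

/-- The round metric has curvature one. -/
theorem round_curvature (θ : Fin 2 → ℝ) : -(roundFactor θ * (rfDD 0 0 θ + rfDD 1 1 θ))
    + (rfD 0 θ ^ 2 + rfD 1 θ ^ 2) = 2 * roundFactor θ ^ 3 := by
  have h : rq θ * (1 + (θ 0 ^ 2 + θ 1 ^ 2) / 4) = 1 := by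
    have : 1 + rsq θ / 4 ≠ 0 := by have := rsq_nonneg θ; positivity
    rw [rq, one_div, rsq]
    exact inv_mul_cancel₀ this
  rw [rfDD_eq, rfDD_eq, rfD_eq, rfD_eq, roundFactor_eq]
  simp only [kd, Matrix.one_apply_eq]
  linear_combination -2 * rq θ ^ 5 * h

variable {ι : Type*} {δ : ι → ℝ}

namespace Config

variable {u₀ m₀ : ℝ} {Γ : ι → Config u₀ m₀} {n : ℕ}

/-- The assumptions on a family of solutions. -/
structure Good (Γ : ι → Config u₀ m₀) (n : ℕ) : Prop where
  adm : Admissible u₀ m₀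
  short : Short (dl Γ)
  low : Low Γ
  bound : ∃ B, ∀ c, (Γ c).ψ.CnBound (n + 1) B

variable (Γ) in
/-- Contraction with the inverse metric. -/
def ctrF (u : Fin 2 → Fin 2 → Fam ι) : Fam ι := ∑ C, ∑ D, u C D * gi Γ C D

variable (Γ) in
/-- Contraction with the reference inverse metric. -/
def ctrF0 (u : Fin 2 → Fin 2 → Fam ι) : Fam ι := ∑ C, ∑ D, u C D * gi0 Γ C D

variable (Γ) in
/-- The Christoffel symbols of the first kind of the spheres. -/
def fΓ (C A B : Fin 2) : Fam ι := fam Γ fun c => (Γ c).S.Γs (Γ c).i C A B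

variable (Γ) in
/-- The torsion. -/
def fc (A : Fin 2) : Fam ι := fam Γ fun c => (Γ c).S.c (Γ c).i A

variable (Γ) in
/-- The second fundamental form `χ̲`. -/
def fk (A B : Fin 2) : Fam ι := fam Γ fun c => (Γ c).S.k (Γ c).i A B

variable (Γ) in
/-- The derivative of the lapse. -/
def fw : Fam ι := fam Γ fun c => (Γ c).S.w (Γ c).i

variable (Γ) in
/-- The reference Christoffel symbols. -/
def fΓ0 (C A B : Fin 2) : Fam ι := fun c t θ => (1 / 2) * rr Γ c t θ ^ 2 *
  (rfD A θ * kd B C + rfD B θ * kd A C - rfD C θ * kd A B)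

variable (Γ) in
/-- The families of the components of the curvature. -/
def fR (a b c' d : Fin 4) : Fam ι :=
  fam Γ fun c => lowCurv ((Γ c).S.metric (Γ c).i) a b c' d

theorem sm_Γ (C A B : Fin 2) : Sm Γ fun c => (Γ c).S.Γs (Γ c).i C A B :=
  fun c => (Γ c).S.smoothAtOn_Γs _ C A B

theorem sm_c (A : Fin 2) : Sm Γ fun c => (Γ c).S.c (Γ c).i A := fun c => (gauge c).smoothAtOn_c A

theorem sm_k (A B : Fin 2) : Sm Γ fun c => (Γ c).S.k (Γ c).i A B :=
  fun c => (Γ c).S.smoothAtOn_k _ A B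

theorem sm_w : Sm Γ fun c => (Γ c).S.w (Γ c).i := fun c => (Γ c).S.smoothAtOn_w _

theorem sm_gm (A B : Fin 2) : Sm Γ fun c x => (Γ c).S.sphereMetric (Γ c).i x A B :=
  fun c => (Γ c).S.smoothAtOn_sphereMetric _ A B

theorem sm_R (a b c' d : Fin 4) : Sm Γ fun c => lowCurv ((Γ c).S.metric (Γ c).i) a b c' d :=
  fun c => (gauge c).metricOn.lowCurv_smooth a b c' d

theorem ctrF_apply (u : Fin 2 → Fin 2 → Fam ι) (c : ι) (t : ℝ) (θ : Fin 2 → ℝ) :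
    ctrF Γ u c t θ = (Γ c).S.ctr (Γ c).i (fun C D => u C D c t θ) (pt t u₀ θ) := by
  simp only [ctrF, Spacetime.ctr, Finset.sum_apply, Pi.mul_apply, gi, fam]
  exact Finset.sum_congr rfl fun _ _ => Finset.sum_congr rfl fun _ _ => mul_comm _ _

namespace Good

theorem of_succ (H : Good Γ (n + 1)) : Good Γ n where
  adm := H.adm
  short := H.short
  low := H.low
  bound := by
    obtain ⟨B, hB⟩ := H.bound
    exact ⟨B, fun c j hj => hB c j (by omega)⟩

variable (H : Good Γ n)
include H

theorem ap_gm (A C : Fin 2) : Ap (dl Γ) n false (gm Γ A C) (gm0 Γ A C) :=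
  Config.ap_gm H.adm H.short H.bound.choose_spec A C

theorem ap_gi (A C : Fin 2) : Ap (dl Γ) n false (gi Γ A C) (gi0 Γ A C) :=
  Config.ap_gi H.adm H.short H.bound.choose_spec H.low A C

theorem ap_fX (A C : Fin 2) : Ap (dl Γ) n true (fX Γ A C) (fX0 Γ A C) :=
  Config.ap_fX H.adm H.short H.bound.choose_spec A C

/-- The contracted tensor stands to the left of the inverse metric because only the left factor in
`Ap.mul` may have a weighted error. -/
theorem ap_ctr {b : Bool} {u u₀ : Fin 2 → Fin 2 → Fam ι}
    (h : ∀ C D, Ap (dl Γ) n b (u C D) (u₀ C D)) : Ap (dl Γ) n b (ctrF Γ u) (ctrF0 Γ u₀) :=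
  Ap.sum fun C _ => Ap.sum fun D _ => (h C D).mul H.short (H.ap_gi C D)

omit H in
theorem _root_.NullCone.pd_mul_fixed {F : (Fin 2 → ℝ) → ℝ} (hF : ContDiff ℝ ∞ F) (a b : ℝ)
    (A : Fin 2) (θ : Fin 2 → ℝ) : pd A (fun y => a * F y * b) θ = a * pd A F θ * b := by
  have e : (fun y => a * F y * b) = fun y => (a * b) * F y := by funext y; ring
  rw [e, pd_const_mul A _ (s := Set.univ) (fun _ _ => hF.contDiffAt) (Set.mem_univ θ)]
  ring

omit H in
theorem _root_.NullCone.Config.D_gm0 (A B C : Fin 2) : Fam.D A (gm0 Γ B C)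
    = fun c t θ => rr Γ c t θ ^ 2 * rfD A θ * kd B C := by
  funext c t θ
  exact pd_mul_fixed contDiff_roundFactor (rr Γ c t θ ^ 2) (kd B C) A θ

omit H in
theorem _root_.NullCone.Config.D_fX0 (A B C : Fin 2) : Fam.D A (fX0 Γ B C)
    = fun c t θ => (1 - 2 * m₀ / |u₀|) * rr Γ c t θ * rfD A θ * kd B C := by
  funext c t θ
  exact pd_mul_fixed contDiff_roundFactor ((1 - 2 * m₀ / |u₀|) * rr Γ c t θ) (kd B C) A θ

omit H in
theorem ap_fΓ (H : Good Γ (n + 1)) (C A B : Fin 2) :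
    Ap (dl Γ) n false (fΓ Γ C A B) (fΓ0 Γ C A B) := by
  refine (((((H.ap_gm B C).D A).add ((H.ap_gm A C).D B)).sub ((H.ap_gm A B).D C)).smul
    (1 / 2)).congr (fun c t ht θ => ?_) fun c t ht θ => ?_
  · have e := fun A B C => D_fam (Γ := Γ) (sm_gm B C) A c t ht θ
    simp only [gm, Pi.smul_apply, Pi.sub_apply, Pi.add_apply, e, smul_eq_mul]
    rfl
  · simp only [D_gm0, Pi.smul_apply, Pi.sub_apply, Pi.add_apply, smul_eq_mul, fΓ0]
    ring

end Good

end Config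

end

/-! ### Transport of the torsion -/

section

theorem fin2_cases (A : Fin 2) : A = 0 ∨ A = 1 := by omega

theorem kd00 : kd 0 0 = 1 := rfl
theorem kd01 : kd 0 1 = 0 := rfl
theorem kd10 : kd 1 0 = 0 := rfl
theorem kd11 : kd 1 1 = 1 := rfl

namespace Config

variable {ι : Type*} {u₀ m₀ : ℝ} {Γ : ι → Config u₀ m₀} {n : ℕ}

theorem gi_symm {c : ι} {t : ℝ} (ht : t ∈ Set.Icc 0 (dl Γ c + 1)) (θ : Fin 2 → ℝ) (A B : Fin 2) :
    gi Γ A B c t θ = gi Γ B A c t θ := (Γ c).S.inv_sphereMetric_symm _ (mem_slab ht θ) A B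

theorem fk_symm {c : ι} {t : ℝ} (ht : t ∈ Set.Icc 0 (dl Γ c + 1)) (θ : Fin 2 → ℝ) (A B : Fin 2) :
    fk Γ A B c t θ = fk Γ B A c t θ := (gauge c).k_symm (mem_slab ht θ) A B

variable (Γ) in
/-- The source of the transport equation of the torsion. -/
def srcC (A : Fin 2) : Fam ι := (4 : ℝ) • ctrF Γ fun C D =>
  Fam.D C (fX Γ D A) - Fam.D A (fX Γ D C) - ctrF Γ (fun E F => fX Γ F A * fΓ Γ E C D)
    + ctrF Γ (fun E F => fX Γ F C * fΓ Γ E A D)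

/-- The transport equation of the torsion. -/
theorem dt_fc (A : Fin 2) : Fam.Eq (dl Γ) (Fam.dt (fc Γ A))
    (-ctrF Γ (fX Γ) * fc Γ A + srcC Γ A) := by
  intro c t ht θ
  have hx := mem_cone (Γ := Γ) ht θ
  have h1 := (gauge c).lowCurv_100A hx A
  have h2 := (gauge c).vacuum_0A (Γ c).vacuum hx A
  have h3 := fun C D A => (gauge c).lowCurv_C0DA hx C D A
  have hd := dt_fam (Γ := Γ) (sm_c A) c t ht θ
  have hD := fun A B C => D_fam (Γ := Γ) (sm_X B C) A c t ht θ
  have hX : ∀ A B, (Γ c).S.X (Γ c).i A B (pt t u₀ θ) = fX Γ A B c t θ := fun _ _ => rfl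
  have hc : ∀ A, (Γ c).S.c (Γ c).i A (pt t u₀ θ) = fc Γ A c t θ := fun _ => rfl
  have hΓ : ∀ C A B, (Γ c).S.Γs (Γ c).i C A B (pt t u₀ θ) = fΓ Γ C A B c t θ := fun _ _ _ => rfl
  have hg : ∀ A B, (Γ c).S.hinv (Γ c).i A B (pt t u₀ θ) = gi Γ A B c t θ := fun _ _ => rfl
  have hd' : Fam.dt (fc Γ A) c t θ = pd 0 ((Γ c).S.c (Γ c).i A) (pt t u₀ θ) := hd
  have hD' : ∀ A B C, pd (sph A) ((Γ c).S.X (Γ c).i B C) (pt t u₀ θ) = Fam.D A (fX Γ B C) c t θ :=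
    fun A B C => (hD A B C).symm
  simp only [h1, h3, ← hd', hD', hX, hc, hΓ, hg, Spacetime.ctr, Fin.sum_univ_two] at h2
  simp only [srcC, ctrF, Fin.sum_univ_two, Pi.add_apply, Pi.sub_apply, Pi.mul_apply, Pi.smul_apply,
    Pi.neg_apply, smul_eq_mul]
  have s1 := fX_symm (Γ := Γ) ht θ 1 0
  have s2 := gi_symm (Γ := Γ) ht θ 1 0
  rcases fin2_cases A with rfl | rfl <;> simp only [s1, s2] at h2 ⊢ <;>
    linear_combination 2 * h2

theorem js_fc (A : Fin 2) : JS (dl Γ) (fc Γ A) := js_fam (sm_c A)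

theorem fc_corner (c : ι) (θ : Fin 2 → ℝ) (A : Fin 2) : fc Γ A c 0 θ = 0 := by
  have hx := mem_cone (Γ := Γ) (zero_mem c) θ
  have h := (Γ c).data.torsion_corner (Γ c).i θ A
  rw [Spacetime.zeta, (gauge c).eta_cone hx, (gauge c).etab_cone hx] at h
  change (Γ c).S.c (Γ c).i A (pt 0 u₀ θ) = 0
  linarith

theorem js_zero : JS (dl Γ) (0 : Fam ι) := fun _ _ _ _ => contDiffAt_const

theorem dt_zero : Fam.dt (0 : Fam ι) = 0 := by
  funext c t θ
  simp [Fam.dt]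

namespace Good

variable (H : Good Γ (n + 1))
include H

theorem ref_pos {c : ι} {t : ℝ} (ht : t ∈ Set.Icc 0 (dl Γ c + 1)) (θ : Fin 2 → ℝ) :
    0 < rr Γ c t θ := by
  have := rr_pos H.adm H.short ht θ
  linarith

/-- The source is a trace of the skew part of ∇χ. The reference χ is a constant multiple of the
reference metric on each sphere, hence parallel, so its contribution vanishes. -/
theorem ap_srcC (A : Fin 2) : Ap (dl Γ) n true (srcC Γ A) 0 := by
  have hX := H.of_succ.ap_fX
  have hΓ := H.ap_fΓ
  refine Ap.congr ((H.of_succ.ap_ctr fun C D => ((((H.ap_fX D A).D C).sub ((H.ap_fX D C).D A)).sub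
    (H.of_succ.ap_ctr fun E F => (hX F A).mul H.short (hΓ E C D))).add
    (H.of_succ.ap_ctr fun E F => (hX F C).mul H.short (hΓ E A D))).smul 4)
    (fun _ _ _ _ => rfl) fun c t ht θ => ?_
  have hr := H.ref_pos ht θ
  have hf := roundFactor_pos θ
  simp only [D_fX0, ctrF0, Fin.sum_univ_two, Pi.add_apply, Pi.sub_apply, Pi.mul_apply,
    Pi.smul_apply, smul_eq_mul, gi0, fX0, fΓ0, Pi.zero_apply]
  rcases fin2_cases A with rfl | rfl <;> simp only [kd00, kd01, kd10, kd11] <;> field_simp <;> ring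

/-- The system is diagonal with coefficient −tr χ. Its reference solution is zero, and the torsion
vanishes at the corner. -/
theorem ap_fc (A : Fin 2) : Ap (dl Γ) n false (fc Γ A) 0 := by
  have h := Ap.ode H.short (y := fc Γ) (y₀ := fun _ => 0) (f := srcC Γ) (f₀ := fun _ => 0)
    (M := fun A C => kd A C • -ctrF Γ (fX Γ)) (M₀ := fun A C => kd A C • -ctrF0 Γ (fX0 Γ))
    js_fc (fun _ => js_zero) (fun A c t ht θ => ?_) (fun A c t ht θ => ?_) (fun _ => Ctl.zero)
    (fun A C => (H.of_succ.ap_ctr H.of_succ.ap_fX).neg.smul _) H.ap_srcC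
    (fun A => Ctl.zero.congr fun c t _ θ => ?_) A
  · exact h
  · rw [dt_fc A c t ht θ]
    rcases fin2_cases A with rfl | rfl <;> simp [kd00, kd01, kd10, kd11]
  · rw [dt_zero]
    simp
  · simp [fc_corner]

end Good

end Config

end

/-! ### Intrinsic curvature of the spheres and transport of χ̲ -/

section

namespace Config

variable {ι : Type*} {u₀ m₀ : ℝ} {Γ : ι → Config u₀ m₀} {n : ℕ}

variable (Γ) in
/-- The intrinsic curvature of the spheres. -/
def gC (C A D B : Fin 2) : Fam ι := Fam.D D (fΓ Γ C B A) - Fam.D B (fΓ Γ C D A)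
  - ctrF Γ (fun E F => fΓ Γ E D C * fΓ Γ F B A) + ctrF Γ (fun E F => fΓ Γ E B C * fΓ Γ F D A)

variable (Γ) in
/-- The reference value of the intrinsic curvature of the spheres. -/
def gC0 (C A D B : Fin 2) : Fam ι := fun c t θ =>
  rr Γ c t θ ^ 2 * roundFactor θ ^ 2 * (kd C D * kd A B - kd C B * kd A D)

variable (Γ) in
/-- The endomorphism associated with `χ`. -/
def fY (C B : Fin 2) : Fam ι := ∑ D, fX Γ D B * gi Γ C D

variable (Γ) in
/-- The reference value of `fY`. -/
def fY0 (C B : Fin 2) : Fam ι := ∑ D, fX0 Γ D B * gi0 Γ C D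

variable (Γ) in
/-- The reference value of `χ̲`. -/
def fk0 (A B : Fin 2) : Fam ι := fun c t θ =>
  -((rr Γ c t θ - 2 * m₀) / (1 - 2 * m₀ / |u₀|)) * roundFactor θ * kd A B

variable (Γ) in
/-- The coefficients of the transport equation of `χ̲`. -/
def matK (p s : Fin 2 × Fin 2) : Fam ι := kd s.2 p.1 • fY Γ s.1 p.2
  + (1 / 2 * kd s.2 p.2) • fY Γ s.1 p.1 + (1 / 2 * kd s.1 p.2) • fY Γ s.2 p.1
  - (1 / 2 * kd s.1 p.2 * kd s.2 p.1) • ctrF Γ (fX Γ) - (1 / 2 : ℝ) • (fX Γ p.1 p.2 * gi Γ s.1 s.2)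

variable (Γ) in
/-- The reference coefficients of the transport equation of `χ̲`. -/
def matK0 (p s : Fin 2 × Fin 2) : Fam ι := kd s.2 p.1 • fY0 Γ s.1 p.2
  + (1 / 2 * kd s.2 p.2) • fY0 Γ s.1 p.1 + (1 / 2 * kd s.1 p.2) • fY0 Γ s.2 p.1
  - (1 / 2 * kd s.1 p.2 * kd s.2 p.1) • ctrF0 Γ (fX0 Γ)
  - (1 / 2 : ℝ) • (fX0 Γ p.1 p.2 * gi0 Γ s.1 s.2)

variable (Γ) in
/-- The source of the transport equation of `χ̲`. -/
def srcK (p : Fin 2 × Fin 2) : Fam ι := (-(1 / 4) : ℝ) • (Fam.D p.1 (fc Γ p.2) + Fam.D p.2 (fc Γ p.1))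
  + (1 / 2 : ℝ) • ctrF Γ (fun C D => fc Γ C * fΓ Γ D p.1 p.2) + (1 / 8 : ℝ) • (fc Γ p.1 * fc Γ p.2)
  - ctrF Γ (fun C D => gC Γ D p.1 C p.2)

theorem js_fk (A B : Fin 2) : JS (dl Γ) (fk Γ A B) := js_fam (sm_k A B)

/-- The transport equation of `χ̲`. -/
theorem dt_fk (A B : Fin 2) : Fam.Eq (dl Γ) (Fam.dt (fk Γ A B))
    (∑ s, matK Γ (A, B) s * fk Γ s.1 s.2 + srcK Γ (A, B)) := by
  intro c t ht θ
  have hx := mem_cone (Γ := Γ) ht θ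
  have h2 := (gauge c).vacuum_AB (Γ c).vacuum hx A B
  have h1 := fun A B => (gauge c).lowCurv_1B0A hx B A
  have h3 := fun C A D B => (gauge c).lowCurv_CADB hx C A D B
  have hk : ∀ A B, (Γ c).S.k (Γ c).i A B (pt t u₀ θ) = fk Γ A B c t θ := fun _ _ => rfl
  have hX : ∀ A B, (Γ c).S.X (Γ c).i A B (pt t u₀ θ) = fX Γ A B c t θ := fun _ _ => rfl
  have hc : ∀ A, (Γ c).S.c (Γ c).i A (pt t u₀ θ) = fc Γ A c t θ := fun _ => rfl
  have hΓ : ∀ C A B, (Γ c).S.Γs (Γ c).i C A B (pt t u₀ θ) = fΓ Γ C A B c t θ := fun _ _ _ => rfl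
  have hg : ∀ A B, (Γ c).S.hinv (Γ c).i A B (pt t u₀ θ) = gi Γ A B c t θ := fun _ _ => rfl
  have hd : ∀ A B, pd 0 ((Γ c).S.k (Γ c).i A B) (pt t u₀ θ) = Fam.dt (fk Γ A B) c t θ :=
    fun A B => (dt_fam (Γ := Γ) (sm_k A B) c t ht θ).symm
  have hDc : ∀ A B, pd (sph A) ((Γ c).S.c (Γ c).i B) (pt t u₀ θ) = Fam.D A (fc Γ B) c t θ :=
    fun A B => (D_fam (Γ := Γ) (sm_c B) A c t ht θ).symm
  have hDΓ : ∀ D C A B, pd (sph D) ((Γ c).S.Γs (Γ c).i C A B) (pt t u₀ θ)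
      = Fam.D D (fΓ Γ C A B) c t θ :=
    fun D C A B => (D_fam (Γ := Γ) (sm_Γ C A B) D c t ht θ).symm
  have ks := JS.dt_congr dl_pos (js_fk (Γ := Γ) 1 0) (js_fk 0 1) (fun _ _ ht θ => fk_symm ht θ 1 0)
    c t ht θ
  have hΓs : ∀ C, fΓ Γ C 1 0 c t θ = fΓ Γ C 0 1 c t θ := by
    intro C
    rw [← hΓ, ← hΓ, Spacetime.Γs, Spacetime.Γs, (gauge c).pd_sphereMetric_symm
      (mem_slab (Γ := Γ) ht θ) (sph C) 1 0]
    ring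
  simp only [h1, h3, hd, hDc, hDΓ, hk, hX, hc, hΓ, hg, Spacetime.ctr, Fin.sum_univ_two] at h2
  simp only [srcK, matK, fY, ctrF, gC, Fintype.sum_prod_type, Fin.sum_univ_two, Pi.add_apply,
    Pi.sub_apply, Pi.mul_apply, Pi.smul_apply, smul_eq_mul]
  have s1 := fX_symm (Γ := Γ) ht θ 1 0
  have s2 := gi_symm (Γ := Γ) ht θ 1 0
  have s3 := fk_symm (Γ := Γ) ht θ 1 0
  rcases fin2_cases A with rfl | rfl <;> rcases fin2_cases B with rfl | rfl <;>
    simp only [s1, s2, s3, ks, hΓs, kd00, kd01, kd10, kd11] at h2 ⊢ <;>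
    linear_combination (-(1 / 2)) * h2

theorem D_fΓ0 (D C A B : Fin 2) : Fam.D D (fΓ0 Γ C A B) = fun c t θ => (1 / 2) * rr Γ c t θ ^ 2 *
    (rfDD D A θ * kd B C + rfDD D B θ * kd A C - rfDD D C θ * kd A B) := by
  funext c t θ
  have e : fΓ0 Γ C A B c t = fun y => ((1 / 2 * rr Γ c t 0 ^ 2) * rfD A y * kd B C
      + (1 / 2 * rr Γ c t 0 ^ 2) * rfD B y * kd A C)
      - (1 / 2 * rr Γ c t 0 ^ 2) * rfD C y * kd A B := by
    funext y
    simp only [fΓ0, rr]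
    ring
  have hs : ∀ A (a b : ℝ), SmoothAtOn Set.univ (fun y => a * rfD A y * b) := fun A a b θ _ =>
    ((contDiff_const.mul (contDiff_rfD A)).mul contDiff_const).contDiffAt
  rw [Fam.D, e, pd_sub D ((hs A _ _).add (hs B _ _)) (hs C _ _) (Set.mem_univ θ),
    pd_add D (hs A _ _) (hs B _ _) (Set.mem_univ θ), pd_mul_fixed (contDiff_rfD A),
    pd_mul_fixed (contDiff_rfD B), pd_mul_fixed (contDiff_rfD C)]
  simp only [rfDD, rr]
  ring

theorem dt_fk0 (c : ι) (t : ℝ) (hA : Admissible u₀ m₀) (θ : Fin 2 → ℝ) (A B : Fin 2) :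
    Fam.dt (fk0 Γ A B) c t θ = -roundFactor θ * kd A B := by
  have h1 : HasDerivAt (fun s => |u₀| + (1 - 2 * m₀ / |u₀|) * (s - dl Γ c))
      ((1 - 2 * m₀ / |u₀|) * 1) t := (((hasDerivAt_id' t).sub_const _).const_mul _).const_add _
  have h2 := ((((h1.sub_const (2 * m₀)).div_const (1 - 2 * m₀ / |u₀|)).neg).mul_const
    (roundFactor θ)).mul_const (kd A B)
  refine h2.deriv.trans ?_
  have := hA.f_pos.ne'
  field_simp

theorem js_fk0 (A B : Fin 2) : JS (dl Γ) (fk0 Γ A B) := by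
  have h1 : JS (dl Γ) (fun c t _ => -((schwR m₀ u₀ (dl Γ c) t - 2 * m₀) / (1 - 2 * m₀ / |u₀|))) :=
    JS.param fun c _ _ => (((contDiff_rr c).sub contDiff_const).div_const _).neg.contDiffAt
  exact (h1.mul (JS.fixed contDiff_roundFactor)).mul (JS.fixed (F := fun _ => kd A B) contDiff_const)

namespace Good

theorem ap_fY (H : Good Γ n) (C B : Fin 2) : Ap (dl Γ) n true (fY Γ C B) (fY0 Γ C B) :=
  Ap.sum fun D _ => (H.ap_fX D B).mul H.short (H.ap_gi C D)

theorem ap_matK (H : Good Γ n) (p s : Fin 2 × Fin 2) :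
    Ap (dl Γ) n true (matK Γ p s) (matK0 Γ p s) :=
  (((((H.ap_fY s.1 p.2).smul _).add ((H.ap_fY s.1 p.1).smul _)).add
    ((H.ap_fY s.2 p.1).smul _)).sub ((H.ap_ctr H.ap_fX).smul _)).sub
    (((H.ap_fX p.1 p.2).mul H.short (H.ap_gi s.1 s.2)).smul _)

/-- The reference metric r²γ has Gauss curvature 1/r². Two angular derivatives of h enter, whence `n
+ 2`. -/
theorem ap_gC (H : Good Γ (n + 2)) (C A D B : Fin 2) :
    Ap (dl Γ) n false (gC Γ C A D B) (gC0 Γ C A D B) := by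
  have hΓ := H.of_succ.ap_fΓ
  have hg := H.of_succ.of_succ
  refine Ap.congr (((((H.ap_fΓ C B A).D D).sub ((H.ap_fΓ C D A).D B)).sub
    (hg.ap_ctr fun E F => (hΓ E D C).mul H.short (hΓ F B A))).add
    (hg.ap_ctr fun E F => (hΓ E B C).mul H.short (hΓ F D A))) (fun _ _ _ _ => rfl) fun c t ht θ => ?_
  have hr := H.ref_pos ht θ
  have hf := roundFactor_pos θ
  have hs := rfDD_symm 1 0 θ
  have hcurv := round_curvature θ
  simp only [D_fΓ0, ctrF0, Fin.sum_univ_two, Pi.add_apply, Pi.sub_apply, Pi.mul_apply,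
    gi0, fΓ0, gC0]
  rcases fin2_cases A with rfl | rfl <;> rcases fin2_cases B with rfl | rfl <;>
    rcases fin2_cases C with rfl | rfl <;> rcases fin2_cases D with rfl | rfl <;>
    simp only [kd00, kd01, kd10, kd11, hs] <;> field_simp <;>
    -- Every component is either zero or, up to sign, the single independent one, which is given by
    -- `round_curvature`.
    first
    | ring1
    | linear_combination hcurv
    | linear_combination -hcurv
    | linear_combination 2 * hcurv
    | linear_combination -2 * hcurv

end Good

end Config

end

section

namespace Config

variable {ι : Type*} {u₀ m₀ : ℝ} {Γ : ι → Config u₀ m₀} {n : ℕ}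

/-! ### The incoming cone -/

/-- Derivatives along the incoming cone. -/
theorem pd_one_incoming {c : ι} {F : (Fin 4 → ℝ) → ℝ} {f : ℝ → ℝ} {θ : Fin 2 → ℝ}
    (hF : SmoothAtOn (slab ((Γ c).δ + 1) u₀ (Γ c).u₁) F)
    (h : ∀ u ∈ Set.Icc u₀ (Γ c).u₁, F (pt 0 u θ) = f u) {u : ℝ} (hu : u ∈ Set.Icc u₀ (Γ c).u₁)
    {f' : ℝ} (hf : HasDerivAt f f' u) : pd 1 F (pt 0 u θ) = f' := by
  have hs : pt 0 u θ ∈ slab ((Γ c).δ + 1) u₀ (Γ c).u₁ :=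
    by
    have h0 := (Γ c).δ_pos
    exact ⟨⟨by simp [pt], by simp only [pt, Matrix.cons_val_zero]; linarith⟩, by simpa [pt] using hu⟩
  have h1 : HasDerivAt (fun s => pt 0 s θ) (Pi.single 1 1) u := by
    refine hasDerivAt_pi.2 fun μ => ?_
    fin_cases μ
    · simpa [pt] using hasDerivAt_const u (0 : ℝ)
    · simpa [pt] using hasDerivAt_id' u
    · simpa [pt] using hasDerivAt_const u (θ 0)
    · simpa [pt] using hasDerivAt_const u (θ 1)
  have h2 := ((hF.differentiableAt hs).hasFDerivAt.comp_hasDerivAt u h1).hasDerivWithinAt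
    (s := Set.Icc u₀ (Γ c).u₁)
  have h3 := hf.hasDerivWithinAt (s := Set.Icc u₀ (Γ c).u₁)
  exact (uniqueDiffOn_Icc (Γ c).lt u hu).eq_deriv _ h2 (h3.congr h (h u hu))

theorem k_incoming (c : ι) {u : ℝ} (hu : u ∈ Set.Icc u₀ (Γ c).u₁) (θ : Fin 2 → ℝ) (A B : Fin 2) :
    (Γ c).S.k (Γ c).i A B (pt 0 u θ) = u * (roundFactor θ * kd A B) := by
  have h : HasDerivAt (fun s : ℝ => s * s * (roundFactor θ * kd A B))
      ((1 * u + u * 1) * (roundFactor θ * kd A B)) u :=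
    (((hasDerivAt_id' u).mul (hasDerivAt_id' u))).mul_const _
  rw [Spacetime.k, pd_one_incoming (Γ := Γ) (sm_gm A B c) (fun s hs => ?_) hu h]
  · ring
  · change (Γ c).S.sphereMetric (Γ c).i (pt 0 s θ) A B = _
    rw [(Γ c).data.sphereMetric_incoming (Γ c).i s hs θ, Matrix.smul_apply, smul_eq_mul, sq_abs, kd]
    ring

theorem corner_mem (c : ι) : u₀ ∈ Set.Icc u₀ (Γ c).u₁ := ⟨le_rfl, (Γ c).lt.le⟩

theorem fk_corner (c : ι) (θ : Fin 2 → ℝ) (A B : Fin 2) :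
    fk Γ A B c 0 θ = u₀ * (roundFactor θ * kd A B) := k_incoming c (corner_mem c) θ A B

theorem fw_corner (c : ι) (θ : Fin 2 → ℝ) : fw Γ c 0 θ = 0 :=
  pd_one_incoming (Γ := Γ) ((Γ c).S.smoothAtOn_lapse _)
    (fun s hs => (Γ c).data.lapse_incoming _ s hs θ) (corner_mem c) (hasDerivAt_const u₀ (1 : ℝ))

/-- On the incoming cone k = uγ for all u, so the transversal derivative ∂_u k is known at the
corner. With ∂_uΩ = 0 the terms cancel as in Minkowski space. -/
theorem fR_corner (hu : u₀ < -2) (c : ι) (θ : Fin 2 → ℝ) (A B : Fin 2) :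
    fR Γ 1 (sph A) 1 (sph B) c 0 θ = 0 := by
  have h0 := zero_mem (Γ := Γ) c
  have hx := mem_cone (Γ := Γ) h0 θ
  have e1 : christoffel1 ((Γ c).S.metric (Γ c).i) 1 (sph B) (sph A)
      = fun x => -(Γ c).S.k (Γ c).i B A x := by
    funext x
    simp only [christoffel1, Spacetime.metric_sph_one, Spacetime.metric_sph_sph, pd_const,
      Spacetime.k]
    ring
  have e2 : christoffel1 ((Γ c).S.metric (Γ c).i) 1 1 (sph A) = fun _ => 0 := by
    funext x
    simp only [christoffel1, Spacetime.metric_sph_one, Spacetime.metric_one_sph,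
      Spacetime.metric_one_one, pd_const]
    ring
  have hk1 : pd 1 ((Γ c).S.k (Γ c).i B A) (pt 0 u₀ θ) = roundFactor θ * kd B A := by
    have h := ((hasDerivAt_id' u₀).mul_const (roundFactor θ * kd B A))
    rw [one_mul] at h
    exact pd_one_incoming (Γ := Γ) (sm_k B A c) (fun s hs => k_incoming c hs θ B A)
      (corner_mem c) h
  obtain ⟨-, -, -, f1, -, -, -, -, -, f2, f3, f4, -, -, -, f5, f6, -⟩ :=
    (gauge c).christoffel1_cone hx
  have hw : (Γ c).S.w (Γ c).i (pt 0 u₀ θ) = 0 := fw_corner c θ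
  have hk : ∀ A B, (Γ c).S.k (Γ c).i A B (pt 0 u₀ θ) = u₀ * (roundFactor θ * kd A B) :=
    fk_corner c θ
  have hg : ∀ A B, (Γ c).S.hinv (Γ c).i A B (pt 0 u₀ θ) = gi Γ A B c 0 θ := fun _ _ => rfl
  obtain ⟨g1, g2, g3, g4⟩ := gi_eq (Γ := Γ) (c := c) (t := 0) (θ := θ)
  have hr := roundFactor_pos θ
  have hu' : 0 < u₀ ^ 2 := by nlinarith
  have hun : u₀ ≠ 0 := by linarith
  rw [fR, fam, (gauge c).lowCurv_cone hx, e1, e2, pd_const, pd_neg, hk1]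
  have sy := fun l a b => (gauge c).metricOn.christoffel1_symm ((gauge c).sub hx) l a b
  simp only [sy _ (sph _) 1, Spacetime.ctr, Fin.sum_univ_two, f1, f2, f3, f5, f6, hw, hk, hg,
    g1, g2, g3, g4, gm_corner, Matrix.one_apply]
  rcases fin2_cases A with rfl | rfl <;> rcases fin2_cases B with rfl | rfl <;>
    simp [kd00, kd01, kd10, kd11] <;> field_simp <;> ring

namespace Good

theorem ctl_fk0 (hA : Admissible u₀ m₀) (hδ : Short (dl Γ)) (A B : Fin 2) :
    Ctl (dl Γ) n 1 (fk0 Γ A B) := by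
  have h1 : Ctl (dl Γ) n 1 (fun c t θ => rr Γ c t θ - 2 * m₀) :=
    (ctl_rr hA hδ).sub (Ctl.const (2 * m₀))
  have h2 := (h1.const_mul (-1 / (1 - 2 * m₀ / |u₀|))).mul
    (Ctl.fixed (contDiff_roundFactor.mul (contDiff_const (c := kd A B))))
  rw [one_mul] at h2
  refine h2.congr fun c t _ θ => ?_
  simp only [Pi.mul_apply, fk0]
  ring

/-- δ = ε² ≤ ε: mismatches of order δ at the corner are harmless initial errors. -/
theorem ctl_dl (H : Good Γ n) {a : ι → ℝ} {C : ℝ} (h : ∀ c, |a c| ≤ C * dl Γ c) :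
    Ctl (dl Γ) n (fun c _ => ε (dl Γ) c) (fun c _ _ => a c) := by
  refine Ctl.param (fun c _ => a c) |C| fun c _ _ => (h c).trans ?_
  have e1 := H.short.ε_sq c
  have e2 := H.short.ε_le_one c
  have e3 := H.short.ε_pos c
  have hd := (H.short c).1
  calc C * dl Γ c ≤ |C| * dl Γ c := mul_le_mul_of_nonneg_right (le_abs_self C) hd.le
    _ = |C| * (ε (dl Γ) c * ε (dl Γ) c) := by rw [e1]
    _ ≤ |C| * ε (dl Γ) c :=
      mul_le_mul_of_nonneg_left (mul_le_of_le_one_right e3.le e2) (abs_nonneg C)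

/-- The source tends to minus the trace of the intrinsic curvature, that is −γ. The reference `fk0`
solves the reference equation exactly and misses the corner value by a term of order δ. -/
theorem ap_fk (H : Good Γ (n + 2)) (A B : Fin 2) :
    Ap (dl Γ) n false (fk Γ A B) (fk0 Γ A B) := by
  have hA := H.adm
  have hg := H.of_succ.of_succ
  have hsrc : ∀ p : Fin 2 × Fin 2, Ap (dl Γ) n false (srcK Γ p)
      (fun c t θ => -roundFactor θ * kd p.1 p.2) := by
    intro p
    refine Ap.congr ((((((H.ap_fc p.2).D p.1).add ((H.ap_fc p.1).D p.2)).smul (-(1 / 4))).add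
      ((hg.ap_ctr fun C D => (H.of_succ.ap_fc C).mul hg.short (H.of_succ.ap_fΓ D p.1 p.2)).smul
      (1 / 2))).add (((H.of_succ.ap_fc p.1).mul hg.short (H.of_succ.ap_fc p.2)).smul (1 / 8)) |>.sub
      (hg.ap_ctr fun C D => H.ap_gC D p.1 C p.2)) (fun _ _ _ _ => rfl) fun c t ht θ => ?_
    have hz : ∀ A, Fam.D A (0 : Fam ι) c t θ = 0 := fun A => by
      have : (0 : Fam ι) = fun _ _ _ => 0 := rfl
      rw [this, Fam.D_param (fun _ _ => 0)]
    have hr := H.ref_pos ht θ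
    have hf := roundFactor_pos θ
    obtain ⟨A, B⟩ := p
    simp only [ctrF0, Fin.sum_univ_two, Pi.add_apply, Pi.sub_apply, Pi.mul_apply, Pi.smul_apply,
      hz, Pi.zero_apply, smul_eq_mul, gC0, gi0]
    rcases fin2_cases A with rfl | rfl <;> rcases fin2_cases B with rfl | rfl <;>
      simp only [kd00, kd01, kd10, kd11] <;> field_simp <;> ring
  have h := Ap.ode H.short (y := fun p : Fin 2 × Fin 2 => fk Γ p.1 p.2)
    (y₀ := fun p => fk0 Γ p.1 p.2) (f := srcK Γ) (f₀ := fun p c t θ => -roundFactor θ * kd p.1 p.2)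
    (M := matK Γ) (M₀ := matK0 Γ) (fun p => js_fk p.1 p.2) (fun p => js_fk0 p.1 p.2)
    (fun p => dt_fk p.1 p.2) (fun p c t ht θ => ?_) (fun p => ctl_fk0 hA H.short p.1 p.2)
    hg.ap_matK (fun p => (hsrc p).weaken hg.short true) (fun p => ?_) (A, B)
  · exact h
  · have hr := H.ref_pos ht θ
    have hf := roundFactor_pos θ
    obtain ⟨A, B⟩ := p
    have hfp := hA.f_pos
    rw [dt_fk0 c t hA]
    simp only [matK0, fY0, ctrF0, Fintype.sum_prod_type, Fin.sum_univ_two, Pi.add_apply,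
      Pi.sub_apply, Pi.mul_apply, Pi.smul_apply, smul_eq_mul, gi0, fX0, fk0]
    generalize 1 - 2 * m₀ / |u₀| = f at hfp ⊢
    rcases fin2_cases A with rfl | rfl <;> rcases fin2_cases B with rfl | rfl <;>
      simp only [kd00, kd01, kd10, kd11] <;> field_simp <;> ring
  · refine (((hg.ctl_dl (a := dl Γ) (C := 1) fun c => ?_).mul
      (Ctl.fixed (contDiff_roundFactor.mul (contDiff_const (c := -kd p.1 p.2))))).mono 1
      (s' := fun c _ => ε (dl Γ) c) fun c t _ => ?_).congr fun c t ht θ => ?_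
    · rw [one_mul, abs_of_pos (H.short c).1]
    · simpa using (H.short.ε_pos c).le
    · have hfp := hA.f_pos
      have hab := hA.abs_gt
      have hu : |u₀| = -u₀ := abs_of_neg (by linarith [hA.lt])
      -- This factorization shows that the reference value at the corner is −(|u₀| − δ)γ, against
      -- the true value u₀γ.
      have e : (rr Γ c 0 θ - 2 * m₀) = (1 - 2 * m₀ / |u₀|) * (|u₀| - dl Γ c) := by
        simp only [rr, schwR]
        field_simp
        ring
      simp only [fk_corner, fk0, Pi.mul_apply, e]
      rw [mul_div_cancel_left₀ _ hfp.ne', hu]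
      ring

end Good

end Config

end

section

namespace Config

variable {ι : Type*} {u₀ m₀ : ℝ} {Γ : ι → Config u₀ m₀} {n : ℕ}

/-! ### The curvature components on the cone -/

theorem fR_pair (a b c' d : Fin 4) : Fam.Eq (dl Γ) (fR Γ a b c' d) (fR Γ c' d a b) :=
  fun c _ ht θ => (gauge c).metricOn.lowCurv_pair (mem_slab ht θ) a b c' d

theorem fR_swap_left (a b c' d : Fin 4) : Fam.Eq (dl Γ) (fR Γ a b c' d) (-fR Γ b a c' d) :=
  fun c _ ht θ => (gauge c).metricOn.lowCurv_swap_left (mem_slab ht θ) a b c' d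

theorem fR_swap_right (a b c' d : Fin 4) : Fam.Eq (dl Γ) (fR Γ a b c' d) (-fR Γ a b d c') :=
  fun _ _ _ _ => MetricOn.lowCurv_swap_right a b c' d _

variable (Γ) in
/-- The reference value of `R_{CADB}`. -/
def fT0 (C A D B : Fin 2) : Fam ι := fun c t θ => 2 * m₀ * rr Γ c t θ * roundFactor θ ^ 2 *
  (kd C D * kd A B - kd C B * kd A D)

variable (Γ) in
/-- The reference value of `R_{1B0A}`. -/
def fP0 (B A : Fin 2) : Fam ι := ctrF0 Γ fun C D => fT0 Γ D A C B

/-- The components `R_{CADB}`. -/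
theorem fR_CADB (C A D B : Fin 2) : Fam.Eq (dl Γ) (fR Γ (sph C) (sph A) (sph D) (sph B))
    (gC Γ C A D B + (1 / 2 : ℝ) • (fX Γ D C * fk Γ B A + fX Γ B A * fk Γ D C)
      - (1 / 2 : ℝ) • (fX Γ B C * fk Γ D A + fX Γ D A * fk Γ B C)) := by
  intro c t ht θ
  have hx := mem_cone (Γ := Γ) ht θ
  have hX : ∀ A B, (Γ c).S.X (Γ c).i A B (pt t u₀ θ) = fX Γ A B c t θ := fun _ _ => rfl
  have hk : ∀ A B, (Γ c).S.k (Γ c).i A B (pt t u₀ θ) = fk Γ A B c t θ := fun _ _ => rfl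
  have hDΓ : ∀ D C A B, pd (sph D) ((Γ c).S.Γs (Γ c).i C A B) (pt t u₀ θ)
      = Fam.D D (fΓ Γ C A B) c t θ :=
    fun D C A B => (D_fam (Γ := Γ) (sm_Γ C A B) D c t ht θ).symm
  rw [fR, fam, (gauge c).lowCurv_CADB hx, hDΓ, hDΓ]
  simp only [gC, Pi.add_apply, Pi.sub_apply, Pi.mul_apply, Pi.smul_apply, smul_eq_mul, ctrF_apply,
    hX, hk]
  change _ - _ - (_ + (Γ c).S.ctr (Γ c).i (fun E F => fΓ Γ E D C c t θ * fΓ Γ F B A c t θ) _)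
    + (_ + (Γ c).S.ctr (Γ c).i (fun E F => fΓ Γ E B C c t θ * fΓ Γ F D A c t θ) _) = _
  ring

/-- The components `R_{10AB}`. -/
theorem fR_10AB (A B : Fin 2) : Fam.Eq (dl Γ) (fR Γ 1 0 (sph A) (sph B))
    ((1 / 2 : ℝ) • Fam.D A (fc Γ B) - (1 / 2 : ℝ) • Fam.D B (fc Γ A)
      - ctrF Γ (fun C D => fX Γ D B * fk Γ C A) + ctrF Γ (fun C D => fX Γ D A * fk Γ C B)) := by
  intro c t ht θ
  have hx := mem_cone (Γ := Γ) ht θ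
  have hX : ∀ A B, (Γ c).S.X (Γ c).i A B (pt t u₀ θ) = fX Γ A B c t θ := fun _ _ => rfl
  have hk : ∀ A B, (Γ c).S.k (Γ c).i A B (pt t u₀ θ) = fk Γ A B c t θ := fun _ _ => rfl
  have hDc : ∀ A B, pd (sph A) ((Γ c).S.c (Γ c).i B) (pt t u₀ θ) = Fam.D A (fc Γ B) c t θ :=
    fun A B => (D_fam (Γ := Γ) (sm_c B) A c t ht θ).symm
  rw [fR, fam, (gauge c).lowCurv_10AB hx, hDc, hDc]
  simp only [Pi.add_apply, Pi.sub_apply, Pi.mul_apply, Pi.smul_apply, smul_eq_mul, ctrF_apply,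
    hX, hk, Spacetime.ctr, Fin.sum_univ_two]
  ring

/-- The components `R_{1B0A}`. -/
theorem fR_1B0A (B A : Fin 2) : Fam.Eq (dl Γ) (fR Γ 1 (sph B) 0 (sph A))
    (ctrF Γ (fun C D => fR Γ (sph D) (sph A) (sph C) (sph B))
      - (1 / 2 : ℝ) • fR Γ 1 0 (sph A) (sph B)) := by
  intro c t ht θ
  have hx := mem_cone (Γ := Γ) ht θ
  have h := (gauge c).vacuum_AB (Γ c).vacuum hx A B
  have h1 := (gauge c).lowCurv_1B0A hx B A
  have h2 := (gauge c).lowCurv_1B0A hx A B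
  have h3 := (gauge c).lowCurv_10AB hx A B
  have ks := JS.dt_congr dl_pos (js_fk (Γ := Γ) A B) (js_fk B A) (fun _ _ ht θ => fk_symm ht θ A B)
    c t ht θ
  have hd : ∀ A B, pd 0 ((Γ c).S.k (Γ c).i A B) (pt t u₀ θ) = Fam.dt (fk Γ A B) c t θ :=
    fun A B => (dt_fam (Γ := Γ) (sm_k A B) c t ht θ).symm
  have hΓs : ∀ C, (Γ c).S.Γs (Γ c).i C A B (pt t u₀ θ) = (Γ c).S.Γs (Γ c).i C B A (pt t u₀ θ) := by
    intro C
    rw [Spacetime.Γs, Spacetime.Γs, (gauge c).pd_sphereMetric_symm (mem_slab (Γ := Γ) ht θ)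
      (sph C) A B]
    ring
  rw [hd] at h1 h2
  simp only [Pi.sub_apply, Pi.smul_apply, smul_eq_mul, ctrF_apply, fR, fam]
  simp only [hΓs] at h1
  rw [ks] at h1
  -- The vacuum equation gives the part symmetric in A and B. The skew part is −½R_{10AB}:
  -- subtracting the two explicit formulas cancels ∂₀k, an instance of the first Bianchi identity.
  linarith

/-- The component `R_{1010}`. -/
theorem fR_1010 : Fam.Eq (dl Γ) (fR Γ 1 0 1 0)
    ((-2 : ℝ) • ctrF Γ (fun C D => fR Γ 1 (sph C) 0 (sph D))) := by
  intro c t ht θ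
  simp only [Pi.smul_apply, smul_eq_mul, ctrF_apply]
  exact (gauge c).vacuum_01 (Γ c).vacuum (mem_cone ht θ)

/-- The components `R_{C1DA}`. -/
theorem fR_C1DA (C D A : Fin 2) : Fam.Eq (dl Γ) (fR Γ (sph C) 1 (sph D) (sph A))
    (Fam.D D (fk Γ C A) - Fam.D A (fk Γ C D) + (1 / 4 : ℝ) • (fk Γ D C * fc Γ A)
      - ctrF Γ (fun E F => fΓ Γ E D C * fk Γ F A) - (1 / 4 : ℝ) • (fk Γ A C * fc Γ D)
      + ctrF Γ (fun E F => fΓ Γ E A C * fk Γ F D)) := by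
  intro c t ht θ
  have hx := mem_cone (Γ := Γ) ht θ
  have hk : ∀ A B, (Γ c).S.k (Γ c).i A B (pt t u₀ θ) = fk Γ A B c t θ := fun _ _ => rfl
  have hc : ∀ A, (Γ c).S.c (Γ c).i A (pt t u₀ θ) = fc Γ A c t θ := fun _ => rfl
  have hΓ : ∀ C A B, (Γ c).S.Γs (Γ c).i C A B (pt t u₀ θ) = fΓ Γ C A B c t θ := fun _ _ _ => rfl
  have hDk : ∀ D A B, pd (sph D) ((Γ c).S.k (Γ c).i A B) (pt t u₀ θ) = Fam.D D (fk Γ A B) c t θ :=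
    fun D A B => (D_fam (Γ := Γ) (sm_k A B) D c t ht θ).symm
  rw [fR, fam, (gauge c).lowCurv_C1DA hx, hDk, hDk]
  simp only [Pi.add_apply, Pi.sub_apply, Pi.mul_apply, Pi.smul_apply, smul_eq_mul, ctrF_apply,
    hc, hk, hΓ]
  ring

/-- The components `R_{011A}`. -/
theorem fR_011A (A : Fin 2) : Fam.Eq (dl Γ) (fR Γ 0 1 1 (sph A))
    ((2 : ℝ) • ctrF Γ (fun C D => fR Γ (sph D) 1 (sph C) (sph A))) := by
  intro c t ht θ
  simp only [Pi.smul_apply, smul_eq_mul, ctrF_apply]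
  exact (gauge c).vacuum_1A (Γ c).vacuum (mem_cone ht θ) A

theorem D_fk0 (D A B : Fin 2) : Fam.D D (fk0 Γ A B) = fun c t θ =>
    -((rr Γ c t θ - 2 * m₀) / (1 - 2 * m₀ / |u₀|)) * rfD D θ * kd A B := by
  funext c t θ
  exact pd_mul_fixed contDiff_roundFactor
    (-((rr Γ c t θ - 2 * m₀) / (1 - 2 * m₀ / |u₀|))) (kd A B) D θ

theorem Fam_D_zero (D : Fin 2) : Fam.D D (0 : Fam ι) = 0 := by
  funext c t θ
  exact pd_const D 0

namespace Good

/-- Gauss equation. The intrinsic term contributes r² and the products of χ and χ̲ contribute −r(r −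
2m₀), both times the squared round factor, which leaves 2m₀r. -/
theorem ap_CADB (H : Good Γ (n + 2)) (C A D B : Fin 2) :
    Ap (dl Γ) n true (fR Γ (sph C) (sph A) (sph D) (sph B)) (fT0 Γ C A D B) := by
  have hX := H.of_succ.of_succ.ap_fX
  refine Ap.congr ((((H.ap_gC C A D B).weaken H.short true).add
    ((((hX D C).mul H.short (H.ap_fk B A)).add ((hX B A).mul H.short (H.ap_fk D C))).smul
    (1 / 2))).sub ((((hX B C).mul H.short (H.ap_fk D A)).add
    ((hX D A).mul H.short (H.ap_fk B C))).smul (1 / 2)))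
    (fun c t ht θ => (fR_CADB C A D B c t ht θ).symm) fun c t ht θ => ?_
  have hf := H.adm.f_pos.ne'
  simp only [gC0, fT0, fX0, fk0, Pi.add_apply, Pi.sub_apply, Pi.mul_apply, Pi.smul_apply,
    smul_eq_mul]
  generalize 1 - 2 * m₀ / |u₀| = f at hf ⊢
  rcases fin2_cases A with rfl | rfl <;> rcases fin2_cases B with rfl | rfl <;>
    rcases fin2_cases C with rfl | rfl <;> rcases fin2_cases D with rfl | rfl <;>
    simp only [kd00, kd01, kd10, kd11] <;> field_simp <;> ring

/-- Both reference second fundamental forms are multiples of the metric, so their commutator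
vanishes and the rest is the curl of the small torsion. -/
theorem ap_10AB (H : Good Γ (n + 2)) (A B : Fin 2) :
    Ap (dl Γ) n true (fR Γ 1 0 (sph A) (sph B)) 0 := by
  have hg := H.of_succ.of_succ
  refine Ap.congr (((((((H.ap_fc B).D A).smul (1 / 2)).sub
    (((H.ap_fc A).D B).smul (1 / 2))).weaken H.short true).sub
    (hg.ap_ctr fun C D => (hg.ap_fX D B).mul H.short (H.ap_fk C A))).add
    (hg.ap_ctr fun C D => (hg.ap_fX D A).mul H.short (H.ap_fk C B)))
    (fun c t ht θ => (fR_10AB A B c t ht θ).symm) fun c t ht θ => ?_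
  simp only [Fam_D_zero, ctrF0, fX0, fk0, gi0, Fin.sum_univ_two, Pi.add_apply, Pi.sub_apply,
    Pi.mul_apply, Pi.smul_apply, Pi.zero_apply, smul_eq_mul]
  rcases fin2_cases A with rfl | rfl <;> rcases fin2_cases B with rfl | rfl <;>
    simp only [kd00, kd01, kd10, kd11] <;> ring

theorem ap_1B0A (H : Good Γ (n + 2)) (B A : Fin 2) :
    Ap (dl Γ) n true (fR Γ 1 (sph B) 0 (sph A)) (fP0 Γ B A) := by
  refine Ap.congr ((H.of_succ.of_succ.ap_ctr fun C D => H.ap_CADB D A C B).sub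
    ((H.ap_10AB A B).smul (1 / 2))) (fun c t ht θ => (fR_1B0A B A c t ht θ).symm)
    fun c t ht θ => ?_
  simp [fP0]

theorem ap_1010 (H : Good Γ (n + 2)) :
    Ap (dl Γ) n true (fR Γ 1 0 1 0) ((-2 : ℝ) • ctrF0 Γ (fP0 Γ)) :=
  Ap.congr ((H.of_succ.of_succ.ap_ctr fun C D => H.ap_1B0A C D).smul (-2))
    (fun c t ht θ => (fR_1010 c t ht θ).symm) fun _ _ _ _ => rfl

/-- Codazzi equation for χ̲. No χ occurs, so the error is unweighted; the angular derivative of χ̲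
raises the requirement to `n + 3`. -/
theorem ap_C1DA (H : Good Γ (n + 3)) (C D A : Fin 2) :
    Ap (dl Γ) n false (fR Γ (sph C) 1 (sph D) (sph A)) 0 := by
  have hg := H.of_succ.of_succ.of_succ
  have hk := H.of_succ.ap_fk
  have hc := H.of_succ.of_succ.ap_fc
  have hΓ := H.of_succ.of_succ.ap_fΓ
  refine Ap.congr (((((((H.ap_fk C A).D D).sub ((H.ap_fk C D).D A)).add
    (((hk D C).mul H.short (hc A)).smul (1 / 4))).sub
    (hg.ap_ctr fun E F => (hΓ E D C).mul H.short (hk F A))).sub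
    (((hk A C).mul H.short (hc D)).smul (1 / 4))).add
    (hg.ap_ctr fun E F => (hΓ E A C).mul H.short (hk F D)))
    (fun c t ht θ => (fR_C1DA C D A c t ht θ).symm) fun c t ht θ => ?_
  have hf := H.adm.f_pos.ne'
  have hr := H.ref_pos ht θ
  have hp := roundFactor_pos θ
  simp only [D_fk0, ctrF0, fΓ0, fk0, gi0, Fin.sum_univ_two, Pi.add_apply, Pi.sub_apply,
    Pi.mul_apply, Pi.smul_apply, Pi.zero_apply, smul_eq_mul]
  generalize 1 - 2 * m₀ / |u₀| = f at hf ⊢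
  rcases fin2_cases A with rfl | rfl <;> rcases fin2_cases C with rfl | rfl <;>
    rcases fin2_cases D with rfl | rfl <;> simp only [kd00, kd01, kd10, kd11] <;> field_simp <;>
    ring1

theorem ap_011A (H : Good Γ (n + 3)) (A : Fin 2) :
    Ap (dl Γ) n false (fR Γ 0 1 1 (sph A)) 0 := by
  refine Ap.congr ((H.of_succ.of_succ.of_succ.ap_ctr fun C D => H.ap_C1DA D C A).smul 2)
    (fun c t ht θ => (fR_011A A c t ht θ).symm) fun c t ht θ => ?_
  simp [ctrF0]

end Good

end Config

end

section

namespace Config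

variable {ι : Type*} {u₀ m₀ : ℝ} {Γ : ι → Config u₀ m₀} {n : ℕ}

/-! ### The derivative of the lapse -/

variable (Γ) in
/-- The reference value of `ω̲`. -/
def fw0 : Fam ι := fun c t _ => schwOmegab m₀ u₀ (dl Γ c) t

theorem js_fw : JS (dl Γ) (fw Γ) := js_fam sm_w

theorem dt_fw : Fam.Eq (dl Γ) (Fam.dt (fw Γ)) ((-(1 / 4) : ℝ) • fR Γ 1 0 1 0
    - (3 / 16 : ℝ) • ctrF Γ (fun C D => fc Γ C * fc Γ D)) := by
  intro c t ht θ
  have h1 := (gauge c).lowCurv_1010 (mem_cone (Γ := Γ) ht θ)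
  have h2 : Fam.dt (fw Γ) c t θ = pd 0 ((Γ c).S.w (Γ c).i) (pt t u₀ θ) :=
    dt_fam (Γ := Γ) sm_w c t ht θ
  rw [h2]
  simp only [Pi.sub_apply, Pi.smul_apply, smul_eq_mul, ctrF_apply, fR, fam, h1]
  change _ = _ - 3 / 16 * (Γ c).S.ctr (Γ c).i (fun C D => (Γ c).S.c (Γ c).i C (pt t u₀ θ) *
    (Γ c).S.c (Γ c).i D (pt t u₀ θ)) _
  ring

theorem hasDerivAt_fw0 (c : ι) {t : ℝ} (hA : Admissible u₀ m₀) (hr : 0 < schwR m₀ u₀ (dl Γ c) t) :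
    HasDerivAt (schwOmegab m₀ u₀ (dl Γ c)) (2 * m₀ / schwR m₀ u₀ (dl Γ c) t ^ 3) t := by
  have hf := hA.f_pos.ne'
  have h1 : HasDerivAt (schwR m₀ u₀ (dl Γ c)) ((1 - 2 * m₀ / |u₀|) * 1) t :=
    (((hasDerivAt_id' t).sub_const _).const_mul _).const_add _
  have h2 := (((h1.pow 2).inv (pow_pos hr 2).ne').const_sub (1 / |u₀| ^ 2)).const_mul
    (m₀ / (1 - 2 * m₀ / |u₀|))
  have e : schwOmegab m₀ u₀ (dl Γ c) = fun s => m₀ / (1 - 2 * m₀ / |u₀|) *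
      (1 / |u₀| ^ 2 - (schwR m₀ u₀ (dl Γ c) ^ 2)⁻¹ s) := by
    funext s
    simp [schwOmegab]
  rw [e]
  refine h2.congr_deriv ?_
  simp only [Pi.pow_apply]
  generalize 1 - 2 * m₀ / |u₀| = f at hf ⊢
  field_simp
  ring

/-- With a = |u₀| and R = r(0), a − R = (1 − 2m₀/|u₀|)δ, and this factor cancels the denominator of
ω̲. What remains is m₀δ(a + R)/(a²R²), where a ≥ 2 and 1 ≤ R ≤ a bound the fraction by 1. -/
theorem abs_schwOmegab_zero_le (hA : Admissible u₀ m₀) {d : ℝ} (hd : 0 < d) (hd1 : d < 1) :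
    |schwOmegab m₀ u₀ d 0| ≤ m₀ * d := by
  have hf := hA.f_pos
  have hab := hA.abs_gt
  have hm := hA.pos
  have hR := hA.one_le_schwR hd1 le_rfl
  have e : schwR m₀ u₀ d 0 = |u₀| - (1 - 2 * m₀ / |u₀|) * d := by simp only [schwR]; ring
  unfold schwOmegab
  generalize schwR m₀ u₀ d 0 = R at hR e ⊢
  generalize 1 - 2 * m₀ / |u₀| = f at hf e ⊢
  generalize |u₀| = a at hab e ⊢
  have hle : R ≤ a := by nlinarith
  have e1 : m₀ / f * (1 / a ^ 2 - 1 / R ^ 2) = -(m₀ * d * ((a + R) / (a ^ 2 * R ^ 2))) := by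
    have : a - R = f * d := by rw [e]; ring
    field_simp
    linear_combination -(a + R) * this
  have h1 : (a + R) / (a ^ 2 * R ^ 2) ≤ 1 := by
    rw [div_le_one (by positivity)]
    nlinarith [mul_le_mul (show 2 * a ≤ a ^ 2 by nlinarith) (show (1 : ℝ) ≤ R ^ 2 by nlinarith)
      (by norm_num) (by positivity)]
  rw [e1, abs_neg, abs_of_nonneg (by positivity)]
  exact mul_le_of_le_one_right (by positivity) h1

theorem js_fw0 (hA : Admissible u₀ m₀) (hδ : Short (dl Γ)) : JS (dl Γ) (fw0 Γ) := by
  refine JS.param fun c t ht => ?_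
  have hr := rr_pos hA hδ ht 0
  exact contDiffAt_const.mul (contDiffAt_const.sub
    (contDiffAt_const.div ((contDiff_rr c).contDiffAt.pow 2) (by
      have : 0 < schwR m₀ u₀ (dl Γ c) t := by simp only [rr] at hr; linarith
      positivity)))

namespace Good

theorem ctl_rr_inv (H : Good Γ n) : Ctl (dl Γ) n 1 (rr Γ)⁻¹ := by
  have hlow := fun c t (ht : t ∈ Set.Icc 0 (dl Γ c + 1)) θ => rr_pos (Γ := Γ) H.adm H.short ht θ
  refine (ctl_rr H.adm H.short).inv (fun c t ht θ => ?_) one_pos fun c t ht θ _ => ?_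
  · have := hlow c t ht θ
    linarith
  · exact (hlow c t ht θ).trans (le_abs_self _)

theorem ctl_fw0 (H : Good Γ n) : Ctl (dl Γ) n 1 (fw0 Γ) := by
  have h := H.ctl_rr_inv
  have h2 : Ctl (dl Γ) n 1 (fun _ _ _ => 1 / |u₀| ^ 2 : Fam ι) := Ctl.const _
  have h3 := h.mul h
  rw [one_mul] at h3
  refine ((h2.sub h3).const_mul (m₀ / (1 - 2 * m₀ / |u₀|))).congr fun c t _ θ => ?_
  simp only [Pi.sub_apply, Pi.mul_apply, Pi.inv_apply, fw0, schwOmegab, rr]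
  ring

/-- A pure quadrature, hence the zero matrix: the source is −ρ up to a term quadratic in the
torsion. -/
theorem ap_fw (H : Good Γ (n + 2)) : Ap (dl Γ) n false (fw Γ) (fw0 Γ) := by
  have hg := H.of_succ.of_succ
  have hsrc : Ap (dl Γ) n true ((-(1 / 4) : ℝ) • fR Γ 1 0 1 0
      - (3 / 16 : ℝ) • ctrF Γ (fun C D => fc Γ C * fc Γ D))
      (fun c t θ => 2 * m₀ / rr Γ c t θ ^ 3) := by
    refine ((H.ap_1010.smul _).sub (((hg.ap_ctr fun C D => (H.of_succ.ap_fc C).mul H.short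
      (H.of_succ.ap_fc D)).weaken H.short true).smul _)).congr (fun _ _ _ _ => rfl)
      fun c t ht θ => ?_
    have hr := H.ref_pos ht θ
    have hp := roundFactor_pos θ
    simp only [ctrF0, fP0, fT0, gi0, Fin.sum_univ_two, Pi.add_apply, Pi.sub_apply,
      Pi.mul_apply, Pi.smul_apply, Pi.zero_apply, smul_eq_mul, kd00, kd01, kd10, kd11]
    field_simp
    ring
  have h := Ap.ode (κ := Unit) H.short (y := fun _ => fw Γ) (y₀ := fun _ => fw0 Γ)
    (f := fun _ => (-(1 / 4) : ℝ) • fR Γ 1 0 1 0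
      - (3 / 16 : ℝ) • ctrF Γ (fun C D => fc Γ C * fc Γ D))
    (f₀ := fun _ c t θ => 2 * m₀ / rr Γ c t θ ^ 3) (M := 0) (M₀ := 0) (fun _ => js_fw)
    (fun _ => js_fw0 H.adm H.short) (fun _ c t ht θ => by simp [dt_fw c t ht θ])
    (fun _ c t ht θ => ?_) (fun _ => hg.ctl_fw0) (fun _ _ => Ap.exact' Ctl.zero) (fun _ => hsrc)
    (fun _ => ?_) ()
  · exact h
  · simp only [Pi.zero_apply, zero_mul, Finset.sum_const_zero, Pi.add_apply, zero_add]
    exact (hasDerivAt_fw0 c H.adm (H.ref_pos ht θ)).deriv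
  · refine (hg.ctl_dl (a := fun c => -fw0 Γ c 0 0) (C := m₀) fun c => ?_).congr fun c t _ θ => ?_
    · rw [abs_neg]
      exact abs_schwOmegab_zero_le H.adm (H.short c).1 (H.short c).2
    · simp [fw_corner, fw0]

end Good

end Config

end

section

namespace Config

variable {ι : Type*} {u₀ m₀ : ℝ} {Γ : ι → Config u₀ m₀} {n : ℕ}

/-! ### The component `α̲` -/

variable (Γ) in
/-- The coefficients of the transport equation of `α̲`. -/
def matA (p s : Fin 2 × Fin 2) : Fam ι := (3 / 2 * kd s.2 p.2) • fY Γ s.1 p.1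
  + kd s.1 p.1 • fY Γ s.2 p.2 - (1 / 2 * kd s.1 p.2) • fY Γ s.2 p.1
  - (1 / 2 * kd s.1 p.1 * kd s.2 p.2) • ctrF Γ (fX Γ)

variable (Γ) in
/-- The reference coefficients of the transport equation of `α̲`. -/
def matA0 (p s : Fin 2 × Fin 2) : Fam ι := (3 / 2 * kd s.2 p.2) • fY0 Γ s.1 p.1
  + kd s.1 p.1 • fY0 Γ s.2 p.2 - (1 / 2 * kd s.1 p.2) • fY0 Γ s.2 p.1
  - (1 / 2 * kd s.1 p.1 * kd s.2 p.2) • ctrF0 Γ (fX0 Γ)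

variable (Γ) in
/-- The source of the transport equation of `α̲`. -/
def srcA (p : Fin 2 × Fin 2) : Fam ι :=
  -((1 / 2 : ℝ) • ctrF Γ (fun C D => (fR Γ (sph C) (sph p.1) 1 (sph p.2)
      + fR Γ 1 (sph p.1) (sph C) (sph p.2)) * fc Γ D))
  - (1 / 4 : ℝ) • (fc Γ p.1 * fR Γ 1 0 1 (sph p.2) + fc Γ p.2 * fR Γ 1 (sph p.1) 1 0)
  + (1 / 2 : ℝ) • (Fam.D p.1 (fR Γ 1 (sph p.2) 1 0)
    - (1 / 4 : ℝ) • (fc Γ p.1 * fR Γ 1 (sph p.2) 1 0)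
    - ctrF Γ (fun C D => fR Γ (sph C) (sph p.2) 1 0 * fk Γ D p.1)
    - (1 / 2 : ℝ) • (fR Γ 1 0 1 0 * fk Γ p.1 p.2)
    - ctrF Γ (fun C D => fΓ Γ D p.1 p.2 * fR Γ 1 (sph C) 1 0)
    - ctrF Γ (fun C D => fR Γ 1 (sph p.2) (sph C) 0 * fk Γ D p.1))
  + ctrF Γ (fun C D => Fam.D C (fR Γ (sph D) (sph p.1) 1 (sph p.2))
    - (1 / 2 : ℝ) • (fR Γ 0 (sph p.1) 1 (sph p.2) * fk Γ C D)
    - ctrF Γ (fun E F => fΓ Γ F C D * fR Γ (sph E) (sph p.1) 1 (sph p.2))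
    - (1 / 2 : ℝ) • (fR Γ (sph D) 0 1 (sph p.2) * fk Γ C p.1)
    - ctrF Γ (fun E F => fΓ Γ F C p.1 * fR Γ (sph D) (sph E) 1 (sph p.2))
    - (1 / 4 : ℝ) • (fc Γ C * fR Γ (sph D) (sph p.1) 1 (sph p.2))
    - ctrF Γ (fun E F => fR Γ (sph D) (sph p.1) (sph E) (sph p.2) * fk Γ F C)
    - (1 / 2 : ℝ) • (fR Γ (sph D) (sph p.1) 1 0 * fk Γ C p.2)
    - ctrF Γ (fun E F => fΓ Γ F C p.2 * fR Γ (sph D) (sph p.1) 1 (sph E)))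

theorem js_fR (a b c' d : Fin 4) : JS (dl Γ) (fR Γ a b c' d) := js_fam (sm_R a b c' d)

theorem fR_1A1B_symm (A B : Fin 2) :
    Fam.Eq (dl Γ) (fR Γ 1 (sph A) 1 (sph B)) (fR Γ 1 (sph B) 1 (sph A)) := fR_pair _ _ _ _

/-- The transport equation of `α̲`. -/
theorem dt_fR_1A1B (p : Fin 2 × Fin 2) : Fam.Eq (dl Γ) (Fam.dt (fR Γ 1 (sph p.1) 1 (sph p.2)))
    (∑ s, matA Γ p s * fR Γ 1 (sph s.1) 1 (sph s.2) + srcA Γ p) := by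
  intro c t ht θ
  obtain ⟨A, B⟩ := p
  have hx := mem_cone (Γ := Γ) ht θ
  have h := (gauge c).pd_zero_lowCurv_1A1B (Γ c).vacuum hx A B
  have hd : Fam.dt (fR Γ 1 (sph A) 1 (sph B)) c t θ
      = pd 0 (lowCurv ((Γ c).S.metric (Γ c).i) 1 (sph A) 1 (sph B)) (pt t u₀ θ) :=
    dt_fam (Γ := Γ) (sm_R 1 (sph A) 1 (sph B)) c t ht θ
  have hk : ∀ A B, (Γ c).S.k (Γ c).i A B (pt t u₀ θ) = fk Γ A B c t θ := fun _ _ => rfl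
  have hX : ∀ A B, (Γ c).S.X (Γ c).i A B (pt t u₀ θ) = fX Γ A B c t θ := fun _ _ => rfl
  have hc : ∀ A, (Γ c).S.c (Γ c).i A (pt t u₀ θ) = fc Γ A c t θ := fun _ => rfl
  have hΓ : ∀ C A B, (Γ c).S.Γs (Γ c).i C A B (pt t u₀ θ) = fΓ Γ C A B c t θ := fun _ _ _ => rfl
  have hg : ∀ A B, (Γ c).S.hinv (Γ c).i A B (pt t u₀ θ) = gi Γ A B c t θ := fun _ _ => rfl
  have hDR : ∀ C a b c' d, pd (sph C) (lowCurv ((Γ c).S.metric (Γ c).i) a b c' d) (pt t u₀ θ)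
      = Fam.D C (fR Γ a b c' d) c t θ :=
    fun C a b c' d => (D_fam (Γ := Γ) (sm_R a b c' d) C c t ht θ).symm
  have hR : ∀ a b c' d, lowCurv ((Γ c).S.metric (Γ c).i) a b c' d (pt t u₀ θ)
    = fR Γ a b c' d c t θ := fun _ _ _ _ => rfl
  have y1 : ∀ D B, fR Γ (sph D) 1 1 (sph B) c t θ = -fR Γ 1 (sph D) 1 (sph B) c t θ :=
    fun D B => fR_swap_left _ _ _ _ c t ht θ
  rw [hd, h]
  simp only [hDR, hR, hk, hX, hc, hΓ, hg, y1, Spacetime.ctr, Fin.sum_univ_two]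
  simp only [srcA, matA, fY, ctrF, Fintype.sum_prod_type, Fin.sum_univ_two, Pi.add_apply,
    Pi.sub_apply, Pi.mul_apply, Pi.smul_apply, Pi.neg_apply, smul_eq_mul]
  have s1 := fX_symm (Γ := Γ) ht θ 1 0
  have s2 := gi_symm (Γ := Γ) ht θ 1 0
  have s3 := fR_1A1B_symm (Γ := Γ) 1 0 c t ht θ
  rcases fin2_cases A with rfl | rfl <;> rcases fin2_cases B with rfl | rfl <;>
    simp only [s1, s2, s3, kd00, kd01, kd10, kd11] <;> ring

namespace Good

/-- Rewriting of a curvature family by the symmetries of the curvature tensor. -/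
theorem ap_neg {b : Bool} {j : ℕ} {f g : Fam ι} (h : Ap (dl Γ) j b g 0)
    (e : Fam.Eq (dl Γ) f (-g)) : Ap (dl Γ) j b f 0 :=
  h.neg.congr (fun c t ht θ => (e c t ht θ).symm) fun _ _ _ _ => by simp

theorem ap_101A (H : Good Γ (n + 3)) (A : Fin 2) : Ap (dl Γ) n false (fR Γ 1 0 1 (sph A)) 0 :=
  ap_neg (H.ap_011A A) (fR_swap_left _ _ _ _)

theorem ap_1A10 (H : Good Γ (n + 3)) (A : Fin 2) : Ap (dl Γ) n false (fR Γ 1 (sph A) 1 0) 0 :=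
  (H.ap_101A A).congr (fR_pair _ _ _ _) fun _ _ _ _ => rfl

theorem ap_1ACB (H : Good Γ (n + 3)) (A C B : Fin 2) :
    Ap (dl Γ) n false (fR Γ 1 (sph A) (sph C) (sph B)) 0 :=
  ap_neg (H.ap_C1DA A C B) (fR_swap_left _ _ _ _)

theorem ap_CA1B (H : Good Γ (n + 3)) (C A B : Fin 2) :
    Ap (dl Γ) n false (fR Γ (sph C) (sph A) 1 (sph B)) 0 :=
  (H.ap_1ACB B C A).congr (fR_pair _ _ _ _) fun _ _ _ _ => rfl

theorem ap_CA10 (H : Good Γ (n + 2)) (C A : Fin 2) :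
    Ap (dl Γ) n true (fR Γ (sph C) (sph A) 1 0) 0 :=
  (H.ap_10AB C A).congr (fR_pair _ _ _ _) fun _ _ _ _ => rfl

theorem ap_1BC0 (H : Good Γ (n + 2)) (B C : Fin 2) :
    Ap (dl Γ) n true (fR Γ 1 (sph B) (sph C) 0) (-fP0 Γ B C) :=
  (H.ap_1B0A B C).neg.congr (fun c t ht θ => (fR_swap_right _ _ _ _ c t ht θ).symm)
    fun _ _ _ _ => rfl

theorem ap_0A1B (H : Good Γ (n + 2)) (A B : Fin 2) :
    Ap (dl Γ) n true (fR Γ 0 (sph A) 1 (sph B)) (fP0 Γ B A) :=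
  (H.ap_1B0A B A).congr (fR_pair _ _ _ _) fun _ _ _ _ => rfl

theorem ap_D01B (H : Good Γ (n + 2)) (D B : Fin 2) :
    Ap (dl Γ) n true (fR Γ (sph D) 0 1 (sph B)) (-fP0 Γ B D) :=
  (H.ap_0A1B D B).neg.congr (fun c t ht θ => (fR_swap_left _ _ _ _ c t ht θ).symm)
    fun _ _ _ _ => rfl

theorem ap_matA (H : Good Γ n) (p s : Fin 2 × Fin 2) :
    Ap (dl Γ) n true (matA Γ p s) (matA0 Γ p s) :=
  ((((H.ap_fY s.1 p.1).smul _).add ((H.ap_fY s.2 p.2).smul _)).sub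
    ((H.ap_fY s.2 p.1).smul _)).sub ((H.ap_ctr H.ap_fX).smul _)

/-- Terms with torsion, β̲-type components or R_{10AB} have reference value zero. The others pair
pure-trace curvature with the pure-trace reference χ̲ and cancel, consistently with α̲ = 0 in
Schwarzschild. The angular derivatives of the `n + 3` components require `n + 4`. -/
theorem ap_srcA (H : Good Γ (n + 4)) (p : Fin 2 × Fin 2) : Ap (dl Γ) n true (srcA Γ p) 0 := by
  have hδ := H.short
  have h3 := H.of_succ
  have h2 := h3.of_succ
  have hg := h2.of_succ.of_succ
  have hc := h2.of_succ.ap_fc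
  have hk := h2.ap_fk
  have hΓ := h2.of_succ.ap_fΓ
  obtain ⟨A, B⟩ := p
  refine Ap.congr (((Ap.weaken hδ ((((hg.ap_ctr fun C D =>
      ((h3.ap_CA1B C A B).add (h3.ap_1ACB A C B)).mul hδ (hc D)).smul (1 / 2)).neg).sub
      ((((hc A).mul hδ (h3.ap_101A B)).add ((hc B).mul hδ (h3.ap_1A10 A))).smul (1 / 4))) true).add
    (((((Ap.weaken hδ (((H.ap_1A10 B).D A).sub (((hc A).mul hδ (h3.ap_1A10 B)).smul (1 / 4)))
      true).sub (hg.ap_ctr fun C D => (h2.ap_CA10 C B).mul hδ (hk D A))).sub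
      ((h2.ap_1010.mul hδ (hk A B)).smul (1 / 2))).sub
      (Ap.weaken hδ (hg.ap_ctr fun C D => (hΓ D A B).mul hδ (h3.ap_1A10 C)) true)).sub
      (hg.ap_ctr fun C D => (h2.ap_1BC0 B C).mul hδ (hk D A)) |>.smul (1 / 2))).add
    (hg.ap_ctr fun C D => (((((((((Ap.weaken hδ ((H.ap_CA1B D A B).D C) true).sub
      (((h2.ap_0A1B A B).mul hδ (hk C D)).smul (1 / 2))).sub
      (Ap.weaken hδ (hg.ap_ctr fun E F => (hΓ F C D).mul hδ (h3.ap_CA1B E A B)) true)).sub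
      (((h2.ap_D01B D B).mul hδ (hk C A)).smul (1 / 2))).sub
      (Ap.weaken hδ (hg.ap_ctr fun E F => (hΓ F C A).mul hδ (h3.ap_CA1B D E B)) true)).sub
      (Ap.weaken hδ (((hc C).mul hδ (h3.ap_CA1B D A B)).smul (1 / 4)) true)).sub
      (hg.ap_ctr fun E F => (h2.ap_CADB D A E B).mul hδ (hk F C))).sub
      (((h2.ap_CA10 D A).mul hδ (hk C B)).smul (1 / 2))).sub
      (Ap.weaken hδ (hg.ap_ctr fun E F => (hΓ F C B).mul hδ (h3.ap_CA1B D A E)) true))))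
    (fun _ _ _ _ => rfl) fun c t ht θ => ?_
  have hf := H.adm.f_pos.ne'
  have hr := H.ref_pos ht θ
  have hp := roundFactor_pos θ
  simp only [Fam_D_zero, ctrF0, fP0, fT0, fk0, gi0, Fin.sum_univ_two, Pi.add_apply, Pi.sub_apply,
    Pi.neg_apply, Pi.mul_apply, Pi.smul_apply, Pi.zero_apply, smul_eq_mul, mul_zero, zero_mul,
    add_zero, sub_zero, zero_add, neg_zero]
  generalize 1 - 2 * m₀ / |u₀| = f at hf ⊢
  rcases fin2_cases A with rfl | rfl <;> rcases fin2_cases B with rfl | rfl <;>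
    simp only [kd00, kd01, kd10, kd11] <;> field_simp <;> ring

theorem ap_1A1B (H : Good Γ (n + 4)) (A B : Fin 2) :
    Ap (dl Γ) n false (fR Γ 1 (sph A) 1 (sph B)) 0 := by
  have h := Ap.ode H.short (y := fun p : Fin 2 × Fin 2 => fR Γ 1 (sph p.1) 1 (sph p.2))
    (y₀ := fun _ => 0) (f := srcA Γ) (f₀ := fun _ => 0) (M := matA Γ) (M₀ := matA0 Γ)
    (fun p => js_fR 1 (sph p.1) 1 (sph p.2)) (fun _ => js_zero) dt_fR_1A1B
    (fun p c t ht θ => by simp [dt_zero]) (fun _ => Ctl.zero)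
    H.of_succ.of_succ.of_succ.of_succ.ap_matA H.ap_srcA
    (fun p => Ctl.zero.congr fun c t _ θ => by simp [fR_corner H.adm.lt]) (A, B)
  exact h

end Good

end Config

end

section

/-! ### Norms of covariant derivatives -/

section Tensor

variable {ι : Type*} {δ : ι → ℝ} {s : ι → ℝ → ℝ} {r : ℕ}

theorem Ctl.prod {κ : Type*} {t : Finset κ} {f : κ → Fam ι} {j : ℕ}
    (h : ∀ a ∈ t, Ctl δ j 1 (f a)) : Ctl δ j 1 (∏ a ∈ t, f a) := by
  classical
  induction t using Finset.induction_on with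
  | empty => exact Ctl.const 1
  | insert a t ha ih =>
    rw [Finset.prod_insert ha, ← one_mul (1 : ι → ℝ → ℝ)]
    exact (h a (by simp)).mul (ih fun b hb => h b (by simp [hb]))

/-- Each covariant derivative consumes one order of control of the tensor and of the Christoffel
symbols, while the scale `s`, entering linearly, is preserved. -/
theorem Ctl.iterCovDeriv {G : ι → ℝ → (Fin 2 → ℝ) → Matrix (Fin 2) (Fin 2) ℝ} (k m : ℕ)
    (hG : ∀ a b c', Ctl δ (m + k) 1 (fun c t θ => christoffel (G c t) a b c' θ))
    {T : ι → ℝ → (Fin 2 → ℝ) → (Fin r → Fin 2) → ℝ}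
    (hT : ∀ I, Ctl δ (m + k) s (fun c t θ => T c t θ I)) (I : Fin (r + k) → Fin 2) :
    Ctl δ m s (fun c t θ => NullCone.iterCovDeriv (G c t) (T c t) k θ I) := by
  induction k generalizing m with
  | zero => exact hT I
  | succ k ih =>
    have ih' := ih (m + 1) (fun a b c' => (hG a b c').of_le (by omega))
      fun I => (hT I).of_le (by omega)
    have h1 := (ih' (Fin.tail I)).D (I 0)
    have h2 : Ctl δ m s (∑ j : Fin (r + k), ∑ c' : Fin 2,
        (fun c t θ => christoffel (G c t) c' (I 0) (Fin.tail I j) θ) *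
          fun c t θ => NullCone.iterCovDeriv (G c t) (T c t) k θ
            (Function.update (Fin.tail I) j c')) := by
      refine Ctl.sum fun j _ => Ctl.sum fun c' _ => ?_
      have := ((hG c' (I 0) (Fin.tail I j)).of_le (l := m) (by omega)).mul
        ((ih' (Function.update (Fin.tail I) j c')).of_le (Nat.le_succ m))
      rwa [one_mul] at this
    refine (h1.sub h2).congr fun c t _ θ => ?_
    simp only [Pi.sub_apply, Finset.sum_apply, Pi.mul_apply]
    rfl

/-- The squared norm is quadratic in the components, hence of scale s², and the square root restores
s. -/
theorem Ctl.tensorNorm_le {G : ι → ℝ → (Fin 2 → ℝ) → Matrix (Fin 2) (Fin 2) ℝ}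
    (hG : ∀ a b, Ctl δ 0 1 (fun c t θ => (G c t θ)⁻¹ a b))
    (hs : ∀ c t, 0 ≤ s c t) {T : ι → ℝ → (Fin 2 → ℝ) → (Fin r → Fin 2) → ℝ}
    (hT : ∀ I, Ctl δ 0 s (fun c t θ => T c t θ I)) :
    ∃ C, ∀ c, ∀ t ∈ Set.Icc 0 (δ c + 1), ∀ θ, rsq θ ≤ 4 →
      tensorNorm (G c t) (T c t) θ ≤ C * s c t := by
  have h : Ctl δ 0 (1 * s * s) (∑ I : Fin r → Fin 2, ∑ J : Fin r → Fin 2,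
      (∏ i, fun c t θ => (G c t θ)⁻¹ (I i) (J i)) * (fun c t θ => T c t θ I)
        * fun c t θ => T c t θ J) :=
    Ctl.sum fun I _ => Ctl.sum fun J _ =>
      ((Ctl.prod fun i _ => hG (I i) (J i)).mul (hT I)).mul (hT J)
  obtain ⟨C, hC⟩ := h.2
  refine ⟨Real.sqrt |C|, fun c t ht θ hθ => ?_⟩
  have h1 := hC c t ht θ hθ
  simp only [Finset.sum_apply, Pi.mul_apply, Finset.prod_apply, one_mul] at h1
  have h2 : tensorNorm (G c t) (T c t) θ ≤ Real.sqrt (|C| * (s c t * s c t)) :=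
    Real.sqrt_le_sqrt (((le_abs_self _).trans h1).trans
      (mul_le_mul_of_nonneg_right (le_abs_self C) (mul_self_nonneg _)))
  rwa [Real.sqrt_mul (abs_nonneg C), Real.sqrt_mul_self (hs c t)] at h2

end Tensor

namespace Config

variable {ι : Type*} {u₀ m₀ : ℝ} {Γ : ι → Config u₀ m₀} {n : ℕ}

variable (Γ) in
/-- The metrics of the spheres. -/
def sm (c : ι) (t : ℝ) : (Fin 2 → ℝ) → Matrix (Fin 2) (Fin 2) ℝ := (Γ c).S.sphereAt (Γ c).i t u₀

namespace Good

theorem ctl_christoffel (H : Good Γ (n + 1)) (a b c' : Fin 2) :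
    Ctl (dl Γ) n 1 (fun c t θ => christoffel (sm Γ c t) a b c' θ) := by
  have hD : ∀ A B C, Ctl (dl Γ) n 1 (Fam.D A (gm Γ B C)) := fun A B C =>
    ((H.ap_gm B C).ctl H.short).D A
  have hg : ∀ A B, Ctl (dl Γ) n 1 (gi Γ A B) := fun A B => (H.of_succ.ap_gi A B).ctl H.short
  have h : Ctl (dl Γ) n 1 (∑ l, gi Γ a l *
      (Fam.D b (gm Γ c' l) + Fam.D c' (gm Γ b l) - Fam.D l (gm Γ b c'))) := by
    refine Ctl.sum fun l _ => ?_
    have := (hg a l).mul (((hD b c' l).add (hD c' b l)).sub (hD l b c'))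
    rwa [one_mul] at this
  refine (h.const_mul (1 / 2)).congr fun c t _ θ => ?_
  simp only [Finset.sum_apply, Pi.mul_apply, Pi.add_apply, Pi.sub_apply]
  rfl

/-- Controlled tensors have small covariant derivatives after the pulse. -/
theorem eventually_norm_le (H : Good Γ (n + 1)) {r : ℕ}
    {T : ι → ℝ → (Fin 2 → ℝ) → (Fin r → Fin 2) → ℝ} {b : Bool}
    (hT : ∀ I, Ctl (dl Γ) n (errScale (dl Γ) b) (fun c t θ => T c t θ I)) :
    ∀ᶠ C in Filter.atTop, ∀ c, ∀ t ∈ Set.Icc (dl Γ c) (dl Γ c + 1), ∀ θ, rsq θ ≤ 4 →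
      tensorNorm (sm Γ c t) (iterCovDeriv (sm Γ c t) (T c t) n) θ ≤ C * Real.sqrt (dl Γ c) := by
  have h1 := Ctl.iterCovDeriv (G := sm Γ) n 0 (fun a b c' => by
    rw [zero_add]; exact H.ctl_christoffel a b c') (T := T) (fun I => by
    rw [zero_add]; exact hT I)
  obtain ⟨C, hC⟩ := Ctl.tensorNorm_le (G := sm Γ)
    (fun a b => ((H.ap_gi a b).ctl H.short).of_le (Nat.zero_le _))
    (fun c t => (H.short.errScale_pos b c t).le) h1
  filter_upwards [Filter.eventually_ge_atTop C] with K hK c t ht θ hθ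
  have hpos := (H.short c).1
  refine (hC c t ⟨hpos.le.trans ht.1, ht.2⟩ θ hθ).trans ?_
  -- After the pulse the weight is 1, so weighted and unweighted errors are both √δ.
  have e : errScale (dl Γ) b c t = Real.sqrt (dl Γ c) := by
    cases b
    · rfl
    · simp [errScale, μ, ε, not_lt.2 ht.1]
  rw [e]
  exact mul_le_mul_of_nonneg_right hK (Real.sqrt_nonneg _)

/-- The bound is claimed for all large constants, so that finitely many such statements can be
intersected to share one constant. -/
theorem eventually_normDeriv0_le (H : Good Γ (n + 1)) {b : Bool} {f : Fam ι}
    (hf : Ctl (dl Γ) n (errScale (dl Γ) b) f) :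
    ∀ᶠ C in Filter.atTop, ∀ c, ∀ t ∈ Set.Icc (dl Γ c) (dl Γ c + 1), ∀ θ, rsq θ ≤ 4 →
      normDeriv0 (sm Γ c t) n (f c t) θ ≤ C * Real.sqrt (dl Γ c) :=
  H.eventually_norm_le (r := 0) (T := fun c t θ _ => f c t θ) fun _ => hf

theorem eventually_normDeriv1_le (H : Good Γ (n + 1)) {b : Bool} {f : Fin 2 → Fam ι}
    (hf : ∀ A, Ctl (dl Γ) n (errScale (dl Γ) b) (f A)) :
    ∀ᶠ C in Filter.atTop, ∀ c, ∀ t ∈ Set.Icc (dl Γ c) (dl Γ c + 1), ∀ θ, rsq θ ≤ 4 →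
      normDeriv1 (sm Γ c t) n (fun y A => f A c t y) θ ≤ C * Real.sqrt (dl Γ c) :=
  H.eventually_norm_le (r := 1) (T := fun c t θ I => f (I 0) c t θ) fun I => hf (I 0)

theorem eventually_normDeriv2_le (H : Good Γ (n + 1)) {b : Bool} {f : Fin 2 → Fin 2 → Fam ι}
    (hf : ∀ A B, Ctl (dl Γ) n (errScale (dl Γ) b) (f A B)) :
    ∀ᶠ C in Filter.atTop, ∀ c, ∀ t ∈ Set.Icc (dl Γ c) (dl Γ c + 1), ∀ θ, rsq θ ≤ 4 →
      normDeriv2 (sm Γ c t) n (fun y A B => f A B c t y) θ ≤ C * Real.sqrt (dl Γ c) :=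
  H.eventually_norm_le (r := 2) (T := fun c t θ I => f (I 0) (I 1) c t θ) fun I => hf (I 0) (I 1)

end Good

end Config

end

section

namespace Config

variable {ι : Type*} {u₀ m₀ : ℝ} {Γ : ι → Config u₀ m₀} {n : ℕ}

/-! ### The region after the pulse -/

theorem dt_eq_zero_of_const {y : Fam ι} (hy : JS (dl Γ) y) {a : ℝ} {c : ι} {θ : Fin 2 → ℝ}
    (h : ∀ t ∈ Set.Icc (dl Γ c) (dl Γ c + 1), y c t θ = a) {t : ℝ}
    (ht : t ∈ Set.Icc (dl Γ c) (dl Γ c + 1)) : Fam.dt y c t θ = 0 := by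
  have hp := dl_pos (Γ := Γ) c
  have h1 := (hy.hasDerivAt (t := t) ⟨hp.le.trans ht.1, ht.2⟩ θ).hasDerivWithinAt
    (s := Set.Icc (dl Γ c) (dl Γ c + 1))
  have h2 := (hasDerivWithinAt_const t (Set.Icc (dl Γ c) (dl Γ c + 1)) a).congr h (h t ht)
  exact (uniqueDiffOn_Icc (by linarith) t ht).eq_deriv _ h1 h2

theorem em_after {c : ι} {t : ℝ} (ht : dl Γ c ≤ t) (θ : Fin 2 → ℝ) (A B : Fin 2) :
    em Γ A B c t θ = kd A B := by
  have : (fun a => q Γ a c t θ) = 0 := funext fun a => q_eq_zero Γ a c (Or.inl ht) θ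
  rw [em, Fam.comp, this, expF_zero, kd]

theorem dt_em_after {c : ι} {t : ℝ} (ht : t ∈ Set.Icc (dl Γ c) (dl Γ c + 1)) (θ : Fin 2 → ℝ)
    (A B : Fin 2) : Fam.dt (em Γ A B) c t θ = 0 :=
  dt_eq_zero_of_const (js_em A B) (fun _ hs => em_after hs.1 θ A B) ht

theorem dt_dt_em_after {c : ι} {t : ℝ} (ht : t ∈ Set.Icc (dl Γ c) (dl Γ c + 1)) (θ : Fin 2 → ℝ)
    (A B : Fin 2) : Fam.dt (Fam.dt (em Γ A B)) c t θ = 0 :=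
  dt_eq_zero_of_const (js_em A B).dt (fun _ hs => dt_em_after hs θ A B) ht

theorem mem_of_after {c : ι} {t : ℝ} (ht : t ∈ Set.Icc (dl Γ c) (dl Γ c + 1)) :
    t ∈ Set.Icc 0 (dl Γ c + 1) := ⟨(dl_pos (Γ := Γ) c).le.trans ht.1, ht.2⟩

theorem fX_after (hu : u₀ < -2) {c : ι} {t : ℝ} (ht : t ∈ Set.Icc (dl Γ c) (dl Γ c + 1))
    (θ : Fin 2 → ℝ) (A B : Fin 2) : fX Γ A B c t θ = 1 / 2 * Fam.dt (pf Γ) c t θ * kd A B := by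
  rw [fX_eq hu A B c t (mem_of_after ht) θ]
  simp only [Pi.smul_apply, Pi.add_apply, Pi.mul_apply, smul_eq_mul, dt_em_after ht, em_after ht.1]
  ring

theorem gi_after (hu : u₀ < -2) {c : ι} {t : ℝ} (ht : t ∈ Set.Icc (dl Γ c) (dl Γ c + 1))
    (θ : Fin 2 → ℝ) (A B : Fin 2) : gi Γ A B c t θ = kd A B / pf Γ c t θ := by
  obtain ⟨g1, g2, g3, g4⟩ := gi_conformal (Γ := Γ) hu (mem_of_after ht) θ
  simp only [em_after ht.1] at g1 g2 g3 g4
  rcases fin2_cases A with rfl | rfl <;> rcases fin2_cases B with rfl | rfl <;>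
    simp [g1, g2, g3, g4, kd00, kd01, kd10, kd11]

theorem gm_after (hu : u₀ < -2) {c : ι} {t : ℝ} (ht : t ∈ Set.Icc (dl Γ c) (dl Γ c + 1))
    (θ : Fin 2 → ℝ) (A B : Fin 2) : gm Γ A B c t θ = pf Γ c t θ * kd A B := by
  rw [(conformal (Γ := Γ) hu (mem_of_after ht) θ).2 A B, Pi.mul_apply, Pi.mul_apply, Pi.mul_apply,
    em_after ht.1]

theorem ctr_after (hu : u₀ < -2) {c : ι} {t : ℝ} (ht : t ∈ Set.Icc (dl Γ c) (dl Γ c + 1))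
    (θ : Fin 2 → ℝ) (u : Fin 2 → Fin 2 → ℝ) :
    (Γ c).S.ctr (Γ c).i u (pt t u₀ θ) = (u 0 0 + u 1 1) / pf Γ c t θ := by
  have hg : ∀ A B, (Γ c).S.hinv (Γ c).i A B (pt t u₀ θ) = gi Γ A B c t θ := fun _ _ => rfl
  simp only [Spacetime.ctr, Fin.sum_univ_two, hg, gi_after hu ht, kd00, kd01, kd10, kd11]
  ring

/-- The shear vanishes after the pulse. -/
theorem chih_after (hu : u₀ < -2) {c : ι} {t : ℝ} (ht : t ∈ Set.Icc (dl Γ c) (dl Γ c + 1))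
    (θ : Fin 2 → ℝ) (A B : Fin 2) : (Γ c).S.chih (Γ c).i (pt t u₀ θ) A B = 0 := by
  have hx := mem_cone (Γ := Γ) (mem_of_after ht) θ
  have hX : ∀ A B, (Γ c).S.X (Γ c).i A B (pt t u₀ θ) = fX Γ A B c t θ := fun _ _ => rfl
  have hm : (Γ c).S.sphereMetric (Γ c).i (pt t u₀ θ) A B = gm Γ A B c t θ := rfl
  have hp := pf_pos (Γ := Γ) hu (mem_of_after ht) θ
  have htr : (Γ c).S.trchi (Γ c).i (pt t u₀ θ)
      = (Γ c).S.ctr (Γ c).i (fun A B => fX Γ A B c t θ) (pt t u₀ θ) := by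
    simp only [Spacetime.trchi, (gauge c).chi_cone hx]
    rfl
  rw [Spacetime.chih, htr, ctr_after hu ht, (gauge c).chi_cone hx, hX, hm, gm_after hu ht]
  simp only [fX_after hu ht, kd00, kd11]
  field_simp
  ring

/-- The curvature component `α` vanishes after the pulse. -/
theorem alpha_after (hu : u₀ < -2) {c : ι} {t : ℝ} (ht : t ∈ Set.Icc (dl Γ c) (dl Γ c + 1))
    (θ : Fin 2 → ℝ) (A B : Fin 2) : (Γ c).S.alpha (Γ c).i (pt t u₀ θ) A B = 0 := by
  have hx := mem_cone (Γ := Γ) (mem_of_after ht) θ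
  have hX : ∀ A B, (Γ c).S.X (Γ c).i A B (pt t u₀ θ) = fX Γ A B c t θ := fun _ _ => rfl
  have hp := pf_pos (Γ := Γ) hu (mem_of_after ht) θ
  have hd : ∀ A B, pd 0 ((Γ c).S.X (Γ c).i A B) (pt t u₀ θ)
      = 1 / 2 * Fam.dt (Fam.dt (pf Γ)) c t θ * kd A B := by
    intro A B
    have h := (dt_fam (Γ := Γ) (sm_X A B) c t (mem_of_after ht) θ).symm
    refine h.trans ?_
    change Fam.dt (fX Γ A B) c t θ = _
    rw [dt_fX hu A B c t (mem_of_after ht) θ]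
    simp only [Pi.smul_apply, Pi.add_apply, Pi.mul_apply, smul_eq_mul, dt_em_after ht,
      em_after ht.1, dt_dt_em_after ht]
    ring
  -- With ψ = 0 the metric is a multiple of the identity and so is R_{A0B0}; only its trace remains
  -- to be killed.
  have key : ∀ A B, lowCurv ((Γ c).S.metric (Γ c).i) (sph A) 0 (sph B) 0 (pt t u₀ θ)
      = (-(1 / 2) * Fam.dt (Fam.dt (pf Γ)) c t θ
        + 1 / 4 * Fam.dt (pf Γ) c t θ ^ 2 / pf Γ c t θ) * kd A B := by
    intro A B
    rw [(gauge c).lowCurv_A0B0 hx, hd, ctr_after hu ht]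
    simp only [hX, fX_after hu ht]
    rcases fin2_cases A with rfl | rfl <;> rcases fin2_cases B with rfl | rfl <;>
      simp only [kd00, kd01, kd10, kd11] <;> ring
  -- R₀₀ = 0 says precisely that this trace vanishes.
  have h0 := (gauge c).vacuum_00 (Γ c).vacuum hx
  rw [ctr_after hu ht, key, key, kd00, kd11] at h0
  rw [(gauge c).alpha_cone hx, key]
  have h1 := (div_eq_zero_iff.1 h0).resolve_right hp.ne'
  have h2 : -(1 / 2) * Fam.dt (Fam.dt (pf Γ)) c t θ
      + 1 / 4 * Fam.dt (pf Γ) c t θ ^ 2 / pf Γ c t θ = 0 := by linarith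
  rw [h2, zero_mul]

end Config

end

section

theorem Ap.ctl_of_eq {ι : Type*} {δ : ι → ℝ} {j : ℕ} {b : Bool} {f f₀ g : Fam ι}
    (h : Ap δ j b f f₀) (e : Fam.Eq δ (f - f₀) g) : Ctl δ j (errScale δ b) g := h.2.congr e

namespace Config

variable {ι : Type*} {u₀ m₀ : ℝ} {Γ : ι → Config u₀ m₀} {n : ℕ}

/-! ### The connection and curvature components -/

theorem trchi_eq {c : ι} {t : ℝ} (ht : t ∈ Set.Icc 0 (dl Γ c + 1)) (θ : Fin 2 → ℝ) :
    (Γ c).S.trchi (Γ c).i (pt t u₀ θ) = ctrF Γ (fX Γ) c t θ := by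
  simp only [Spacetime.trchi, (gauge c).chi_cone (mem_cone (Γ := Γ) ht θ), ctrF_apply]
  rfl

theorem trchib_eq {c : ι} {t : ℝ} (ht : t ∈ Set.Icc 0 (dl Γ c + 1)) (θ : Fin 2 → ℝ) :
    (Γ c).S.trchib (Γ c).i (pt t u₀ θ) = ctrF Γ (fk Γ) c t θ := by
  simp only [Spacetime.trchib, (gauge c).chib_cone (mem_cone (Γ := Γ) ht θ), ctrF_apply]
  rfl

/-- e^ψ is unimodular, so the area density of h is the conformal factor `pf` alone. -/
theorem sqrt_det_gm (hu : u₀ < -2) {c : ι} {t : ℝ} (ht : t ∈ Set.Icc 0 (dl Γ c + 1))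
    (θ : Fin 2 → ℝ) :
    Real.sqrt ((Γ c).S.sphereMetric (Γ c).i (pt t u₀ θ)).det = pf Γ c t θ := by
  have h1 := (conformal (Γ := Γ) hu ht θ).2
  have h2 := det_em (Γ := Γ) c t θ
  have hs : em Γ 1 0 c t θ = em Γ 0 1 c t θ := by rw [em_symm]
  have e : ((Γ c).S.sphereMetric (Γ c).i (pt t u₀ θ)).det = pf Γ c t θ * pf Γ c t θ := by
    rw [Matrix.det_fin_two]
    change gm Γ 0 0 c t θ * gm Γ 1 1 c t θ - gm Γ 0 1 c t θ * gm Γ 1 0 c t θ = _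
    simp only [h1, Pi.mul_apply, hs]
    linear_combination pf Γ c t θ ^ 2 * h2
  rw [e, Real.sqrt_mul_self (pf_pos hu ht θ).le]

namespace Good

theorem ctl_chibh (H : Good Γ (n + 2)) (A B : Fin 2) : Ctl (dl Γ) n (errScale (dl Γ) false)
    (fun c t θ => (Γ c).S.chibh (Γ c).i (pt t u₀ θ) A B) := by
  have hg := H.of_succ.of_succ
  refine ((H.ap_fk A B).sub (((hg.ap_ctr H.ap_fk).mul H.short (hg.ap_gm A B)).smul
    (1 / 2))).ctl_of_eq fun c t ht θ => ?_
  have hr := H.ref_pos ht θ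
  have hp := roundFactor_pos θ
  have hf := H.adm.f_pos.ne'
  -- The reference χ̲ is pure trace, so nothing is to be subtracted from its trace-free part.
  have h0 : fk0 Γ A B c t θ - 1 / 2 * (ctrF0 Γ (fk0 Γ) c t θ * gm0 Γ A B c t θ) = 0 := by
    simp only [ctrF0, fk0, gi0, gm0, Fin.sum_univ_two, Pi.add_apply, Pi.mul_apply]
    generalize 1 - 2 * m₀ / |u₀| = f at hf ⊢
    simp only [kd00, kd01, kd10, kd11]
    field_simp
    ring
  rw [Spacetime.chibh, trchib_eq ht, (gauge c).chib_cone (mem_cone ht θ)]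
  simp only [Pi.sub_apply, Pi.smul_apply, Pi.mul_apply, smul_eq_mul, h0, sub_zero, mul_assoc]
  rfl

theorem ctl_eta (H : Good Γ (n + 1)) (A : Fin 2) : Ctl (dl Γ) n (errScale (dl Γ) false)
    (fun c t θ => (Γ c).S.eta (Γ c).i (pt t u₀ θ) A) :=
  ((H.ap_fc A).smul (1 / 4)).ctl_of_eq fun c t ht θ => by
    rw [(gauge c).eta_cone (mem_cone ht θ)]
    simp only [Pi.sub_apply, Pi.smul_apply, Pi.zero_apply, smul_zero, sub_zero, smul_eq_mul]
    rfl

theorem ctl_etab (H : Good Γ (n + 1)) (A : Fin 2) : Ctl (dl Γ) n (errScale (dl Γ) false)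
    (fun c t θ => (Γ c).S.etab (Γ c).i (pt t u₀ θ) A) :=
  ((H.ap_fc A).smul (-(1 / 4))).ctl_of_eq fun c t ht θ => by
    rw [(gauge c).etab_cone (mem_cone ht θ)]
    simp only [Pi.sub_apply, Pi.smul_apply, Pi.zero_apply, smul_zero, sub_zero, smul_eq_mul]
    rfl

theorem ctl_omegab (H : Good Γ (n + 2)) : Ctl (dl Γ) n (errScale (dl Γ) false)
    (fun c t θ => (Γ c).S.omegab (Γ c).i (pt t u₀ θ) - schwOmegab m₀ u₀ (dl Γ c) t) :=
  H.ap_fw.ctl_of_eq fun c t ht θ => by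
    rw [(gauge c).omegab_cone (mem_cone ht θ)]
    rfl

theorem ctl_trchi (H : Good Γ (n + 1)) : Ctl (dl Γ) n (errScale (dl Γ) true)
    (fun c t θ => (Γ c).S.trchi (Γ c).i (pt t u₀ θ) - schwTrchi m₀ u₀ (dl Γ c) t) := by
  refine (H.of_succ.ap_ctr H.of_succ.ap_fX).ctl_of_eq fun c t ht θ => ?_
  have hr := H.ref_pos ht θ
  have hp := roundFactor_pos θ
  rw [trchi_eq ht, Pi.sub_apply, Pi.sub_apply, Pi.sub_apply]
  congr 1
  simp only [ctrF0, fX0, gi0, Fin.sum_univ_two, Pi.add_apply, Pi.mul_apply, kd00, kd01, kd10, kd11,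
    schwTrchi]
  change _ = _ / rr Γ c t θ
  field_simp
  ring

theorem ctl_trchib (H : Good Γ (n + 2)) : Ctl (dl Γ) n (errScale (dl Γ) false)
    (fun c t θ => (Γ c).S.trchib (Γ c).i (pt t u₀ θ) - schwTrchib m₀ u₀ (dl Γ c) t) := by
  refine (H.of_succ.of_succ.ap_ctr H.ap_fk).ctl_of_eq fun c t ht θ => ?_
  have hr := H.ref_pos ht θ
  have hp := roundFactor_pos θ
  have hf := H.adm.f_pos.ne'
  rw [trchib_eq ht, Pi.sub_apply, Pi.sub_apply, Pi.sub_apply]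
  congr 1
  simp only [ctrF0, fk0, gi0, Fin.sum_univ_two, Pi.add_apply, Pi.mul_apply, kd00, kd01, kd10, kd11,
    schwTrchib]
  change _ = -(2 / rr Γ c t θ) * ((1 - 2 * m₀ / rr Γ c t θ) / _)
  generalize 1 - 2 * m₀ / |u₀| = f at hf ⊢
  field_simp
  ring

/-- β contains ∂₀c, which is replaced through the transport equation of the torsion by quantities
already approximated. -/
theorem ctl_beta (H : Good Γ (n + 1)) (A : Fin 2) : Ctl (dl Γ) n (errScale (dl Γ) true)
    (fun c t θ => (Γ c).S.beta (Γ c).i (pt t u₀ θ) A) := by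
  have hg := H.of_succ
  refine ((((((hg.ap_ctr hg.ap_fX).neg.mul H.short (H.ap_fc A)).add (H.ap_srcC A)).add
    (hg.ap_ctr fun C D => (hg.ap_fX D A).mul H.short (H.ap_fc C))).smul
    (-(1 / 4)))).ctl_of_eq fun c t ht θ => ?_
  have hd : pd 0 ((Γ c).S.c (Γ c).i A) (pt t u₀ θ) = Fam.dt (fc Γ A) c t θ :=
    (dt_fam (Γ := Γ) (sm_c A) c t ht θ).symm
  have hX : ∀ A B, (Γ c).S.X (Γ c).i A B (pt t u₀ θ) = fX Γ A B c t θ := fun _ _ => rfl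
  have hc : ∀ A, (Γ c).S.c (Γ c).i A (pt t u₀ θ) = fc Γ A c t θ := fun _ => rfl
  rw [(gauge c).beta_cone (mem_cone ht θ), (gauge c).lowCurv_100A (mem_cone ht θ), hd,
    dt_fc A c t ht θ]
  simp only [ctrF0, Pi.sub_apply, Pi.smul_apply, Pi.add_apply, Pi.mul_apply, Pi.neg_apply,
    Pi.zero_apply, smul_eq_mul, mul_zero, zero_mul, Finset.sum_const_zero,
    add_zero, sub_zero, ctrF_apply, hX, hc, Spacetime.ctr, Fin.sum_univ_two]
  ring

theorem ctl_rho (H : Good Γ (n + 2)) : Ctl (dl Γ) n (errScale (dl Γ) true)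
    (fun c t θ => (Γ c).S.rho (Γ c).i (pt t u₀ θ) - schwRho m₀ u₀ (dl Γ c) t) := by
  refine (H.ap_1010.smul (1 / 4)).ctl_of_eq fun c t ht θ => ?_
  have hr := H.ref_pos ht θ
  have hp := roundFactor_pos θ
  rw [(gauge c).rho_cone (mem_cone ht θ), Pi.sub_apply, Pi.sub_apply, Pi.sub_apply]
  congr 1
  simp only [ctrF0, fP0, fT0, gi0, Fin.sum_univ_two, Pi.add_apply, Pi.mul_apply, Pi.smul_apply,
    smul_eq_mul, kd00, kd01, kd10, kd11, schwRho]
  change _ = -(_ / rr Γ c t θ ^ 3)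
  field_simp
  ring

theorem ctl_sigma (H : Good Γ (n + 2)) : Ctl (dl Γ) n (errScale (dl Γ) true)
    (fun c t θ => (Γ c).S.sigma (Γ c).i (pt t u₀ θ)) := by
  obtain ⟨B, hB⟩ := H.of_succ.of_succ.bound
  refine ((((H.ap_10AB 0 1).sub (H.ap_10AB 1 0)).mul H.short
    (ap_inv_pf H.adm H.short hB H.low)).smul (1 / 4)).ctl_of_eq fun c t ht θ => ?_
  rw [(gauge c).sigma_cone (mem_cone ht θ)]
  simp only [Spacetime.areaForm, sqrt_det_gm H.adm.lt ht, Fin.sum_univ_two, Pi.sub_apply,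
    Pi.smul_apply, Pi.mul_apply, Pi.zero_apply, Pi.inv_apply, smul_eq_mul, fR, fam]
  simp
  ring

theorem ctl_betab (H : Good Γ (n + 3)) (A : Fin 2) : Ctl (dl Γ) n (errScale (dl Γ) false)
    (fun c t θ => (Γ c).S.betab (Γ c).i (pt t u₀ θ) A) :=
  ((H.ap_011A A).smul (1 / 2)).ctl_of_eq fun c t ht θ => by
    rw [(gauge c).betab_cone (mem_cone ht θ)]
    simp only [Pi.sub_apply, Pi.smul_apply, Pi.zero_apply, smul_zero, sub_zero, smul_eq_mul]
    rfl

theorem ctl_alphab (H : Good Γ (n + 4)) (A B : Fin 2) : Ctl (dl Γ) n (errScale (dl Γ) false)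
    (fun c t θ => (Γ c).S.alphab (Γ c).i (pt t u₀ θ) A B) :=
  (H.ap_1A1B A B).ctl_of_eq fun c t ht θ => by
    rw [(gauge c).alphab_cone (mem_cone ht θ), sub_zero]
    rfl

end Good

end Config

end

/-! ### Uniform choice of the pulse length and the main theorem -/

section

namespace Config

variable {u₀ m₀ : ℝ}

/-- The solutions with controlled seeds and sufficiently short pulses form a good family. -/
theorem exists_good (hA : Admissible u₀ m₀) (B₀ : ℝ) : ∃ δ₀ > 0, ∀ (n : ℕ) (B : ℝ),
    Good (fun c : {c : Config u₀ m₀ // c.ψ.CnBound 5 B₀ ∧ c.ψ.CnBound (n + 1) B ∧ c.δ < δ₀} => c.1)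
      n := by
  -- The threshold is taken at order `n = 0` from the bound B₀ alone, so it depends neither on the
  -- order n nor on the higher bound B.
  obtain ⟨d, hd, h⟩ := exists_phi_lower (n := 0) (B := B₀)
    (Γ := fun c : {c : Config u₀ m₀ // c.ψ.CnBound 5 B₀ ∧ c.δ < 1} => c.1) hA
    (fun c => ⟨c.1.δ_pos, c.2.2⟩) fun c j hj => c.2.1 j (by omega)
  refine ⟨min 1 d, lt_min one_pos hd, fun n B => ⟨hA, fun c => ⟨c.1.δ_pos, ?_⟩, ?_,
    B, fun c => c.2.2.1⟩⟩
  · exact c.2.2.2.trans_le (min_le_left _ _)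
  · exact fun c t ht θ hθ => h ⟨c.1, c.2.1, c.2.2.2.trans_le (min_le_left _ _)⟩
      (c.2.2.2.trans_le (min_le_right _ _)) t ht θ hθ

end Config

end

end NullCone

end

theorem mainTheorem6 :
    ∃ N : ℕ, ∀ u₀ m₀ : ℝ, u₀ < -2 → 0 < m₀ → 2 * m₀ < |u₀| →
      (∀ ψ : SeedData, ψ.HasMass m₀ →
        ∀ δ u₁ : ℝ, 0 < δ → u₀ < u₁ → ∀ S : Spacetime (δ + 1) u₀ u₁, S.IsVacuum →
          S.HasShortPulseData ψ →
        ∀ i : Fin 2, ∀ ub ∈ Set.Icc δ (δ + 1), ∀ θ : Fin 2 → ℝ,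
          (∀ A B, S.chih i (pt ub u₀ θ) A B = 0) ∧
          (∀ A B, S.alpha i (pt ub u₀ θ) A B = 0) ∧
          S.omega i (pt ub u₀ θ) = 0) ∧
      ∀ B₀ : ℝ, ∃ δ₀ : ℝ, 0 < δ₀ ∧ ∀ (k : ℕ) (B : ℝ), ∃ C : ℝ,
        ∀ ψ : SeedData, ψ.HasMass m₀ → ψ.CnBound N B₀ → ψ.CnBound (k + N) B →
        ∀ δ u₁ : ℝ, 0 < δ → δ < δ₀ → u₀ < u₁ → ∀ S : Spacetime (δ + 1) u₀ u₁, S.IsVacuum →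
          S.HasShortPulseData ψ →
        ∀ i : Fin 2, ∀ ub ∈ Set.Icc δ (δ + 1), ∀ θ : Fin 2 → ℝ, rsq θ ≤ 4 →
          normDeriv2 (S.sphereAt i ub u₀) k
            (fun y => S.chibh i (pt ub u₀ y)) θ ≤ C * Real.sqrt δ ∧
          normDeriv1 (S.sphereAt i ub u₀) k
            (fun y => S.eta i (pt ub u₀ y)) θ ≤ C * Real.sqrt δ ∧
          normDeriv1 (S.sphereAt i ub u₀) k
            (fun y => S.etab i (pt ub u₀ y)) θ ≤ C * Real.sqrt δ ∧
          normDeriv0 (S.sphereAt i ub u₀) k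
            (fun y => S.omegab i (pt ub u₀ y) - schwOmegab m₀ u₀ δ ub) θ ≤ C * Real.sqrt δ ∧
          normDeriv0 (S.sphereAt i ub u₀) k
            (fun y => S.trchi i (pt ub u₀ y) - schwTrchi m₀ u₀ δ ub) θ ≤ C * Real.sqrt δ ∧
          normDeriv0 (S.sphereAt i ub u₀) k
            (fun y => S.trchib i (pt ub u₀ y) - schwTrchib m₀ u₀ δ ub) θ ≤ C * Real.sqrt δ ∧
          normDeriv1 (S.sphereAt i ub u₀) k
            (fun y => S.beta i (pt ub u₀ y)) θ ≤ C * Real.sqrt δ ∧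
          normDeriv0 (S.sphereAt i ub u₀) k
            (fun y => S.rho i (pt ub u₀ y) - schwRho m₀ u₀ δ ub) θ ≤ C * Real.sqrt δ ∧
          normDeriv0 (S.sphereAt i ub u₀) k
            (fun y => S.sigma i (pt ub u₀ y)) θ ≤ C * Real.sqrt δ ∧
          normDeriv1 (S.sphereAt i ub u₀) k
            (fun y => S.betab i (pt ub u₀ y)) θ ≤ C * Real.sqrt δ ∧
          normDeriv2 (S.sphereAt i ub u₀) k
            (fun y => S.alphab i (pt ub u₀ y)) θ ≤ C * Real.sqrt δ := by
  -- The seed is differentiated once in s, and α̲ lies four angular derivatives above h: curvature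
  -- of the spheres (2), Codazzi for χ̲ (3), Bianchi (4).
  refine ⟨5, fun u₀ m₀ hu hm hmu => ⟨?_, fun B₀ => ?_⟩⟩
  · intro ψ hψ δ u₁ hδ hlt S hS hdata i ub hub θ
    -- The exact vanishing concerns one solution at a time, so a family with one member suffices.
    let Γ : Unit → Config u₀ m₀ := fun _ => ⟨ψ, δ, u₁, S, i, hψ, hδ, hlt, hS, hdata⟩
    exact ⟨Config.chih_after (Γ := Γ) (c := ()) hu hub θ,
      Config.alpha_after (Γ := Γ) (c := ()) hu hub θ,
      (Config.gauge (Γ := Γ) ()).omega_cone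
        (Config.mem_cone (Γ := Γ) (c := ()) (Config.mem_of_after hub) θ)⟩
  · obtain ⟨δ₀, hδ₀, hgood⟩ := Config.exists_good ⟨hu, hm, hmu⟩ B₀
    refine ⟨δ₀, hδ₀, fun k B => ?_⟩
    -- The index set of this family consists of all solutions with these seed bounds, in either
    -- chart, so a constant valid for the family is the uniform constant required.
    have H4 := hgood (k + 4) B
    have H3 := H4.of_succ
    have H2 := H3.of_succ
    have H1 := H2.of_succ
    obtain ⟨C, h1, h2, h3, h4, h5, h6, h7, h8, h9, h10, h11⟩ :=
      ((H1.eventually_normDeriv2_le H2.ctl_chibh).and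
      ((H1.eventually_normDeriv1_le H1.ctl_eta).and
      ((H1.eventually_normDeriv1_le H1.ctl_etab).and
      ((H1.eventually_normDeriv0_le H2.ctl_omegab).and
      ((H1.eventually_normDeriv0_le H1.ctl_trchi).and
      ((H1.eventually_normDeriv0_le H2.ctl_trchib).and
      ((H1.eventually_normDeriv1_le H1.ctl_beta).and
      ((H1.eventually_normDeriv0_le H2.ctl_rho).and
      ((H1.eventually_normDeriv0_le H2.ctl_sigma).and
      ((H1.eventually_normDeriv1_le H3.ctl_betab).and
      (H1.eventually_normDeriv2_le H4.ctl_alphab))))))))))).exists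
    refine ⟨C, fun ψ hψ hB₀ hB δ u₁ hδ hδlt hlt S hS hdata i ub hub θ hθ => ?_⟩
    let c : {c : Config u₀ m₀ // c.ψ.CnBound 5 B₀ ∧ c.ψ.CnBound (k + 4 + 1) B ∧ c.δ < δ₀} :=
      ⟨⟨ψ, δ, u₁, S, i, hψ, hδ, hlt, hS, hdata⟩, hB₀, hB, hδlt⟩
    exact ⟨h1 c ub hub θ hθ, h2 c ub hub θ hθ, h3 c ub hub θ hθ, h4 c ub hub θ hθ,
      h5 c ub hub θ hθ, h6 c ub hub θ hθ, h7 c ub hub θ hθ, h8 c ub hub θ hθ, h9 c ub hub θ hθ,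
      h10 c ub hub θ hθ, h11 c ub hub θ hθ⟩
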